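/- An instance $G$ of the rank-maximal matching problem is a finite bipartite graph between applicants and posts, each of whose edges has a rank in $\{1,2,3,\dots\}$ (ties and gaps allowed). The signature of a matching is the sequence $(x_1,x_2,\dots)$ where $x_i$ is the number of its edges of rank $i$; a matching is rank-maximal if its signature is lexicographically maximum. The stages of the algorithm of Irving et al. on $G$ are as follows. Stage $i\ge 1$ adds the remaining edges of rank $i$ to the reduced graph $G'_{i-1}$ (with $G'_0$ having no edges) and takes a maximum matching of the resulting graph $F_i$. A vertex is even (odd) if an alternating path of even (odd) length leads to it from an unmatched vertex, and unreachable if no alternating path from an unmatched vertex does; these labels do not depend on the maximum matching. The stage then deletes the edges joining an odd vertex to an odd or unreachable vertex, which gives the reduced graph $G'_i$, and deletes all edges of rank greater than $i$ at odd or unreachable vertices. $G$ is stored by listing its vertices and its edges with their ranks, together with a rank-maximal matching $M$ (a mark on each edge of $M$) and, for each edge, the stage at which it is deleted, if any, and, for each vertex, the first stage, if any, at which it is not even, with one bit telling whether it is then odd or unreachable. So an edge belongs to $G'_i$ exactly if its rank is at most $i$ and it is not deleted in stages $1,\dots,i$. **Theorem.** There are fixed programs for a random access machine (registers and arrays of natural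 numbers; increments, decrements, copying, comparisons and indirect addressing at unit cost) that update this stored information, that is, turn any such representation of $G$ into one of the updated instance $H$, including a rank-maximal matching of $H$ and the reduced graphs of all stages of $H$, when a vertex with its incident edges or a single edge is added to or deleted from $G$. They take time $O(r(m+n))$, where $n$ and $m$ are the numbers of vertices and edges of $G$ and $r$ is the maximum rank of an edge used in a rank-maximal matching of $G$ (each of the factors $r$ and $m+n$ is read as $1$ if it is $0$). Within this time bound, the addition or deletion of an edge $(a,p)$ is carried out by running the vertex-deletion program to delete the applicant $a$ and then the vertex-addition program to add $a$ back with its updated list of edges. -/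

import Mathlib

namespace DynRankMax

/-! ### Instances, matchings, signatures -/

/-- An edge joins an applicant (first component) to a post (second component). Applicants and posts
are named by natural numbers, in two separate name spaces. -/
abbrev Edge := ℕ × ℕ

/-- A vertex: `Sum.inl a` is the applicant `a`, `Sum.inr p` is the post `p`. -/
abbrev Vertex := ℕ ⊕ ℕ

/-- An instance of the rank-maximal matching problem: a finite bipartite graph whose edges carry
ranks `1, 2, 3, …`. The value `rank (a, p) = 0` says that `(a, p)` is not an edge. Ties and gaps
in the preference lists are allowed. -/
@[ext]
structure Instance where
  applicants : Finset ℕ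
  posts : Finset ℕ
  rank : Edge → ℕ
  rank_eq_zero : ∀ e, e ∉ applicants ×ˢ posts → rank e = 0

namespace Instance

variable (G : Instance)

/-- The edge set of the instance. -/
def edges : Finset Edge := (G.applicants ×ˢ G.posts).filter (fun e => G.rank e ≠ 0)

/-- The number `n` of vertices. -/
def numVertices : ℕ := G.applicants.card + G.posts.card

/-- The number `m` of edges. -/
def numEdges : ℕ := G.edges.card

end Instance

/-- No two distinct edges of `M` share an applicant or a post. -/
def IsMatching (M : Finset Edge) : Prop :=
  ∀ e ∈ M, ∀ f ∈ M, e.1 = f.1 ∨ e.2 = f.2 → e = f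

/-- `M` is a matching of maximum cardinality in the bipartite graph with edge set `F`. -/
def IsMaximumMatching (F M : Finset Edge) : Prop :=
  M ⊆ F ∧ IsMatching M ∧ ∀ N, N ⊆ F → IsMatching N → N.card ≤ M.card

namespace Instance

variable (G : Instance)

/-- The `i`-th entry of the signature of `M`: the number of edges of rank `i` in `M`. -/
def signature (M : Finset Edge) (i : ℕ) : ℕ := (M.filter (fun e => G.rank e = i)).card

/-- `M ≻ N`: at the first rank at which the signatures differ, `M` has the larger entry. -/
def Better (M N : Finset Edge) : Prop :=
  ∃ k, (∀ i < k, G.signature M i = G.signature N i) ∧ G.signature N k < G.signature M k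

/-- `M` is a matching of `G` whose signature is the maximum over all matchings of `G`. -/
def IsRankMaximal (M : Finset Edge) : Prop :=
  M ⊆ G.edges ∧ IsMatching M ∧
    ∀ N, N ⊆ G.edges → IsMatching N → G.signature N = G.signature M ∨ G.Better M N

open Classical in
/-- The number `r`: the maximum rank of an edge used in a rank-maximal matching of `G`
(`0` if `G` has no edges). -/
noncomputable def maxRank : ℕ :=
  (G.edges.filter (fun e => ∃ M, G.IsRankMaximal M ∧ e ∈ M)).sup G.rank

end Instance

/-! ### Even, odd and unreachable vertices -/

/-- Adjacency in the bipartite graph with edge set `F`. -/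
def Adj (F : Finset Edge) : Vertex → Vertex → Prop
  | Sum.inl a, Sum.inr p => (a, p) ∈ F
  | Sum.inr p, Sum.inl a => (a, p) ∈ F
  | _, _ => False

/-- `AltPath F M k v`: some `M`-alternating path of length `k` leads from a vertex that `M` leaves
unmatched to `v`. It starts with an edge of `F` outside `M`, then uses edges of `M` and of `F \ M`
in turn. Repeated vertices are not excluded: the graph is bipartite, so both occurrences of a
repeated vertex are at positions of equal parity, and cutting out the part between them leaves an
alternating path of the same parity. -/
inductive AltPath (F M : Finset Edge) : ℕ → Vertex → Prop
  | start (v : Vertex) (h : ∀ w, ¬ Adj M v w) : AltPath F M 0 v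
  | unmatchedEdge (k : ℕ) (v w : Vertex) (hv : AltPath F M k v) (hk : Even k)
      (h : Adj (F \ M) v w) : AltPath F M (k + 1) w
  | matchedEdge (k : ℕ) (v w : Vertex) (hv : AltPath F M k v) (hk : Odd k)
      (h : Adj M v w) : AltPath F M (k + 1) w

/-- The vertex `v` is even in the graph with edge set `F`. The three labels are the same for every
maximum matching of `F`, so it does not matter which one is used. -/
def IsEvenVertex (F : Finset Edge) (v : Vertex) : Prop :=
  ∃ M, IsMaximumMatching F M ∧ ∃ k, Even k ∧ AltPath F M k v

/-- The vertex `v` is odd in the graph with edge set `F`. -/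
def IsOddVertex (F : Finset Edge) (v : Vertex) : Prop :=
  ∃ M, IsMaximumMatching F M ∧ ∃ k, Odd k ∧ AltPath F M k v

/-- The vertex `v` is unreachable in the graph with edge set `F`. -/
def IsUnreachableVertex (F : Finset Edge) (v : Vertex) : Prop :=
  ∃ M, IsMaximumMatching F M ∧ ∀ k, ¬ AltPath F M k v

/-- The edge `e` joins an odd vertex to an odd or unreachable vertex. -/
def IsUselessEdge (F : Finset Edge) (e : Edge) : Prop :=
  (IsOddVertex F (Sum.inl e.1) ∧
    (IsOddVertex F (Sum.inr e.2) ∨ IsUnreachableVertex F (Sum.inr e.2))) ∨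
  (IsOddVertex F (Sum.inr e.2) ∧
    (IsOddVertex F (Sum.inl e.1) ∨ IsUnreachableVertex F (Sum.inl e.1)))

/-- The edge `e` has an odd or unreachable end-point. -/
def IsBlockedEdge (F : Finset Edge) (e : Edge) : Prop :=
  (IsOddVertex F (Sum.inl e.1) ∨ IsUnreachableVertex F (Sum.inl e.1)) ∨
  (IsOddVertex F (Sum.inr e.2) ∨ IsUnreachableVertex F (Sum.inr e.2))

/-! ### The stages of the algorithm of Irving et al. -/

/-- What is left after a stage: the edges of the reduced graph of that stage, and the edges of
higher rank that have not been deleted so far. -/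
structure Phase where
  reduced : Finset Edge
  rest : Finset Edge

namespace Instance

variable (G : Instance)

/-- The edges of rank `i` that are still present join the graph. -/
def enter (i : ℕ) (S : Phase) : Finset Edge :=
  S.reduced ∪ S.rest.filter (fun e => G.rank e = i)

open Classical in
/-- The situation after stage `i`. In stage `i + 1`, the remaining edges of rank `i + 1` join the
reduced graph of stage `i`; the vertices of the resulting graph `F` are labelled; the edges between
odd vertices and between odd and unreachable vertices are deleted from `F`; and the edges of rank
greater than `i + 1` at odd or unreachable vertices are deleted. -/
noncomputable def phase : ℕ → Phase
  | 0 => ⟨∅, G.edges⟩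
  | i + 1 =>
      { reduced := (G.enter (i + 1) (phase i)).filter
          (fun e => ¬ IsUselessEdge (G.enter (i + 1) (phase i)) e)
        rest := (phase i).rest.filter
          (fun e => i + 1 < G.rank e ∧ ¬ IsBlockedEdge (G.enter (i + 1) (phase i)) e) }

/-- The reduced graph `G'ᵢ` of stage `i ≥ 1`. -/
noncomputable def reducedGraph (i : ℕ) : Finset Edge := (G.phase i).reduced

/-- The graph in which the vertices are labelled in stage `i ≥ 1`. -/
noncomputable def labelGraph (i : ℕ) : Finset Edge := G.enter i (G.phase (i - 1))

end Instance

/-! ### Updates -/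

/-- The updates. A new vertex comes with the ranks of its edges (`0` where there is no edge). -/
inductive Update
  | addApplicant (a : ℕ) (list : ℕ → ℕ)
  | addPost (p : ℕ) (list : ℕ → ℕ)
  | delApplicant (a : ℕ)
  | delPost (p : ℕ)
  | addEdge (a p i : ℕ)
  | delEdge (a p : ℕ)

namespace Update

/-- When an update makes sense for `G`: new vertices are new and adjacent to old vertices only, new
edges are new, join old vertices and have positive rank, and what is deleted is present. -/
def Valid (G : Instance) : Update → Prop
  | addApplicant a list => a ∉ G.applicants ∧ ∀ p, list p ≠ 0 → p ∈ G.posts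
  | addPost p list => p ∉ G.posts ∧ ∀ a, list a ≠ 0 → a ∈ G.applicants
  | delApplicant a => a ∈ G.applicants
  | delPost p => p ∈ G.posts
  | addEdge a p i => a ∈ G.applicants ∧ p ∈ G.posts ∧ (a, p) ∉ G.edges ∧ 1 ≤ i
  | delEdge a p => (a, p) ∈ G.edges

/-- The vertices and ranks `A`, `P`, `ρ`, where ranks of pairs outside `A × P` are disregarded. -/
def mk (A P : Finset ℕ) (ρ : Edge → ℕ) : Instance where
  applicants := A
  posts := P
  rank := fun e => if e ∈ A ×ˢ P then ρ e else 0
  rank_eq_zero := fun _ he => if_neg he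

/-- The updated instance. -/
def apply (G : Instance) : Update → Instance
  | addApplicant a list => mk (insert a G.applicants) G.posts
      (fun e => if e.1 = a then list e.2 else G.rank e)
  | addPost p list => mk G.applicants (insert p G.posts)
      (fun e => if e.2 = p then list e.1 else G.rank e)
  | delApplicant a => mk (G.applicants.erase a) G.posts G.rank
  | delPost p => mk G.applicants (G.posts.erase p) G.rank
  | addEdge a p i => mk G.applicants G.posts (fun e => if e = (a, p) then i else G.rank e)
  | delEdge a p => mk G.applicants G.posts (fun e => if e = (a, p) then 0 else G.rank e)

end Update

/-! ### The random access machine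

A machine has registers and a memory divided into arrays; registers and array cells hold natural
numbers. A program refers to finitely many registers and arrays by fixed names; array cells are
addressed indirectly, through the content of a register. Arithmetic is by increments and decrements
only, so `t` steps raise the largest number in use by at most `t` (or to a constant of the
program), and no number of more than logarithmic length is created from short ones. -/

/-- The content of the machine. -/
structure State where
  reg : ℕ → ℕ
  arr : ℕ → ℕ → ℕ

namespace State

/-- Put `n` into register `x`. -/
def setReg (s : State) (x n : ℕ) : State := { s with reg := Function.update s.reg x n }

/-- Put `n` into cell `j` of array `b`. -/
def setArr (s : State) (b j n : ℕ) : State :=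
  { s with arr := Function.update s.arr b (Function.update (s.arr b) j n) }

end State

/-- Tests compare two registers. -/
inductive Test
  | eq (x y : ℕ)
  | lt (x y : ℕ)

/-- The outcome of a test. -/
def Test.holds (s : State) : Test → Prop
  | eq x y => s.reg x = s.reg y
  | lt x y => s.reg x < s.reg y

/-- Programs. -/
inductive Prog
  /-- do nothing -/
  | skip
  /-- put the constant `n` into register `x` -/
  | const (x n : ℕ)
  /-- copy register `y` to register `x` -/
  | copy (x y : ℕ)
  /-- increment register `x` -/
  | succ (x : ℕ)
  /-- decrement register `x`, stopping at `0` -/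
  | pred (x : ℕ)
  /-- copy the cell of array `b` whose address is in register `j` to register `x` -/
  | read (x b j : ℕ)
  /-- copy register `x` to the cell of array `b` whose address is in register `j` -/
  | write (b j x : ℕ)
  /-- sequential composition -/
  | seq (c d : Prog)
  /-- conditional -/
  | ite (q : Test) (c d : Prog)
  /-- loop -/
  | while (q : Test) (c : Prog)

/-- `Exec c s t s'`: started in `s`, the program `c` halts in `s'` after `t` steps. Every elementary
instruction and every evaluation of a test is one step. -/
inductive Exec : Prog → State → ℕ → State → Prop
  | skip (s : State) : Exec Prog.skip s 1 s
  | const (s : State) (x n : ℕ) : Exec (Prog.const x n) s 1 (s.setReg x n)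
  | copy (s : State) (x y : ℕ) : Exec (Prog.copy x y) s 1 (s.setReg x (s.reg y))
  | succ (s : State) (x : ℕ) : Exec (Prog.succ x) s 1 (s.setReg x (s.reg x + 1))
  | pred (s : State) (x : ℕ) : Exec (Prog.pred x) s 1 (s.setReg x (s.reg x - 1))
  | read (s : State) (x b j : ℕ) : Exec (Prog.read x b j) s 1 (s.setReg x (s.arr b (s.reg j)))
  | write (s : State) (b j x : ℕ) :
      Exec (Prog.write b j x) s 1 (s.setArr b (s.reg j) (s.reg x))
  | seq (c d : Prog) (s s' s'' : State) (t t' : ℕ) (h : Exec c s t s') (h' : Exec d s' t' s'') :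
      Exec (Prog.seq c d) s (t + t') s''
  | iteTrue (q : Test) (c d : Prog) (s s' : State) (t : ℕ) (hq : q.holds s) (h : Exec c s t s') :
      Exec (Prog.ite q c d) s (t + 1) s'
  | iteFalse (q : Test) (c d : Prog) (s s' : State) (t : ℕ) (hq : ¬ q.holds s)
      (h : Exec d s t s') : Exec (Prog.ite q c d) s (t + 1) s'
  | whileFalse (q : Test) (c : Prog) (s : State) (hq : ¬ q.holds s) :
      Exec (Prog.while q c) s 1 s
  | whileTrue (q : Test) (c : Prog) (s s' s'' : State) (t t' : ℕ) (hq : q.holds s)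
      (h : Exec c s t s') (h' : Exec (Prog.while q c) s' t' s'') :
      Exec (Prog.while q c) s (t + t' + 1) s''

/-! ### The stored information and the requests -/

/-- The entries `stage` and `bit` stored with the vertex `v`: `stage` is the first stage at which
`v` is odd or unreachable, or `0` if there is none, and then `bit` is `0` for odd and `1` for
unreachable. -/
def StoresLabel (G : Instance) (v : Vertex) (stage bit : ℕ) : Prop :=
  (∀ i, 1 ≤ i → (stage = 0 ∨ i < stage) → IsEvenVertex (G.labelGraph i) v) ∧
  (stage ≠ 0 →
    (bit = 0 ∧ IsOddVertex (G.labelGraph stage) v) ∨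
    (bit = 1 ∧ IsUnreachableVertex (G.labelGraph stage) v))

/-- The state `s` stores the instance `G`, the rank-maximal matching `M` of `G`, and the reduced
graphs of all stages.

Registers `0`, `1`, `2` hold the numbers of applicants, posts and edges. Arrays `0` and `1` list the
applicants and the posts, arrays `2` and `3` the end-points of the edges, each in any order and
without repetition. With edge number `k`, arrays `4`, `5`, `6` hold at `k` its rank, whether it is
in `M`, and the stage at which it is deleted (`0` if it is never deleted). Arrays `7`, `8` hold
the stage and the bit of applicants, arrays `9`, `10` those of posts. All other registers and
cells are arbitrary. -/
structure Stores (s : State) (G : Instance) (M : Finset Edge) : Prop where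
  applicants : Set.BijOn (s.arr 0) (Set.Iio (s.reg 0)) (G.applicants : Set ℕ)
  posts : Set.BijOn (s.arr 1) (Set.Iio (s.reg 1)) (G.posts : Set ℕ)
  edges : Set.BijOn (fun k => (s.arr 2 k, s.arr 3 k)) (Set.Iio (s.reg 2)) (G.edges : Set Edge)
  rank : ∀ k < s.reg 2, s.arr 4 k = G.rank (s.arr 2 k, s.arr 3 k)
  rankMaximal : G.IsRankMaximal M
  matched : ∀ k < s.reg 2, (s.arr 2 k, s.arr 3 k) ∈ M → s.arr 5 k = 1
  unmatched : ∀ k < s.reg 2, (s.arr 2 k, s.arr 3 k) ∉ M → s.arr 5 k = 0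
  deleted : ∀ k < s.reg 2, ∀ i,
    (s.arr 2 k, s.arr 3 k) ∈ (G.phase i).reduced ∪ (G.phase i).rest ↔
      s.arr 6 k = 0 ∨ i < s.arr 6 k
  applicantLabel : ∀ a ∈ G.applicants, StoresLabel G (Sum.inl a) (s.arr 7 a) (s.arr 8 a)
  postLabel : ∀ p ∈ G.posts, StoresLabel G (Sum.inr p) (s.arr 9 p) (s.arr 10 p)

/-- The list of edges of a new vertex: register `4` holds their number, arrays `11` and `12` hold
the other end-points, in any order and without repetition, and the ranks. -/
def Lists (s : State) (list : ℕ → ℕ) : Prop :=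
  Set.BijOn (s.arr 11) (Set.Iio (s.reg 4)) {x | list x ≠ 0} ∧
    ∀ k < s.reg 4, s.arr 12 k = list (s.arr 11 k)

/-- The state `s` holds the data of the update: the vertex in register `3` and, for a new vertex,
its list of edges; for an edge, its end-points in registers `3` and `4`, and for a new edge its
rank in register `5`. -/
def Requests (s : State) : Update → Prop
  | Update.addApplicant a list => s.reg 3 = a ∧ Lists s list
  | Update.addPost p list => s.reg 3 = p ∧ Lists s list
  | Update.delApplicant a => s.reg 3 = a
  | Update.delPost p => s.reg 3 = p
  | Update.addEdge a p i => s.reg 3 = a ∧ s.reg 4 = p ∧ s.reg 5 = i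
  | Update.delEdge a p => s.reg 3 = a ∧ s.reg 4 = p

/-- For every state that stores `G` (with any rank-maximal matching) and holds the data of the
update `u`, the program `c` halts within `B` steps in a state that stores the updated instance. -/
def UpdatesWithin (B : ℕ) (c : Prog) (G : Instance) (u : Update) : Prop :=
  ∀ M s, Stores s G M → Requests s u →
    ∃ M' s' t, Exec c s t s' ∧ t ≤ B ∧ Stores s' (u.apply G) M'

/-- The program `before; del; between; add` performs the update `u` within `B` steps, for every
state that stores `G`, by a deletion of the applicant `a` followed by an addition of `a` with the
list of edges that `a` has in the updated instance: `before` and `between` only prepare the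
requests for `del` and `add`. -/
def UpdatesByVertexWithin (B : ℕ) (before del between add : Prog) (G : Instance) (a : ℕ)
    (u : Update) : Prop :=
  ∀ M s, Stores s G M → Requests s u →
    ∃ M₁ M' s₁ s₂ s₃ s' t₁ t₂ t₃ t₄,
      Exec before s t₁ s₁ ∧ Stores s₁ G M ∧ Requests s₁ (Update.delApplicant a) ∧
      Exec del s₁ t₂ s₂ ∧ Stores s₂ ((Update.delApplicant a).apply G) M₁ ∧
      Exec between s₂ t₃ s₃ ∧ Stores s₃ ((Update.delApplicant a).apply G) M₁ ∧
      Requests s₃ (Update.addApplicant a (fun p => (u.apply G).rank (a, p))) ∧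
      Exec add s₃ t₄ s' ∧ Stores s' (u.apply G) M' ∧
      t₁ + t₂ + t₃ + t₄ ≤ B

end DynRankMax

open DynRankMax

/-!
An update changes the instance at one vertex only, so the old rank-maximal matching is almost
optimal for the new instance at every prefix of the ranks, and each stage can be repeated in linear
time.

*The stages.* A matching is optimal up to rank `i` (`Instance.Opt`) if no matching has a better
signature when only ranks up to `i` are considered. The labels of a graph are recognised by a
certificate (`Cert`): weights `0`, `1`, `2` for even, unreachable and odd vertices, which form a
half-integral vertex cover complementary to a matching, together with alternating paths as witnesses.
Such a certificate shows that the matching is maximum and that the labels do not depend on it. The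
theorem of Irving et al. (`Instance.Hist`) says that the matchings that are optimal up to rank `i`
are maximum matchings of the graph of stage `i`; so a maximum matching of the graph of stage `i + 1`
that covers all vertices of a matching optimal up to rank `i` is optimal up to rank `i + 1`
(`Instance.Hist.opt_of_covers`, `Instance.Hist.succ`). Stages in which no edge joins the graph change
nothing (`Instance.Hist.skip`).

*Locality.* Let `M₀` be the old matching without the edge at a deleted vertex, and `z` the added
vertex, or the former partner of the deleted one, or the deleted vertex itself if it was unmatched.
On a set of vertices that avoids `z` and is closed under the exchange, `M₀` cannot be improved, for
any prefix of the ranks (`Instance.Good`): such an improvement would also be one of the old matching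
in the old instance. So if `K` is optimal up to
rank `i` in the new instance, then off the component of `z` in the union of `K` and the edges of `M₀`
of rank at most `i + 1`, the two matchings have the same signature up to rank `i`, and `K` may be
replaced by `M₀` there (`Instance.Good.mix_opt`). As the component of `z` is a path or a cycle, the
resulting matching has at most one edge less than `M₀` has edges of rank up to `i + 1`; and no
matching obtained from it by augmentation in the graph of stage `i + 1` has more than one edge more
(`Instance.Good.card_le`). Hence two augmentations suffice, and a stage takes linear time
(`stage_spec`).

*The number of stages.* Only stages in which an edge joins the graph are carried out, and each of
them enlarges the matching, as the new edge joins two even vertices (`Cert.card_lt`). The size of `K`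
differs by at most one from the number of edges of `M₀` of rank at most `i`
(`Instance.Good.card_opt`); so apart from stages `1, …, r` there are at most three stages more than
there are edges of `M₀` of rank above `r` (`stages_spec`). If `r` is the maximum rank in
rank-maximal matchings of `G`, there are no such edges for an update at a vertex, and at most two for
the addition of a vertex that has just been deleted (`Instance.IsDeletion.card_le`).

*The programs.* `Prog.core` builds linked lists of the half-edges, runs the stages, and writes the
result to the output arrays. A stage traces the component of `z`, exchanges the matchings, augments
along alternating paths found by breadth-first search from the unmatched applicants, completes the
labels by a search from the unmatched posts, and records labels and deletions. The four vertex
updates run `Prog.core` after editing the lists of vertices and edges. For an edge `(a, p)`, the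
updated list of the edges of `a` is prepared first; the deletion of `a` leaves this list alone.
-/

set_option linter.unusedSimpArgs false

namespace DynRankMax

/-! ### A program logic with running times -/

infixr:60 " ;; " => Prog.seq

instance (s : State) : (q : Test) → Decidable (q.holds s)
  | Test.eq x y => inferInstanceAs (Decidable (s.reg x = s.reg y))
  | Test.lt x y => inferInstanceAs (Decidable (s.reg x < s.reg y))

@[simp] theorem Test.holds_eq (s : State) (x y : ℕ) :
    (Test.eq x y).holds s ↔ s.reg x = s.reg y := Iff.rfl

@[simp] theorem Test.holds_lt (s : State) (x y : ℕ) :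
    (Test.lt x y).holds s ↔ s.reg x < s.reg y := Iff.rfl

@[simp] theorem State.setReg_reg (s : State) (x n y : ℕ) :
    (s.setReg x n).reg y = if y = x then n else s.reg y := by
  simp [State.setReg, Function.update_apply]

@[simp] theorem State.setReg_arr (s : State) (x n : ℕ) : (s.setReg x n).arr = s.arr := rfl

@[simp] theorem State.setArr_reg (s : State) (b j n : ℕ) : (s.setArr b j n).reg = s.reg := rfl

@[simp] theorem State.setArr_arr (s : State) (b j n c : ℕ) :
    (s.setArr b j n).arr c = if c = b then Function.update (s.arr b) j n else s.arr c := by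
  simp [State.setArr, Function.update_apply]

/-- `Runs c s T s'`: the program `c` leads from `s` to `s'` within `T` steps. -/
def Runs (c : Prog) (s : State) (T : ℕ) (s' : State) : Prop := ∃ t ≤ T, Exec c s t s'

namespace Prog

/-- The program contains no loop. -/
def Flat : Prog → Bool
  | seq c d => c.Flat && d.Flat
  | ite _ c d => c.Flat && d.Flat
  | .while _ _ => false
  | _ => true

/-- The final state of a loop-free program. The value at a loop is a placeholder, never used. -/
def ev : Prog → State → State
  | skip, s => s
  | const x n, s => s.setReg x n
  | copy x y, s => s.setReg x (s.reg y)
  | succ x, s => s.setReg x (s.reg x + 1)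
  | pred x, s => s.setReg x (s.reg x - 1)
  | read x b j, s => s.setReg x (s.arr b (s.reg j))
  | write b j x, s => s.setArr b (s.reg j) (s.reg x)
  | seq c d, s => d.ev (c.ev s)
  | ite q c d, s => if q.holds s then c.ev s else d.ev s
  | .while _ _, s => s

/-- A bound on the running time of a loop-free program. -/
def cost : Prog → ℕ
  | seq c d => c.cost + d.cost
  | ite _ c d => c.cost + d.cost + 1
  | _ => 1

/-- The registers that occur as targets of an instruction. -/
def regs : Prog → List ℕ
  | const x _ => [x]
  | copy x _ => [x]
  | succ x => [x]
  | pred x => [x]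
  | read x _ _ => [x]
  | seq c d => c.regs ++ d.regs
  | ite _ c d => c.regs ++ d.regs
  | .while _ c => c.regs
  | _ => []

/-- The arrays that the program writes to. -/
def arrs : Prog → List ℕ
  | write b _ _ => [b]
  | seq c d => c.arrs ++ d.arrs
  | ite _ c d => c.arrs ++ d.arrs
  | .while _ c => c.arrs
  | _ => []

end Prog

/-- The states agree on all registers and arrays that `c` does not write to. -/
def Frame (c : Prog) (s s' : State) : Prop :=
  (∀ x, x ∉ c.regs → s'.reg x = s.reg x) ∧ (∀ b, b ∉ c.arrs → s'.arr b = s.arr b)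

theorem Frame.rfl {c : Prog} {s : State} : Frame c s s := ⟨fun _ _ => Eq.refl _, fun _ _ => Eq.refl _⟩

theorem Frame.trans {c : Prog} {s s' s'' : State} (h : Frame c s s') (h' : Frame c s' s'') :
    Frame c s s'' :=
  ⟨fun x hx => (h'.1 x hx).trans (h.1 x hx), fun b hb => (h'.2 b hb).trans (h.2 b hb)⟩

theorem Frame.mono {c d : Prog} {s s' : State} (h : Frame c s s') (hr : c.regs ⊆ d.regs)
    (ha : c.arrs ⊆ d.arrs) : Frame d s s' :=
  ⟨fun x hx => h.1 x fun hc => hx (hr hc), fun b hb => h.2 b fun hc => hb (ha hc)⟩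

theorem Exec.frame {c : Prog} {s s' : State} {t : ℕ} (h : Exec c s t s') : Frame c s s' := by
  induction h with
  | skip s => exact Frame.rfl
  | const s x n | copy s x y | succ s x | pred s x | read s x b j =>
    refine ⟨fun y hy => ?_, fun _ _ => Eq.refl _⟩
    simp [Prog.regs] at hy
    simp [hy]
  | write s b j x =>
    refine ⟨fun y hy => Eq.refl _, fun c hc => ?_⟩
    simp [Prog.arrs] at hc
    simp [hc]
  | seq c d s s' s'' t t' h h' ih ih' =>
    exact (ih.mono (by simp [Prog.regs]) (by simp [Prog.arrs])).trans
      (ih'.mono (by simp [Prog.regs]) (by simp [Prog.arrs]))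
  | iteTrue q c d s s' t hq h ih => exact ih.mono (by simp [Prog.regs]) (by simp [Prog.arrs])
  | iteFalse q c d s s' t hq h ih => exact ih.mono (by simp [Prog.regs]) (by simp [Prog.arrs])
  | whileFalse q c s hq => exact Frame.rfl
  | whileTrue q c s s' s'' t t' hq h h' ih ih' =>
    exact (ih.mono (by simp [Prog.regs]) (by simp [Prog.arrs])).trans ih'

theorem Runs.frame {c : Prog} {s s' : State} {T : ℕ} (h : Runs c s T s') : Frame c s s' :=
  h.choose_spec.2.frame

theorem Runs.mono {c : Prog} {s s' : State} {T T' : ℕ} (h : Runs c s T s') (hT : T ≤ T') :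
    Runs c s T' s' :=
  let ⟨t, ht, h⟩ := h
  ⟨t, ht.trans hT, h⟩

theorem Runs.seq {c d : Prog} {s s' s'' : State} {T T' : ℕ} (h : Runs c s T s')
    (h' : Runs d s' T' s'') : Runs (c ;; d) s (T + T') s'' :=
  let ⟨_, ht, h⟩ := h
  let ⟨_, ht', h'⟩ := h'
  ⟨_, add_le_add ht ht', .seq _ _ _ _ _ _ _ h h'⟩

theorem Runs.ite_pos {q : Test} {c d : Prog} {s s' : State} {T : ℕ} (hq : q.holds s)
    (h : Runs c s T s') : Runs (.ite q c d) s (T + 1) s' :=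
  let ⟨_, ht, h⟩ := h
  ⟨_, add_le_add ht le_rfl, .iteTrue _ _ _ _ _ _ hq h⟩

theorem Runs.ite_neg {q : Test} {c d : Prog} {s s' : State} {T : ℕ} (hq : ¬ q.holds s)
    (h : Runs d s T s') : Runs (.ite q c d) s (T + 1) s' :=
  let ⟨_, ht, h⟩ := h
  ⟨_, add_le_add ht le_rfl, .iteFalse _ _ _ _ _ _ hq h⟩

theorem Runs.ev {c : Prog} (hc : c.Flat = true) (s : State) : Runs c s c.cost (c.ev s) := by
  induction c generalizing s with
  | skip => exact ⟨1, le_rfl, .skip s⟩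
  | const x n => exact ⟨1, le_rfl, .const s x n⟩
  | copy x y => exact ⟨1, le_rfl, .copy s x y⟩
  | succ x => exact ⟨1, le_rfl, .succ s x⟩
  | pred x => exact ⟨1, le_rfl, .pred s x⟩
  | read x b j => exact ⟨1, le_rfl, .read s x b j⟩
  | write b j x => exact ⟨1, le_rfl, .write s b j x⟩
  | seq c d ihc ihd =>
    simp only [Prog.Flat, Bool.and_eq_true] at hc
    exact (ihc hc.1 s).seq (ihd hc.2 _)
  | ite q c d ihc ihd =>
    simp only [Prog.Flat, Bool.and_eq_true] at hc
    by_cases hq : q.holds s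
    · simp only [Prog.ev, hq, if_true]
      exact (Runs.ite_pos hq (ihc hc.1 s)).mono (by simp [Prog.cost])
    · simp only [Prog.ev, hq, if_false]
      exact (Runs.ite_neg hq (ihd hc.2 s)).mono (by simp [Prog.cost])
  | _ => simp [Prog.Flat] at hc

/-- A loop terminates if its body preserves an invariant and decreases a measure. Inside the loop,
everything that the body does not write to is as in the initial state. -/
theorem Runs.loop {q : Test} {c : Prog} {T : ℕ} {s₀ : State} (I : State → Prop) (μ : State → ℕ)
    (h : ∀ s, Frame c s₀ s → I s → q.holds s →
      ∃ s', Runs c s T s' ∧ I s' ∧ μ s' + 1 ≤ μ s) (h₀ : I s₀) :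
    ∃ s', Runs (.while q c) s₀ ((T + 1) * μ s₀ + 1) s' ∧ I s' ∧ ¬ q.holds s' ∧ Frame c s₀ s' := by
  suffices H : ∀ n s, μ s ≤ n → Frame c s₀ s → I s →
      ∃ s', Runs (.while q c) s ((T + 1) * n + 1) s' ∧ I s' ∧ ¬ q.holds s' ∧ Frame c s₀ s' from
    H _ s₀ le_rfl Frame.rfl h₀
  intro n
  induction n with
  | zero =>
    intro s hn hf hs
    by_cases hq : q.holds s
    · obtain ⟨s', -, -, hm⟩ := h s hf hs hq
      omega
    · exact ⟨s, ⟨1, by omega, .whileFalse _ _ _ hq⟩, hs, hq, hf⟩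
  | succ n ih =>
    intro s hn hf hs
    by_cases hq : q.holds s
    · obtain ⟨s', hr, hi, hm⟩ := h s hf hs hq
      obtain ⟨s'', ⟨t', ht', hr'⟩, h'⟩ := ih s' (by omega) (hf.trans hr.frame) hi
      obtain ⟨t, ht, hr⟩ := hr
      refine ⟨s'', ⟨t + t' + 1, ?_, .whileTrue _ _ _ _ _ _ _ hq hr hr'⟩, h'⟩
      rw [mul_add, mul_one]
      omega
    · exact ⟨s, ⟨1, by omega, .whileFalse _ _ _ hq⟩, hs, hq, hf⟩

/-- The loop that runs `c` while register `x` is below register `y`, incrementing `x`. -/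
def Prog.upTo (x y : ℕ) (c : Prog) : Prog := .while (.lt x y) (c ;; .succ x)

theorem Runs.upTo {x y : ℕ} {c : Prog} {s₀ : State} (hc : c.Flat = true) (hx : x ∉ c.regs)
    (hy : y ∉ c.regs) (hxy : y ≠ x) (I : ℕ → State → Prop)
    (h : ∀ s, Frame (c ;; .succ x) s₀ s → I (s.reg x) s → s.reg x < s₀.reg y →
      I (s.reg x + 1) ((c ;; .succ x).ev s))
    (hle : s₀.reg x ≤ s₀.reg y) (h₀ : I (s₀.reg x) s₀) :
    ∃ s', Runs (Prog.upTo x y c) s₀ ((c.cost + 2) * (s₀.reg y - s₀.reg x) + 1) s' ∧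
      I (s₀.reg y) s' ∧ s'.reg x = s₀.reg y ∧ Frame (c ;; .succ x) s₀ s' := by
  have hyc : y ∉ (c ;; .succ x).regs := by simp [Prog.regs, hy, hxy]
  obtain ⟨s', hr, ⟨hi, hi'⟩, hq, hf⟩ := Runs.loop (q := .lt x y) (c := c ;; .succ x) (T := c.cost + 1)
    (s₀ := s₀) (fun s => I (s.reg x) s ∧ s.reg x ≤ s₀.reg y) (fun s => s₀.reg y - s.reg x)
    (by
      intro s hf ⟨hi, hle⟩ hq
      have hlt : s.reg x < s₀.reg y := by
        have := hf.1 y hyc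
        simp at hq
        omega
      have hfl : (c ;; .succ x).Flat = true := by simp [Prog.Flat, hc]
      have hr := Runs.ev hfl s
      have hcx : ((c ;; .succ x).ev s).reg x = s.reg x + 1 := by
        have := (Runs.ev hc s).frame.1 x hx
        simp [Prog.ev, this]
      refine ⟨_, hr, ⟨?_, by omega⟩, by omega⟩
      rw [hcx]
      exact h s hf hi hlt) ⟨h₀, hle⟩
  have hy' := hf.1 y hyc
  have : s'.reg x = s₀.reg y := by
    simp at hq
    omega
  exact ⟨s', hr, this ▸ hi, this, hf⟩

/-- The loop that runs `c` with register `19` running through the numbers below register `y`. -/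
def Prog.each (y : ℕ) (c : Prog) : Prog := .const 19 0 ;; .upTo 19 y c

theorem Runs.each {y : ℕ} {c : Prog} {s : State} (hc : c.Flat = true) (hx : 19 ∉ c.regs)
    (hy : y ∉ c.regs) (hxy : y ≠ 19) (I : ℕ → State → Prop) (h₀ : I 0 (s.setReg 19 0))
    (h : ∀ t j, Frame (.each y c) s t → t.reg 19 = j → j < s.reg y → I j t →
      I (j + 1) ((c ;; .succ 19).ev t)) :
    ∃ s', Runs (.each y c) s ((c.cost + 2) * s.reg y + 2) s' ∧ I (s.reg y) s' := by
  have h1 := Runs.ev (c := .const 19 0) rfl s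
  have hf1 : Frame (.each y c) s (s.setReg 19 0) :=
    h1.frame.mono (by simp [Prog.each, Prog.upTo, Prog.regs])
      (by simp [Prog.arrs, Prog.each, Prog.upTo])
  obtain ⟨s', hr, hi, -, -⟩ := Runs.upTo (x := 19) (s₀ := s.setReg 19 0) hc hx hy hxy I
    (fun t hf hi hlt => h t _ (hf1.trans (hf.mono (by simp [Prog.each, Prog.upTo, Prog.regs])
      (by simp [Prog.arrs, Prog.each, Prog.upTo]))) rfl (by simpa [hxy] using hlt) hi)
    (by simp) (by simpa using h₀)
  simp only [State.setReg_reg, hxy, if_true, if_false, Nat.sub_zero] at hr hi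
  exact ⟨s', (h1.seq hr).mono (by simp [Prog.cost]; omega), hi⟩

/-! ### Matchings and dual certificates -/

/-- The vertex `v` is an end-point of the edge `e`. -/
def Inc (v : Vertex) (e : Edge) : Prop := v = Sum.inl e.1 ∨ v = Sum.inr e.2

/-- Some edge of `M` has the end-point `v`. -/
def Covers (M : Finset Edge) (v : Vertex) : Prop := ∃ e ∈ M, Inc v e

theorem inc_inl (e : Edge) : Inc (Sum.inl e.1) e := Or.inl rfl

theorem inc_inr (e : Edge) : Inc (Sum.inr e.2) e := Or.inr rfl

theorem isMatching_iff {M : Finset Edge} :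
    IsMatching M ↔ ∀ v, ∀ e ∈ M, ∀ f ∈ M, Inc v e → Inc v f → e = f := by
  constructor
  · intro h v e he f hf hve hvf
    apply h e he f hf
    rcases hve with rfl | rfl <;> rcases hvf with h | h
    · exact Or.inl (Sum.inl.inj h)
    · cases h
    · cases h
    · exact Or.inr (Sum.inr.inj h)
  · rintro h e he f hf (h1 | h1)
    · exact h _ e he f hf (inc_inl e) (h1 ▸ inc_inl f)
    · exact h _ e he f hf (inc_inr e) (h1 ▸ inc_inr f)

theorem IsMatching.eq {M : Finset Edge} (h : IsMatching M) {v : Vertex} {e f : Edge} (he : e ∈ M)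
    (hf : f ∈ M) (hve : Inc v e) (hvf : Inc v f) : e = f := isMatching_iff.1 h v e he f hf hve hvf

theorem IsMatching.mono {M N : Finset Edge} (h : IsMatching M) (hN : N ⊆ M) : IsMatching N :=
  fun e he f hf => h e (hN he) f (hN hf)

theorem adj_iff {F : Finset Edge} {v w : Vertex} :
    Adj F v w ↔ ∃ e ∈ F, Inc v e ∧ Inc w e ∧ v ≠ w := by
  rcases v with a | p <;> rcases w with b | q <;> simp [Adj, Inc]
  · rintro x hx rfl
    rfl
  · rintro x y hx
    exact hx.symm

theorem not_covers_iff {M : Finset Edge} {v : Vertex} : (∀ w, ¬ Adj M v w) ↔ ¬ Covers M v := by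
  constructor
  · rintro h ⟨e, he, rfl | rfl⟩
    · exact h (Sum.inr e.2) (by simpa [Adj] using he)
    · exact h (Sum.inl e.1) (by simpa [Adj] using he)
  · intro h w hw
    obtain ⟨e, he, h1, -, -⟩ := adj_iff.1 hw
    exact h ⟨e, he, h1⟩

/-- The end-points of the edges of `M`. -/
def verts (M : Finset Edge) : Finset Vertex :=
  M.image (fun e => Sum.inl e.1) ∪ M.image (fun e => Sum.inr e.2)

theorem mem_verts {M : Finset Edge} {v : Vertex} : v ∈ verts M ↔ Covers M v := by
  simp only [verts, Finset.mem_union, Finset.mem_image, Covers, Inc]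
  constructor
  · rintro (⟨e, he, rfl⟩ | ⟨e, he, rfl⟩)
    · exact ⟨e, he, Or.inl rfl⟩
    · exact ⟨e, he, Or.inr rfl⟩
  · rintro ⟨e, he, rfl | rfl⟩
    · exact Or.inl ⟨e, he, rfl⟩
    · exact Or.inr ⟨e, he, rfl⟩

/-- The sum of the vertex weights at the two end-points of an edge. -/
def wt (w : Vertex → ℕ) (e : Edge) : ℕ := w (Sum.inl e.1) + w (Sum.inr e.2)

theorem sum_verts {M : Finset Edge} (hM : IsMatching M) (w : Vertex → ℕ) :
    ∑ v ∈ verts M, w v = ∑ e ∈ M, wt w e := by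
  rw [verts, Finset.sum_union, Finset.sum_image, Finset.sum_image, ← Finset.sum_add_distrib]
  · rfl
  · intro e he f hf h
    exact hM e he f hf (Or.inr (Sum.inr.inj h))
  · intro e he f hf h
    exact hM e he f hf (Or.inl (Sum.inl.inj h))
  · rw [Finset.disjoint_left]
    intro v hv hv'
    simp only [Finset.mem_image] at hv hv'
    obtain ⟨e, -, rfl⟩ := hv
    obtain ⟨f, -, h⟩ := hv'
    cases h

/-- A half-integral vertex cover `w / 2` of `F` that is complementary to the matching `M`: a
certificate of linear programming duality for the maximality of `M` in `F`. -/
structure Dual (F M : Finset Edge) (w : Vertex → ℕ) : Prop where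
  sub : M ⊆ F
  matching : IsMatching M
  feasible : ∀ e ∈ F, 2 ≤ wt w e
  tight : ∀ e ∈ M, wt w e = 2
  cov : ∀ v, w v ≠ 0 → Covers M v

namespace Dual

variable {F M N : Finset Edge} {w : Vertex → ℕ}

theorem le_two (h : Dual F M w) (v : Vertex) : w v ≤ 2 := by
  by_cases hv : w v = 0
  · omega
  · obtain ⟨e, he, rfl | rfl⟩ := h.cov v hv
    · have := h.tight e he
      unfold wt at this
      omega
    · have := h.tight e he
      unfold wt at this
      omega

theorem sum_le (h : Dual F M w) (S : Finset Vertex) : ∑ v ∈ S, w v ≤ 2 * M.card := by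
  have h1 : ∑ v ∈ verts M, w v = 2 * M.card := by
    rw [sum_verts h.matching, Finset.sum_congr rfl h.tight]
    simp [mul_comm]
  rw [← h1, ← Finset.sum_filter_ne_zero]
  refine Finset.sum_le_sum_of_subset fun v hv => ?_
  exact mem_verts.2 (h.cov v (Finset.mem_filter.1 hv).2)

theorem card_le_sum (h : Dual F M w) (hN : N ⊆ F) (hN' : IsMatching N) :
    2 * N.card ≤ ∑ v ∈ verts N, w v := by
  rw [sum_verts hN', mul_comm, ← smul_eq_mul]
  exact Finset.card_nsmul_le_sum _ _ _ fun e he => h.feasible e (hN he)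

theorem isMaximumMatching (h : Dual F M w) : IsMaximumMatching F M :=
  ⟨h.sub, h.matching, fun N hN hN' => by
    have := h.card_le_sum hN hN'
    have := h.sum_le (verts N)
    omega⟩

/-- Complementary slackness: every other matching of the same size is complementary to `w`. -/
theorem of_card (h : Dual F M w) (hN : N ⊆ F) (hN' : IsMatching N) (hc : M.card ≤ N.card) :
    Dual F N w := by
  have h1 := h.card_le_sum hN hN'
  have h2 := h.sum_le (verts N)
  have h3 := h.isMaximumMatching.2.2 N hN hN'
  refine ⟨hN, hN', h.feasible, fun e he => ?_, fun v hv => ?_⟩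
  · have h4 : ∑ e ∈ N, wt w e = ∑ e ∈ N, 2 := by
      rw [← sum_verts hN']
      simp
      omega
    exact ((Finset.sum_eq_sum_iff_of_le fun e he => h.feasible e (hN he)).1 h4.symm e he).symm
  · by_contra hcv
    have h4 := h.sum_le (insert v (verts N))
    rw [Finset.sum_insert (mt mem_verts.1 hcv)] at h4
    omega

theorem of_max (h : Dual F M w) (hN : IsMaximumMatching F N) : Dual F N w :=
  h.of_card hN.1 hN.2.1 (hN.2.2 M h.sub h.matching)

theorem alt_label (h : Dual F M w) {k : ℕ} {v : Vertex} (hv : AltPath F M k v) :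
    (Even k → w v = 0) ∧ (Odd k → w v = 2) := by
  induction hv with
  | start v hv =>
    refine ⟨fun _ => ?_, fun h => by simp at h⟩
    by_contra h0
    exact not_covers_iff.1 hv (h.cov v h0)
  | unmatchedEdge k v u hv hk he ih =>
    refine ⟨fun h => by simp [Nat.even_add_one, hk] at h, fun _ => ?_⟩
    obtain ⟨e, he, h1, h2, h3⟩ := adj_iff.1 he
    have h4 := h.feasible e (Finset.mem_sdiff.1 he).1
    have h5 := ih.1 hk
    have h6 := h.le_two u
    rcases h1 with rfl | rfl <;> rcases h2 with rfl | rfl <;> simp_all [wt] <;> omega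
  | matchedEdge k v u hv hk he ih =>
    refine ⟨fun _ => ?_, fun h => by simp [Nat.odd_add_one, hk] at h⟩
    obtain ⟨e, he, h1, h2, h3⟩ := adj_iff.1 he
    have h4 := h.tight e he
    have h5 := ih.2 hk
    rcases h1 with rfl | rfl <;> rcases h2 with rfl | rfl <;> simp_all [wt]

end Dual

/-- A dual certificate whose weights are the labels of the vertices: weight `0` for even, `1` for
unreachable and `2` for odd vertices, the latter being witnessed by alternating paths. -/
structure Cert (F M : Finset Edge) (w : Vertex → ℕ) : Prop where
  dual : Dual F M w
  even : ∀ v, w v = 0 → ∃ k, Even k ∧ AltPath F M k v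
  odd : ∀ v, w v = 2 → ∃ k, Odd k ∧ AltPath F M k v

namespace Cert

variable {F M N : Finset Edge} {w : Vertex → ℕ}

open Classical in
/-- The labels do not depend on the maximum matching: the labels read off from the alternating
paths of `N` form a dual certificate, so `M` is complementary to them as well. -/
theorem of_max (h : Cert F M w) (hN : IsMaximumMatching F N) : Cert F N w := by
  have hd := h.dual.of_max hN
  let w' : Vertex → ℕ := fun v =>
    if ∃ k, Even k ∧ AltPath F N k v then 0 else if ∃ k, Odd k ∧ AltPath F N k v then 2 else 1
  have e0 : ∀ v, w' v = 0 ↔ ∃ k, Even k ∧ AltPath F N k v := by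
    intro v
    simp only [w']
    split_ifs <;> simp_all
  have e2 : ∀ v, (∃ k, Odd k ∧ AltPath F N k v) → w' v = 2 := by
    rintro v ⟨k, hk, hv⟩
    have h1 := (hd.alt_label hv).2 hk
    have h2 : ¬ ∃ k, Even k ∧ AltPath F N k v := by
      rintro ⟨l, hl, hv'⟩
      have := (hd.alt_label hv').1 hl
      omega
    simp only [w', if_neg h2]
    rw [if_pos ⟨k, hk, hv⟩]
  have e2' : ∀ v, w' v = 2 → ∃ k, Odd k ∧ AltPath F N k v := by
    intro v
    simp only [w']
    split_ifs <;> simp_all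
  have e1 : ∀ v, w' v ≠ 0 → w' v ≠ 2 → w' v = 1 := by
    intro v
    simp only [w']
    split_ifs <;> simp_all
  -- the edge of `N` at an even vertex leads back to its predecessor
  have back : ∀ e ∈ N, ∀ u v, Inc u e → Inc v e → u ≠ v → w' u = 0 → w' v = 2 := by
    intro e he u v hu hv huv h0
    obtain ⟨k, hk, hp⟩ := (e0 u).1 h0
    cases hp with
    | start _ hs => exact absurd ⟨e, he, hu⟩ (not_covers_iff.1 hs)
    | unmatchedEdge k x _ hx hk' hxu => simp [Nat.even_add_one, hk'] at hk
    | matchedEdge k x _ hx hk' hxu =>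
      obtain ⟨f, hf, h1, h2, h3⟩ := adj_iff.1 hxu
      have := isMatching_iff.1 hN.2.1 u f hf e he h2 hu
      subst this
      have : x = v := by
        rcases h1 with rfl | rfl <;> rcases h2 with rfl | rfl <;> rcases hv with rfl | rfl <;>
          simp_all
      subst this
      exact e2 _ ⟨k, hk', hx⟩
  have step : ∀ e ∈ F, ∀ u v, Inc u e → Inc v e → u ≠ v → w' u = 0 → w' v = 2 := by
    intro e he u v hu hv huv h0
    by_cases heN : e ∈ N
    · exact back e heN u v hu hv huv h0
    · obtain ⟨k, hk, hp⟩ := (e0 u).1 h0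
      exact e2 _ ⟨k + 1, hk.add_one, .unmatchedEdge k u v hp hk
        (adj_iff.2 ⟨e, Finset.mem_sdiff.2 ⟨he, heN⟩, hu, hv, huv⟩)⟩
  have hd' : Dual F N w' := by
    refine ⟨hN.1, hN.2.1, fun e he => ?_, fun e he => ?_, fun v hv => ?_⟩
    · have h1 := step e he _ _ (inc_inl e) (inc_inr e) (by simp)
      have h2 := step e he _ _ (inc_inr e) (inc_inl e) (by simp)
      unfold wt
      by_cases h3 : w' (Sum.inl e.1) = 0
      · have := h1 h3
        omega
      · by_cases h4 : w' (Sum.inr e.2) = 0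
        · have := h2 h4
          omega
        · omega
    · have h1 := back e he _ _ (inc_inl e) (inc_inr e) (by simp)
      have h2 := back e he _ _ (inc_inr e) (inc_inl e) (by simp)
      have fwd : ∀ u v, Inc u e → Inc v e → u ≠ v → w' u = 2 → w' v = 0 := by
        intro u v hu hv huv h
        obtain ⟨k, hk, hp⟩ := e2' u h
        exact (e0 v).2 ⟨k + 1, hk.add_one, .matchedEdge k u v hp hk
          (adj_iff.2 ⟨e, he, hu, hv, huv⟩)⟩
      have h3 := fwd _ _ (inc_inl e) (inc_inr e) (by simp)
      have h4 := fwd _ _ (inc_inr e) (inc_inl e) (by simp)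
      have h5 := e1 (Sum.inl e.1)
      have h6 := e1 (Sum.inr e.2)
      unfold wt
      omega
    · by_contra hc
      exact hv ((e0 v).2 ⟨0, by simp, .start v (not_covers_iff.2 hc)⟩)
  have hM := hd'.of_max h.dual.isMaximumMatching
  refine ⟨hd, fun v hv => ?_, fun v hv => ?_⟩
  · obtain ⟨k, hk, hp⟩ := h.even v hv
    exact (e0 v).1 ((hM.alt_label hp).1 hk)
  · obtain ⟨k, hk, hp⟩ := h.odd v hv
    exact e2' v ((hM.alt_label hp).2 hk)

theorem isEvenVertex_iff (h : Cert F M w) (v : Vertex) : IsEvenVertex F v ↔ w v = 0 := by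
  constructor
  · rintro ⟨N, hN, k, hk, hp⟩
    exact ((h.of_max hN).dual.alt_label hp).1 hk
  · intro hv
    exact ⟨M, h.dual.isMaximumMatching, h.even v hv⟩

theorem isOddVertex_iff (h : Cert F M w) (v : Vertex) : IsOddVertex F v ↔ w v = 2 := by
  constructor
  · rintro ⟨N, hN, k, hk, hp⟩
    exact ((h.of_max hN).dual.alt_label hp).2 hk
  · intro hv
    exact ⟨M, h.dual.isMaximumMatching, h.odd v hv⟩

theorem isUnreachableVertex_iff (h : Cert F M w) (v : Vertex) :
    IsUnreachableVertex F v ↔ w v = 1 := by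
  constructor
  · rintro ⟨N, hN, hp⟩
    have hN' := h.of_max hN
    have h2 := hN'.dual.le_two v
    have h0 : w v ≠ 0 := fun h0 => by
      obtain ⟨k, -, hk⟩ := hN'.even v h0
      exact hp k hk
    have h1 : w v ≠ 2 := fun h0 => by
      obtain ⟨k, -, hk⟩ := hN'.odd v h0
      exact hp k hk
    omega
  · intro hv
    refine ⟨M, h.dual.isMaximumMatching, fun k hk => ?_⟩
    have h1 := h.dual.alt_label hk
    rcases Nat.even_or_odd k with hk | hk
    · have := h1.1 hk
      omega
    · have := h1.2 hk
      omega

theorem isUselessEdge_iff (h : Cert F M w) {e : Edge} (he : e ∈ F) :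
    IsUselessEdge F e ↔ wt w e ≠ 2 := by
  simp only [IsUselessEdge, h.isOddVertex_iff, h.isUnreachableVertex_iff, wt]
  have h1 := h.dual.feasible e he
  have h2 := h.dual.le_two (Sum.inl e.1)
  have h3 := h.dual.le_two (Sum.inr e.2)
  unfold wt at h1
  omega

theorem isBlockedEdge_iff (h : Cert F M w) (e : Edge) :
    IsBlockedEdge F e ↔ w (Sum.inl e.1) ≠ 0 ∨ w (Sum.inr e.2) ≠ 0 := by
  simp only [IsBlockedEdge, h.isOddVertex_iff, h.isUnreachableVertex_iff]
  have h2 := h.dual.le_two (Sum.inl e.1)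
  have h3 := h.dual.le_two (Sum.inr e.2)
  omega

/-- Alternating paths use only edges whose weight sum is `2`. -/
theorem altPath_of_sub (h : Cert F M w) {F' : Finset Edge}
    (hF : ∀ e ∈ F, wt w e = 2 → e ∈ F') {k : ℕ} {v : Vertex} (hp : AltPath F M k v) :
    AltPath F' M k v := by
  induction hp with
  | start v hv => exact .start v hv
  | unmatchedEdge k v u hv hk he ih =>
    refine .unmatchedEdge k v u ih hk ?_
    have hu := (h.dual.alt_label (.unmatchedEdge k v u hv hk he)).2 hk.add_one
    have hv := (h.dual.alt_label hv).1 hk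
    obtain ⟨e, he, h1, h2, h3⟩ := adj_iff.1 he
    rw [Finset.mem_sdiff] at he
    refine adj_iff.2 ⟨e, Finset.mem_sdiff.2 ⟨hF e he.1 ?_, he.2⟩, h1, h2, h3⟩
    rcases h1 with rfl | rfl <;> rcases h2 with rfl | rfl <;> simp_all [wt]
  | matchedEdge k v u hv hk he ih => exact .matchedEdge k v u ih hk he

theorem reduce (h : Cert F M w) {F' : Finset Edge} (hF' : F' ⊆ F)
    (hF : ∀ e ∈ F, wt w e = 2 → e ∈ F') : Cert F' M w :=
  ⟨⟨fun e he => hF e (h.dual.sub he) (h.dual.tight e he), h.dual.matching,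
    fun e he => h.dual.feasible e (hF' he), h.dual.tight, h.dual.cov⟩,
   fun v hv => let ⟨k, hk, hp⟩ := h.even v hv; ⟨k, hk, h.altPath_of_sub hF hp⟩,
   fun v hv => let ⟨k, hk, hp⟩ := h.odd v hv; ⟨k, hk, h.altPath_of_sub hF hp⟩⟩

theorem empty : Cert ∅ ∅ (fun _ => 0) :=
  ⟨⟨le_rfl, by simp [IsMatching], by simp, by simp, by simp⟩,
   fun v _ => ⟨0, by simp, .start v (by simp [adj_iff])⟩, by simp⟩

theorem eq_zero_of_empty (h : Cert ∅ M w) (v : Vertex) : w v = 0 := by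
  by_contra h0
  obtain ⟨e, he, -⟩ := h.dual.cov v h0
  exact absurd (h.dual.sub he) (by simp)

/-- If an edge between two even vertices joins the graph, then the maximum matching grows. -/
theorem card_lt {F' M' : Finset Edge} {w' : Vertex → ℕ} (h : Cert F M w) (h' : Cert F' M' w')
    (hF : ∀ e ∈ F, wt w e = 2 → e ∈ F') {e : Edge} (he : e ∈ F')
    (h1 : w (Sum.inl e.1) = 0) (h2 : w (Sum.inr e.2) = 0) : M.card < M'.card := by
  have hM : M ⊆ F' := fun e he => hF e (h.dual.sub he) (h.dual.tight e he)
  by_contra hc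
  have hd := h'.dual.of_card hM h.dual.matching (by omega)
  obtain ⟨k, hk, hp⟩ := h.even _ h1
  obtain ⟨l, hl, hq⟩ := h.even _ h2
  have h3 := (hd.alt_label (h.altPath_of_sub hF hp)).1 hk
  have h4 := (hd.alt_label (h.altPath_of_sub hF hq)).1 hl
  have := hd.feasible e he
  unfold wt at this
  omega

end Cert

/-! ### The stages and prefix-optimal matchings -/

namespace Instance

variable (G : Instance)

theorem mem_edges {e : Edge} : e ∈ G.edges ↔ G.rank e ≠ 0 := by
  simp only [edges, Finset.mem_filter, and_iff_right_iff_imp]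
  intro h
  by_contra h'
  exact h (G.rank_eq_zero e h')

theorem labelGraph_zero : G.labelGraph 0 = ∅ := by
  ext e
  have h : G.phase 0 = ⟨∅, G.edges⟩ := rfl
  simp [labelGraph, enter, h, mem_edges]

theorem mem_reduced_succ {i : ℕ} {e : Edge} : e ∈ (G.phase (i + 1)).reduced ↔
    e ∈ G.labelGraph (i + 1) ∧ ¬ IsUselessEdge (G.labelGraph (i + 1)) e := by
  simp [phase, labelGraph]

theorem mem_rest_succ {i : ℕ} {e : Edge} : e ∈ (G.phase (i + 1)).rest ↔
    e ∈ (G.phase i).rest ∧ i + 1 < G.rank e ∧ ¬ IsBlockedEdge (G.labelGraph (i + 1)) e := by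
  simp [phase, labelGraph]

theorem mem_labelGraph_succ {i : ℕ} {e : Edge} : e ∈ G.labelGraph (i + 1) ↔
    e ∈ (G.phase i).reduced ∨ e ∈ (G.phase i).rest ∧ G.rank e = i + 1 := by
  simp [labelGraph, enter]

theorem reduced_subset (i : ℕ) : (G.phase i).reduced ⊆ G.labelGraph i := by
  cases i with
  | zero => simp [phase]
  | succ i => exact fun e he => (G.mem_reduced_succ.1 he).1

theorem rest_subset (i : ℕ) : (G.phase i).rest ⊆ G.edges := by
  induction i with
  | zero => simp [phase]
  | succ i ih => exact fun e he => ih (G.mem_rest_succ.1 he).1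

theorem lt_rank_of_mem_rest {i : ℕ} {e : Edge} (he : e ∈ (G.phase i).rest) : i < G.rank e := by
  cases i with
  | zero =>
    have := G.mem_edges.1 (G.rest_subset 0 he)
    omega
  | succ i => exact (G.mem_rest_succ.1 he).2.1

theorem labelGraph_subset (i : ℕ) : ∀ e ∈ G.labelGraph i, e ∈ G.edges ∧ G.rank e ≤ i := by
  induction i with
  | zero => simp [labelGraph_zero]
  | succ i ih =>
    intro e he
    rcases G.mem_labelGraph_succ.1 he with he | ⟨he, h⟩
    · have := ih e (G.reduced_subset i he)
      exact ⟨this.1, by omega⟩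
    · exact ⟨G.rest_subset i he, by omega⟩

/-- The edges that are present after stage `i`. -/
noncomputable def alive (i : ℕ) : Finset Edge := (G.phase i).reduced ∪ (G.phase i).rest

theorem mem_alive {i : ℕ} {e : Edge} :
    e ∈ G.alive i ↔ e ∈ (G.phase i).reduced ∨ e ∈ (G.phase i).rest := Finset.mem_union

theorem mem_labelGraph_succ_iff {i : ℕ} {e : Edge} :
    e ∈ G.labelGraph (i + 1) ↔ e ∈ G.alive i ∧ G.rank e ≤ i + 1 := by
  rw [mem_labelGraph_succ, mem_alive]
  constructor
  · rintro (h | ⟨h, h'⟩)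
    · exact ⟨Or.inl h, ((G.labelGraph_subset i e (G.reduced_subset i h)).2.trans (by omega))⟩
    · exact ⟨Or.inr h, by omega⟩
  · rintro ⟨h | h, h'⟩
    · exact Or.inl h
    · have := G.lt_rank_of_mem_rest h
      exact Or.inr ⟨h, by omega⟩

theorem mem_reduced_of_mem_labelGraph {i j : ℕ} (hj : j ≤ i) {e : Edge}
    (he : e ∈ G.labelGraph (i + 1)) (hr : G.rank e ≤ j) : e ∈ (G.phase j).reduced := by
  induction i with
  | zero =>
    obtain rfl : j = 0 := by omega
    exact absurd (G.labelGraph_subset 1 e he).1 (by rw [mem_edges]; omega)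
  | succ i ih =>
    rcases G.mem_labelGraph_succ.1 he with h | ⟨h, h'⟩
    · rcases Nat.lt_or_ge i j with hij | hij
      · obtain rfl : j = i + 1 := by omega
        exact h
      · exact ih hij (G.reduced_subset _ h)
    · omega

theorem mem_rest_of_mem_labelGraph {i j : ℕ} (hj : j ≤ i) {e : Edge}
    (he : e ∈ G.labelGraph (i + 1)) (hr : j < G.rank e) : e ∈ (G.phase j).rest := by
  induction i with
  | zero =>
    obtain rfl : j = 0 := by omega
    rcases G.mem_labelGraph_succ.1 he with h | ⟨h, h'⟩
    · simp [phase] at h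
    · exact h
  | succ i ih =>
    rcases Nat.lt_or_ge i j with hij | hij
    · obtain rfl : j = i + 1 := by omega
      rcases G.mem_labelGraph_succ.1 he with h | ⟨h, h'⟩
      · have := (G.labelGraph_subset _ _ (G.reduced_subset _ h)).2
        omega
      · exact h
    · rcases G.mem_labelGraph_succ.1 he with h | ⟨h, h'⟩
      · exact ih hij (G.reduced_subset _ h)
      · have h1 : ∀ d, e ∈ (G.phase (j + d)).rest → e ∈ (G.phase j).rest := by
          intro d
          induction d with
          | zero => exact id
          | succ d ihd => exact fun hd => ihd (G.mem_rest_succ.1 hd).1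
        obtain ⟨d, hd⟩ := Nat.exists_eq_add_of_le (show j ≤ i + 1 by omega)
        exact h1 d (hd ▸ h)

/-! #### Signatures -/

/-- The edges of rank at most `i` of `M`. -/
def trunc (i : ℕ) (M : Finset Edge) : Finset Edge := M.filter (fun e => G.rank e ≤ i)

@[simp] theorem mem_trunc {i : ℕ} {M : Finset Edge} {e : Edge} :
    e ∈ G.trunc i M ↔ e ∈ M ∧ G.rank e ≤ i := by simp [trunc]

theorem trunc_subset (i : ℕ) (M : Finset Edge) : G.trunc i M ⊆ M := Finset.filter_subset _ _

theorem trunc_trunc {i j : ℕ} (h : j ≤ i) (M : Finset Edge) :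
    G.trunc j (G.trunc i M) = G.trunc j M := by
  ext e
  simp only [mem_trunc]
  constructor
  · exact fun h => ⟨h.1.1, h.2⟩
  · exact fun h => ⟨⟨h.1, by omega⟩, h.2⟩

theorem trunc_eq_self {i : ℕ} {M : Finset Edge} (h : ∀ e ∈ M, G.rank e ≤ i) : G.trunc i M = M :=
  Finset.filter_true_of_mem h

theorem signature_trunc {i j : ℕ} (h : j ≤ i) (M : Finset Edge) :
    G.signature (G.trunc i M) j = G.signature M j := by
  unfold signature trunc
  rw [Finset.filter_filter]
  congr 1
  ext e
  simp only [Finset.mem_filter]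
  constructor
  · exact fun h => ⟨h.1, h.2.2⟩
  · exact fun h => ⟨h.1, by omega, h.2⟩

theorem card_trunc (i : ℕ) (M : Finset Edge) :
    (G.trunc i M).card = ∑ j ∈ Finset.range (i + 1), G.signature M j := by
  rw [Finset.card_eq_sum_card_fiberwise (f := G.rank) (t := Finset.range (i + 1))]
  · refine Finset.sum_congr rfl fun j hj => ?_
    rw [← G.signature_trunc (show j ≤ i by simp at hj; omega) M]
    rfl
  · intro e he
    simp only [Finset.mem_coe, mem_trunc] at he
    simp
    omega

theorem signature_succ (i : ℕ) (M : Finset Edge) :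
    G.signature M (i + 1) = (G.trunc (i + 1) M).card - (G.trunc i M).card := by
  rw [card_trunc, card_trunc, Finset.sum_range_succ _ (i + 1)]
  omega

theorem signature_zero {M : Finset Edge} (h : M ⊆ G.edges) : G.signature M 0 = 0 := by
  simp only [signature, Finset.card_eq_zero, Finset.filter_eq_empty_iff]
  exact fun e he => G.mem_edges.1 (h he)

/-- `M` is better than `N` if only ranks up to `i` are considered. -/
def BetterTo (i : ℕ) (M N : Finset Edge) : Prop :=
  ∃ k ≤ i, (∀ j < k, G.signature M j = G.signature N j) ∧ G.signature N k < G.signature M k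

/-- `N` uses edges of rank at most `i` only, and is optimal among all matchings if only these ranks
are considered. -/
structure Opt (i : ℕ) (N : Finset Edge) : Prop where
  sub : N ⊆ G.edges
  matching : IsMatching N
  rank_le : ∀ e ∈ N, G.rank e ≤ i
  best : ∀ N', N' ⊆ G.edges → IsMatching N' → ¬ G.BetterTo i N' N

variable {G}

theorem betterTo_or_eq (i : ℕ) (M N : Finset Edge) :
    G.BetterTo i M N ∨ G.BetterTo i N M ∨ ∀ j ≤ i, G.signature M j = G.signature N j := by
  by_cases h : ∃ j, j ≤ i ∧ G.signature M j ≠ G.signature N j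
  · have h1 := Nat.find_spec h
    have h2 : ∀ j < Nat.find h, G.signature M j = G.signature N j := by
      intro j hj
      have := Nat.find_min h hj
      by_contra h'
      exact this ⟨by omega, h'⟩
    rcases Nat.lt_or_gt_of_ne h1.2 with h3 | h3
    · exact Or.inr (Or.inl ⟨_, h1.1, fun j hj => (h2 j hj).symm, h3⟩)
    · exact Or.inl ⟨_, h1.1, h2, h3⟩
  · push Not at h
    exact Or.inr (Or.inr h)

theorem BetterTo.congr {i : ℕ} {M N N' : Finset Edge} (h : G.BetterTo i M N)
    (hN : ∀ j ≤ i, G.signature N j = G.signature N' j) : G.BetterTo i M N' := by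
  obtain ⟨k, hk, h1, h2⟩ := h
  exact ⟨k, hk, fun j hj => (h1 j hj).trans (hN j (by omega)), by rwa [← hN k hk]⟩

theorem BetterTo.mono {i j : ℕ} {M N : Finset Edge} (h : G.BetterTo j M N) (hj : j ≤ i) :
    G.BetterTo i M N := by
  obtain ⟨k, hk, h1⟩ := h
  exact ⟨k, hk.trans hj, h1⟩

namespace Opt

variable {i j : ℕ} {M N : Finset Edge}

theorem signature_eq (hM : G.Opt i M) (hN : G.Opt i N) :
    ∀ j ≤ i, G.signature M j = G.signature N j := by
  rcases betterTo_or_eq (G := G) i M N with h | h | h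
  · exact absurd h (hN.best M hM.sub hM.matching)
  · exact absurd h (hM.best N hN.sub hN.matching)
  · exact h

theorem card_eq (hM : G.Opt i M) (hN : G.Opt i N) : M.card = N.card := by
  rw [← G.trunc_eq_self hM.rank_le, ← G.trunc_eq_self hN.rank_le, card_trunc, card_trunc]
  exact Finset.sum_congr rfl fun j hj => hM.signature_eq hN j (by simp at hj; omega)

theorem of_signature (hM : G.Opt i M) (hN : N ⊆ G.edges) (hN' : IsMatching N)
    (h : ∀ j ≤ i, G.signature N j = G.signature M j) : G.Opt i (G.trunc i N) := by
  refine ⟨(G.trunc_subset i N).trans hN, hN'.mono (G.trunc_subset i N),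
    fun e he => (G.mem_trunc.1 he).2, fun L hL hL' hb => hM.best L hL hL' (hb.congr fun j hj => ?_)⟩
  rw [G.signature_trunc hj, h j hj]

theorem trunc (hM : G.Opt i M) (hj : j ≤ i) : G.Opt j (G.trunc j M) := by
  refine ⟨(G.trunc_subset j M).trans hM.sub, hM.matching.mono (G.trunc_subset j M),
    fun e he => (G.mem_trunc.1 he).2, fun L hL hL' hb => hM.best L hL hL' ?_⟩
  exact (hb.congr fun k hk => G.signature_trunc hk M).mono hj

theorem zero : G.Opt 0 ∅ := by
  refine ⟨by simp, by simp [IsMatching], by simp, fun N hN _ => ?_⟩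
  rintro ⟨k, hk, -, h⟩
  obtain rfl : k = 0 := by omega
  rw [G.signature_zero hN] at h
  omega

end Opt

theorem IsRankMaximal.opt_trunc {M : Finset Edge} (h : G.IsRankMaximal M) (i : ℕ) :
    G.Opt i (G.trunc i M) := by
  refine ⟨(G.trunc_subset i M).trans h.1, h.2.1.mono (G.trunc_subset i M),
    fun e he => (G.mem_trunc.1 he).2, fun L hL hL' hb => ?_⟩
  obtain ⟨k, hk, h1, h2⟩ := hb.congr (fun k hk => G.signature_trunc hk M)
  rcases h.2.2 L hL hL' with h3 | ⟨l, h3, h4⟩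
  · rw [h3] at h2
    omega
  · rcases Nat.lt_trichotomy l k with h5 | rfl | h5
    · have := h1 l h5
      omega
    · omega
    · have := h3 k h5
      omega

/-! #### Prefix-optimal matchings are maximum matchings of the stages -/

variable (G)

/-- The theorem of Irving et al. for the stages up to `i`: the labels of each stage are certified,
and the prefix-optimal matchings are maximum matchings of the graph of the stage. -/
def Hist (i : ℕ) : Prop :=
  ∀ j ≤ i, ∃ K w, Cert (G.labelGraph j) K w ∧ G.Opt j K ∧ ∀ N, G.Opt j N → N ⊆ G.labelGraph j

variable {G}

theorem Hist.mono {i j : ℕ} (h : G.Hist i) (hj : j ≤ i) : G.Hist j :=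
  fun k hk => h k (hk.trans hj)

theorem Hist.isMaximumMatching {i : ℕ} (h : G.Hist i) {N : Finset Edge} (hN : G.Opt i N) :
    IsMaximumMatching (G.labelGraph i) N := by
  obtain ⟨K, w, hc, hK, hs⟩ := h i le_rfl
  exact ⟨hs N hN, hN.matching, fun L hL hL' => by
    rw [hN.card_eq hK]
    exact hc.dual.isMaximumMatching.2.2 L hL hL'⟩

theorem Hist.cert {i : ℕ} (h : G.Hist i) {N : Finset Edge} (hN : G.Opt i N) :
    ∃ w, Cert (G.labelGraph i) N w := by
  obtain ⟨K, w, hc, hK, hs⟩ := h i le_rfl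
  exact ⟨w, hc.of_max (h.isMaximumMatching hN)⟩

theorem Hist.zero : G.Hist 0 := by
  intro j hj
  obtain rfl : j = 0 := by omega
  refine ⟨∅, fun _ => 0, by rw [labelGraph_zero]; exact Cert.empty, Opt.zero, fun N hN e he => ?_⟩
  have h1 := hN.rank_le e he
  have h2 := G.mem_edges.1 (hN.sub he)
  omega

theorem mem_reduced_of_tight {i : ℕ} {K : Finset Edge} {w : Vertex → ℕ}
    (h : Cert (G.labelGraph i) K w) {e : Edge} (he : e ∈ G.labelGraph i) :
    e ∈ (G.phase i).reduced ↔ wt w e = 2 := by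
  cases i with
  | zero => simp [labelGraph_zero] at he
  | succ i => rw [mem_reduced_succ, h.isUselessEdge_iff he]; simp [he]

theorem mem_rest_iff {i : ℕ} {K : Finset Edge} {w : Vertex → ℕ}
    (h : Cert (G.labelGraph (i + 1)) K w) {e : Edge} :
    e ∈ (G.phase (i + 1)).rest ↔ e ∈ (G.phase i).rest ∧ i + 1 < G.rank e ∧
      w (Sum.inl e.1) = 0 ∧ w (Sum.inr e.2) = 0 := by
  rw [mem_rest_succ, h.isBlockedEdge_iff]
  tauto

theorem even_of_mem_rest {i : ℕ} {K : Finset Edge} {w : Vertex → ℕ}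
    (h : Cert (G.labelGraph i) K w) {e : Edge} (he : e ∈ (G.phase i).rest) :
    w (Sum.inl e.1) = 0 ∧ w (Sum.inr e.2) = 0 := by
  cases i with
  | zero =>
    rw [labelGraph_zero] at h
    exact ⟨h.eq_zero_of_empty _, h.eq_zero_of_empty _⟩
  | succ i => exact ((mem_rest_iff h).1 he).2.2

/-- A matching with a prefix that is optimal up to rank `i` avoids the edges deleted so far. -/
theorem Hist.mem_of_opt {i : ℕ} (h : G.Hist i) {N : Finset Edge} (hN : N ⊆ G.edges)
    (hN' : IsMatching N) (ho : G.Opt i (G.trunc i N)) :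
    (∀ e ∈ N, G.rank e ≤ i → e ∈ (G.phase i).reduced) ∧
    (∀ e ∈ N, i < G.rank e → e ∈ (G.phase i).rest) := by
  induction i with
  | zero =>
    refine ⟨fun e he hr => ?_, fun e he hr => hN he⟩
    have := G.mem_edges.1 (hN he)
    omega
  | succ i ih =>
    have ho' : G.Opt i (G.trunc i N) := by
      have := ho.trunc (Nat.le_succ i)
      rwa [G.trunc_trunc (Nat.le_succ i)] at this
    obtain ⟨h1, h2⟩ := ih (h.mono (Nat.le_succ i)) ho'
    obtain ⟨w, hw⟩ := h.cert ho
    refine ⟨fun e he hr => ?_, fun e he hr => ?_⟩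
    · have he' : e ∈ G.trunc (i + 1) N := by simp [he, hr]
      exact (mem_reduced_of_tight hw (hw.dual.sub he')).2 (hw.dual.tight e he')
    · refine (mem_rest_iff hw).2 ⟨h2 e he (by omega), hr, ?_⟩
      have h3 : ∀ v, Inc v e → w v = 0 := by
        intro v hv
        by_contra h0
        obtain ⟨f, hf, hvf⟩ := hw.dual.cov v h0
        rw [mem_trunc] at hf
        have := hN'.eq hf.1 he hvf hv
        subst this
        omega
      exact ⟨h3 _ (inc_inl e), h3 _ (inc_inr e)⟩

theorem Hist.trunc_succ_subset {i : ℕ} (h : G.Hist i) {N : Finset Edge} (hN : N ⊆ G.edges)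
    (hN' : IsMatching N) (ho : G.Opt i (G.trunc i N)) :
    G.trunc (i + 1) N ⊆ G.labelGraph (i + 1) := by
  obtain ⟨h1, h2⟩ := h.mem_of_opt hN hN' ho
  intro e he
  rw [mem_trunc] at he
  rw [mem_labelGraph_succ]
  rcases Nat.lt_or_ge i (G.rank e) with h3 | h3
  · exact Or.inr ⟨h2 e he.1 h3, by omega⟩
  · exact Or.inl (h1 e he.1 h3)

/-- Augmentation in the graph of stage `i + 1` keeps the prefix up to rank `i` optimal, since it
keeps the vertices covered that are odd or unreachable in an earlier stage. -/
theorem Hist.opt_of_covers {i : ℕ} (h : G.Hist i) {K K' : Finset Edge} (hK : G.Opt i K)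
    (hs : K' ⊆ G.labelGraph (i + 1)) (hm : IsMatching K')
    (hc : ∀ v, Covers K v → Covers K' v) : G.Opt i (G.trunc i K') := by
  have hE : K' ⊆ G.edges := fun e he => (G.labelGraph_subset _ e (hs he)).1
  have key : ∀ j ≤ i, (G.trunc j K').card = (G.trunc j K).card := by
    intro j hj
    have hKj : G.Opt j (G.trunc j K) := hK.trunc hj
    obtain ⟨w, hw⟩ := (h.mono hj).cert hKj
    have hred : ∀ e ∈ G.trunc j K', e ∈ (G.phase j).reduced := by
      intro e he
      rw [mem_trunc] at he
      exact G.mem_reduced_of_mem_labelGraph hj (hs he.1) he.2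
    have hd : Dual (G.labelGraph j) (G.trunc j K') w := by
      refine ⟨fun e he => G.reduced_subset j (hred e he), hm.mono (G.trunc_subset _ _),
        hw.dual.feasible, fun e he => ?_, fun v hv => ?_⟩
      · exact (mem_reduced_of_tight hw (G.reduced_subset j (hred e he))).1 (hred e he)
      · obtain ⟨f, hf, hvf⟩ := hw.dual.cov v hv
        obtain ⟨e, he, hve⟩ := hc v ⟨f, (G.mem_trunc.1 hf).1, hvf⟩
        refine ⟨e, G.mem_trunc.2 ⟨he, ?_⟩, hve⟩
        by_contra hr
        have := even_of_mem_rest hw (G.mem_rest_of_mem_labelGraph hj (hs he) (by omega))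
        rcases hve with rfl | rfl
        · exact hv this.1
        · exact hv this.2
    have h1 := hd.isMaximumMatching
    have h2 := hw.dual.isMaximumMatching
    exact le_antisymm (h2.2.2 _ h1.1 h1.2.1) (h1.2.2 _ h2.1 h2.2.1)
  refine hK.of_signature hE hm fun j hj => ?_
  cases j with
  | zero => rw [G.signature_zero hE, G.signature_zero hK.sub]
  | succ j => rw [signature_succ, signature_succ, key _ hj, key _ (by omega)]

/-- The inductive step of the theorem of Irving et al.: among the matchings that are optimal up to
rank `i`, the maximum matchings of the graph of stage `i + 1` have the most edges of rank `i + 1`. -/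
theorem Hist.succ {i : ℕ} (h : G.Hist i) {K : Finset Edge} {w : Vertex → ℕ}
    (hK : G.Opt i (G.trunc i K)) (hc : Cert (G.labelGraph (i + 1)) K w) :
    G.Hist (i + 1) ∧ G.Opt (i + 1) K := by
  have hE : K ⊆ G.edges := fun e he => (G.labelGraph_subset _ e (hc.dual.sub he)).1
  have hr : ∀ e ∈ K, G.rank e ≤ i + 1 := fun e he => (G.labelGraph_subset _ e (hc.dual.sub he)).2
  have hKo : G.Opt (i + 1) K := by
    refine ⟨hE, hc.dual.matching, hr, fun N hN hN' ⟨k, hk, h1, h2⟩ => ?_⟩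
    rcases Nat.lt_or_ge i k with h3 | h3
    · obtain rfl : k = i + 1 := by omega
      have h4 : G.Opt i (G.trunc i N) := hK.of_signature hN hN' fun j hj => by
        rw [h1 j (by omega), G.signature_trunc hj]
      have h5 := hc.dual.isMaximumMatching.2.2 _ (h.trunc_succ_subset hN hN' h4)
        (hN'.mono (G.trunc_subset _ _))
      have h6 : ∑ j ∈ Finset.range (i + 1), G.signature N j =
          ∑ j ∈ Finset.range (i + 1), G.signature K j :=
        Finset.sum_congr rfl fun j hj => h1 j (by simpa using hj)
      rw [← G.trunc_eq_self hr, card_trunc, card_trunc, Finset.sum_range_succ _ (i + 1),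
        Finset.sum_range_succ _ (i + 1)] at h5
      omega
    · exact hK.best N hN hN' ⟨k, h3, fun j hj => by rw [h1 j hj, G.signature_trunc (by omega)],
        by rwa [G.signature_trunc h3]⟩
  refine ⟨fun j hj => ?_, hKo⟩
  rcases Nat.lt_or_ge i j with h3 | h3
  · obtain rfl : j = i + 1 := by omega
    refine ⟨K, w, hc, hKo, fun N hN => ?_⟩
    have := h.trunc_succ_subset hN.sub hN.matching (hN.trunc (Nat.le_succ i))
    rwa [G.trunc_eq_self hN.rank_le] at this
  · exact h j h3

/-- Nothing happens in a stage in which no edge joins the graph. -/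
theorem Hist.skip {i : ℕ} (h : G.Hist i) {K : Finset Edge} {w : Vertex → ℕ}
    (hK : G.Opt i K) (hc : Cert (G.labelGraph i) K w) (d : ℕ)
    (hr : ∀ e ∈ (G.phase i).rest, i + d < G.rank e) :
    G.Hist (i + d) ∧ G.Opt (i + d) K ∧ Cert (G.labelGraph (i + d)) K w ∧
      G.phase (i + d) = G.phase i := by
  induction d with
  | zero => exact ⟨h, hK, hc, rfl⟩
  | succ d ih =>
    obtain ⟨h1, h2, h3, h4⟩ := ih fun e he => by have := hr e he; omega
    have hF : G.labelGraph (i + d + 1) = (G.phase (i + d)).reduced := by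
      ext e
      rw [mem_labelGraph_succ, or_iff_left]
      rintro ⟨h5, h6⟩
      have := hr e (h4 ▸ h5)
      omega
    have hc' : Cert (G.labelGraph (i + d + 1)) K w := by
      rw [hF]
      exact h3.reduce (G.reduced_subset _) fun e he ht => (mem_reduced_of_tight h3 he).2 ht
    have h5 := h1.succ (K := K) (w := w) (by rwa [G.trunc_eq_self h2.rank_le]) hc'
    have hred : (G.phase (i + d + 1)).reduced = (G.phase (i + d)).reduced := by
      ext e
      constructor
      · intro he
        have := G.reduced_subset _ he
        rwa [hF] at this
      · intro he
        have he' : e ∈ G.labelGraph (i + d + 1) := by rwa [hF]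
        exact (mem_reduced_of_tight hc' he').2
          ((mem_reduced_of_tight h3 (G.reduced_subset _ he)).1 he)
    have hrest : (G.phase (i + d + 1)).rest = (G.phase (i + d)).rest := by
      ext e
      rw [mem_rest_iff hc']
      constructor
      · exact fun he => he.1
      · exact fun he => ⟨he, hr e (h4 ▸ he), even_of_mem_rest h3 he⟩
    refine ⟨h5.1, h5.2, hc', ?_⟩
    rw [← h4, ← add_assoc]
    cases hp : G.phase (i + d + 1)
    cases hq : G.phase (i + d)
    simp_all

theorem Hist.isRankMaximal {i : ℕ} (h : G.Hist i) {K : Finset Edge} (hK : G.Opt i K)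
    (hr : (G.phase i).rest = ∅) : G.IsRankMaximal K := by
  refine ⟨hK.sub, hK.matching, fun N hN hN' => ?_⟩
  rcases betterTo_or_eq (G := G) i N K with h1 | ⟨k, -, h2⟩ | h1
  · exact absurd h1 (hK.best N hN hN')
  · exact Or.inr ⟨k, h2⟩
  · left
    have h2 := hK.of_signature hN hN' h1
    have h3 : ∀ e ∈ N, G.rank e ≤ i := by
      intro e he
      by_contra hc
      have := (h.mem_of_opt hN hN' h2).2 e he (by omega)
      simp [hr] at this
    rw [G.trunc_eq_self h3] at h2
    ext j
    rcases Nat.lt_or_ge i j with h4 | h4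
    · have h5 : ∀ L : Finset Edge, (∀ e ∈ L, G.rank e ≤ i) → G.signature L j = 0 := by
        intro L hL
        simp only [signature, Finset.card_eq_zero, Finset.filter_eq_empty_iff]
        intro e he
        have := hL e he
        omega
      rw [h5 N h3, h5 K hK.rank_le]
    · exact h1 j h4

end Instance

/-! ### Exchanges along closed sets of vertices -/

/-- Every edge of `F` has both or none of its end-points in `X`. -/
def Closed (F : Finset Edge) (X : Set Vertex) : Prop :=
  ∀ e ∈ F, Sum.inl e.1 ∈ X ↔ Sum.inr e.2 ∈ X

/-- Both end-points of `e` lie in `X`. -/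
def Within (X : Set Vertex) (e : Edge) : Prop := Sum.inl e.1 ∈ X ∧ Sum.inr e.2 ∈ X

theorem Closed.mono {F F' : Finset Edge} {X : Set Vertex} (h : Closed F X) (hF : F' ⊆ F) :
    Closed F' X := fun e he => h e (hF he)

theorem Closed.compl {F : Finset Edge} {X : Set Vertex} (h : Closed F X) : Closed F Xᶜ :=
  fun e he => not_congr (h e he)

theorem Closed.within_of_inc {F : Finset Edge} {X : Set Vertex} (h : Closed F X) {e : Edge}
    (he : e ∈ F) {v : Vertex} (hv : Inc v e) (hX : v ∈ X) : Within X e := by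
  rcases hv with rfl | rfl
  · exact ⟨hX, (h e he).1 hX⟩
  · exact ⟨(h e he).2 hX, hX⟩

theorem Within.mem {X : Set Vertex} {e : Edge} (h : Within X e) {v : Vertex} (hv : Inc v e) :
    v ∈ X := by
  rcases hv with rfl | rfl
  · exact h.1
  · exact h.2

open Classical in
/-- The edges of `M` within `X`. -/
noncomputable def inside (X : Set Vertex) (M : Finset Edge) : Finset Edge :=
  M.filter (Within X)

open Classical in
/-- The edges of `K` within `X` and the edges of `M` not within `X`. -/
noncomputable def mix (X : Set Vertex) (K M : Finset Edge) : Finset Edge :=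
  K.filter (Within X) ∪ M.filter (fun e => ¬ Within X e)

@[simp] theorem mem_inside {X : Set Vertex} {M : Finset Edge} {e : Edge} :
    e ∈ inside X M ↔ e ∈ M ∧ Within X e := by simp [inside]

@[simp] theorem mem_mix {X : Set Vertex} {K M : Finset Edge} {e : Edge} :
    e ∈ mix X K M ↔ e ∈ K ∧ Within X e ∨ e ∈ M ∧ ¬ Within X e := by simp [mix]

theorem inside_subset (X : Set Vertex) (M : Finset Edge) : inside X M ⊆ M :=
  fun _ he => (mem_inside.1 he).1

theorem inside_compl {X : Set Vertex} {M : Finset Edge} (h : Closed M X) {e : Edge} (he : e ∈ M) :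
    Within Xᶜ e ↔ ¬ Within X e := by
  have := h e he
  simp only [Within, Set.mem_compl_iff]
  tauto

theorem isMatching_mix {X : Set Vertex} {K M : Finset Edge} (hK : IsMatching K)
    (hM : IsMatching M) (hM' : Closed M X) : IsMatching (mix X K M) := by
  rw [isMatching_iff]
  intro v e he f hf hve hvf
  rw [mem_mix] at he hf
  rcases he with ⟨he, he'⟩ | ⟨he, he'⟩ <;> rcases hf with ⟨hf, hf'⟩ | ⟨hf, hf'⟩
  · exact hK.eq he hf hve hvf
  · exact absurd (hM'.within_of_inc hf hvf (he'.mem hve)) hf'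
  · exact absurd (hM'.within_of_inc he hve (hf'.mem hvf)) he'
  · exact hM.eq he hf hve hvf

theorem card_inside_add {X : Set Vertex} {M : Finset Edge} (h : Closed M X) :
    M.card = (inside X M).card + (inside Xᶜ M).card := by
  classical
  unfold inside
  rw [← Finset.card_filter_add_card_filter_not (s := M) (Within X),
    Finset.filter_congr fun e he => inside_compl h he]

theorem card_mix {X : Set Vertex} {K M : Finset Edge} (hM : Closed M X) :
    (mix X K M).card = (inside X K).card + (inside Xᶜ M).card := by
  classical
  unfold mix inside
  rw [Finset.card_union_of_disjoint, Finset.filter_congr fun e he => inside_compl hM he]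
  rw [Finset.disjoint_left]
  intro e he he'
  simp only [Finset.mem_filter] at he he'
  exact he'.2 he.2

namespace Instance

variable (G : Instance)

theorem signature_inside_add {X : Set Vertex} {M : Finset Edge} (h : Closed M X) (k : ℕ) :
    G.signature M k = G.signature (inside X M) k + G.signature (inside Xᶜ M) k := by
  classical
  unfold signature
  rw [card_inside_add (h.mono (Finset.filter_subset (fun e => G.rank e = k) M))]
  unfold inside
  rw [Finset.filter_comm, Finset.filter_comm (p := Within Xᶜ)]

theorem signature_mix {X : Set Vertex} {K M : Finset Edge} (hM : Closed M X) (k : ℕ) :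
    G.signature (mix X K M) k = G.signature (inside X K) k + G.signature (inside Xᶜ M) k := by
  classical
  unfold signature
  have h1 : (mix X K M).filter (fun e => G.rank e = k) =
      mix X (K.filter fun e => G.rank e = k) (M.filter fun e => G.rank e = k) := by
    ext e
    simp only [Finset.mem_filter, mem_mix]
    tauto
  rw [h1, card_mix (hM.mono (Finset.filter_subset _ M))]
  unfold inside
  rw [Finset.filter_comm, Finset.filter_comm (p := Within Xᶜ)]

end Instance

/-- The component of `z` in the union of two matchings is a path or a cycle, so the numbers of its
edges in the two matchings differ by at most `1`. The bound comes from counting: a connected set of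
vertices spans at least as many edges as it has vertices, up to one. -/
theorem exists_component {K M : Finset Edge} (hK : IsMatching K) (hM : IsMatching M) (z : Vertex) :
    ∃ S : Set Vertex, z ∈ S ∧ Closed (K ∪ M) S ∧ (∀ Y, Closed (K ∪ M) Y → z ∈ Y → S ⊆ Y) ∧
      (inside S M).card ≤ (inside S K).card + 1 ∧ (inside S K).card ≤ (inside S M).card + 1 := by
  classical
  let P : Finset Vertex → Prop := fun S => z ∈ S ∧
    (∀ Y, Closed (K ∪ M) Y → z ∈ Y → (S : Set Vertex) ⊆ Y) ∧
    S.card ≤ (inside S (K ∪ M)).card + 1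
  let T := insert z (verts (K ∪ M))
  obtain ⟨S, hS, hmax⟩ := Finset.exists_max_image (T.powerset.filter P) Finset.card
    ⟨{z}, by simp [P, T]⟩
  simp only [Finset.mem_filter, Finset.mem_powerset] at hS hmax
  obtain ⟨hST, hz, hmin, hcard⟩ := hS
  -- a maximal connected set is closed, as an edge leaving it could be added
  have hcl : Closed (K ∪ M) (S : Set Vertex) := by
    have grow : ∀ e ∈ K ∪ M, ∀ u v, Inc u e → Inc v e → u ∈ S → v ∉ S → False := by
      intro e he u v hu hv huS hvS
      have h1 : P (insert v S) := by
        refine ⟨by simp [hz], fun Y hY hzY => ?_, ?_⟩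
        · have h2 := hmin Y hY hzY
          rw [Finset.coe_insert, Set.insert_subset_iff]
          exact ⟨(hY.within_of_inc he hu (h2 huS)).mem hv, h2⟩
        · rw [Finset.card_insert_of_notMem hvS]
          have h2 : insert e (inside S (K ∪ M)) ⊆ inside (insert v S : Finset Vertex) (K ∪ M) := by
            intro f hf
            rw [Finset.mem_insert] at hf
            rcases hf with rfl | hf
            · rw [mem_inside]
              refine ⟨he, ?_⟩
              have huv : u ≠ v := fun h => hvS (h ▸ huS)
              rcases hu with rfl | rfl <;> rcases hv with rfl | rfl <;> simp_all [Within]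
            · rw [mem_inside] at hf ⊢
              exact ⟨hf.1, by simpa using Or.inr hf.2.1, by simpa using Or.inr hf.2.2⟩
          have h3 := Finset.card_le_card h2
          rw [Finset.card_insert_of_notMem] at h3
          · omega
          · rw [mem_inside]
            exact fun h => hvS (h.2.mem hv)
      have h2 := hmax (insert v S) ⟨?_, h1⟩
      · rw [Finset.card_insert_of_notMem hvS] at h2
        omega
      · rw [Finset.insert_subset_iff]
        exact ⟨Finset.mem_insert_of_mem (mem_verts.2 ⟨e, he, hv⟩), hST⟩
    intro e he
    constructor
    · intro h
      by_contra h'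
      exact grow e he _ _ (inc_inl e) (inc_inr e) h h'
    · intro h
      by_contra h'
      exact grow e he _ _ (inc_inr e) (inc_inl e) h h'
  have hle : ∀ N : Finset Edge, IsMatching N → 2 * (inside (S : Set Vertex) N).card ≤ S.card := by
    intro N hN
    have hN' := hN.mono (inside_subset (S : Set Vertex) N)
    have h1 := sum_verts hN' (fun _ => 1)
    simp only [wt, Finset.sum_const, smul_eq_mul, mul_one] at h1
    have h2 : verts (inside (S : Set Vertex) N) ⊆ S := by
      intro v hv
      obtain ⟨e, he, hve⟩ := mem_verts.1 hv
      exact (mem_inside.1 he).2.mem hve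
    have := Finset.card_le_card h2
    omega
  have h1 := hle K hK
  have h2 := hle M hM
  have h3 : (inside (S : Set Vertex) (K ∪ M)).card ≤
      (inside (S : Set Vertex) K).card + (inside (S : Set Vertex) M).card := by
    unfold inside
    rw [Finset.filter_union]
    exact Finset.card_union_le _ _
  exact ⟨S, hz, hcl, hmin, by omega, by omega⟩

namespace Instance

variable {G : Instance}

/-- The matching `M` of `G` is a starting point for an update at the vertex `z`: on no set of
vertices that avoids `z` does an exchange of the edges of `M` of rank at most `i` improve it, if
only the ranks up to `i` are considered. -/
structure Good (G : Instance) (M : Finset Edge) (z : Vertex) : Prop where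
  sub : M ⊆ G.edges
  matching : IsMatching M
  uncovered : ¬ Covers M z
  best : ∀ i N X, N ⊆ G.edges → IsMatching N → Closed (G.trunc i M ∪ N) X → z ∉ X →
    ¬ G.BetterTo i (inside X N) (inside X (G.trunc i M))

variable {M : Finset Edge} {z : Vertex}

theorem signature_inside_trunc {i k : ℕ} (hk : k ≤ i) (X : Set Vertex) (M : Finset Edge) :
    G.signature (inside X (G.trunc i M)) k = G.signature (inside X M) k := by
  rw [← G.signature_trunc hk (inside X M)]
  congr 1
  ext e
  simp only [mem_inside, mem_trunc]
  tauto

/-- Off `z`, a matching with an optimal prefix has the same signature as `M`, up to that prefix. -/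
theorem Good.signature_eq (h : G.Good M z) {i i' : ℕ} (hi : i ≤ i') {K : Finset Edge}
    (hK : K ⊆ G.edges) (hK' : IsMatching K) (ho : G.Opt i (G.trunc i K)) {X : Set Vertex}
    (hX : Closed (K ∪ G.trunc i' M) X) (hz : z ∉ X) :
    ∀ k ≤ i, G.signature (inside X K) k = G.signature (inside X (G.trunc i' M)) k := by
  have hKX : Closed K X := hX.mono Finset.subset_union_left
  have hMX : Closed (G.trunc i' M) X := hX.mono Finset.subset_union_right
  rcases betterTo_or_eq (G := G) i (inside X K) (inside X (G.trunc i' M)) with h1 | h1 | h1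
  · refine absurd ?_ (h.best i K X hK hK' ?_ hz)
    · refine h1.congr fun j hj => ?_
      rw [signature_inside_trunc hj, signature_inside_trunc (by omega)]
    · refine hX.mono (Finset.union_subset ?_ Finset.subset_union_left)
      rw [← G.trunc_trunc hi]
      exact (G.trunc_subset i _).trans Finset.subset_union_right
  · exfalso
    refine ho.best (mix X (G.trunc i' M) K) ?_ (isMatching_mix
      (h.matching.mono (G.trunc_subset _ _)) hK' hKX) ?_
    · intro e he
      rcases mem_mix.1 he with he | he
      · exact h.sub (G.trunc_subset _ _ he.1)
      · exact hK he.1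
    · obtain ⟨k, hk, h2, h3⟩ := h1
      have e1 := fun j => G.signature_mix (K := G.trunc i' M) hKX j
      have e2 := fun j => G.signature_inside_add hKX j
      refine ⟨k, hk, fun j hj => ?_, ?_⟩
      · rw [G.signature_trunc (by omega), e1, e2, h2 j hj]
      · rw [G.signature_trunc hk, e1, e2]
        omega
  · exact h1

/-- Exchange `M` for `K` on a component that contains `z`. -/
theorem Good.mix_opt (h : G.Good M z) {i i' : ℕ} (hi : i ≤ i') {K : Finset Edge}
    (ho : G.Opt i K) {S : Set Vertex} (hS : Closed (K ∪ G.trunc i' M) S) (hz : z ∈ S) :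
    mix S K (G.trunc i' M) ⊆ G.edges ∧ IsMatching (mix S K (G.trunc i' M)) ∧
      G.Opt i (G.trunc i (mix S K (G.trunc i' M))) := by
  have hs : mix S K (G.trunc i' M) ⊆ G.edges := by
    intro e he
    rcases mem_mix.1 he with he | he
    · exact ho.sub he.1
    · exact h.sub (G.trunc_subset _ _ he.1)
  have hMX : Closed (G.trunc i' M) S := hS.mono Finset.subset_union_right
  have hm := isMatching_mix ho.matching (h.matching.mono (G.trunc_subset i' M)) hMX
  refine ⟨hs, hm, ho.of_signature hs hm fun j hj => ?_⟩
  rw [G.signature_mix hMX, G.signature_inside_add (hS.mono Finset.subset_union_left),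
    h.signature_eq hi ho.sub ho.matching (by rwa [G.trunc_eq_self ho.rank_le]) hS.compl
      (by simpa using hz) j hj]

theorem card_eq_sum_signature {i : ℕ} {K : Finset Edge} (h : ∀ e ∈ K, G.rank e ≤ i) :
    K.card = ∑ j ∈ Finset.range (i + 1), G.signature K j := by
  rw [← G.trunc_eq_self h, G.card_trunc, G.trunc_eq_self h]

/-- A matching that is optimal up to all ranks but the last has at most one edge more than `M`. -/
theorem Good.card_le (h : G.Good M z) {i : ℕ} {K : Finset Edge} (hK : K ⊆ G.edges)
    (hK' : IsMatching K) (hr : ∀ e ∈ K, G.rank e ≤ i + 1) (ho : G.Opt i (G.trunc i K)) :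
    K.card ≤ (G.trunc (i + 1) M).card + 1 := by
  obtain ⟨S, hz, hS, -, -, hc⟩ := exists_component hK' (h.matching.mono (G.trunc_subset (i + 1) M)) z
  have hX := hS.compl
  have h1 := h.signature_eq (Nat.le_succ i) hK hK' ho hX (by simpa using hz)
  have h2 : G.signature (inside Sᶜ K) (i + 1) ≤
      G.signature (inside Sᶜ (G.trunc (i + 1) M)) (i + 1) := by
    by_contra h3
    refine h.best (i + 1) K Sᶜ hK hK' (by rwa [Finset.union_comm]) (by simpa using hz)
      ⟨i + 1, le_rfl, fun j hj => h1 j (by omega), by omega⟩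
  rw [card_inside_add (hS.mono Finset.subset_union_left),
    card_inside_add (M := G.trunc (i + 1) M) (hS.mono Finset.subset_union_right)]
  have h3 : (inside Sᶜ K).card ≤ (inside Sᶜ (G.trunc (i + 1) M)).card := by
    rw [card_eq_sum_signature (i := i + 1) fun e he => hr e (inside_subset _ _ he),
      card_eq_sum_signature (i := i + 1) fun e he =>
        (G.mem_trunc.1 (inside_subset _ (G.trunc (i + 1) M) he)).2]
    refine Finset.sum_le_sum fun j hj => ?_
    rcases Nat.lt_or_ge i j with h4 | h4
    · obtain rfl : j = i + 1 := by simp at hj; omega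
      exact h2
    · exact (h1 j h4).le
  omega

/-- Off a closed set that contains `z`, an optimal prefix has as many edges as that of `M`. -/
theorem Good.card_eq_compl (h : G.Good M z) {i : ℕ} {K : Finset Edge} (ho : G.Opt i K)
    {S : Set Vertex} (hz : z ∈ S) (hS : Closed (K ∪ G.trunc i M) S) :
    (inside Sᶜ K).card = (inside Sᶜ (G.trunc i M)).card := by
  rw [card_eq_sum_signature (i := i) fun e he => ho.rank_le e (inside_subset _ _ he),
    card_eq_sum_signature (i := i) fun e he =>
      (G.mem_trunc.1 (inside_subset _ (G.trunc i M) he)).2]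
  refine Finset.sum_congr rfl fun j hj => ?_
  exact h.signature_eq le_rfl ho.sub ho.matching (by rwa [G.trunc_eq_self ho.rank_le]) hS.compl
    (by simpa using hz) j (by simp at hj; omega)

/-- The number of edges of rank at most `i` changes by at most one. -/
theorem Good.card_opt (h : G.Good M z) {i : ℕ} {K : Finset Edge} (ho : G.Opt i K) :
    (G.trunc i M).card ≤ K.card + 1 ∧ K.card ≤ (G.trunc i M).card + 1 := by
  obtain ⟨S, hz, hS, -, hc, hc'⟩ :=
    exists_component ho.matching (h.matching.mono (G.trunc_subset i M)) z
  have := h.card_eq_compl ho hz hS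
  rw [card_inside_add (hS.mono Finset.subset_union_left),
    card_inside_add (M := G.trunc i M) (hS.mono Finset.subset_union_right)]
  omega

/-! #### Instances that differ by one vertex -/

/-- The instance `H` arises from `G` by deleting the vertex `v`. -/
structure IsDeletion (G H : Instance) (v : Vertex) : Prop where
  mem_edges : ∀ e, e ∈ H.edges ↔ e ∈ G.edges ∧ ¬ Inc v e
  rank_eq : ∀ e ∈ H.edges, H.rank e = G.rank e

theorem signature_congr {G H : Instance} {M : Finset Edge} (h : ∀ e ∈ M, H.rank e = G.rank e)
    (k : ℕ) : H.signature M k = G.signature M k := by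
  unfold signature
  congr 1
  ext e
  simp only [Finset.mem_filter]
  exact and_congr_right fun he => by rw [h e he]

theorem trunc_congr {G H : Instance} {M : Finset Edge} (h : ∀ e ∈ M, H.rank e = G.rank e)
    (i : ℕ) : H.trunc i M = G.trunc i M := by
  ext e
  simp only [mem_trunc]
  exact and_congr_right fun he => by rw [h e he]

theorem BetterTo.rank_congr {G H : Instance} {i : ℕ} {M N : Finset Edge}
    (hM : ∀ e ∈ M, H.rank e = G.rank e) (hN : ∀ e ∈ N, H.rank e = G.rank e) :
    H.BetterTo i M N → G.BetterTo i M N := by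
  rintro ⟨k, hk, h1, h2⟩
  refine ⟨k, hk, fun j hj => ?_, ?_⟩
  · rw [← signature_congr hM, ← signature_congr hN, h1 j hj]
  · rwa [← signature_congr hM, ← signature_congr hN]

/-- An exchange on a closed set turns an improvement there into an improvement of the whole. -/
theorem Opt.not_betterTo_inside {i : ℕ} {K N : Finset Edge} (ho : G.Opt i K) {X : Set Vertex}
    (hX : Closed K X) (hN : inside X N ⊆ G.edges) (hN' : IsMatching (inside X N)) :
    ¬ G.BetterTo i (inside X N) (inside X K) := by
  rintro ⟨k, hk, h2, h3⟩
  have e0 : inside X (inside X N) = inside X N := by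
    ext e
    simp
  refine ho.best (mix X (inside X N) K) ?_ (isMatching_mix hN' ho.matching hX) ?_
  · intro e he
    rcases mem_mix.1 he with he | he
    · exact hN he.1
    · exact ho.sub he.1
  · refine ⟨k, hk, fun j hj => ?_, ?_⟩
    · rw [G.signature_mix hX, G.signature_inside_add hX, e0, h2 j hj]
    · rw [G.signature_mix hX, G.signature_inside_add hX, e0]
      omega

/-- If `v` is added, an improvement off `v` is one of the old matching in the old instance. -/
theorem IsDeletion.good_of_add {G H : Instance} {v : Vertex} (h : IsDeletion H G v)
    (hM : G.IsRankMaximal M) : H.Good M v := by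
  have hsub : M ⊆ H.edges := fun e he => ((h.mem_edges e).1 (hM.1 he)).1
  have hrk : ∀ e ∈ M, H.rank e = G.rank e := fun e he => (h.rank_eq e (hM.1 he)).symm
  refine ⟨hsub, hM.2.1, ?_, fun i N X hN hN' hX hz hb => ?_⟩
  · rintro ⟨e, he, hv⟩
    exact ((h.mem_edges e).1 (hM.1 he)).2 hv
  · have hin : inside X N ⊆ G.edges := by
      intro e he
      rw [mem_inside] at he
      exact (h.mem_edges e).2 ⟨hN he.1, fun hv => hz (he.2.mem hv)⟩
    rw [trunc_congr hrk] at hX hb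
    refine (hM.opt_trunc i).not_betterTo_inside (N := N) (hX.mono Finset.subset_union_left) hin
      (hN'.mono (inside_subset _ _)) (hb.rank_congr (fun e he => ?_) fun e he => ?_)
    · exact (h.rank_eq e (hin he)).symm
    · exact hrk e (G.trunc_subset _ _ (inside_subset _ _ he))

/-- If the deleted vertex `v` is matched, then the start is its former partner `z`, and otherwise
it is `v` itself. -/
theorem IsDeletion.good_of_delete {G H : Instance} {v : Vertex} (h : IsDeletion G H v)
    {M₀ : Finset Edge} (hM : G.IsRankMaximal M) (hM₀ : ∀ e, e ∈ M₀ ↔ e ∈ M ∧ ¬ Inc v e)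
    (hz : ∀ e ∈ M, Inc v e → Inc z e ∧ z ≠ v) (hz' : ¬ Covers M₀ z) : H.Good M₀ z := by
  have hMM : M₀ ⊆ M := fun e he => ((hM₀ e).1 he).1
  have hsub : M₀ ⊆ H.edges := fun e he =>
    (h.mem_edges e).2 ⟨hM.1 (hMM he), ((hM₀ e).1 he).2⟩
  have hrk : ∀ e ∈ M₀, H.rank e = G.rank e := fun e he => h.rank_eq e (hsub he)
  refine ⟨hsub, hM.2.1.mono hMM, hz', fun i N X hN hN' hX hzX hb => ?_⟩
  rw [trunc_congr hrk] at hX hb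
  have hin : inside (X \ {v}) N = inside X N := by
    ext e
    simp only [mem_inside, and_congr_right_iff]
    intro he
    have := ((h.mem_edges e).1 (hN he)).2
    simp only [Inc, not_or] at this
    simp only [Within, Set.mem_sdiff, Set.mem_singleton_iff]
    exact ⟨fun h => ⟨h.1.1, h.2.1⟩, fun h => ⟨⟨h.1, Ne.symm this.1⟩, ⟨h.2, Ne.symm this.2⟩⟩⟩
  have hin' : inside (X \ {v}) (G.trunc i M) = inside X (G.trunc i M₀) := by
    ext e
    simp only [mem_inside, mem_trunc, hM₀, Within, Set.mem_sdiff, Set.mem_singleton_iff, Inc, not_or]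
    constructor
    · rintro ⟨h1, ⟨h2, h3⟩, h4, h5⟩
      exact ⟨⟨⟨h1.1, Ne.symm h3, Ne.symm h5⟩, h1.2⟩, h2, h4⟩
    · rintro ⟨⟨⟨h1, h2, h3⟩, h4⟩, h5, h6⟩
      exact ⟨⟨h1, h4⟩, ⟨h5, Ne.symm h2⟩, h6, Ne.symm h3⟩
  have hcl : Closed (G.trunc i M) (X \ {v}) := by
    intro e he
    by_cases hv : Inc v e
    · -- the edge of `M` at `v` ends in `v` and `z`, neither of which is in the set
      have h1 := hz e (G.trunc_subset _ _ he) hv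
      have h2 : v ∉ X \ {v} := by simp
      have h3 : z ∉ X \ {v} := fun h => hzX h.1
      obtain ⟨h1, h4⟩ := h1
      rcases hv with rfl | rfl <;> rcases h1 with rfl | rfl <;> tauto
    · have h2 : e ∈ G.trunc i M₀ := by
        rw [mem_trunc] at he ⊢
        exact ⟨(hM₀ e).2 ⟨he.1, hv⟩, he.2⟩
      have h3 := hX e (Finset.mem_union_left _ h2)
      simp only [Inc, not_or] at hv
      simp only [Set.mem_sdiff, Set.mem_singleton_iff, Ne.symm hv.1, Ne.symm hv.2,
        not_false_eq_true, and_true]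
      exact h3
  rw [← hin, ← hin'] at hb
  refine (hM.opt_trunc i).not_betterTo_inside hcl ?_ ?_ (hb.rank_congr (fun e he => ?_) fun e he => ?_)
  · exact fun e he => ((h.mem_edges e).1 (hN (inside_subset _ _ he))).1
  · exact hN'.mono (inside_subset _ _)
  · exact h.rank_eq e (hN (inside_subset _ _ he))
  · rw [hin'] at he
    exact hrk e (G.trunc_subset _ _ (inside_subset _ _ he))

end Instance

/-! ### The internal representation of an instance -/

/-- An instance in the form in which the update programs work on it. Vertices are the numbers
below `N`: first the `n₁` applicants, then the posts, then one dummy vertex. Vertex number `v`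
stands for `vx v`, edge number `k < m` for `ed k`, with end-points number `U k` and `W k` and rank
`RK k`; `ORG` marks the edges of the initial matching `M₀`, and `Z` is the number of the vertex `z`
at which the update takes place. The `NH` half-edges, numbered from `1`, form linked lists: the
half-edge `h` leads from `HS h` along the edge `HK h` to `HO h`, the list of `v` starts with
`HEAD v`, and `HN h` follows `h`, with `0` at the end. -/
structure Data where
  H : Instance
  M₀ : Finset Edge
  z : Vertex
  vx : ℕ → Vertex
  ed : ℕ → Edge
  (n₁ N m NH Z : ℕ)
  (RK ORG U W HEAD HN HO HK HS : ℕ → ℕ)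

namespace Data

/-- The size of the instance, which bounds the time for a pass over all vertices and edges. -/
def size (D : Data) : ℕ := D.N + D.m + 1

/-- The laws that relate the components of `Data`. The lists of half-edges are in decreasing
order. -/
structure Valid (D : Data) : Prop where
  good : D.H.Good D.M₀ D.z
  vx_inj : ∀ u < D.N, ∀ v < D.N, D.vx u = D.vx v → u = v
  ed_mem : ∀ k < D.m, D.ed k ∈ D.H.edges
  ed_inj : ∀ k < D.m, ∀ l < D.m, D.ed k = D.ed l → k = l
  ed_surj : ∀ e ∈ D.H.edges, ∃ k < D.m, D.ed k = e
  n₁_le : D.n₁ ≤ D.N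
  U_lt : ∀ k < D.m, D.U k < D.n₁
  W_ge : ∀ k < D.m, D.n₁ ≤ D.W k
  W_lt : ∀ k < D.m, D.W k < D.N
  vx_U : ∀ k < D.m, D.vx (D.U k) = Sum.inl (D.ed k).1
  vx_W : ∀ k < D.m, D.vx (D.W k) = Sum.inr (D.ed k).2
  Z_lt : D.Z < D.N
  vx_Z : D.vx D.Z = D.z
  RK_eq : ∀ k < D.m, D.RK k = D.H.rank (D.ed k)
  ORG_one : ∀ k < D.m, D.ed k ∈ D.M₀ → D.ORG k = 1
  ORG_zero : ∀ k < D.m, D.ed k ∉ D.M₀ → D.ORG k = 0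
  NH_eq : D.NH = 2 * D.m
  head_le : ∀ v < D.N, D.HEAD v ≤ D.NH
  head_src : ∀ v < D.N, D.HEAD v ≠ 0 → D.HS (D.HEAD v) = v
  le_head : ∀ h, 1 ≤ h → h ≤ D.NH → h ≤ D.HEAD (D.HS h)
  next_lt : ∀ h, 1 ≤ h → h ≤ D.NH → D.HN h < h
  next_src : ∀ h, 1 ≤ h → h ≤ D.NH → D.HN h ≠ 0 → D.HS (D.HN h) = D.HS h
  le_next : ∀ h h', 1 ≤ h' → h' < h → h ≤ D.NH → D.HS h' = D.HS h → h' ≤ D.HN h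
  half_lt : ∀ h, 1 ≤ h → h ≤ D.NH → D.HK h < D.m
  half : ∀ h, 1 ≤ h → h ≤ D.NH → D.HS h = D.U (D.HK h) ∧ D.HO h = D.W (D.HK h) ∨
    D.HS h = D.W (D.HK h) ∧ D.HO h = D.U (D.HK h)
  half_U : ∀ k < D.m, ∃ h, 1 ≤ h ∧ h ≤ D.NH ∧ D.HK h = k ∧ D.HS h = D.U k ∧ D.HO h = D.W k
  half_W : ∀ k < D.m, ∃ h, 1 ≤ h ∧ h ≤ D.NH ∧ D.HK h = k ∧ D.HS h = D.W k ∧ D.HO h = D.U k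

/-- The state `s` holds the data and the constants `0`, `1`, `2`. -/
structure Has (D : Data) (s : State) : Prop where
  zero : s.reg 10 = 0
  one : s.reg 11 = 1
  two : s.reg 12 = 2
  n₁ : s.reg 0 = D.n₁
  m : s.reg 2 = D.m
  N : s.reg 13 = D.N
  Z : s.reg 14 = D.Z
  RK : s.arr 4 = D.RK
  ORG : s.arr 5 = D.ORG
  U : s.arr 22 = D.U
  W : s.arr 23 = D.W
  HEAD : s.arr 28 = D.HEAD
  HN : s.arr 29 = D.HN
  HO : s.arr 30 = D.HO
  HK : s.arr 31 = D.HK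

theorem Has.frame {D : Data} {s s' : State} (h : D.Has s) {c : Prog} (hf : Frame c s s')
    (hr : (c.regs.all fun x => decide (x ∉ [10, 11, 12, 0, 2, 13, 14])) = true)
    (ha : (c.arrs.all fun b => decide (b ∉ [4, 5, 22, 23, 28, 29, 30, 31])) = true) :
    D.Has s' := by
  have h1 : ∀ x ∈ [10, 11, 12, 0, 2, 13, 14], s'.reg x = s.reg x := fun x hx =>
    hf.1 x fun hc => by simpa using (of_decide_eq_true (List.all_eq_true.1 hr x hc)) hx
  have h2 : ∀ b ∈ [4, 5, 22, 23, 28, 29, 30, 31], s'.arr b = s.arr b := fun x hx =>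
    hf.2 x fun hc => by simpa using (of_decide_eq_true (List.all_eq_true.1 ha x hc)) hx
  simp only [List.mem_cons, List.not_mem_nil, or_false, forall_eq_or_imp, forall_eq] at h1 h2
  obtain ⟨a1, a2, a3, a4, a5, a6, a7⟩ := h1
  obtain ⟨b1, b2, b3, b4, b5, b6, b7, b8⟩ := h2
  exact ⟨a1 ▸ h.zero, a2 ▸ h.one, a3 ▸ h.two, a4 ▸ h.n₁, a5 ▸ h.m, a6 ▸ h.N, a7 ▸ h.Z, b1 ▸ h.RK,
    b2 ▸ h.ORG, b3 ▸ h.U, b4 ▸ h.W, b5 ▸ h.HEAD, b6 ▸ h.HN, b7 ▸ h.HO, b8 ▸ h.HK⟩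

variable {D : Data}

theorem Valid.U_lt_N (hD : D.Valid) {k : ℕ} (hk : k < D.m) : D.U k < D.N :=
  (hD.U_lt k hk).trans_le hD.n₁_le

theorem Valid.inc_iff (hD : D.Valid) {k v : ℕ} (hk : k < D.m) (hv : v < D.N) :
    Inc (D.vx v) (D.ed k) ↔ v = D.U k ∨ v = D.W k := by
  unfold Inc
  rw [← hD.vx_U k hk, ← hD.vx_W k hk]
  constructor
  · rintro (h | h)
    · exact Or.inl (hD.vx_inj _ hv _ (hD.U_lt_N hk) h)
    · exact Or.inr (hD.vx_inj _ hv _ (hD.W_lt k hk) h)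
  · rintro (rfl | rfl)
    · exact Or.inl rfl
    · exact Or.inr rfl

theorem Valid.U_ne_W (hD : D.Valid) {k : ℕ} (hk : k < D.m) : D.U k ≠ D.W k := by
  have := hD.U_lt k hk
  have := hD.W_ge k hk
  omega

/-- The edge number `k` joins the vertices number `v` and `w`. -/
def Join (D : Data) (k v w : ℕ) : Prop :=
  k < D.m ∧ (v = D.U k ∧ w = D.W k ∨ v = D.W k ∧ w = D.U k)

/-- The end-point of edge number `k` other than `v`. -/
def opp (D : Data) (k v : ℕ) : ℕ := if D.U k = v then D.W k else D.U k

theorem Join.symm {k v w : ℕ} (h : D.Join k v w) : D.Join k w v := by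
  obtain ⟨hk, h⟩ := h
  exact ⟨hk, by tauto⟩

theorem Valid.join_opp (hD : D.Valid) {k v : ℕ} (hk : k < D.m) (hv : v < D.N)
    (h : Inc (D.vx v) (D.ed k)) : D.Join k v (D.opp k v) := by
  refine ⟨hk, ?_⟩
  have := hD.U_ne_W hk
  rcases (hD.inc_iff hk hv).1 h with rfl | rfl
  · simp [opp]
  · simp [opp, this]

theorem Valid.join_lt (hD : D.Valid) {k v w : ℕ} (h : D.Join k v w) : v < D.N ∧ w < D.N := by
  obtain ⟨hk, ⟨rfl, rfl⟩ | ⟨rfl, rfl⟩⟩ := h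
  · exact ⟨hD.U_lt_N hk, hD.W_lt k hk⟩
  · exact ⟨hD.W_lt k hk, hD.U_lt_N hk⟩

theorem Valid.join_ne (hD : D.Valid) {k v w : ℕ} (h : D.Join k v w) : v ≠ w := by
  obtain ⟨hk, ⟨rfl, rfl⟩ | ⟨rfl, rfl⟩⟩ := h
  · exact hD.U_ne_W hk
  · exact (hD.U_ne_W hk).symm

theorem Valid.join_side (hD : D.Valid) {k v w : ℕ} (h : D.Join k v w) : v < D.n₁ ↔ ¬ w < D.n₁ := by
  obtain ⟨hk, ⟨rfl, rfl⟩ | ⟨rfl, rfl⟩⟩ := h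
  · have := hD.U_lt k hk
    have := hD.W_ge k hk
    omega
  · have := hD.U_lt k hk
    have := hD.W_ge k hk
    omega

theorem Valid.join_inc (hD : D.Valid) {k v w : ℕ} (h : D.Join k v w) :
    Inc (D.vx v) (D.ed k) ∧ Inc (D.vx w) (D.ed k) := by
  have := hD.join_lt h
  rw [hD.inc_iff h.1 this.1, hD.inc_iff h.1 this.2]
  have := h.2
  tauto

theorem Valid.eq_or_eq_of_join (hD : D.Valid) {k v w u : ℕ} (h : D.Join k v w) (hu : u < D.N)
    (hi : Inc (D.vx u) (D.ed k)) : u = v ∨ u = w := by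
  rw [hD.inc_iff h.1 hu] at hi
  have := h.2
  rcases this with ⟨rfl, rfl⟩ | ⟨rfl, rfl⟩ <;> tauto

theorem Valid.join_unique (hD : D.Valid) {k v w w' : ℕ} (h : D.Join k v w) (h' : D.Join k v w') :
    w = w' := by
  have := hD.U_ne_W h.1
  obtain ⟨hk, ⟨rfl, rfl⟩ | ⟨rfl, rfl⟩⟩ := h <;> obtain ⟨-, ⟨h1, rfl⟩ | ⟨h1, rfl⟩⟩ := h' <;> simp_all

theorem Valid.adj (hD : D.Valid) {k v w : ℕ} (h : D.Join k v w) {F : Finset Edge}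
    (hF : D.ed k ∈ F) : Adj F (D.vx v) (D.vx w) := by
  have h1 := hD.join_inc h
  have h2 := hD.join_lt h
  exact adj_iff.2 ⟨_, hF, h1.1, h1.2, fun h3 => hD.join_ne h (hD.vx_inj _ h2.1 _ h2.2 h3)⟩

/-- The array `A` represents the matching `K`: its entry at a vertex is `k + 1` if the edge number
`k` of `K` covers the vertex, and `0` if the vertex is not covered. -/
def Rep (D : Data) (A : ℕ → ℕ) (K : Finset Edge) : Prop :=
  ∀ v < D.N, A v = 0 ∧ ¬ Covers K (D.vx v) ∨
    ∃ k < D.m, A v = k + 1 ∧ D.ed k ∈ K ∧ Inc (D.vx v) (D.ed k)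

theorem Rep.eq_zero_iff {A : ℕ → ℕ} {K : Finset Edge} (h : D.Rep A K) {v : ℕ} (hv : v < D.N) :
    A v = 0 ↔ ¬ Covers K (D.vx v) := by
  rcases h v hv with ⟨h1, h2⟩ | ⟨k, hk, h1, h2, h3⟩
  · simp [h1, h2]
  · simp only [h1, Nat.add_eq_zero_iff, one_ne_zero, and_false, false_iff, not_not]
    exact ⟨_, h2, h3⟩

theorem Rep.eq_of_mem {A : ℕ → ℕ} {K : Finset Edge} (h : D.Rep A K) (hD : D.Valid)
    (hK : IsMatching K) {v k : ℕ} (hv : v < D.N) (hk : k < D.m) (he : D.ed k ∈ K)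
    (hi : Inc (D.vx v) (D.ed k)) : A v = k + 1 := by
  rcases h v hv with ⟨h1, h2⟩ | ⟨l, hl, h1, h2, h3⟩
  · exact absurd ⟨_, he, hi⟩ h2
  · rw [h1, hD.ed_inj l hl k hk (hK.eq h2 he h3 hi)]

theorem Rep.mem_of_eq {A : ℕ → ℕ} {K : Finset Edge} (h : D.Rep A K) {v k : ℕ} (hv : v < D.N)
    (hA : A v = k + 1) : k < D.m ∧ D.ed k ∈ K ∧ Inc (D.vx v) (D.ed k) := by
  rcases h v hv with ⟨h1, h2⟩ | ⟨l, hl, h1, h2, h3⟩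
  · omega
  · obtain rfl : k = l := by omega
    exact ⟨hl, h2, h3⟩

end Data

/-! ### Passes over the edges and vertices

Registers `10`, `11`, `12` hold the constants `0`, `1`, `2`; `13` and `14` hold `D.N` and `D.Z`; `17`
holds the number of the current stage, and `18` that of the next one, or `0` at the end; `19` counts
in loops, and `20` to `24` are scratch registers. The search uses `30` and `31` for the two ends of
the queue, `32` and `33` for the vertex being scanned and its next half-edge, `34` as a loop flag, and
`35` for the unmatched vertex that was found.

Array `6` holds the stages of deletion of the edges. Arrays `22`, `23` and `28` to `31` hold the
graph, as in `Data.Has`; `24` and `25` the labels recorded so far; `26` the initial matching up to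
the rank of the stage, and `27` the current matching, as in `Data.Rep`; `33` the marks of the
component of the start vertex. Arrays `34` to `38` belong to the search, see `Search.of`. -/

namespace Prog

/-- Register `o` receives the end-point other than `x` of the edge whose number plus one is in
register `e`. -/
def other (e x o : ℕ) : Prog :=
  copy 24 e ;; pred 24 ;; read o 22 24 ;; ite (.eq o x) (read o 23 24) skip

/-- Register `18` receives the least rank above register `17` of the remaining edges, or `0`. -/
def findMin : Prog :=
  const 18 0 ;; each 2
    (read 20 6 19 ;; ite (.eq 20 10)
      (read 21 4 19 ;; ite (.lt 17 21)
        (ite (.eq 18 10) (copy 18 21) (ite (.lt 21 18) (copy 18 21) skip)) skip) skip)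

/-- Array `26` receives the edges of the initial matching of rank at most the stage. -/
def setOld : Prog :=
  each 2
    (read 20 5 19 ;; ite (.eq 20 11)
      (read 21 4 19 ;; ite (.lt 17 21) skip
        (copy 22 19 ;; succ 22 ;; read 20 22 19 ;; write 26 20 22 ;; read 20 23 19 ;;
          write 26 20 22)) skip)

/-- Array `27` is replaced by array `26` at the vertices not marked in array `33`. -/
def mixOld : Prog :=
  each 13
    (read 20 33 19 ;; ite (.eq 20 11) skip (read 21 26 19 ;; write 27 19 21))

end Prog

theorem findMin_spec {D : Data} {s : State} (hs : D.Has s) :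
    ∃ s', Runs .findMin s (100 * D.size) s' ∧
      (∀ k < D.m, s.arr 6 k = 0 → s.reg 17 < D.RK k → s'.reg 18 ≠ 0 ∧ s'.reg 18 ≤ D.RK k) ∧
      (s'.reg 18 ≠ 0 → s.reg 17 < s'.reg 18 ∧ ∃ k < D.m, s.arr 6 k = 0 ∧ D.RK k = s'.reg 18) := by
  have h0 := Runs.ev (c := .const 18 0) rfl s
  have hs0 := hs.frame h0.frame rfl rfl
  obtain ⟨s', hr, h1, h2⟩ := Runs.each (y := 2) (s := (Prog.const 18 0).ev s)
    (c := .read 20 6 19 ;; .ite (.eq 20 10)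
      (.read 21 4 19 ;; .ite (.lt 17 21)
        (.ite (.eq 18 10) (.copy 18 21) (.ite (.lt 21 18) (.copy 18 21) .skip)) .skip) .skip)
    rfl (by decide) (by decide) (by decide)
    (fun j t => (∀ k < j, s.arr 6 k = 0 → s.reg 17 < D.RK k → t.reg 18 ≠ 0 ∧ t.reg 18 ≤ D.RK k) ∧
      (t.reg 18 ≠ 0 → s.reg 17 < t.reg 18 ∧ ∃ k < j, s.arr 6 k = 0 ∧ D.RK k = t.reg 18))
    (by simp [Prog.ev])
    (by
      intro t j hf hj hlt ⟨ht1, ht2⟩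
      have ht := hs0.frame hf rfl rfl
      have e1 : t.arr 6 = s.arr 6 := hf.2 6 (by decide)
      have e2 : t.reg 17 = s.reg 17 := hf.1 17 (by decide)
      simp only [Prog.ev, State.setReg_reg, State.setReg_arr, e1, ht.RK, Test.holds_eq,
        Test.holds_lt, e2, ht.zero, hj, Nat.reduceEqDiff, if_true, if_false]
      split_ifs
      all_goals
        simp only [State.setReg_reg, Nat.reduceEqDiff, if_true, if_false]
        clear hf hs0 h0 hs ht
        grind)
  rw [hs0.m] at hr h1 h2
  refine ⟨s', (h0.seq hr).mono ?_, h1, h2⟩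
  simp only [Prog.cost, Data.size]
  omega

theorem setOld_spec {D : Data} (hD : D.Valid) {s : State} (hs : D.Has s) {i : ℕ}
    (hi : i ≤ s.reg 17) (hA : D.Rep (s.arr 26) (D.H.trunc i D.M₀)) :
    ∃ s', Runs .setOld s (100 * D.size) s' ∧
      D.Rep (s'.arr 26) (D.H.trunc (s.reg 17) D.M₀) := by
  have hM := hD.good.matching
  obtain ⟨s', hr, h1, h2⟩ := Runs.each (y := 2) (s := s)
    (c := .read 20 5 19 ;; .ite (.eq 20 11)
      (.read 21 4 19 ;; .ite (.lt 17 21) .skip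
        (.copy 22 19 ;; .succ 22 ;; .read 20 22 19 ;; .write 26 20 22 ;; .read 20 23 19 ;;
          .write 26 20 22)) .skip)
    rfl (by decide) (by decide) (by decide)
    (fun j t => (∀ v < D.N, t.arr 26 v = 0 ∨ ∃ k < D.m, t.arr 26 v = k + 1 ∧
        D.ed k ∈ D.H.trunc (s.reg 17) D.M₀ ∧ Inc (D.vx v) (D.ed k)) ∧
      ∀ k < j, D.ed k ∈ D.H.trunc (s.reg 17) D.M₀ →
        t.arr 26 (D.U k) = k + 1 ∧ t.arr 26 (D.W k) = k + 1)
    (by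
      refine ⟨fun v hv => ?_, by simp⟩
      rcases hA v hv with h | ⟨k, hk, h1, h2, h3⟩
      · exact Or.inl h.1
      · refine Or.inr ⟨k, hk, h1, ?_, h3⟩
        rw [Instance.mem_trunc] at h2 ⊢
        exact ⟨h2.1, h2.2.trans hi⟩)
    (by
      intro t j hf hj hlt ⟨ht1, ht2⟩
      have ht := hs.frame hf rfl rfl
      have e2 : t.reg 17 = s.reg 17 := hf.1 17 (by decide)
      rw [hs.m] at hlt
      simp only [Prog.ev, State.setReg_reg, State.setReg_arr, ht.RK, ht.ORG, Test.holds_eq,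
        Test.holds_lt, e2, ht.one, hj, Nat.reduceEqDiff, if_true, if_false]
      by_cases hO : D.ed j ∈ D.M₀
      · have hrk : D.RK j = _ := hD.RK_eq j hlt
        simp only [hD.ORG_one j hlt hO, if_true]
        by_cases hr : s.reg 17 < D.RK j
        · simp only [hr, if_true, State.setReg_arr]
          refine ⟨ht1, fun k hk hk' => ?_⟩
          rcases Nat.lt_succ_iff_lt_or_eq.1 hk with h | rfl
          · exact ht2 k h hk'
          · rw [Instance.mem_trunc] at hk'
            omega
        · have hmem : D.ed j ∈ D.H.trunc (s.reg 17) D.M₀ := by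
            rw [Instance.mem_trunc]
            exact ⟨hO, by omega⟩
          simp only [hr, if_false, State.setReg_arr, State.setReg_reg, State.setArr_arr,
            State.setArr_reg, Nat.reduceEqDiff, if_true, ht.U, ht.W, hj, Function.update_apply]
          refine ⟨fun v hv => ?_, fun k hk hk' => ?_⟩
          · split_ifs with h1 h2
            · exact Or.inr ⟨j, hlt, rfl, hmem, (hD.inc_iff hlt hv).2 (Or.inr h1)⟩
            · exact Or.inr ⟨j, hlt, rfl, hmem, (hD.inc_iff hlt hv).2 (Or.inl h2)⟩
            · exact ht1 v hv
          · rcases Nat.lt_succ_iff_lt_or_eq.1 hk with h | rfl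
            · have hkm : k < D.m := h.trans hlt
              have key : ∀ v < D.N, Inc (D.vx v) (D.ed k) → ¬ Inc (D.vx v) (D.ed j) := by
                intro v hv h3 h4
                have := hD.ed_inj _ hkm _ hlt
                  (hM.eq (D.H.trunc_subset _ _ hk') (D.H.trunc_subset _ _ hmem) h3 h4)
                omega
              have k1 := key _ (hD.U_lt_N hkm)
              have k2 := key _ (hD.W_lt k hkm)
              rw [hD.inc_iff hkm (hD.U_lt_N hkm), hD.inc_iff hlt (hD.U_lt_N hkm)] at k1
              rw [hD.inc_iff hkm (hD.W_lt k hkm), hD.inc_iff hlt (hD.W_lt k hkm)] at k2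
              have k1 := k1 (Or.inl rfl)
              have k2 := k2 (Or.inr rfl)
              push Not at k1 k2
              have := ht2 k h hk'
              simp [k1, k2, this]
            · simp
      · simp only [hD.ORG_zero j hlt hO, Nat.zero_ne_one, if_false, State.setReg_arr]
        refine ⟨ht1, fun k hk hk' => ?_⟩
        rcases Nat.lt_succ_iff_lt_or_eq.1 hk with h | rfl
        · exact ht2 k h hk'
        · exact absurd (D.H.trunc_subset _ _ hk') hO)
  rw [hs.m] at hr h2
  refine ⟨s', hr.mono ?_, fun v hv => ?_⟩
  · simp only [Prog.cost, Data.size]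
    omega
  · rcases h1 v hv with h | h
    · refine Or.inl ⟨h, ?_⟩
      rintro ⟨e, he, hv'⟩
      obtain ⟨k, hk, rfl⟩ := hD.ed_surj e (hD.good.sub (D.H.trunc_subset _ _ he))
      have := h2 k hk he
      rcases (hD.inc_iff hk hv).1 hv' with rfl | rfl <;> omega
    · exact Or.inr h

theorem mixOld_spec {D : Data} {s : State} (hs : D.Has s) {K M : Finset Edge}
    (hA : D.Rep (s.arr 27) K) (hB : D.Rep (s.arr 26) M) {S : Set Vertex}
    (hS : ∀ v < D.N, s.arr 33 v = 1 ↔ D.vx v ∈ S) (hc : Closed (K ∪ M) S) :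
    ∃ s', Runs .mixOld s (100 * D.size) s' ∧ D.Rep (s'.arr 27) (mix S K M) := by
  obtain ⟨s', hr, h1⟩ := Runs.each (y := 13) (s := s)
    (c := .read 20 33 19 ;; .ite (.eq 20 11) .skip (.read 21 26 19 ;; .write 27 19 21))
    rfl (by decide) (by decide) (by decide)
    (fun j t => ∀ v, t.arr 27 v = if v < j ∧ s.arr 33 v ≠ 1 then s.arr 26 v else s.arr 27 v)
    (by simp)
    (by
      intro t j hf hj hlt ht1 v
      have ht := hs.frame hf rfl rfl
      have e1 : t.arr 33 = s.arr 33 := hf.2 33 (by decide)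
      have e2 : t.arr 26 = s.arr 26 := hf.2 26 (by decide)
      have := ht1 v
      simp only [Prog.ev, State.setReg_reg, State.setReg_arr, Test.holds_eq, ht.one, hj, e1, e2,
        Nat.reduceEqDiff, if_true, if_false]
      by_cases h1 : s.arr 33 j = 1
      · simp only [h1, if_true, State.setReg_arr]
        by_cases hv : v = j
        · subst hv
          simpa [h1] using this
        · have : v < j + 1 ↔ v < j := by omega
          simp_all
      · simp only [h1, if_false, State.setReg_arr, State.setReg_reg, State.setArr_arr, hj,
          Nat.reduceEqDiff, if_true, Function.update_apply]
        by_cases hv : v = j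
        · subst hv
          simp [h1]
        · have : v < j + 1 ↔ v < j := by omega
          simp_all)
  rw [hs.N] at hr h1
  refine ⟨s', hr.mono ?_, fun v hv => ?_⟩
  · simp only [Prog.cost, Data.size]
    omega
  · have hin : D.vx v ∈ S → ∀ e, Inc (D.vx v) e → e ∈ K ∪ M → Within S e := fun h e hi he =>
      hc.within_of_inc he hi h
    have hout : D.vx v ∉ S → ∀ e, Inc (D.vx v) e → ¬ Within S e := fun h e hi he => h (he.mem hi)
    by_cases hvS : D.vx v ∈ S
    · have e : s'.arr 27 v = s.arr 27 v := by simp [h1 v, (hS v hv).2 hvS]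
      rw [e]
      rcases hA v hv with ⟨h2, h3⟩ | ⟨k, hk, h2, h3, h4⟩
      · refine Or.inl ⟨h2, ?_⟩
        rintro ⟨e, he, hi⟩
        rcases mem_mix.1 he with he | he
        · exact h3 ⟨e, he.1, hi⟩
        · exact he.2 (hin hvS e hi (Finset.mem_union_right _ he.1))
      · exact Or.inr ⟨k, hk, h2,
          mem_mix.2 (Or.inl ⟨h3, hin hvS _ h4 (Finset.mem_union_left _ h3)⟩), h4⟩
    · have e : s'.arr 27 v = s.arr 26 v := by simp [h1 v, hv, mt (hS v hv).1 hvS]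
      rw [e]
      rcases hB v hv with ⟨h2, h3⟩ | ⟨k, hk, h2, h3, h4⟩
      · refine Or.inl ⟨h2, ?_⟩
        rintro ⟨e, he, hi⟩
        rcases mem_mix.1 he with he | he
        · exact hout hvS e hi he.2
        · exact h3 ⟨e, he.1, hi⟩
      · exact Or.inr ⟨k, hk, h2, mem_mix.2 (Or.inr ⟨h3, hout hvS _ h4⟩), h4⟩

/-! ### Tracing the component of the start vertex -/

/-- The effect of `Prog.other`, which uses register `24` for the edge number. -/
theorem ev_other {D : Data} {s : State} {e x o : ℕ} (hU : s.arr 22 = D.U) (hW : s.arr 23 = D.W)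
    (hox : o ≠ x) (ho : o ≠ 24) (hx : x ≠ 24) :
    (Prog.other e x o).ev s =
      (s.setReg 24 (s.reg e - 1)).setReg o (D.opp (s.reg e - 1) (s.reg x)) := by
  simp only [Prog.other, Prog.ev, State.setReg_reg, State.setReg_arr, Test.holds_eq, hU, hW,
    hx, if_true, if_false, hox.symm, ho.symm, Data.opp]
  split_ifs <;> simp only [State.setReg, State.mk.injEq, and_true] <;> ext y <;>
    simp only [Function.update_apply] <;> split_ifs <;> simp_all

namespace Data

/-- The matching represented by the array `A` matches the vertices number `v` and `w`. -/
def Mate (D : Data) (A : ℕ → ℕ) (v w : ℕ) : Prop := ∃ k, A v = k + 1 ∧ D.Join k v w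

variable {D : Data} {A : ℕ → ℕ} {K : Finset Edge}

theorem Mate.unique (hD : D.Valid) {v w w' : ℕ} (h : D.Mate A v w) (h' : D.Mate A v w') :
    w = w' := by
  obtain ⟨k, hk, h⟩ := h
  obtain ⟨l, hl, h'⟩ := h'
  obtain rfl : k = l := by omega
  exact hD.join_unique h h'

theorem Rep.mate_symm (h : D.Rep A K) (hD : D.Valid) (hK : IsMatching K) {v w : ℕ}
    (hm : D.Mate A v w) : D.Mate A w v := by
  obtain ⟨k, hk, hj⟩ := hm
  have h1 := hD.join_lt hj
  have h2 := h.mem_of_eq h1.1 hk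
  exact ⟨k, h.eq_of_mem hD hK h1.2 hj.1 h2.2.1 (hD.join_inc hj).2, hj.symm⟩

theorem Rep.exists_mate (h : D.Rep A K) (hD : D.Valid) {v : ℕ} (hv : v < D.N) (hA : A v ≠ 0) :
    D.Mate A v (D.opp (A v - 1) v) := by
  obtain ⟨k, hk⟩ := Nat.exists_eq_succ_of_ne_zero hA
  obtain ⟨h1, h2, h3⟩ := h.mem_of_eq hv hk
  refine ⟨k, hk, ?_⟩
  rw [hk, Nat.succ_eq_add_one, Nat.add_sub_cancel]
  exact hD.join_opp h1 hv h3

theorem Mate.lt (hD : D.Valid) {v w : ℕ} (h : D.Mate A v w) : v < D.N ∧ w < D.N :=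
  let ⟨_, _, h⟩ := h
  hD.join_lt h

theorem Mate.ne (hD : D.Valid) {v w : ℕ} (h : D.Mate A v w) : v ≠ w :=
  let ⟨_, _, h⟩ := h
  hD.join_ne h

theorem Rep.exists_edge (h : D.Rep A K) (hD : D.Valid) {v w : ℕ} (hm : D.Mate A v w) :
    ∃ e ∈ K, Inc (D.vx v) e ∧ Inc (D.vx w) e := by
  obtain ⟨k, hk, hj⟩ := hm
  have h1 := h.mem_of_eq (hD.join_lt hj).1 hk
  exact ⟨_, h1.2.1, hD.join_inc hj⟩

theorem Rep.mate_of_mem (h : D.Rep A K) (hD : D.Valid) (hK : IsMatching K) {k : ℕ} (hk : k < D.m)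
    (he : D.ed k ∈ K) : D.Mate A (D.U k) (D.W k) :=
  have hj : D.Join k (D.U k) (D.W k) := ⟨hk, Or.inl ⟨rfl, rfl⟩⟩
  ⟨k, h.eq_of_mem hD hK (hD.U_lt_N hk) hk he (hD.join_inc hj).1, hj⟩

end Data

namespace Prog

/-- One step of the walk: from the vertex in register `20` along array `27`, then along
array `26`. -/
def traceStep : Prog :=
  write 33 20 11 ;; read 21 27 20 ;; ite (.eq 21 10) (const 34 0)
    (other 21 20 22 ;; write 33 22 11 ;; read 21 26 22 ;; ite (.eq 21 10) (const 34 0)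
      (other 21 22 20))

/-- Array `33` marks the vertices of the component of the start vertex in the union of the
matchings in the arrays `26` and `27`. -/
def trace : Prog :=
  each 13 (write 33 19 10) ;; (copy 20 14 ;; const 34 1) ;; .while (.lt 10 34) traceStep

end Prog

/-- The invariant of the walk with current vertex `c` and marked vertices `mk`. The walk never meets
a marked vertex again, as the marked vertices are matched among themselves in the matching `A`. -/
structure TraceInv (D : Data) (A B : ℕ → ℕ) (F : Finset Edge) (c : ℕ) (run : ℕ) (mk : ℕ → Prop) :
    Prop where
  lt : c < D.N
  reach : ∀ Y, Closed F Y → D.z ∈ Y → ∀ v < D.N, v = c ∨ mk v → D.vx v ∈ Y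
  start : D.Z = c ∨ mk D.Z
  closedB : ∀ v w, v = c ∨ mk v → D.Mate B v w → w = c ∨ mk w
  closedA : ∀ v w, mk v → D.Mate A v w → mk w
  run_le : run ≤ 1
  fresh : run = 1 → ¬ mk c
  marked : run = 0 → mk c

theorem traceStep_spec {D : Data} (hD : D.Valid) {t : State} (ht : D.Has t) {K M : Finset Edge}
    (hK : IsMatching K) (hM : IsMatching M) (hA : D.Rep (t.arr 27) K) (hB : D.Rep (t.arr 26) M)
    (hr : t.reg 34 = 1)
    (hI : TraceInv D (t.arr 27) (t.arr 26) (K ∪ M) (t.reg 20) (t.reg 34) (fun v => t.arr 33 v = 1)) :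
    let t' := Prog.traceStep.ev t
    TraceInv D (t.arr 27) (t.arr 26) (K ∪ M) (t'.reg 20) (t'.reg 34) (fun v => t'.arr 33 v = 1) ∧
      (∀ v, t.arr 33 v = 1 → t'.arr 33 v = 1) ∧ t'.arr 33 (t.reg 20) = 1 := by
  intro t'
  have hfr := hI.fresh hr
  set c := t.reg 20 with hc
  have ev1 : t' = Prog.traceStep.ev t := rfl
  simp only [Prog.traceStep, Prog.ev, State.setReg_reg, State.setReg_arr, State.setArr_reg,
    State.setArr_arr, Test.holds_eq, ht.zero, ht.one, ← hc, Nat.reduceEqDiff, if_true, if_false]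
    at ev1
  by_cases h0 : t.arr 27 c = 0
  · simp only [h0, if_true] at ev1
    have e1 : t'.reg 20 = c := by simp [ev1, hc]
    have e2 : t'.reg 34 = 0 := by simp [ev1]
    have e3 : ∀ v, t'.arr 33 v = 1 ↔ v = c ∨ t.arr 33 v = 1 := by
      intro v
      simp only [ev1, State.setReg_arr, State.setArr_arr, if_true, Function.update_apply]
      split_ifs <;> simp_all
    rw [e1, e2]
    simp only [e3]
    refine ⟨⟨hI.lt, fun Y h1 h2 v hv h3 => hI.reach Y h1 h2 v hv (by tauto), ?_, ?_, ?_, by omega,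
      by omega, by simp⟩, by tauto⟩
    · have := hI.start
      tauto
    · intro v w h1 h2
      have := hI.closedB v w (by tauto) h2
      tauto
    · intro v w h1 h2
      rcases h1 with rfl | h1
      · obtain ⟨k, hk, -⟩ := h2
        omega
      · exact Or.inr (hI.closedA v w h1 h2)
  · have hm := hA.exists_mate hD hI.lt h0
    have hbx : ∃ x, x = D.opp (t.arr 27 c - 1) c := ⟨_, rfl⟩
    obtain ⟨x, hx⟩ := hbx
    rw [← hx] at hm
    simp only [h0, if_false] at ev1
    rw [ev_other (D := D) (by simp [ht.U]) (by simp [ht.W]) (by decide) (by decide) (by decide)] at ev1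
    simp only [State.setReg_reg, State.setReg_arr, State.setArr_reg, State.setArr_arr, ← hc, ← hx,
      ht.one, ht.zero, Nat.reduceEqDiff, if_true, if_false] at ev1
    have hxm : t.arr 33 x ≠ 1 := fun h => hfr (hI.closedA x c h (hA.mate_symm hD hK hm))
    have hxc : x ≠ c := (hm.ne hD).symm
    have hreach : ∀ Y, Closed (K ∪ M) Y → D.z ∈ Y → ∀ v < D.N,
        v = x ∨ v = c ∨ t.arr 33 v = 1 → D.vx v ∈ Y := by
      intro Y h1 h2 v hv h3
      rcases h3 with rfl | h3
      · obtain ⟨e, he, h4, h5⟩ := hA.exists_edge hD hm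
        exact (h1.within_of_inc (Finset.mem_union_left _ he) h4
          (hI.reach Y h1 h2 c hI.lt (Or.inl rfl))).mem h5
      · exact hI.reach Y h1 h2 v hv h3
    have hclA : ∀ v w, v = x ∨ v = c ∨ t.arr 33 v = 1 → D.Mate (t.arr 27) v w →
        w = x ∨ w = c ∨ t.arr 33 w = 1 := by
      intro v w h1 h2
      rcases h1 with rfl | rfl | h1
      · exact Or.inr (Or.inl (h2.unique hD (hA.mate_symm hD hK hm)))
      · exact Or.inl (h2.unique hD hm)
      · exact Or.inr (Or.inr (hI.closedA v w h1 h2))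
    have e3' : ∀ v, Function.update (Function.update (t.arr 33) c 1) x 1 v = 1 ↔
        v = x ∨ v = c ∨ t.arr 33 v = 1 := by
      intro v
      simp only [Function.update_apply]
      split_ifs <;> simp_all
    by_cases h1 : t.arr 26 x = 0
    · simp only [h1, if_true] at ev1
      have e1 : t'.reg 20 = c := by simp [ev1, hc]
      have e2 : t'.reg 34 = 0 := by simp [ev1]
      have e3 : ∀ v, t'.arr 33 v = 1 ↔ v = x ∨ v = c ∨ t.arr 33 v = 1 := by
        intro v
        rw [← e3' v]
        simp [ev1, ht.one]
      rw [e1, e2]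
      simp only [e3]
      refine ⟨⟨hI.lt, fun Y h1 h2 v hv h3 => hreach Y h1 h2 v hv (by tauto), ?_, ?_, hclA,
        by omega, by omega, by simp⟩, by tauto⟩
      · have := hI.start
        tauto
      · intro v w h2 h3
        by_cases hvx : v = x
        · subst hvx
          obtain ⟨k, hk, -⟩ := h3
          omega
        · have := hI.closedB v w (by tauto) h3
          tauto
    · have hm' := hB.exists_mate hD (hm.lt hD).2 h1
      have hbx : ∃ y, y = D.opp (t.arr 26 x - 1) x := ⟨_, rfl⟩
      obtain ⟨y, hy⟩ := hbx
      rw [← hy] at hm'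
      simp only [h1, if_false] at ev1
      rw [ev_other (D := D) (by simp [ht.U]) (by simp [ht.W]) (by decide) (by decide) (by decide)]
        at ev1
      simp only [State.setReg_reg, State.setReg_arr, State.setArr_reg, State.setArr_arr, ← hc, ← hx,
        ht.one, ht.zero, Nat.reduceEqDiff, if_true, if_false, ← hy] at ev1
      have hyx : y ≠ x := (hm'.ne hD).symm
      have hym : ¬ (y = c ∨ t.arr 33 y = 1) := by
        intro h
        have := hI.closedB y x h (hB.mate_symm hD hM hm')
        tauto
      have e1 : t'.reg 20 = y := by simp [ev1]
      have e2 : t'.reg 34 = 1 := by simp [ev1, hr]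
      have e3 : ∀ v, t'.arr 33 v = 1 ↔ v = x ∨ v = c ∨ t.arr 33 v = 1 := by
        intro v
        rw [← e3' v]
        simp [ev1, ht.one]
      rw [e1, e2]
      simp only [e3]
      refine ⟨⟨(hm'.lt hD).2, fun Y h2 h3 v hv h4 => ?_, ?_, ?_, hclA,
        le_rfl, by tauto, by omega⟩, by tauto⟩
      · rcases h4 with rfl | h4
        · obtain ⟨e, he, h5, h6⟩ := hB.exists_edge hD hm'
          exact (h2.within_of_inc (Finset.mem_union_right _ he) h5
            (hreach Y h2 h3 x (hm.lt hD).2 (Or.inl rfl))).mem h6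
        · exact hreach Y h2 h3 v hv h4
      · have := hI.start
        tauto
      · intro v w h2 h3
        by_cases hvx : v = x
        · subst hvx
          exact Or.inl (h3.unique hD hm')
        · by_cases hvy : v = y
          · subst hvy
            exact Or.inr (Or.inl (h3.unique hD (hB.mate_symm hD hM hm')))
          · have := hI.closedB v w (by tauto) h3
            tauto

/-- As `M` leaves the start vertex uncovered, its component in the union of the matchings is a path
that begins there, and the walk along this path finds the component. -/
theorem trace_spec {D : Data} (hD : D.Valid) {s : State} (hs : D.Has s) {K M : Finset Edge}
    (hK : IsMatching K) (hM : IsMatching M) (hA : D.Rep (s.arr 27) K) (hB : D.Rep (s.arr 26) M)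
    (hz : ¬ Covers M D.z) (hKE : K ⊆ D.H.edges) (hME : M ⊆ D.H.edges) :
    ∃ s' S, Runs .trace s (200 * D.size) s' ∧ D.z ∈ S ∧ Closed (K ∪ M) S ∧
      (∀ Y, Closed (K ∪ M) Y → D.z ∈ Y → S ⊆ Y) ∧ ∀ v < D.N, s'.arr 33 v = 1 ↔ D.vx v ∈ S := by
  obtain ⟨s₁, hr₁, h₁⟩ := Runs.each (y := 13) (s := s) (c := .write 33 19 10) rfl (by decide)
    (by decide) (by decide) (fun j t => ∀ v < j, t.arr 33 v = 0) (by simp)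
    (by
      intro t j hf hj hlt ht1 v hv
      have ht := hs.frame hf rfl rfl
      simp only [Prog.ev, State.setReg_arr, State.setArr_arr, if_true, Function.update_apply, hj,
        ht.zero]
      split_ifs with h
      · rfl
      · exact ht1 v (by omega))
  have hs₁ := hs.frame hr₁.frame rfl rfl
  have hr₂ := Runs.ev (c := .copy 20 14 ;; .const 34 1) rfl s₁
  have hs₂ := hs₁.frame hr₂.frame rfl rfl
  obtain ⟨s₂, hs₂'⟩ : ∃ s₂, s₂ = (Prog.copy 20 14 ;; .const 34 1).ev s₁ := ⟨_, rfl⟩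
  rw [← hs₂'] at hr₂ hs₂
  have a27 : s₂.arr 27 = s.arr 27 := (hr₂.frame.2 27 (by decide)).trans (hr₁.frame.2 27 (by decide))
  have a26 : s₂.arr 26 = s.arr 26 := (hr₂.frame.2 26 (by decide)).trans (hr₁.frame.2 26 (by decide))
  have a33 : ∀ v < D.N, s₂.arr 33 v = 0 := by
    rw [hs.N] at h₁
    simpa [hs₂', Prog.ev] using h₁
  have r20 : s₂.reg 20 = D.Z := by simp [hs₂', Prog.ev, hs₁.Z]
  have r34 : s₂.reg 34 = 1 := by simp [hs₂', Prog.ev]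
  have hTI : TraceInv D (s.arr 27) (s.arr 26) (K ∪ M) (s₂.reg 20) (s₂.reg 34)
      (fun v => s₂.arr 33 v = 1) := by
    have hmk : ∀ v < D.N, s₂.arr 33 v ≠ 1 := fun v hv => by simp [a33 v hv]
    rw [r20, r34]
    refine ⟨hD.Z_lt, fun Y h1 h2 v hv h3 => ?_, Or.inl rfl, fun v w h1 h2 => ?_,
      fun v w h1 h2 => absurd h1 (hmk v (h2.lt hD).1), le_rfl, fun _ => hmk _ hD.Z_lt, by simp⟩
    · rcases h3 with rfl | h3
      · rwa [hD.vx_Z]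
      · exact absurd h3 (hmk v hv)
    · rcases h1 with rfl | h1
      · obtain ⟨k, hk, -⟩ := h2
        have := (hB.eq_zero_iff hD.Z_lt).2 (by rwa [hD.vx_Z])
        omega
      · exact absurd h1 (hmk v (h2.lt hD).1)
  obtain ⟨s', hr₃, hI, hq, hf⟩ := Runs.loop (q := .lt 10 34) (c := .traceStep)
    (T := Prog.traceStep.cost) (s₀ := s₂)
    (fun t => TraceInv D (s.arr 27) (s.arr 26) (K ∪ M) (t.reg 20) (t.reg 34)
      (fun v => t.arr 33 v = 1))
    (fun t => ((Finset.range D.N).filter fun v => t.arr 33 v ≠ 1).card)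
    (by
      intro t hf hI hq
      have ht := hs₂.frame hf rfl rfl
      have b27 : t.arr 27 = s.arr 27 := (hf.2 27 (by decide)).trans a27
      have b26 : t.arr 26 = s.arr 26 := (hf.2 26 (by decide)).trans a26
      have hrun : t.reg 34 = 1 := by
        have h1 := hI.run_le
        have h2 : t.reg 10 < t.reg 34 := hq
        rw [ht.zero] at h2
        omega
      have hst := traceStep_spec hD ht hK hM (b27 ▸ hA) (b26 ▸ hB) hrun (by rwa [b27, b26])
      rw [b27, b26] at hst
      refine ⟨_, Runs.ev rfl t, hst.1, Nat.succ_le_of_lt (Finset.card_lt_card ?_)⟩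
      rw [Finset.ssubset_iff_of_subset
        (Finset.monotone_filter_right _ fun v _ h1 h2 => h1 (hst.2.1 v h2))]
      exact ⟨t.reg 20, Finset.mem_filter.2 ⟨Finset.mem_range.2 hI.lt, hI.fresh hrun⟩,
        fun h => (Finset.mem_filter.1 h).2 hst.2.2⟩)
    hTI
  have ht := hs₂.frame hf rfl rfl
  have h34 : s'.reg 34 = 0 := by
    have h1 : ¬ s'.reg 10 < s'.reg 34 := hq
    rw [ht.zero] at h1
    omega
  have hmc := hI.marked h34
  have hin : ∀ v < D.N, D.vx v ∈ {x | ∃ u < D.N, s'.arr 33 u = 1 ∧ D.vx u = x} ↔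
      s'.arr 33 v = 1 := by
    intro v hv
    refine ⟨?_, fun h => ⟨v, hv, h, rfl⟩⟩
    rintro ⟨u, hu, h1, h2⟩
    rwa [← hD.vx_inj _ hu _ hv h2]
  refine ⟨s', {x | ∃ v < D.N, s'.arr 33 v = 1 ∧ D.vx v = x}, ((hr₁.seq (hr₂.seq hr₃))).mono ?_,
    ?_, ?_, ?_, fun v hv => (hin v hv).symm⟩
  · have : ((Finset.range D.N).filter fun v => s₂.arr 33 v ≠ 1).card ≤ D.N :=
      (Finset.card_filter_le _ _).trans (by simp)
    simp only [Prog.cost, Prog.traceStep, Prog.other, Data.size, hs.N]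
    omega
  · refine ⟨D.Z, hD.Z_lt, ?_, hD.vx_Z⟩
    rcases hI.start with h | h
    · rwa [h]
    · exact h
  · have key : ∀ k < D.m, D.ed k ∈ K ∪ M →
        (s'.arr 33 (D.U k) = 1 ↔ s'.arr 33 (D.W k) = 1) := by
      intro k hk he
      rcases Finset.mem_union.1 he with he | he
      · have h1 := hA.mate_of_mem hD hK hk he
        exact ⟨fun h => hI.closedA _ _ h h1,
          fun h => hI.closedA _ _ h (hA.mate_symm hD hK h1)⟩
      · have h1 := hB.mate_of_mem hD hM hk he
        have hc : ∀ v w, s'.arr 33 v = 1 → D.Mate (s.arr 26) v w → s'.arr 33 w = 1 := by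
          intro v w h2 h3
          rcases hI.closedB v w (Or.inr h2) h3 with h | h
          · rwa [h]
          · exact h
        exact ⟨fun h => hc _ _ h h1, fun h => hc _ _ h (hB.mate_symm hD hM h1)⟩
    intro e he
    obtain ⟨k, hk, rfl⟩ := hD.ed_surj e
      ((Finset.mem_union.1 he).elim (fun h => hKE h) fun h => hME h)
    rw [← hD.vx_U k hk, ← hD.vx_W k hk, hin _ (hD.U_lt_N hk), hin _ (hD.W_lt k hk)]
    exact key k hk he
  · rintro Y h1 h2 x ⟨v, hv, h3, rfl⟩
    exact hI.reach Y h1 h2 v hv (Or.inr h3)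

/-! ### Alternating search forests -/

/-- The state of the search for alternating paths: the labels of the vertices (`1` for unvisited,
`0` for even, `2` for odd), for an odd vertex the edge (number plus one) and the vertex from which
it was reached, the positions of the even vertices in the queue, the queue with its two ends, the
vertex that is being scanned and its next half-edge, and the unmatched odd vertex that was found
(plus one), if any. -/
structure Search where
  (LB PAR PV POS Q : ℕ → ℕ)
  (qh qt cv h found : ℕ)

namespace Search

/-- The search state kept in the memory. -/
def of (s : State) : Search where
  LB := s.arr 34
  PAR := s.arr 35
  PV := s.arr 36
  POS := s.arr 37
  Q := s.arr 38
  qh := s.reg 30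
  qt := s.reg 31
  cv := s.reg 32
  h := s.reg 33
  found := s.reg 35

/-- The vertex `x` becomes even and joins the queue. -/
def push (σ : Search) (x : ℕ) : Search :=
  { σ with
    LB := Function.update σ.LB x 0
    POS := Function.update σ.POS x σ.qt
    Q := Function.update σ.Q σ.qt x
    qt := σ.qt + 1 }

/-- The vertex `w` becomes odd, reached from `v` along the edge number `k`. -/
def mark (σ : Search) (k v w : ℕ) : Search :=
  { σ with
    LB := Function.update σ.LB w 2
    PAR := Function.update σ.PAR w (k + 1)
    PV := Function.update σ.PV w v }

variable {D : Data} {F K : Finset Edge} {A : ℕ → ℕ} {side : ℕ → Prop} {σ : Search}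

/-- All half-edges of the vertex `v` in the graph `F` lead to odd vertices. -/
def Done (D : Data) (F : Finset Edge) (LB : ℕ → ℕ) (v : ℕ) : Prop :=
  ∀ h, 1 ≤ h → h ≤ D.NH → D.HS h = v → D.ed (D.HK h) ∈ F → LB (D.HO h) = 2

/-- The invariant of the search in the graph `F` with the matching `K`, represented by the array
`A`. New even vertices are found on one side of the graph only; those on the other side come from an
earlier search and have been scanned completely. -/
structure Inv (D : Data) (F K : Finset Edge) (A : ℕ → ℕ) (side : ℕ → Prop) (σ : Search) :
    Prop where
  le_two : ∀ v < D.N, σ.LB v ≤ 2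
  even : ∀ v < D.N, σ.LB v = 0 → ∃ k, Even k ∧ AltPath F K k (D.vx v)
  odd : ∀ v < D.N, σ.LB v = 2 → ∃ k, Odd k ∧ AltPath F K k (D.vx v)
  mate : ∀ v w, D.Mate A v w → σ.LB v = 0 → σ.LB w = 2
  mate' : ∀ v w, D.Mate A v w → σ.LB v = 2 → σ.LB w = 0
  free : ∀ v < D.N, A v = 0 → σ.LB v = 2 → σ.found = v + 1
  found : σ.found ≠ 0 → ∃ y < D.N, σ.found = y + 1 ∧ A y = 0 ∧ σ.LB y = 2
  tree : ∀ w < D.N, σ.LB w = 2 → σ.LB (σ.PV w) = 0 ∧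
    (∃ k, σ.PAR w = k + 1 ∧ D.ed k ∈ F ∧ D.Join k (σ.PV w) w) ∧
    ∀ x, D.Mate A w x → σ.POS (σ.PV w) < σ.POS x
  queue : ∀ p < σ.qt, σ.Q p < D.N ∧ σ.LB (σ.Q p) = 0 ∧ σ.POS (σ.Q p) = p
  pos : ∀ v < D.N, σ.LB v = 0 → σ.POS v < σ.qt ∧ σ.Q (σ.POS v) = v
  qh_le : σ.qh ≤ σ.qt
  scanned : ∀ v < D.N, σ.LB v = 0 → σ.POS v < σ.qh → ∀ h, 1 ≤ h → h ≤ D.NH → D.HS h = v →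
    (v = σ.cv → σ.h < h) → D.ed (D.HK h) ∈ F → σ.LB (D.HO h) = 2
  side : ∀ v < D.N, σ.LB v = 0 → side v ∨ Done D F σ.LB v
  cur : σ.h ≠ 0 → σ.h ≤ D.NH ∧ D.HS σ.h = σ.cv ∧ σ.cv < D.N ∧ σ.LB σ.cv = 0 ∧ σ.POS σ.cv < σ.qh

theorem Inv.qt_le (hI : Inv D F K A side σ) : σ.qt ≤ D.N := by
  have := Finset.card_le_card_of_injOn (s := Finset.range σ.qt) (t := Finset.range D.N) σ.Q
    (fun p hp => by simpa using (hI.queue p (by simpa using hp)).1)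
    (fun p hp q hq h => by
      rw [← (hI.queue p (by simpa using hp)).2.2, ← (hI.queue q (by simpa using hq)).2.2, h])
  simpa using this

/-- A half-edge joins its source and its target. -/
theorem _root_.DynRankMax.Data.Valid.join_half (hD : D.Valid) {h : ℕ} (h1 : 1 ≤ h)
    (h2 : h ≤ D.NH) : D.Join (D.HK h) (D.HS h) (D.HO h) :=
  ⟨hD.half_lt h h1 h2, hD.half h h1 h2⟩

theorem _root_.DynRankMax.Data.Valid.exists_half (hD : D.Valid) {k v w : ℕ} (hj : D.Join k v w) :
    ∃ h, 1 ≤ h ∧ h ≤ D.NH ∧ D.HK h = k ∧ D.HS h = v ∧ D.HO h = w := by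
  obtain ⟨hk, ⟨rfl, rfl⟩ | ⟨rfl, rfl⟩⟩ := hj
  · exact hD.half_U k hk
  · exact hD.half_W k hk

theorem Done.join (hD : D.Valid) {LB : ℕ → ℕ} {k v w : ℕ} (h : Done D F LB v)
    (hj : D.Join k v w) (he : D.ed k ∈ F) : LB w = 2 := by
  obtain ⟨h', h1, h2, rfl, rfl, rfl⟩ := hD.exists_half hj
  exact h h' h1 h2 rfl he

/-- The target of a half-edge in `F` of the vertex being scanned is not even. -/
theorem Inv.ne_zero (hI : Inv D F K A side σ) (hD : D.Valid)
    (hside : ∀ k v w, D.Join k v w → (side v ↔ ¬ side w)) {k v w : ℕ} (hv : σ.LB v = 0)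
    (hj : D.Join k v w) (he : D.ed k ∈ F) : σ.LB w ≠ 0 := by
  intro hw
  have hlt := hD.join_lt hj
  rcases hI.side v hlt.1 hv with h1 | h1
  · rcases hI.side w hlt.2 hw with h2 | h2
    · exact (hside _ _ _ hj).1 h1 h2
    · have := h2.join hD hj.symm he
      omega
  · have := h1.join hD hj he
    omega

/-- An unmatched vertex that has not been visited becomes the root of a new tree. -/
theorem Inv.push (hI : Inv D F K A side σ) (hR : D.Rep A K) {v : ℕ}
    (hv : v < D.N) (hA : A v = 0) (h1 : σ.LB v = 1) (hs : side v) :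
    Inv D F K A side (σ.push v) := by
  have hup : ∀ u, (σ.push v).LB u = if u = v then 0 else σ.LB u := fun u => by
    simp [Search.push, Function.update_apply]
  have hpos : ∀ u, (σ.push v).POS u = if u = v then σ.qt else σ.POS u := fun u => by
    simp [Search.push, Function.update_apply]
  have hQ : ∀ u, (σ.push v).Q u = if u = σ.qt then v else σ.Q u := fun u => by
    simp [Search.push, Function.update_apply]
  have hm : ∀ u w, D.Mate A u w → u ≠ v := by
    rintro u w ⟨k, hk, -⟩ rfl
    omega
  constructor
  case le_two =>
    intro u hu
    have := hI.le_two u hu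
    rw [hup]
    split_ifs <;> omega
  case even =>
    intro u hu h
    rw [hup] at h
    by_cases huv : u = v
    · subst huv
      exact ⟨0, by simp, .start _ (not_covers_iff.2 ((hR.eq_zero_iff hu).1 hA))⟩
    · exact hI.even u hu (by simpa [huv] using h)
  case odd =>
    intro u hu h
    rw [hup] at h
    by_cases huv : u = v
    · simp [huv] at h
    · exact hI.odd u hu (by simpa [huv] using h)
  case mate =>
    intro u w hm' h
    rw [hup, if_neg (hm u w hm')] at h
    have := hI.mate u w hm' h
    rw [hup]
    split_ifs with h2
    · subst h2
      omega
    · exact this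
  case mate' =>
    intro u w hm' h
    rw [hup, if_neg (hm u w hm')] at h
    have := hI.mate' u w hm' h
    rw [hup]
    split_ifs <;> omega
  case free =>
    intro u hu h2 h
    rw [hup] at h
    split_ifs at h
    exact hI.free u hu h2 h
  case found =>
    intro h
    obtain ⟨y, hy, h2, h3, h4⟩ := hI.found h
    refine ⟨y, hy, h2, h3, ?_⟩
    rw [hup, if_neg (by rintro rfl; omega), h4]
  case tree =>
    intro w hw h
    rw [hup] at h
    split_ifs at h
    obtain ⟨h2, h3, h4⟩ := hI.tree w hw h
    have hne : σ.PV w ≠ v := by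
      intro h
      rw [h] at h2
      omega
    refine ⟨by rw [hup]; simp [Search.push, hne, h2], h3, fun x hx => ?_⟩
    have h5 := h4 x hx
    have h6 := hI.mate' w x hx h
    rw [hpos, hpos, if_neg (show (σ.push v).PV w ≠ v from hne), if_neg (by rintro rfl; omega)]
    exact h5
  case queue =>
    intro p hp
    have hp : p < σ.qt + 1 := hp
    rw [hQ]
    split_ifs with h
    · subst h
      exact ⟨hv, by rw [hup, if_pos rfl], by rw [hpos, if_pos rfl]⟩
    · obtain ⟨h2, h3, h4⟩ := hI.queue p (by omega)
      have hne : σ.Q p ≠ v := by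
        intro h
        rw [h] at h3
        omega
      rw [hup, hpos, if_neg hne, if_neg hne]
      exact ⟨h2, h3, h4⟩
  case pos =>
    intro u hu h
    rw [hup] at h
    rw [hpos]
    by_cases huv : u = v
    · subst huv
      rw [if_pos rfl, hQ, if_pos rfl]
      exact ⟨Nat.lt_succ_self _, rfl⟩
    · rw [if_neg huv] at h ⊢
      obtain ⟨h2, h3⟩ := hI.pos u hu h
      rw [hQ, if_neg (by omega)]
      exact ⟨Nat.lt_succ_of_lt h2, h3⟩
  case qh_le => exact hI.qh_le.trans (Nat.le_succ _)
  case scanned =>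
    intro u hu h hp g hg hg' hgs hc he
    rw [hup] at h
    rw [hpos] at hp
    have := hI.qh_le
    split_ifs at h hp with h2
    · exact absurd (show σ.qt < σ.qh from hp) (by omega)
    · have := hI.scanned u hu h hp g hg hg' hgs hc he
      rw [hup, if_neg (by rintro rfl; omega), this]
  case side =>
    intro u hu h
    by_cases huv : u = v
    · exact Or.inl (huv ▸ hs)
    · rw [hup, if_neg huv] at h
      refine (hI.side u hu h).imp id fun h2 g hg hg' hgs he => ?_
      have := h2 g hg hg' hgs he
      rw [hup, if_neg (by rintro rfl; omega), this]
  case cur =>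
    intro h
    obtain ⟨h2, h3, h4, h5, h6⟩ := hI.cur h
    have hne : σ.cv ≠ v := by
      intro h
      rw [h] at h5
      omega
    refine ⟨h2, h3, h4, ?_, ?_⟩
    · rw [hup, if_neg (show (σ.push v).cv ≠ v from hne)]
      exact h5
    · rw [hpos, if_neg (show (σ.push v).cv ≠ v from hne)]
      exact h6

theorem Inv.not_mem (hI : Inv D F K A side σ) (hD : D.Valid) (hK : IsMatching K) (hR : D.Rep A K)
    {k v w : ℕ} (hj : D.Join k v w) (hv : σ.LB v = 0) (hw : σ.LB w ≠ 2) : D.ed k ∉ K := fun h =>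
  hw (hI.mate v w ⟨k, hR.eq_of_mem hD hK (hD.join_lt hj).1 hj.1 h (hD.join_inc hj).1, hj⟩ hv)

theorem Inv.odd_of_join (hI : Inv D F K A side σ) (hD : D.Valid) (hK : IsMatching K)
    (hR : D.Rep A K) {k v w : ℕ} (hj : D.Join k v w) (he : D.ed k ∈ F) (hv : σ.LB v = 0)
    (hw : σ.LB w ≠ 2) : ∃ k, Odd k ∧ AltPath F K k (D.vx w) := by
  obtain ⟨l, hl, hp⟩ := hI.even v (hD.join_lt hj).1 hv
  exact ⟨l + 1, hl.add_one, .unmatchedEdge l _ _ hp hl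
    (hD.adj hj (Finset.mem_sdiff.2 ⟨he, hI.not_mem hD hK hR hj hv hw⟩))⟩

/-- An unvisited unmatched vertex is reached: the matching can be augmented. -/
theorem Inv.reach_free (hI : Inv D F K A side σ) (hD : D.Valid) (hK : IsMatching K)
    (hR : D.Rep A K) {k v w : ℕ} (hj : D.Join k v w) (he : D.ed k ∈ F) (hv : σ.LB v = 0)
    (hw : σ.LB w = 1) (hA : A w = 0) (hf : σ.found = 0) :
    Inv D F K A side { σ.mark k v w with found := w + 1 } := by
  have hlt := hD.join_lt hj
  have hup : ∀ u, (σ.mark k v w).LB u = if u = w then 2 else σ.LB u := fun u => by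
    simp [mark, Function.update_apply]
  have hm : ∀ u u', D.Mate A u u' → u ≠ w ∧ u' ≠ w := by
    rintro u u' h
    refine ⟨?_, ?_⟩
    · rintro rfl
      obtain ⟨k, hk, -⟩ := h
      omega
    · rintro rfl
      obtain ⟨k, hk, -⟩ := hR.mate_symm hD hK h
      omega
  constructor
  case le_two =>
    intro u hu
    have := hI.le_two u hu
    show (σ.mark k v w).LB u ≤ 2
    rw [hup]
    split_ifs <;> omega
  case even =>
    intro u hu (h : (σ.mark k v w).LB u = 0)
    rw [hup] at h
    split_ifs at h
    exact hI.even u hu h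
  case odd =>
    intro u hu (h : (σ.mark k v w).LB u = 2)
    rw [hup] at h
    split_ifs at h with huw
    · subst huw
      exact hI.odd_of_join hD hK hR hj he hv (by omega)
    · exact hI.odd u hu h
  case mate =>
    intro u u' hm' (h : (σ.mark k v w).LB u = 0)
    show (σ.mark k v w).LB u' = 2
    rw [hup, if_neg (hm u u' hm').1] at h
    rw [hup, if_neg (hm u u' hm').2, hI.mate u u' hm' h]
  case mate' =>
    intro u u' hm' (h : (σ.mark k v w).LB u = 2)
    show (σ.mark k v w).LB u' = 0
    rw [hup, if_neg (hm u u' hm').1] at h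
    rw [hup, if_neg (hm u u' hm').2, hI.mate' u u' hm' h]
  case free =>
    intro u hu h2 (h : (σ.mark k v w).LB u = 2)
    rw [hup] at h
    split_ifs at h with huw
    · rw [huw]
    · have := hI.free u hu h2 h
      omega
  case found =>
    intro _
    exact ⟨w, hlt.2, rfl, hA, by simp [mark]⟩
  case tree =>
    intro u hu (h : (σ.mark k v w).LB u = 2)
    rw [hup] at h
    by_cases huw : u = w
    · subst huw
      have e1 : (σ.mark k v u).PV u = v := by simp [mark]
      show (σ.mark k v u).LB ((σ.mark k v u).PV u) = 0 ∧ _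
      refine ⟨?_, ⟨k, by simp [mark], he, by simpa [mark] using hj⟩, fun x hx =>
        absurd rfl (hm u x hx).1⟩
      rw [e1, hup, if_neg (by rintro rfl; omega), hv]
    · rw [if_neg huw] at h
      obtain ⟨h2, h3, h4⟩ := hI.tree u hu h
      have e1 : (σ.mark k v w).PV u = σ.PV u := by simp [mark, huw]
      have e2 : (σ.mark k v w).PAR u = σ.PAR u := by simp [mark, huw]
      show (σ.mark k v w).LB ((σ.mark k v w).PV u) = 0 ∧ (∃ l, (σ.mark k v w).PAR u = l + 1 ∧ _ ∧
        D.Join l ((σ.mark k v w).PV u) u) ∧ ∀ x, _ → σ.POS ((σ.mark k v w).PV u) < σ.POS x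
      rw [e1, e2, hup, if_neg (by intro h; rw [h] at h2; omega)]
      exact ⟨h2, h3, h4⟩
  case queue =>
    intro p hp
    obtain ⟨h2, h3, h4⟩ := hI.queue p hp
    refine ⟨h2, ?_, h4⟩
    show (σ.mark k v w).LB (σ.Q p) = 0
    rw [hup, if_neg (by intro h; rw [h] at h3; omega), h3]
  case pos =>
    intro u hu (h : (σ.mark k v w).LB u = 0)
    rw [hup] at h
    split_ifs at h
    exact hI.pos u hu h
  case qh_le => exact hI.qh_le
  case scanned =>
    intro u hu (h : (σ.mark k v w).LB u = 0) hp g hg hg' hgs hc hge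
    rw [hup] at h
    split_ifs at h
    show (σ.mark k v w).LB _ = 2
    rw [hup, hI.scanned u hu h hp g hg hg' hgs hc hge, ite_self]
  case side =>
    intro u hu (h : (σ.mark k v w).LB u = 0)
    rw [hup] at h
    split_ifs at h
    refine (hI.side u hu h).imp id fun h2 g hg hg' hgs hge => ?_
    show (σ.mark k v w).LB _ = 2
    rw [hup, h2 g hg hg' hgs hge, ite_self]
  case cur =>
    intro h
    obtain ⟨h2, h3, h4, h5, h6⟩ := hI.cur h
    refine ⟨h2, h3, h4, ?_, h6⟩
    show (σ.mark k v w).LB σ.cv = 0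
    rw [hup, if_neg (by intro h; rw [h] at h5; omega), h5]

/-- An unvisited matched vertex `w` is reached: it becomes odd, and its partner `x` even. -/
theorem Inv.extend (hI : Inv D F K A side σ) (hD : D.Valid) (hK : IsMatching K)
    (hR : D.Rep A K) (hside : ∀ k v w, D.Join k v w → (side v ↔ ¬ side w)) {k v w x : ℕ}
    (hj : D.Join k v w) (he : D.ed k ∈ F) (hv : σ.LB v = 0) (hw : σ.LB w = 1)
    (hx : D.Mate A w x) : Inv D F K A side ((σ.mark k v w).push x) := by
  have hlt := hD.join_lt hj
  have hxN := (hx.lt hD).2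
  have hx' := hR.mate_symm hD hK hx
  have hxw := hx.ne hD
  have hx1 : σ.LB x = 1 := by
    have h1 := hI.le_two x hxN
    have h2 := hI.mate x w hx'
    have h3 := hI.mate' x w hx'
    omega
  have hvw : v ≠ w := by
    rintro rfl
    omega
  have hvx : v ≠ x := by
    rintro rfl
    omega
  obtain ⟨τ, hτ⟩ : ∃ τ, τ = (σ.mark k v w).push x := ⟨_, rfl⟩
  rw [← hτ]
  have hup : ∀ u, τ.LB u = if u = x then 0 else if u = w then 2 else σ.LB u := fun u => by
    simp [hτ, Search.push, mark, Function.update_apply]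
  have hpos : ∀ u, τ.POS u = if u = x then σ.qt else σ.POS u := fun u => by
    simp [hτ, Search.push, mark, Function.update_apply]
  have hQ : ∀ u, τ.Q u = if u = σ.qt then x else σ.Q u := fun u => by
    simp [hτ, Search.push, mark, Function.update_apply]
  have hPV : ∀ u, τ.PV u = if u = w then v else σ.PV u := fun u => by
    simp [hτ, Search.push, mark, Function.update_apply]
  have hPAR : ∀ u, τ.PAR u = if u = w then k + 1 else σ.PAR u := fun u => by
    simp [hτ, Search.push, mark, Function.update_apply]
  have e1 : τ.qh = σ.qh := by simp [hτ, Search.push, mark]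
  have e2 : τ.qt = σ.qt + 1 := by simp [hτ, Search.push, mark]
  have e3 : τ.cv = σ.cv := by simp [hτ, Search.push, mark]
  have e4 : τ.h = σ.h := by simp [hτ, Search.push, mark]
  have e5 : τ.found = σ.found := by simp [hτ, Search.push, mark]
  clear hτ
  have h0 : ∀ u, σ.LB u = 0 → u ≠ w ∧ u ≠ x := by
    intro u hu
    refine ⟨?_, ?_⟩ <;> rintro rfl <;> omega
  have h2 : ∀ u, σ.LB u = 2 → u ≠ w ∧ u ≠ x := by
    intro u hu
    refine ⟨?_, ?_⟩ <;> rintro rfl <;> omega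
  have k0 : ∀ u, σ.LB u = 0 → τ.LB u = 0 := fun u hu => by
    rw [hup, if_neg (h0 u hu).2, if_neg (h0 u hu).1, hu]
  have k2 : ∀ u, σ.LB u = 2 → τ.LB u = 2 := fun u hu => by
    rw [hup, if_neg (h2 u hu).2, if_neg (h2 u hu).1, hu]
  have l0 : ∀ u, τ.LB u = 0 → u = x ∨ σ.LB u = 0 := fun u hu => by
    rw [hup] at hu
    split_ifs at hu with h
    · exact Or.inl h
    · exact Or.inr hu
  have l2 : ∀ u, τ.LB u = 2 → u = w ∨ σ.LB u = 2 := fun u hu => by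
    rw [hup] at hu
    split_ifs at hu with h h'
    · exact Or.inl h'
    · exact Or.inr hu
  constructor
  case le_two =>
    intro u hu
    have := hI.le_two u hu
    rw [hup]
    split_ifs <;> omega
  case even =>
    intro u hu h
    rcases l0 u h with rfl | h
    · obtain ⟨l, hl, hp⟩ := hI.odd_of_join hD hK hR hj he hv (by omega)
      obtain ⟨q, hq, hjq⟩ := hx
      exact ⟨l + 1, hl.add_one, .matchedEdge l _ _ hp hl
        (hD.adj hjq (hR.mem_of_eq hlt.2 hq).2.1)⟩
    · exact hI.even u hu h
  case odd =>
    intro u hu h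
    rcases l2 u h with rfl | h
    · exact hI.odd_of_join hD hK hR hj he hv (by omega)
    · exact hI.odd u hu h
  case mate =>
    intro u u' hm h
    rcases l0 u h with rfl | h
    · rw [hm.unique hD hx', hup, if_neg hxw, if_pos rfl]
    · exact k2 _ (hI.mate u u' hm h)
  case mate' =>
    intro u u' hm h
    rcases l2 u h with rfl | h
    · rw [hm.unique hD hx, hup, if_pos rfl]
    · exact k0 _ (hI.mate' u u' hm h)
  case free =>
    intro u hu hu' h
    rw [e5]
    rcases l2 u h with rfl | h
    · obtain ⟨q, hq, -⟩ := hx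
      omega
    · exact hI.free u hu hu' h
  case found =>
    intro h
    rw [e5] at h ⊢
    obtain ⟨y, hy, h3, h4, h5⟩ := hI.found h
    exact ⟨y, hy, h3, h4, k2 _ h5⟩
  case tree =>
    intro u hu h
    rcases l2 u h with rfl | h
    · rw [hPV, hPAR, if_pos rfl, if_pos rfl]
      refine ⟨k0 v hv, ⟨k, rfl, he, hj⟩, fun y hy => ?_⟩
      rw [hy.unique hD hx, hpos, hpos, if_neg hvx, if_pos rfl]
      exact (hI.pos v hlt.1 hv).1
    · obtain ⟨h3, h4, h5⟩ := hI.tree u hu h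
      rw [hPV, hPAR, if_neg (h2 u h).1, if_neg (h2 u h).1]
      refine ⟨k0 _ h3, h4, fun y hy => ?_⟩
      rw [hpos, hpos, if_neg (h0 _ h3).2, if_neg (h0 _ (hI.mate' u y hy h)).2]
      exact h5 y hy
  case queue =>
    intro p hp
    rw [e2] at hp
    rw [hQ]
    split_ifs with h
    · exact ⟨hxN, by rw [hup, if_pos rfl], by rw [hpos, if_pos rfl, h]⟩
    · obtain ⟨h3, h4, h5⟩ := hI.queue p (by omega)
      exact ⟨h3, k0 _ h4, by rw [hpos, if_neg (h0 _ h4).2, h5]⟩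
  case pos =>
    intro u hu h
    rw [e2, hpos]
    by_cases hux : u = x
    · rw [if_pos hux, hQ, if_pos rfl]
      exact ⟨Nat.lt_succ_self _, hux.symm⟩
    · obtain ⟨h3, h4⟩ := hI.pos u hu ((l0 u h).resolve_left hux)
      rw [if_neg hux, hQ, if_neg (by omega)]
      exact ⟨Nat.lt_succ_of_lt h3, h4⟩
  case qh_le =>
    rw [e1, e2]
    exact hI.qh_le.trans (Nat.le_succ _)
  case scanned =>
    intro u hu h hp g hg hg' hgs hc hge
    have := hI.qh_le
    rw [hpos, e1] at hp
    rw [e3, e4] at hc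
    split_ifs at hp with hux
    · omega
    · exact k2 _ (hI.scanned u hu ((l0 u h).resolve_left hux) hp g hg hg' hgs hc hge)
  case side =>
    intro u hu h
    rcases l0 u h with rfl | h
    · left
      rcases hI.side v hlt.1 hv with h3 | h3
      · obtain ⟨q, -, hq⟩ := hx
        have := hside _ _ _ hj
        have := hside _ _ _ hq
        tauto
      · have := h3.join hD hj he
        omega
    · exact (hI.side u hu h).imp id fun h3 g hg hg' hgs hge => k2 _ (h3 g hg hg' hgs hge)
  case cur =>
    intro h
    rw [e4] at h ⊢
    rw [e3, e1]
    obtain ⟨h3, h4, h5, h6, h7⟩ := hI.cur h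
    exact ⟨h3, h4, h5, k0 _ h6, by rwa [hpos, if_neg (h0 _ h6).2]⟩

/-- The next half-edge, after one that is not in the graph or leads to an odd vertex. -/
theorem Inv.advance (hI : Inv D F K A side σ) (hD : D.Valid) (h0 : σ.h ≠ 0)
    (hd : D.ed (D.HK σ.h) ∈ F → σ.LB (D.HO σ.h) = 2) :
    Inv D F K A side { σ with h := D.HN σ.h } := by
  obtain ⟨h1, h2, h3, h4, h5⟩ := hI.cur h0
  have hpos : 1 ≤ σ.h := by omega
  refine ⟨hI.le_two, hI.even, hI.odd, hI.mate, hI.mate', hI.free, hI.found, hI.tree, hI.queue,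
    hI.pos, hI.qh_le, ?_, hI.side, ?_⟩
  · intro u hu h hp g hg hg' hgs hc hge
    by_cases hgh : u = σ.cv → σ.h < g
    · exact hI.scanned u hu h hp g hg hg' hgs hgh hge
    · push Not at hgh
      obtain ⟨rfl, hgh⟩ := hgh
      have hc : D.HN σ.h < g := hc rfl
      rcases hgh.lt_or_eq with hlt | rfl
      · have := hD.le_next σ.h g hg hlt h1 (by rw [hgs, h2])
        omega
      · exact hd hge
  · intro (h : D.HN σ.h ≠ 0)
    have := hD.next_lt _ hpos h1
    have := hD.next_src _ hpos h1 h
    exact ⟨show D.HN σ.h ≤ _ by omega, by rw [← h2, ← this], h3, h4, h5⟩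

/-- The next even vertex from the queue. -/
theorem Inv.pop (hI : Inv D F K A side σ) (hD : D.Valid) (h0 : σ.h = 0) (hq : σ.qh < σ.qt) :
    Inv D F K A side { σ with qh := σ.qh + 1, cv := σ.Q σ.qh, h := D.HEAD (σ.Q σ.qh) } := by
  obtain ⟨h1, h2, h3⟩ := hI.queue _ hq
  refine ⟨hI.le_two, hI.even, hI.odd, hI.mate, hI.mate', hI.free, hI.found, hI.tree, hI.queue,
    hI.pos, hq, ?_, hI.side, ?_⟩
  · intro u hu h (hp : σ.POS u < σ.qh + 1) g hg hg' hgs (hc : u = σ.Q σ.qh → D.HEAD (σ.Q σ.qh) < g) hge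
    have h4 := hI.pos u hu h
    by_cases huq : u = σ.Q σ.qh
    · have := hc huq
      have := hD.le_head g hg hg'
      rw [hgs, huq] at this
      omega
    · refine hI.scanned u hu h ?_ g hg hg' hgs (fun _ => by omega) hge
      rcases Nat.lt_succ_iff_lt_or_eq.1 hp with h5 | h5
      · exact h5
      · rw [h5] at h4
        exact absurd h4.2.symm huq
  · intro (h : D.HEAD (σ.Q σ.qh) ≠ 0)
    exact ⟨hD.head_le _ h1, hD.head_src _ h1 h, h1, h2, show σ.POS (σ.Q σ.qh) < σ.qh + 1 by omega⟩

/-- The half-edges that have not been looked at. -/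
noncomputable def pending (D : Data) (σ : Search) : ℕ :=
  open Classical in ((Finset.Icc 1 D.NH).filter fun g =>
    ¬ (σ.LB (D.HS g) = 0 ∧ σ.POS (D.HS g) < σ.qh ∧ (D.HS g = σ.cv → σ.h < g))).card

theorem pending_le (D : Data) (σ : Search) : pending D σ ≤ D.NH := by
  classical
  exact (Finset.card_filter_le _ _).trans (by simp)

end Search

namespace Search

variable {D : Data} {F K : Finset Edge} {A : ℕ → ℕ} {side : ℕ → Prop} {σ τ : Search}

theorem pending_mono (h : ∀ g, σ.LB (D.HS g) = 0 → σ.POS (D.HS g) < σ.qh →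
    (D.HS g = σ.cv → σ.h < g) →
    τ.LB (D.HS g) = 0 ∧ τ.POS (D.HS g) < τ.qh ∧ (D.HS g = τ.cv → τ.h < g)) :
    pending D τ ≤ pending D σ := by
  classical
  exact Finset.card_le_card (Finset.monotone_filter_right _ fun g _ h1 h2 =>
    h1 (h g h2.1 h2.2.1 h2.2.2))

theorem Inv.pending_lt (hI : Inv D F K A side σ) (hD : D.Valid) (h0 : σ.h ≠ 0)
    (h : ∀ u, σ.LB u = 0 → τ.LB u = 0 ∧ τ.POS u = σ.POS u) (hq : τ.qh = σ.qh) (hc : τ.cv = σ.cv)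
    (hh : τ.h = D.HN σ.h) : pending D τ < pending D σ := by
  classical
  obtain ⟨h1, h2, h3, h4, h5⟩ := hI.cur h0
  have hlt := hD.next_lt σ.h (by omega) h1
  refine Finset.card_lt_card ((Finset.ssubset_iff_of_subset
    (Finset.monotone_filter_right _ fun g _ h1 h2 => h1 ?_)).2 ⟨σ.h, ?_, ?_⟩)
  · simp only [Finset.mem_filter, Finset.mem_Icc, not_and, h2]
    exact ⟨⟨by omega, h1⟩, fun _ _ => by simp⟩
  · simp only [Finset.mem_filter, not_and, not_not, h2, hq, hc, hh]
    exact fun _ h6 => h6 (h _ h4).1 (by rw [(h _ h4).2]; exact h5) fun _ => hlt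
  · obtain ⟨k1, k2⟩ := h _ h2.1
    rw [k1, k2, hq, hc, hh]
    exact ⟨rfl, h2.2.1, fun h6 => hlt.trans (h2.2.2 h6)⟩

end Search

namespace Prog

/-- One step of the search: the next half-edge is inspected or, at the end of a list, the next even
vertex is taken from the queue. -/
def scanStep : Prog :=
  ite (.eq 33 10)
    (ite (.lt 30 31) (read 32 38 30 ;; succ 30 ;; read 33 28 32) (const 34 0))
    (read 20 31 33 ;; read 21 30 33 ;; read 33 29 33 ;;
      read 22 6 20 ;; ite (.eq 22 10)
        (read 22 4 20 ;; ite (.lt 17 22) skip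
          (read 22 34 21 ;; ite (.eq 22 11)
            (copy 22 20 ;; succ 22 ;; write 34 21 12 ;; write 35 21 22 ;; write 36 21 32 ;;
              read 22 27 21 ;; ite (.eq 22 10)
                (copy 35 21 ;; succ 35 ;; const 34 0)
                (other 22 21 23 ;; write 34 23 10 ;; write 37 23 31 ;; write 38 31 23 ;; succ 31))
            skip))
        skip)

/-- Alternating paths are searched until an unmatched odd vertex is found or the queue is empty. -/
def scan : Prog := const 34 1 ;; .while (.lt 10 34) scanStep

end Prog

section

variable {D : Data} {t : State}

theorem scanStep_pop (ht : D.Has t) (h0 : t.reg 33 = 0) (hq : t.reg 30 < t.reg 31) :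
    Search.of (Prog.scanStep.ev t) = { Search.of t with
        qh := t.reg 30 + 1, cv := t.arr 38 (t.reg 30), h := D.HEAD (t.arr 38 (t.reg 30)) } ∧
      (Prog.scanStep.ev t).reg 34 = t.reg 34 := by
  simp [Prog.scanStep, Prog.ev, Search.of, ht.zero, h0, hq, ht.HEAD]

theorem scanStep_stop (ht : D.Has t) (h0 : t.reg 33 = 0) (hq : ¬ t.reg 30 < t.reg 31) :
    Search.of (Prog.scanStep.ev t) = Search.of t ∧ (Prog.scanStep.ev t).reg 34 = 0 := by
  simp [Prog.scanStep, Prog.ev, Search.of, ht.zero, h0, hq]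

theorem scanStep_skip (ht : D.Has t) (h0 : t.reg 33 ≠ 0)
    (hc : ¬ (t.arr 6 (D.HK (t.reg 33)) = 0 ∧ D.RK (D.HK (t.reg 33)) ≤ t.reg 17 ∧
      t.arr 34 (D.HO (t.reg 33)) = 1)) :
    Search.of (Prog.scanStep.ev t) = { Search.of t with h := D.HN (t.reg 33) } ∧
      (Prog.scanStep.ev t).reg 34 = t.reg 34 := by
  simp only [Prog.scanStep, Prog.ev, Search.of, Test.holds_eq, Test.holds_lt, ht.zero, h0,
    ht.HK, ht.HO, ht.HN, ht.RK, ht.one, State.setReg_reg, State.setReg_arr, if_true, if_false,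
    Nat.reduceEqDiff]
  by_cases h1 : t.arr 6 (D.HK (t.reg 33)) = 0
  · by_cases h2 : D.RK (D.HK (t.reg 33)) ≤ t.reg 17
    · have h3 : t.arr 34 (D.HO (t.reg 33)) ≠ 1 := fun h3 => hc ⟨h1, h2, h3⟩
      simp [h1, not_lt.2 h2, h3]
    · simp [h1, not_le.1 h2]
  · simp [h1]

theorem scanStep_found (ht : D.Has t) (h0 : t.reg 33 ≠ 0)
    (h1 : t.arr 6 (D.HK (t.reg 33)) = 0) (h2 : D.RK (D.HK (t.reg 33)) ≤ t.reg 17)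
    (h3 : t.arr 34 (D.HO (t.reg 33)) = 1) (h4 : t.arr 27 (D.HO (t.reg 33)) = 0) :
    Search.of (Prog.scanStep.ev t) =
      { (Search.of t).mark (D.HK (t.reg 33)) (t.reg 32) (D.HO (t.reg 33)) with
        found := D.HO (t.reg 33) + 1, h := D.HN (t.reg 33) } ∧
      (Prog.scanStep.ev t).reg 34 = 0 := by
  simp [Prog.scanStep, Prog.ev, Search.of, Search.mark, ht.zero, h0, ht.HK, ht.HO, ht.HN, ht.RK,
    ht.one, ht.two, h1, not_lt.2 h2, h3, h4]

theorem scanStep_extend (ht : D.Has t) (h0 : t.reg 33 ≠ 0)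
    (h1 : t.arr 6 (D.HK (t.reg 33)) = 0) (h2 : D.RK (D.HK (t.reg 33)) ≤ t.reg 17)
    (h3 : t.arr 34 (D.HO (t.reg 33)) = 1) (h4 : t.arr 27 (D.HO (t.reg 33)) ≠ 0) :
    Search.of (Prog.scanStep.ev t) =
      { ((Search.of t).mark (D.HK (t.reg 33)) (t.reg 32) (D.HO (t.reg 33))).push
          (D.opp (t.arr 27 (D.HO (t.reg 33)) - 1) (D.HO (t.reg 33))) with
        h := D.HN (t.reg 33) } ∧
      (Prog.scanStep.ev t).reg 34 = t.reg 34 := by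
  simp only [Prog.scanStep, Prog.ev, Test.holds_eq, Test.holds_lt, ht.zero, h0,
    ht.HK, ht.HO, ht.HN, ht.RK, ht.one, State.setReg_reg, State.setReg_arr, if_true, if_false,
    State.setArr_arr, State.setArr_reg, Nat.reduceEqDiff, h1, not_lt.2 h2, h3, h4]
  rw [ev_other (D := D) (by simp [ht.U]) (by simp [ht.W]) (by decide) (by decide) (by decide)]
  simp [Search.of, Search.mark, Search.push, ht.two, ht.zero]

/-- The search inspects every half-edge at most once. It ends with an unmatched odd vertex or with an
empty queue. -/
theorem scan_spec (hD : D.Valid) {s : State} (hs : D.Has s) {F K : Finset Edge}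
    (hK : IsMatching K) (hR : D.Rep (s.arr 27) K) {side : ℕ → Prop}
    (hside : ∀ k v w, D.Join k v w → (side v ↔ ¬ side w))
    (hF : ∀ k < D.m, D.ed k ∈ F ↔ s.arr 6 k = 0 ∧ D.RK k ≤ s.reg 17)
    (hI : Search.Inv D F K (s.arr 27) side (Search.of s)) (hf : s.reg 35 = 0) :
    ∃ s', Runs .scan s (200 * D.size) s' ∧
      Search.Inv D F K (s.arr 27) side (Search.of s') ∧
      (∀ v, s.arr 34 v ≠ 1 → s'.arr 34 v = s.arr 34 v) ∧
      (s'.reg 35 ≠ 0 ∨ s'.reg 33 = 0 ∧ s'.reg 30 = s'.reg 31) := by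
  have hr₁ := Runs.ev (c := .const 34 1) rfl s
  have hs₁ := hs.frame hr₁.frame rfl rfl
  obtain ⟨s', hr, ⟨h1, h2, h3, h4, h5⟩, hq, hfr⟩ := Runs.loop (q := .lt 10 34) (c := .scanStep)
    (T := Prog.scanStep.cost) (s₀ := (Prog.const 34 1).ev s)
    (fun t => Search.Inv D F K (s.arr 27) side (Search.of t) ∧
      (∀ v, s.arr 34 v ≠ 1 → t.arr 34 v = s.arr 34 v) ∧ t.reg 34 ≤ 1 ∧
      (t.reg 34 = 0 → t.reg 35 ≠ 0 ∨ t.reg 33 = 0 ∧ t.reg 30 = t.reg 31) ∧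
      (t.reg 35 ≠ 0 → t.reg 34 = 0))
    (fun t => Search.pending D (Search.of t) + (D.N - t.reg 30) + t.reg 34)
    (by
      intro t hfr ⟨h1, h2, h3, h4, h5⟩ hq
      have ht := hs₁.frame hfr rfl rfl
      have a6 : t.arr 6 = s.arr 6 := hfr.2 6 (by decide)
      have a27 : t.arr 27 = s.arr 27 := hfr.2 27 (by decide)
      have a17 : t.reg 17 = s.reg 17 := hfr.1 17 (by decide)
      rw [← a6, ← a17] at hF
      rw [← a27] at h1 hR ⊢
      have hrun : t.reg 34 = 1 := by
        have h6 : t.reg 10 < t.reg 34 := hq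
        rw [ht.zero] at h6
        omega
      have hfound : t.reg 35 = 0 := by
        by_contra h
        have := h5 h
        omega
      refine ⟨_, Runs.ev rfl t, ?_⟩
      obtain ⟨t', ht'⟩ : ∃ t', t' = Prog.scanStep.ev t := ⟨_, rfl⟩
      rw [← ht']
      by_cases h0 : t.reg 33 = 0
      · by_cases hlt : t.reg 30 < t.reg 31
        · obtain ⟨e1, e2⟩ := scanStep_pop ht h0 hlt
          rw [← ht'] at e1 e2
          have e30 : t'.reg 30 = t.reg 30 + 1 := congrArg Search.qh e1
          have e34 : t'.arr 34 = t.arr 34 := congrArg Search.LB e1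
          have e35 : t'.reg 35 = t.reg 35 := congrArg Search.found e1
          refine ⟨⟨by rw [e1]; exact h1.pop hD h0 hlt, by rwa [e34], by omega, by omega, by omega⟩, ?_⟩
          have h6 := h1.qt_le
          have h6 : t.reg 31 ≤ D.N := h6
          have h7 : Search.pending D (Search.of t') ≤ Search.pending D (Search.of t) := by
            rw [e1]
            refine Search.pending_mono fun g k1 k2 k3 => ⟨k1, Nat.lt_succ_of_lt k2, fun k4 => ?_⟩
            have k5 := (h1.queue _ hlt).2.2
            have k4 : D.HS g = t.arr 38 (t.reg 30) := k4
            rw [k4] at k2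
            have k5 : t.arr 37 (t.arr 38 (t.reg 30)) = t.reg 30 := k5
            have k2 : t.arr 37 (t.arr 38 (t.reg 30)) < t.reg 30 := k2
            omega
          rw [e30, e2]
          omega
        · obtain ⟨e1, e2⟩ := scanStep_stop ht h0 hlt
          rw [← ht'] at e1 e2
          have e30 : t'.reg 30 = t.reg 30 := congrArg Search.qh e1
          have e31 : t'.reg 31 = t.reg 31 := congrArg Search.qt e1
          have e33 : t'.reg 33 = t.reg 33 := congrArg Search.h e1
          have e34 : t'.arr 34 = t.arr 34 := congrArg Search.LB e1
          have e35 : t'.reg 35 = t.reg 35 := congrArg Search.found e1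
          have h6 : t.reg 30 ≤ t.reg 31 := h1.qh_le
          refine ⟨⟨by rwa [e1], by rwa [e34], by omega, fun _ => Or.inr (by omega), by omega⟩, ?_⟩
          rw [e1, e30, e2]
          omega
      · obtain ⟨c1, c2, c3, c4, c5⟩ := h1.cur h0
        have c1 : t.reg 33 ≤ D.NH := c1
        have c2 : D.HS (t.reg 33) = t.reg 32 := c2
        have hj := hD.join_half (h := t.reg 33) (by omega) c1
        rw [c2] at hj
        by_cases hc : t.arr 6 (D.HK (t.reg 33)) = 0 ∧ D.RK (D.HK (t.reg 33)) ≤ t.reg 17 ∧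
            t.arr 34 (D.HO (t.reg 33)) = 1
        · obtain ⟨hc1, hc2, hc3⟩ := hc
          have he : D.ed (D.HK (t.reg 33)) ∈ F := (hF _ hj.1).2 ⟨hc1, hc2⟩
          have h34 : ∀ v, s.arr 34 v ≠ 1 → v ≠ D.HO (t.reg 33) := by
            rintro v hv rfl
            have := h2 _ hv
            omega
          by_cases hA : t.arr 27 (D.HO (t.reg 33)) = 0
          · obtain ⟨e1, e2⟩ := scanStep_found ht h0 hc1 hc2 hc3 hA
            rw [← ht'] at e1 e2
            have hI' := h1.reach_free hD hK hR hj he c4 hc3 hA hfound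
            have hI'' := hI'.advance hD h0 (fun _ => by simp [Search.mark, Search.of])
            have e30 : t'.reg 30 = t.reg 30 := congrArg Search.qh e1
            have e34 : t'.arr 34 = Function.update (t.arr 34) (D.HO (t.reg 33)) 2 :=
              congrArg Search.LB e1
            have e35 : t'.reg 35 = D.HO (t.reg 33) + 1 := congrArg Search.found e1
            refine ⟨⟨by rw [e1]; exact hI'', fun v hv => ?_, by omega, fun _ => Or.inl (by omega),
              by omega⟩, ?_⟩
            · rw [e34, Function.update_of_ne (h34 v hv), h2 v hv]
            · have := h1.pending_lt (τ := Search.of t') hD h0 (fun u hu => by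
                rw [e1]
                have : u ≠ D.HO (t.reg 33) := by
                  rintro rfl
                  have : t.arr 34 (D.HO (t.reg 33)) = 0 := hu
                  omega
                simp only [Search.mark, Function.update_of_ne this]
                exact ⟨hu, trivial⟩) (by rw [e1]; rfl) (by rw [e1]; rfl) (by rw [e1]; rfl)
              rw [e30, e2]
              omega
          · obtain ⟨e1, e2⟩ := scanStep_extend ht h0 hc1 hc2 hc3 hA
            rw [← ht'] at e1 e2
            have hm := hR.exists_mate hD (hD.join_lt hj).2 hA
            obtain ⟨x, hx⟩ : ∃ x, x = D.opp (t.arr 27 (D.HO (t.reg 33)) - 1) (D.HO (t.reg 33)) :=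
              ⟨_, rfl⟩
            rw [← hx] at e1 hm
            have hm' := hR.mate_symm hD hK hm
            have hxw := hm.ne hD
            have hx1 : t.arr 34 x = 1 := by
              have h1' : t.arr 34 x ≤ 2 := h1.le_two x (hm.lt hD).2
              have h2' : t.arr 34 x = 0 → t.arr 34 (D.HO (t.reg 33)) = 2 := h1.mate x _ hm'
              have h3' : t.arr 34 x = 2 → t.arr 34 (D.HO (t.reg 33)) = 0 := h1.mate' x _ hm'
              omega
            have hI' := h1.extend hD hK hR hside hj he c4 hc3 hm
            have hI'' := hI'.advance hD h0 (fun _ => by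
              simp [Search.push, Search.mark, Search.of, hxw])
            have e30 : t'.reg 30 = t.reg 30 := congrArg Search.qh e1
            have e34 : t'.arr 34 =
                Function.update (Function.update (t.arr 34) (D.HO (t.reg 33)) 2) x 0 :=
              congrArg Search.LB e1
            have e35 : t'.reg 35 = t.reg 35 := congrArg Search.found e1
            refine ⟨⟨by rw [e1]; exact hI'', fun v hv => ?_, by omega, by omega, by omega⟩, ?_⟩
            · rw [e34, Function.update_of_ne, Function.update_of_ne (h34 v hv), h2 v hv]
              rintro rfl
              have := h2 _ hv
              omega
            · have := h1.pending_lt (τ := Search.of t') hD h0 (fun u hu => by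
                rw [e1]
                have hu : t.arr 34 u = 0 := hu
                have h6 : u ≠ D.HO (t.reg 33) := by
                  rintro rfl
                  omega
                have h7 : u ≠ x := by
                  rintro rfl
                  omega
                simp only [Search.mark, Search.push, Function.update_of_ne h6,
                  Function.update_of_ne h7]
                exact ⟨hu, trivial⟩) (by rw [e1]; rfl) (by rw [e1]; rfl) (by rw [e1]; rfl)
              rw [e30, e2]
              omega
        · obtain ⟨e1, e2⟩ := scanStep_skip ht h0 hc
          rw [← ht'] at e1 e2
          have hI' := h1.advance hD h0 (fun he => by
            obtain ⟨h6, h7⟩ := (hF _ hj.1).1 he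
            have h8 : t.arr 34 (D.HO (t.reg 33)) ≠ 1 := fun h8 => hc ⟨h6, h7, h8⟩
            have h9 : t.arr 34 (D.HO (t.reg 33)) ≠ 0 := h1.ne_zero hD hside c4 hj he
            have h10 : t.arr 34 (D.HO (t.reg 33)) ≤ 2 := h1.le_two _ (hD.join_lt hj).2
            show t.arr 34 (D.HO (t.reg 33)) = 2
            omega)
          have e30 : t'.reg 30 = t.reg 30 := congrArg Search.qh e1
          have e34 : t'.arr 34 = t.arr 34 := congrArg Search.LB e1
          have e35 : t'.reg 35 = t.reg 35 := congrArg Search.found e1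
          refine ⟨⟨by rw [e1]; exact hI', by rwa [e34], by omega, by omega, by omega⟩, ?_⟩
          have := h1.pending_lt (τ := Search.of t') hD h0 (fun u hu => by
                rw [e1]
                exact ⟨hu, rfl⟩) (by rw [e1]) (by rw [e1]) (by rw [e1]; rfl)
          rw [e30, e2]
          omega)
    ⟨by simpa [Search.of, Prog.ev] using hI, by simp [Prog.ev], by simp [Prog.ev],
      by simp [Prog.ev], by simp [Prog.ev, hf]⟩
  have ht := hs₁.frame hfr rfl rfl
  have h34 : s'.reg 34 = 0 := by
    have h1 : ¬ s'.reg 10 < s'.reg 34 := hq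
    rw [ht.zero] at h1
    omega
  refine ⟨s', (hr₁.seq hr).mono ?_, h1, h2, h4 h34⟩
  have h6 := Search.pending_le D (Search.of ((Prog.const 34 1).ev s))
  have h7 : ((Prog.const 34 1).ev s).reg 34 = 1 := by simp [Prog.ev]
  have h8 := hD.NH_eq
  simp only [Prog.cost, Prog.scanStep, Prog.other, Data.size, h7]
  omega

end

/-! ### Augmenting the matching -/

theorem isMatching_insert {M : Finset Edge} {e : Edge} (hM : IsMatching M)
    (h : ∀ v, Inc v e → ¬ Covers M v) : IsMatching (insert e M) := by
  rw [isMatching_iff]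
  intro v f hf g hg hvf hvg
  rcases Finset.mem_insert.1 hf with rfl | hf' <;>
    rcases Finset.mem_insert.1 hg with rfl | hg'
  · rfl
  · exact absurd ⟨g, hg', hvg⟩ (h v hvf)
  · exact absurd ⟨f, hf', hvf⟩ (h v hvg)
  · exact hM.eq hf' hg' hvf hvg

namespace Data

variable {D : Data} {F K : Finset Edge}

theorem Valid.eq_vx_of_join (hD : D.Valid) {k v w : ℕ} (h : D.Join k v w) {u : Vertex}
    (hu : Inc u (D.ed k)) : u = D.vx v ∨ u = D.vx w := by
  obtain ⟨hk, ⟨rfl, rfl⟩ | ⟨rfl, rfl⟩⟩ := h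
  · rw [hD.vx_U k hk, hD.vx_W k hk]
    exact hu
  · rw [hD.vx_U k hk, hD.vx_W k hk]
    exact hu.symm

/-- The array `B` represents the matching `K` at the vertex number `v`. -/
def RepAt (D : Data) (B : ℕ → ℕ) (K : Finset Edge) (v : ℕ) : Prop :=
  B v = 0 ∧ ¬ Covers K (D.vx v) ∨ ∃ k < D.m, B v = k + 1 ∧ D.ed k ∈ K ∧ Inc (D.vx v) (D.ed k)

end Data

/-- An intermediate state when the path to an odd unmatched vertex is flipped backwards: a matching
`L` of the same size as the initial one `K`, which leaves the odd vertex `y` unmatched instead, and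
which agrees with `K` on the part of the forest that has not been reached. The array `A` represents
`K`, and `B` represents `L` except at `y`. -/
structure FlipInv (D : Data) (F K : Finset Edge) (A : ℕ → ℕ) (σ : Search) (B : ℕ → ℕ) (y : ℕ)
    (L : Finset Edge) : Prop where
  sub : L ⊆ F
  matching : IsMatching L
  card : L.card = K.card
  lt : y < D.N
  odd : σ.LB y = 2
  uncovered : ¬ Covers L (D.vx y)
  covers : ∀ v, Covers K v → Covers L v ∨ v = D.vx y
  rep : ∀ v < D.N, v ≠ y → D.RepAt B L v
  agree : ∀ v < D.N, σ.LB v = 0 → σ.POS v ≤ σ.POS (σ.PV y) → B v = A v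

section

variable {D : Data} {F K L : Finset Edge} {A B : ℕ → ℕ} {σ : Search} {side : ℕ → Prop} {y : ℕ}

/-- The predecessor of `y` is a root, where the path ends: matching `y` to it augments `K`. -/
theorem FlipInv.last (h : FlipInv D F K A σ B y L) (hI : Search.Inv D F K A side σ)
    (hD : D.Valid) (h0 : B (σ.PV y) = 0) :
    ∃ L', L' ⊆ F ∧ IsMatching L' ∧ L'.card = K.card + 1 ∧ (∀ v, Covers K v → Covers L' v) ∧
      D.Rep (Function.update (Function.update B y (σ.PAR y)) (σ.PV y) (σ.PAR y)) L' := by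
  obtain ⟨h1, ⟨k, h2, h3, h4⟩, h5⟩ := hI.tree y h.lt h.odd
  have hlt := hD.join_lt h4
  have hinc := hD.join_inc h4
  have hx : ¬ Covers L (D.vx (σ.PV y)) := by
    rcases h.rep _ hlt.1 (hD.join_ne h4) with h6 | ⟨l, -, h6, -⟩
    · exact h6.2
    · omega
  have hnc : ∀ v, Inc v (D.ed k) → ¬ Covers L v := by
    intro v hv
    rcases hD.eq_vx_of_join h4 hv with rfl | rfl
    · exact hx
    · exact h.uncovered
  refine ⟨insert (D.ed k) L, Finset.insert_subset h3 h.sub, isMatching_insert h.matching hnc, ?_,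
    fun v hv => ?_, fun v hv => ?_⟩
  · rw [Finset.card_insert_of_notMem fun hm => hx ⟨_, hm, hinc.1⟩, h.card]
  · rcases h.covers v hv with ⟨e, he, hve⟩ | rfl
    · exact ⟨e, Finset.mem_insert_of_mem he, hve⟩
    · exact ⟨_, Finset.mem_insert_self _ _, hinc.2⟩
  · simp only [Function.update_apply]
    by_cases hvx : v = σ.PV y
    · rw [if_pos hvx, hvx]
      exact Or.inr ⟨k, h4.1, h2, Finset.mem_insert_self _ _, hinc.1⟩
    · by_cases hvy : v = y
      · rw [if_neg hvx, if_pos hvy, hvy]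
        exact Or.inr ⟨k, h4.1, h2, Finset.mem_insert_self _ _, hinc.2⟩
      · rw [if_neg hvx, if_neg hvy]
        rcases h.rep v hv hvy with ⟨h6, h7⟩ | ⟨l, hl, h6, h7, h8⟩
        · refine Or.inl ⟨h6, ?_⟩
          rintro ⟨e, he, hve⟩
          rcases Finset.mem_insert.1 he with rfl | he
          · rcases hD.eq_or_eq_of_join h4 hv hve with h9 | h9
            · exact hvx h9
            · exact hvy h9
          · exact h7 ⟨e, he, hve⟩
        · exact Or.inr ⟨l, hl, h6, Finset.mem_insert_of_mem h7, h8⟩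

/-- The predecessor of `y` is matched: `y` takes its place, and its former partner becomes free. -/
theorem FlipInv.next (h : FlipInv D F K A σ B y L) (hI : Search.Inv D F K A side σ)
    (hD : D.Valid) (hK : IsMatching K) (hR : D.Rep A K) (h0 : B (σ.PV y) ≠ 0) :
    ∃ L', FlipInv D F K A σ
        (Function.update (Function.update B y (σ.PAR y)) (σ.PV y) (σ.PAR y))
        (D.opp (B (σ.PV y) - 1) (σ.PV y)) L' ∧
      σ.POS (σ.PV (D.opp (B (σ.PV y) - 1) (σ.PV y))) < σ.POS (σ.PV y) := by
  obtain ⟨h1, ⟨k, h2, h3, h4⟩, h5⟩ := hI.tree y h.lt h.odd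
  obtain ⟨x, hx⟩ : ∃ x, x = σ.PV y := ⟨_, rfl⟩
  rw [← hx] at h0 h1 h4 ⊢
  have hlt := hD.join_lt h4
  have hinc := hD.join_inc h4
  have hxy := hD.join_ne h4
  have hBA : B x = A x := h.agree x hlt.1 h1 (by rw [hx])
  have hm := hR.exists_mate hD hlt.1 (hBA ▸ h0)
  rw [← hBA] at hm
  obtain ⟨w, hw⟩ : ∃ w, w = D.opp (B x - 1) x := ⟨_, rfl⟩
  rw [← hw] at hm ⊢
  have hm' := hR.mate_symm hD hK hm
  have hw2 := hI.mate x w hm h1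
  have hwN := (hm.lt hD).2
  obtain ⟨h6, -, h7⟩ := hI.tree w hwN hw2
  have h7 := h7 x hm'
  obtain ⟨l, hl, hjl⟩ := hm
  have hil := hD.join_inc hjl
  have hlL : D.ed l ∈ L := by
    rcases h.rep x hlt.1 hxy with h8 | ⟨l', h8, h9, h10, -⟩
    · omega
    · obtain rfl : l' = l := by omega
      exact h10
  have hwx := hD.join_ne hjl
  have hwy : w ≠ y := by
    rintro rfl
    exact h.uncovered ⟨_, hlL, hil.2⟩
  -- only the edge number `l` of the matching meets `x` and `w`
  have hun : ∀ u, u = D.vx x ∨ u = D.vx w → ¬ Covers (L.erase (D.ed l)) u := by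
    rintro u hu ⟨e, he, hue⟩
    rw [Finset.mem_erase] at he
    have : Inc u (D.ed l) := by
      rcases hu with rfl | rfl
      · exact hil.1
      · exact hil.2
    exact he.1 (h.matching.eq he.2 hlL hue this)
  have hnc : ∀ u, Inc u (D.ed k) → ¬ Covers (L.erase (D.ed l)) u := by
    intro u hu
    rcases hD.eq_vx_of_join h4 hu with rfl | rfl
    · exact hun _ (Or.inl rfl)
    · rintro ⟨e, he, hue⟩
      exact h.uncovered ⟨e, Finset.mem_of_mem_erase he, hue⟩
  refine ⟨insert (D.ed k) (L.erase (D.ed l)), ⟨?_, ?_, ?_, hwN, hw2, ?_, fun v hv => ?_,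
    fun v hv hvw => ?_, fun v hv hv0 hvp => ?_⟩, by rw [← hx] at *; exact h7⟩
  · exact Finset.insert_subset h3 ((Finset.erase_subset _ _).trans h.sub)
  · exact isMatching_insert (h.matching.mono (Finset.erase_subset _ _)) hnc
  · rw [Finset.card_insert_of_notMem fun hm => hnc _ hinc.1 ⟨_, hm, hinc.1⟩,
      Finset.card_erase_of_mem hlL, h.card]
    have := Finset.card_pos.2 ⟨_, hlL⟩
    rw [h.card] at this
    omega
  · rintro ⟨e, he, hwe⟩
    rcases Finset.mem_insert.1 he with rfl | he
    · rcases hD.eq_or_eq_of_join h4 hwN hwe with h9 | h9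
      · exact hwx h9.symm
      · exact hwy h9
    · exact hun _ (Or.inr rfl) ⟨e, he, hwe⟩
  · rcases h.covers v hv with ⟨e, he, hve⟩ | rfl
    · by_cases hel : e = D.ed l
      · rw [hel] at hve
        rcases hD.eq_vx_of_join hjl hve with rfl | rfl
        · exact Or.inl ⟨_, Finset.mem_insert_self _ _, hinc.1⟩
        · exact Or.inr rfl
      · exact Or.inl ⟨e, Finset.mem_insert_of_mem (Finset.mem_erase.2 ⟨hel, he⟩), hve⟩
    · exact Or.inl ⟨_, Finset.mem_insert_self _ _, hinc.2⟩
  · unfold Data.RepAt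
    simp only [Function.update_apply]
    by_cases hvx : v = x
    · rw [if_pos hvx, hvx]
      exact Or.inr ⟨k, h4.1, h2, Finset.mem_insert_self _ _, hinc.1⟩
    · by_cases hvy : v = y
      · rw [if_neg hvx, if_pos hvy, hvy]
        exact Or.inr ⟨k, h4.1, h2, Finset.mem_insert_self _ _, hinc.2⟩
      · rw [if_neg hvx, if_neg hvy]
        rcases h.rep v hv hvy with ⟨h8, h9⟩ | ⟨q, hq, h8, h9, h10⟩
        · refine Or.inl ⟨h8, ?_⟩
          rintro ⟨e, he, hve⟩
          rcases Finset.mem_insert.1 he with rfl | he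
          · rcases hD.eq_or_eq_of_join h4 hv hve with h11 | h11
            · exact hvx h11
            · exact hvy h11
          · exact h9 ⟨e, Finset.mem_of_mem_erase he, hve⟩
        · refine Or.inr ⟨q, hq, h8, Finset.mem_insert_of_mem (Finset.mem_erase.2 ⟨fun h11 => ?_, h9⟩),
            h10⟩
          rw [h11] at h10
          rcases hD.eq_or_eq_of_join hjl hv h10 with h12 | h12
          · exact hvx h12
          · exact hvw h12
  · have hvx : v ≠ x := by
      rintro rfl
      omega
    have hvy : v ≠ y := by
      rintro rfl
      have := h.odd
      omega
    rw [Function.update_of_ne hvx, Function.update_of_ne hvy]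
    exact h.agree v hv hv0 (by rw [← hx]; omega)

end

namespace Prog

/-- All vertices become unvisited, and the queue empty. -/
def reset : Prog :=
  each 13 (write 34 19 11) ;; const 30 0 ;; const 31 0 ;; const 33 0 ;; const 35 0

/-- The unvisited unmatched vertices with numbers below register `x` become even. -/
def pushFree (x : ℕ) : Prog :=
  each x (read 20 27 19 ;; ite (.eq 20 10)
    (read 20 34 19 ;; ite (.eq 20 11)
      (write 34 19 10 ;; write 37 19 31 ;; write 38 31 19 ;; succ 31) skip) skip)

/-- One step of the augmentation: the odd vertex in register `20` is matched to its predecessor, and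
the former partner of the latter is put into register `20`. -/
def flipStep : Prog :=
  read 21 35 20 ;; write 27 20 21 ;; read 22 36 20 ;; read 23 27 22 ;; write 27 22 21 ;;
    ite (.eq 23 10) (const 34 0) (other 23 22 20)

/-- The matching is augmented along the path to the vertex that was found. -/
def flip : Prog := (copy 20 35 ;; pred 20 ;; const 34 1) ;; .while (.lt 10 34) flipStep

end Prog

section

variable {D : Data} {F K : Finset Edge} {side : ℕ → Prop}

theorem reset_spec (hD : D.Valid) {s : State} (hs : D.Has s) (F K : Finset Edge) (side : ℕ → Prop) :
    ∃ s', Runs .reset s (100 * D.size) s' ∧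
      Search.Inv D F K (s.arr 27) side (Search.of s') ∧ (∀ v < D.N, s'.arr 34 v = 1) ∧
      s'.reg 35 = 0 := by
  obtain ⟨s₁, hr₁, h₁⟩ := Runs.each (y := 13) (s := s) (c := .write 34 19 11) rfl (by decide)
    (by decide) (by decide) (fun j t => ∀ v < j, t.arr 34 v = 1) (by simp)
    (by
      intro t j hf hj hlt ht1 v hv
      have ht := hs.frame hf rfl rfl
      simp only [Prog.ev, State.setReg_arr, State.setArr_arr, if_true, Function.update_apply, hj,
        ht.one]
      split_ifs with h
      · rfl
      · exact ht1 v (by omega))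
  have hr₂ := Runs.ev (c := .const 30 0 ;; .const 31 0 ;; .const 33 0 ;; .const 35 0) rfl s₁
  obtain ⟨s₂, hs₂⟩ : ∃ s₂, s₂ = (Prog.const 30 0 ;; .const 31 0 ;; .const 33 0 ;; .const 35 0).ev s₁ :=
    ⟨_, rfl⟩
  rw [← hs₂] at hr₂
  rw [hs.N] at h₁ hr₁
  have hL : ∀ v < D.N, s₂.arr 34 v = 1 := by simpa [hs₂, Prog.ev] using h₁
  have e30 : s₂.reg 30 = 0 := by simp [hs₂, Prog.ev]
  have e31 : s₂.reg 31 = 0 := by simp [hs₂, Prog.ev]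
  have e33 : s₂.reg 33 = 0 := by simp [hs₂, Prog.ev]
  have e35 : s₂.reg 35 = 0 := by simp [hs₂, Prog.ev]
  have hL0 : ∀ v < D.N, (Search.of s₂).LB v ≠ 0 := fun v hv => by simp [Search.of, hL v hv]
  have hL2 : ∀ v < D.N, (Search.of s₂).LB v ≠ 2 := fun v hv => by simp [Search.of, hL v hv]
  refine ⟨s₂, (hr₁.seq hr₂).mono ?_, ?_, hL, e35⟩
  · simp only [Prog.cost, Data.size]
    omega
  · exact {
      le_two := fun v hv => by simp [Search.of, hL v hv]
      even := fun v hv h => absurd h (hL0 v hv)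
      odd := fun v hv h => absurd h (hL2 v hv)
      mate := fun v w hm h => absurd h (hL0 v (hm.lt hD).1)
      mate' := fun v w hm h => absurd h (hL2 v (hm.lt hD).1)
      free := fun v hv _ h => absurd h (hL2 v hv)
      found := fun h => absurd e35 h
      tree := fun v hv h => absurd h (hL2 v hv)
      queue := fun p hp => absurd (show p < s₂.reg 31 from hp) (by omega)
      pos := fun v hv h => absurd h (hL0 v hv)
      qh_le := show s₂.reg 30 ≤ s₂.reg 31 by omega
      scanned := fun v hv h => absurd h (hL0 v hv)
      side := fun v hv h => absurd h (hL0 v hv)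
      cur := fun h => absurd e33 h }

theorem pushFree_spec {s : State} (hs : D.Has s) (hR : D.Rep (s.arr 27) K) {x : ℕ}
    (hx : x = 0 ∨ x = 13) (hxN : s.reg x ≤ D.N)
    (hside : ∀ v < s.reg x, s.arr 27 v = 0 → s.arr 34 v = 1 → side v)
    (hI : Search.Inv D F K (s.arr 27) side (Search.of s)) (hf : s.reg 35 = 0) :
    ∃ s', Runs (.pushFree x) s (100 * D.size) s' ∧
      Search.Inv D F K (s.arr 27) side (Search.of s') ∧
      (∀ v, s.arr 34 v ≠ 1 → s'.arr 34 v = s.arr 34 v) ∧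
      (∀ v < s.reg x, s.arr 27 v = 0 → s'.arr 34 v = 0) := by
  obtain ⟨s', hr, h1, h2, h3⟩ := Runs.each (y := x) (s := s)
    (c := .read 20 27 19 ;; .ite (.eq 20 10)
      (.read 20 34 19 ;; .ite (.eq 20 11)
        (.write 34 19 10 ;; .write 37 19 31 ;; .write 38 31 19 ;; .succ 31) .skip) .skip)
    rfl (by decide) (by rcases hx with rfl | rfl <;> decide)
    (by rcases hx with rfl | rfl <;> decide)
    (fun j t => Search.Inv D F K (s.arr 27) side (Search.of t) ∧
      (∀ v, s.arr 34 v ≠ 1 → t.arr 34 v = s.arr 34 v) ∧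
      (∀ v < j, s.arr 27 v = 0 → t.arr 34 v = 0) ∧ ∀ v, j ≤ v → t.arr 34 v = s.arr 34 v)
    ⟨by simpa [Search.of] using hI, by simp, by simp, by simp⟩
    (by
      intro t j hfr hj hlt ⟨ht1, ht2, ht3, ht4⟩
      have ht : D.Has t := by
        rcases hx with rfl | rfl <;> exact hs.frame hfr rfl rfl
      have a27 : t.arr 27 = s.arr 27 := by
        rcases hx with rfl | rfl <;> exact hfr.2 27 (by decide)
      have a35 : t.reg 35 = 0 := by
        rw [← hf]
        rcases hx with rfl | rfl <;> exact hfr.1 35 (by decide)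
      have hjN : j < D.N := by omega
      obtain ⟨t', ht'⟩ : ∃ t', t' = ((Prog.read 20 27 19 ;; .ite (.eq 20 10)
        (.read 20 34 19 ;; .ite (.eq 20 11)
          (.write 34 19 10 ;; .write 37 19 31 ;; .write 38 31 19 ;; .succ 31) .skip) .skip) ;;
        Prog.succ 19).ev t := ⟨_, rfl⟩
      rw [← ht']
      by_cases h1 : s.arr 27 j = 0 ∧ t.arr 34 j = 1
      · have e1 : Search.of t' = (Search.of t).push j := by
          simp [ht', Prog.ev, Search.of, Search.push, a27, hj, h1, ht.zero, ht.one]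
        have e2 : t'.arr 34 = Function.update (t.arr 34) j 0 := congrArg Search.LB e1
        have h4 := ht4 j le_rfl
        refine ⟨?_, fun v hv => ?_, fun v hv hv' => ?_, fun v hv => ?_⟩
        · rw [e1]
          exact ht1.push hR hjN h1.1 h1.2 (hside j hlt h1.1 (by omega))
        · rw [e2, Function.update_of_ne, ht2 v hv]
          rintro rfl
          omega
        · rw [e2, Function.update_apply]
          split_ifs with h5
          · rfl
          · exact ht3 v (by omega) hv'
        · rw [e2, Function.update_of_ne (by omega), ht4 v (by omega)]
      · have e1 : Search.of t' = Search.of t := by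
          by_cases h2 : s.arr 27 j = 0
          · have h3 : t.arr 34 j ≠ 1 := fun h3 => h1 ⟨h2, h3⟩
            simp [ht', Prog.ev, Search.of, a27, hj, h2, h3, ht.zero, ht.one]
          · simp [ht', Prog.ev, Search.of, a27, hj, h2, ht.zero, ht.one]
        have e2 : t'.arr 34 = t.arr 34 := congrArg Search.LB e1
        refine ⟨by rwa [e1], by rwa [e2], fun v hv hv' => ?_, fun v hv => ?_⟩
        · rw [e2]
          rcases Nat.lt_succ_iff_lt_or_eq.1 hv with h | rfl
          · exact ht3 v h hv'
          · have h4 : t.arr 34 v ≤ 2 := ht1.le_two v hjN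
            have h5 : t.arr 34 v = 2 → t.reg 35 = v + 1 := ht1.free v hjN hv'
            have h6 : t.arr 34 v ≠ 1 := fun h6 => h1 ⟨hv', h6⟩
            omega
        · rw [e2, ht4 v (by omega)])
  refine ⟨s', hr.mono ?_, h1, h2, h3.1⟩
  simp only [Prog.cost, Data.size]
  omega

theorem flip_spec (hD : D.Valid) {s : State} (hs : D.Has s) (hKF : K ⊆ F) (hK : IsMatching K)
    (hR : D.Rep (s.arr 27) K) (hI : Search.Inv D F K (s.arr 27) side (Search.of s))
    (hf : s.reg 35 ≠ 0) :
    ∃ s' K', Runs .flip s (100 * D.size) s' ∧ K' ⊆ F ∧ IsMatching K' ∧ K'.card = K.card + 1 ∧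
      (∀ v, Covers K v → Covers K' v) ∧ D.Rep (s'.arr 27) K' := by
  obtain ⟨y, hyN, hy, hA, hy2⟩ := hI.found hf
  have hy : s.reg 35 = y + 1 := hy
  have hr₁ := Runs.ev (c := .copy 20 35 ;; .pred 20 ;; .const 34 1) rfl s
  have hs₁ := hs.frame hr₁.frame rfl rfl
  obtain ⟨s₁, hs₁'⟩ : ∃ s₁, s₁ = (Prog.copy 20 35 ;; .pred 20 ;; .const 34 1).ev s := ⟨_, rfl⟩
  rw [← hs₁'] at hr₁ hs₁
  have b34 : s₁.reg 34 = 1 := by simp [hs₁', Prog.ev]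
  have b20 : s₁.reg 20 = y := by simp [hs₁', Prog.ev, hy]
  have bof : Search.of s₁ = Search.of s := by simp [hs₁', Prog.ev, Search.of]
  have b27 : s₁.arr 27 = s.arr 27 := by simp [hs₁', Prog.ev]
  obtain ⟨s', hr, ⟨h1, h2, h3⟩, hq, hfr⟩ := Runs.loop (q := .lt 10 34) (c := .flipStep)
    (T := Prog.flipStep.cost) (s₀ := s₁)
    (fun t => t.reg 34 ≤ 1 ∧
      (t.reg 34 = 1 → ∃ L, FlipInv D F K (s.arr 27) (Search.of s) (t.arr 27) (t.reg 20) L) ∧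
      (t.reg 34 = 0 → ∃ K', K' ⊆ F ∧ IsMatching K' ∧ K'.card = K.card + 1 ∧
        (∀ v, Covers K v → Covers K' v) ∧ D.Rep (t.arr 27) K'))
    (fun t => if t.reg 34 = 0 then 0 else s.arr 37 (s.arr 36 (t.reg 20)) + 1)
    (by
      intro t hfr ⟨h1, h2, h3⟩ hq
      have ht := hs₁.frame hfr rfl rfl
      have eof : Search.of t = Search.of s := by
        rw [← bof]
        simp only [Search.of, hfr.1 30 (by decide), hfr.1 31 (by decide), hfr.1 32 (by decide),
          hfr.1 33 (by decide), hfr.1 35 (by decide), hfr.2 34 (by decide), hfr.2 35 (by decide),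
          hfr.2 36 (by decide), hfr.2 37 (by decide), hfr.2 38 (by decide)]
      have a35 : t.arr 35 = s.arr 35 := congrArg Search.PAR eof
      have a36 : t.arr 36 = s.arr 36 := congrArg Search.PV eof
      have hrun : t.reg 34 = 1 := by
        have h6 : t.reg 10 < t.reg 34 := hq
        rw [ht.zero] at h6
        omega
      obtain ⟨L, hL⟩ := h2 hrun
      have hxy : s.arr 36 (t.reg 20) ≠ t.reg 20 := by
        obtain ⟨h4, -, -⟩ := hI.tree _ hL.lt hL.odd
        intro h5
        have h4 : s.arr 34 (s.arr 36 (t.reg 20)) = 0 := h4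
        have h6 : s.arr 34 (t.reg 20) = 2 := hL.odd
        rw [h5] at h4
        omega
      refine ⟨_, Runs.ev rfl t, ?_⟩
      obtain ⟨t', ht'⟩ : ∃ t', t' = Prog.flipStep.ev t := ⟨_, rfl⟩
      rw [← ht']
      simp only [Prog.flipStep, Prog.ev, State.setReg_reg, State.setReg_arr, State.setArr_reg,
        State.setArr_arr, Test.holds_eq, ht.zero, Nat.reduceEqDiff, if_true, if_false, a35, a36,
        Function.update_of_ne hxy] at ht'
      by_cases h0 : t.arr 27 (s.arr 36 (t.reg 20)) = 0
      · obtain ⟨K', hK'⟩ := hL.last hI hD h0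
        simp only [h0, if_true] at ht'
        have e34 : t'.reg 34 = 0 := by simp [ht']
        have e27 : t'.arr 27 = Function.update (Function.update (t.arr 27) (t.reg 20)
          (s.arr 35 (t.reg 20))) (s.arr 36 (t.reg 20)) (s.arr 35 (t.reg 20)) := by simp [ht']
        refine ⟨⟨by omega, by omega, fun _ => ⟨K', ?_⟩⟩, ?_⟩
        · rw [e27]
          exact hK'
        · rw [if_pos e34, if_neg (by omega)]
          omega
      · obtain ⟨L', hL', hlt⟩ := hL.next hI hD hK hR h0
        simp only [h0, if_false] at ht'
        rw [ev_other (D := D) (by simp [ht.U]) (by simp [ht.W]) (by decide) (by decide)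
          (by decide)] at ht'
        simp only [State.setReg_reg, State.setReg_arr, State.setArr_reg, State.setArr_arr,
          Nat.reduceEqDiff, if_true, if_false] at ht'
        have e34 : t'.reg 34 = 1 := by simp [ht', hrun]
        have e20 : t'.reg 20 = D.opp (t.arr 27 (s.arr 36 (t.reg 20)) - 1) (s.arr 36 (t.reg 20)) := by
          simp [ht']
        have e27 : t'.arr 27 = Function.update (Function.update (t.arr 27) (t.reg 20)
          (s.arr 35 (t.reg 20))) (s.arr 36 (t.reg 20)) (s.arr 35 (t.reg 20)) := by simp [ht']
        refine ⟨⟨by omega, fun _ => ⟨L', ?_⟩, by omega⟩, ?_⟩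
        · rw [e27, e20]
          exact hL'
        · rw [if_neg (by omega), if_neg (by omega), e20]
          exact Nat.succ_le_succ hlt)
    (by
      refine ⟨by omega, fun _ => ⟨K, ?_⟩, by omega⟩
      rw [b20, b27]
      have hyc : ¬ Covers K (D.vx y) := (hR.eq_zero_iff hyN).1 hA
      exact ⟨hKF, hK, rfl, hyN, hy2, hyc, fun v hv => Or.inl hv, fun v hv _ => hR v hv,
        fun v _ _ _ => rfl⟩)
  have ht := hs₁.frame hfr rfl rfl
  have h34 : s'.reg 34 = 0 := by
    have h1 : ¬ s'.reg 10 < s'.reg 34 := hq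
    rw [ht.zero] at h1
    omega
  obtain ⟨K', h4, h5, h6, h7, h8⟩ := h3 h34
  refine ⟨s', K', (hr₁.seq hr).mono ?_, h4, h5, h6, h7, h8⟩
  obtain ⟨h9, ⟨k, -, -, hj⟩, -⟩ := hI.tree y hyN hy2
  have h10 : s.arr 37 (s.arr 36 y) < s.reg 31 := (hI.pos _ (hD.join_lt hj).1 h9).1
  have h11 : s.reg 31 ≤ D.N := hI.qt_le
  rw [b34, b20, if_neg (by omega)]
  simp only [Prog.cost, Prog.flipStep, Prog.other, Data.size]
  omega

end

namespace Data

variable {D : Data} {K : Finset Edge} {A : ℕ → ℕ}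

/-- The number of edges of the matching that the array `A` represents. -/
def count (D : Data) (A : ℕ → ℕ) : ℕ :=
  ((Finset.range D.m).filter fun k => A (D.U k) = k + 1).card

theorem Rep.count_eq (h : D.Rep A K) (hD : D.Valid) (hK : IsMatching K) (hE : K ⊆ D.H.edges) :
    D.count A = K.card := by
  refine Finset.card_bij (fun k _ => D.ed k) (fun k hk => ?_) (fun k hk l hl h => ?_)
    (fun e he => ?_)
  · simp only [Finset.mem_filter, Finset.mem_range] at hk
    exact (h.mem_of_eq (hD.U_lt_N hk.1) hk.2).2.1
  · simp only [Finset.mem_filter, Finset.mem_range] at hk hl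
    exact hD.ed_inj k hk.1 l hl.1 h
  · obtain ⟨k, hk, rfl⟩ := hD.ed_surj e (hE he)
    refine ⟨k, ?_, rfl⟩
    simp only [Finset.mem_filter, Finset.mem_range]
    exact ⟨hk, h.eq_of_mem hD hK (hD.U_lt_N hk) hk he ((hD.inc_iff hk (hD.U_lt_N hk)).2 (Or.inl rfl))⟩

theorem Valid.exists_vx (hD : D.Valid) {u : Vertex} (hE : K ⊆ D.H.edges) (hu : Covers K u) :
    ∃ v < D.N, D.vx v = u := by
  obtain ⟨e, he, hu⟩ := hu
  obtain ⟨k, hk, rfl⟩ := hD.ed_surj e (hE he)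
  rcases hu with rfl | rfl
  · exact ⟨_, hD.U_lt_N hk, hD.vx_U k hk⟩
  · exact ⟨_, hD.W_lt k hk, hD.vx_W k hk⟩

end Data

/-- The array `LB` holds the weight function `w` on the numbered vertices; it vanishes elsewhere. -/
structure Weights (D : Data) (LB : ℕ → ℕ) (w : Vertex → ℕ) : Prop where
  eq : ∀ v < D.N, w (D.vx v) = LB v
  zero : ∀ u, (∀ v < D.N, D.vx v ≠ u) → w u = 0

namespace Search

variable {D : Data} {F K : Finset Edge} {A : ℕ → ℕ} {side : ℕ → Prop} {σ : Search}

theorem Inv.done (hI : Inv D F K A side σ) (h0 : σ.h = 0) (hq : σ.qh = σ.qt) {v : ℕ}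
    (hv : v < D.N) (h : σ.LB v = 0) : Done D F σ.LB v := fun g hg hg' hgs he =>
  hI.scanned v hv h (hq ▸ (hI.pos v hv h).1) g hg hg' hgs (fun _ => by omega) he

theorem Inv.cert (hI : Inv D F K A side σ) (hD : D.Valid) (hK : IsMatching K) (hR : D.Rep A K)
    (hKF : K ⊆ F) (hF : F ⊆ D.H.edges) (h0 : σ.h = 0) (hq : σ.qh = σ.qt)
    (hfree : ∀ v < D.N, A v = 0 → σ.LB v = 0) : ∃ w, Weights D σ.LB w ∧ Cert F K w := by
  classical
  obtain ⟨w, hw⟩ : ∃ w : Vertex → ℕ, w = fun u => if h : ∃ v < D.N, D.vx v = u then σ.LB h.choose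
    else 0 := ⟨_, rfl⟩
  have hW : Weights D σ.LB w := by
    refine ⟨fun v hv => ?_, fun u hu => ?_⟩
    · have h : ∃ u < D.N, D.vx u = D.vx v := ⟨v, hv, rfl⟩
      rw [hw]
      simp only [dif_pos h]
      rw [hD.vx_inj _ h.choose_spec.1 _ hv h.choose_spec.2]
    · rw [hw]
      exact dif_neg (by push Not; exact hu)
  refine ⟨w, hW, ⟨hKF, hK, fun e he => ?_, fun e he => ?_, fun u hu => ?_⟩, fun u hu => ?_,
    fun u hu => ?_⟩
  · obtain ⟨k, hk, rfl⟩ := hD.ed_surj e (hF he)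
    have hj : D.Join k (D.U k) (D.W k) := ⟨hk, Or.inl ⟨rfl, rfl⟩⟩
    have h1 := hI.le_two _ (hD.U_lt_N hk)
    have h2 := hI.le_two _ (hD.W_lt k hk)
    have h3 := fun h => (hI.done h0 hq (hD.U_lt_N hk) h).join hD hj he
    have h4 := fun h => (hI.done h0 hq (hD.W_lt k hk) h).join hD hj.symm he
    rw [wt, ← hD.vx_U k hk, ← hD.vx_W k hk, hW.eq _ (hD.U_lt_N hk), hW.eq _ (hD.W_lt k hk)]
    omega
  · obtain ⟨k, hk, rfl⟩ := hD.ed_surj e (hF (hKF he))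
    have hm := hR.mate_of_mem hD hK hk he
    have hm' := hR.mate_symm hD hK hm
    have h1 := hI.le_two _ (hD.U_lt_N hk)
    have h2 := hI.le_two _ (hD.W_lt k hk)
    have h3 := hI.mate _ _ hm
    have h4 := hI.mate' _ _ hm
    have h5 := hI.mate _ _ hm'
    have h6 := hI.mate' _ _ hm'
    rw [wt, ← hD.vx_U k hk, ← hD.vx_W k hk, hW.eq _ (hD.U_lt_N hk), hW.eq _ (hD.W_lt k hk)]
    omega
  · by_cases h : ∃ v < D.N, D.vx v = u
    · obtain ⟨v, hv, rfl⟩ := h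
      rw [hW.eq v hv] at hu
      by_contra hc
      exact hu (hfree v hv ((hR.eq_zero_iff hv).2 hc))
    · push Not at h
      exact absurd (hW.zero u h) hu
  · by_cases h : ∃ v < D.N, D.vx v = u
    · obtain ⟨v, hv, rfl⟩ := h
      exact hI.even v hv (by rwa [hW.eq v hv] at hu)
    · exact ⟨0, by simp, .start _ (not_covers_iff.2 fun hc => h (hD.exists_vx (hKF.trans hF) hc))⟩
  · by_cases h : ∃ v < D.N, D.vx v = u
    · obtain ⟨v, hv, rfl⟩ := h
      exact hI.odd v hv (by rwa [hW.eq v hv] at hu)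
    · push Not at h
      have := hW.zero u h
      omega

end Search

namespace Prog

/-- One search from the unmatched applicants, with an augmentation if possible. -/
def round : Prog := reset ;; pushFree 0 ;; scan ;; ite (.lt 10 35) flip skip

/-- The matching is augmented as often as possible; then the search is completed by a search from
the unmatched posts. -/
def labelling : Prog := const 35 1 ;; .while (.lt 10 35) round ;; pushFree 13 ;; scan

end Prog

section

variable {D : Data} {F K : Finset Edge}

theorem round_spec (hD : D.Valid) {s : State} (hs : D.Has s) (hKF : K ⊆ F) (hK : IsMatching K)
    (hR : D.Rep (s.arr 27) K)
    (hF : ∀ k < D.m, D.ed k ∈ F ↔ s.arr 6 k = 0 ∧ D.RK k ≤ s.reg 17) :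
    ∃ s', Runs .round s (600 * D.size) s' ∧
      ((s'.reg 35 ≠ 0 ∧ ∃ K' ⊆ F, IsMatching K' ∧ K'.card = K.card + 1 ∧
          (∀ v, Covers K v → Covers K' v) ∧ D.Rep (s'.arr 27) K') ∨
        s'.reg 35 = 0 ∧ s'.arr 27 = s.arr 27 ∧
          Search.Inv D F K (s'.arr 27) (fun v => v < D.n₁) (Search.of s') ∧ s'.reg 33 = 0 ∧
          s'.reg 30 = s'.reg 31 ∧ ∀ v < D.n₁, s'.arr 27 v = 0 → s'.arr 34 v = 0) := by
  obtain ⟨s₁, hr₁, hI₁, -, hf₁⟩ := reset_spec hD hs F K (fun v => v < D.n₁)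
  have hs₁ := hs.frame hr₁.frame rfl rfl
  have a27₁ : s₁.arr 27 = s.arr 27 := hr₁.frame.2 27 (by decide)
  have a6₁ : s₁.arr 6 = s.arr 6 := hr₁.frame.2 6 (by decide)
  have a17₁ : s₁.reg 17 = s.reg 17 := hr₁.frame.1 17 (by decide)
  rw [← a27₁] at hR hI₁
  obtain ⟨s₂, hr₂, hI₂, -, hz₂⟩ := pushFree_spec hs₁ hR (x := 0) (Or.inl rfl)
    (by rw [hs₁.n₁]; exact hD.n₁_le) (fun v hv _ _ => by rwa [hs₁.n₁] at hv) hI₁ hf₁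
  rw [hs₁.n₁] at hz₂
  have hs₂ := hs₁.frame hr₂.frame rfl rfl
  have a27₂ : s₂.arr 27 = s₁.arr 27 := hr₂.frame.2 27 (by decide)
  have a6₂ : s₂.arr 6 = s₁.arr 6 := hr₂.frame.2 6 (by decide)
  have a17₂ : s₂.reg 17 = s₁.reg 17 := hr₂.frame.1 17 (by decide)
  have f₂ : s₂.reg 35 = 0 := by rw [← hf₁]; exact hr₂.frame.1 35 (by decide)
  rw [← a27₂] at hR hI₂ hz₂
  rw [← a6₁, ← a6₂, ← a17₁, ← a17₂] at hF
  obtain ⟨s₃, hr₃, hI₃, hst₃, hend⟩ := scan_spec hD hs₂ hK hR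
    (fun k v w hj => hD.join_side hj) hF hI₂ f₂
  have hs₃ := hs₂.frame hr₃.frame rfl rfl
  have a27₃ : s₃.arr 27 = s₂.arr 27 := hr₃.frame.2 27 (by decide)
  rw [← a27₃] at hR hI₃ hz₂
  by_cases h35 : s₃.reg 35 = 0
  · have hq : ¬ (Test.lt 10 35).holds s₃ := by simp [h35]
    refine ⟨s₃, (hr₁.seq (hr₂.seq (hr₃.seq (.ite_neg hq (.ev (c := .skip) rfl s₃))))).mono ?_,
      Or.inr ⟨h35, by rw [a27₃, a27₂, a27₁], hI₃, ?_⟩⟩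
    · simp only [Prog.cost, Data.size]
      omega
    · rcases hend with h | h
      · exact absurd h35 h
      · refine ⟨h.1, h.2, fun v hv hA => ?_⟩
        have := hz₂ v hv hA
        rw [hst₃ v (by omega), this]
  · have hq : (Test.lt 10 35).holds s₃ := by simp [hs₃.zero]; omega
    obtain ⟨s₄, K', hr₄, h1, h2, h3, h4, h5⟩ := flip_spec hD hs₃ hKF hK hR hI₃ h35
    refine ⟨s₄, (hr₁.seq (hr₂.seq (hr₃.seq (.ite_pos hq hr₄)))).mono ?_,
      Or.inl ⟨?_, K', h1, h2, h3, h4, h5⟩⟩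
    · simp only [Data.size]
      omega
    · rw [hr₄.frame.1 35 (by decide)]
      exact h35

/-- If at most two augmentations are possible, three searches from the unmatched applicants suffice.
The last of them, together with the search from the unmatched posts, labels all vertices. -/
theorem labelling_spec (hD : D.Valid) {s : State} (hs : D.Has s) (hKF : K ⊆ F)
    (hFE : F ⊆ D.H.edges) (hK : IsMatching K) (hR : D.Rep (s.arr 27) K)
    (hF : ∀ k < D.m, D.ed k ∈ F ↔ s.arr 6 k = 0 ∧ D.RK k ≤ s.reg 17)
    (hb : ∀ L ⊆ F, IsMatching L → (∀ v, Covers K v → Covers L v) → L.card ≤ K.card + 2) :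
    ∃ s' L w, Runs .labelling s (3000 * D.size) s' ∧ L ⊆ F ∧ IsMatching L ∧
      (∀ v, Covers K v → Covers L v) ∧ D.Rep (s'.arr 27) L ∧ Weights D (s'.arr 34) w ∧
      Cert F L w := by
  have hr₁ := Runs.ev (c := .const 35 1) rfl s
  have hs₁ := hs.frame hr₁.frame rfl rfl
  obtain ⟨s₁, hs₁'⟩ : ∃ s₁, s₁ = (Prog.const 35 1).ev s := ⟨_, rfl⟩
  rw [← hs₁'] at hr₁ hs₁
  have b35 : s₁.reg 35 = 1 := by simp [hs₁', Prog.ev]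
  have b27 : s₁.arr 27 = s.arr 27 := by simp [hs₁', Prog.ev]
  have b6 : s₁.arr 6 = s.arr 6 := by simp [hs₁', Prog.ev]
  have b17 : s₁.reg 17 = s.reg 17 := by simp [hs₁', Prog.ev]
  obtain ⟨s₂, hr₂, ⟨L, h1, h2, h3, h4, h5⟩, hq, hfr⟩ := Runs.loop (q := .lt 10 35) (c := .round)
    (T := 600 * D.size) (s₀ := s₁)
    (fun t => ∃ L ⊆ F, IsMatching L ∧ (∀ v, Covers K v → Covers L v) ∧ D.Rep (t.arr 27) L ∧
      (t.reg 35 = 0 → Search.Inv D F L (t.arr 27) (fun v => v < D.n₁) (Search.of t) ∧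
        t.reg 33 = 0 ∧ t.reg 30 = t.reg 31 ∧ ∀ v < D.n₁, t.arr 27 v = 0 → t.arr 34 v = 0))
    (fun t => if t.reg 35 = 0 then 0 else K.card + 3 - D.count (t.arr 27))
    (by
      intro t hfr ⟨L, h1, h2, h3, h4, h5⟩ hq
      have ht := hs₁.frame hfr rfl rfl
      have a6 : t.arr 6 = s.arr 6 := (hfr.2 6 (by decide)).trans b6
      have a17 : t.reg 17 = s.reg 17 := (hfr.1 17 (by decide)).trans b17
      have h35 : t.reg 35 ≠ 0 := by
        have h6 : t.reg 10 < t.reg 35 := hq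
        rw [ht.zero] at h6
        omega
      obtain ⟨t', hr, h⟩ := round_spec hD ht h1 h2 h4 (by rwa [a6, a17])
      refine ⟨t', hr, ?_⟩
      have hc := h4.count_eq hD h2 (h1.trans hFE)
      have hbL := hb L h1 h2 h3
      rcases h with ⟨h6, L', h7, h8, h9, h10, h11⟩ | ⟨h6, h7, h8, h9, h10, h11⟩
      · refine ⟨⟨L', h7, h8, fun v hv => h10 v (h3 v hv), h11, fun h => absurd h h6⟩, ?_⟩
        rw [if_neg h6, if_neg h35, h11.count_eq hD h8 (h7.trans hFE), hc]
        omega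
      · refine ⟨⟨L, h1, h2, h3, by rwa [h7], fun _ => ⟨h8, h9, h10, h11⟩⟩, ?_⟩
        rw [if_pos h6, if_neg h35, hc]
        omega)
    ⟨K, hKF, hK, fun v hv => hv, by rwa [b27], fun h => by omega⟩
  have hs₂ := hs₁.frame hfr rfl rfl
  have h35 : s₂.reg 35 = 0 := by
    have h6 : ¬ s₂.reg 10 < s₂.reg 35 := hq
    rw [hs₂.zero] at h6
    omega
  obtain ⟨hI, h0, hqq, hz⟩ := h5 h35
  have hdone := fun v hv h => hI.done h0 hqq (v := v) hv h
  have hI' : Search.Inv D F L (s₂.arr 27) (fun v => ¬ v < D.n₁) (Search.of s₂) :=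
    { hI with side := fun v hv h => Or.inr (hdone v hv h) }
  obtain ⟨s₃, hr₃, hI₃, -, hz₃⟩ := pushFree_spec hs₂ h4 (x := 13) (Or.inr rfl)
    (by rw [hs₂.N]) (fun v hv hA h1 hlt => by
      have := hz v hlt hA
      omega) hI' h35
  rw [hs₂.N] at hz₃
  have hs₃ := hs₂.frame hr₃.frame rfl rfl
  have a27₃ : s₃.arr 27 = s₂.arr 27 := hr₃.frame.2 27 (by decide)
  have a6₃ : s₃.arr 6 = s.arr 6 :=
    (hr₃.frame.2 6 (by decide)).trans ((hfr.2 6 (by decide)).trans b6)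
  have a17₃ : s₃.reg 17 = s.reg 17 :=
    (hr₃.frame.1 17 (by decide)).trans ((hfr.1 17 (by decide)).trans b17)
  have f₃ : s₃.reg 35 = 0 := by rw [← h35]; exact hr₃.frame.1 35 (by decide)
  rw [← a27₃] at h4 hI₃ hz₃
  obtain ⟨s₄, hr₄, hI₄, hst₄, hend⟩ := scan_spec hD hs₃ h2 h4
    (fun k v w hj => by have := hD.join_side hj; tauto) (by rwa [a6₃, a17₃]) hI₃ f₃
  have a27₄ : s₄.arr 27 = s₃.arr 27 := hr₄.frame.2 27 (by decide)
  rw [← a27₄] at h4 hI₄ hz₃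
  have hz₄ : ∀ v < D.N, s₄.arr 27 v = 0 → s₄.arr 34 v = 0 := fun v hv hA => by
    have := hz₃ v hv hA
    rw [hst₄ v (by omega), this]
  have h35' : s₄.reg 35 = 0 := by
    by_contra h
    obtain ⟨y, hy, -, h6, h7⟩ := hI₄.found h
    have h7 : s₄.arr 34 y = 2 := h7
    have := hz₄ y hy h6
    omega
  obtain ⟨h6, h7⟩ := hend.resolve_left (not_not.2 h35')
  obtain ⟨w, hw, hc⟩ := hI₄.cert hD h2 h4 h1 hFE h6 h7 hz₄
  refine ⟨s₄, L, w, (hr₁.seq (hr₂.seq (hr₃.seq hr₄))).mono ?_, h1, h2, h3, h4, hw, hc⟩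
  have hμ : (if s₁.reg 35 = 0 then 0 else K.card + 3 - D.count (s₁.arr 27)) = 3 := by
    rw [if_neg (by omega), b27, hR.count_eq hD hK (hKF.trans hFE)]
    omega
  rw [hμ]
  simp only [Prog.cost, Data.size]
  omega

end

/-! ### One stage -/

namespace Prog

/-- A vertex that has been even so far gets the label of the current stage, unless it is even. -/
def labelStep : Prog :=
  (read 20 24 19 ;; ite (.eq 20 10)
    (read 20 34 19 ;; ite (.eq 20 10) skip
      (write 24 19 17 ;; ite (.eq 20 12) (write 25 19 10) (write 25 19 11))) skip)

/-- The labels of the current stage are recorded at the vertices that have been even so far. -/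
def labels : Prog := each 13 labelStep

/-- An edge that is still present is deleted by the rules of the stage, see `Dead`. -/
def deletionStep : Prog :=
  (read 20 6 19 ;; ite (.eq 20 10)
    (read 20 22 19 ;; read 20 34 20 ;; read 21 23 19 ;; read 21 34 21 ;; read 22 4 19 ;;
      ite (.lt 17 22)
        (ite (.eq 20 10) (ite (.eq 21 10) skip (write 6 19 17)) (write 6 19 17))
        (ite (.eq 20 12) (ite (.eq 21 10) skip (write 6 19 17))
          (ite (.eq 21 12) (ite (.eq 20 10) skip (write 6 19 17)) skip))) skip)

/-- The edges that are deleted in the current stage are recorded. -/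
def deletion : Prog := each 2 deletionStep

/-- A stage whose number is in register `18`. The matching of the previous stage is replaced by the
initial matching off the component of the start vertex, and augmented. -/
def stage : Prog :=
  copy 17 18 ;; setOld ;; trace ;; mixOld ;; labelling ;; labels ;; deletion

/-- The stages in which edges join the graph. -/
def stages : Prog := const 17 0 ;; findMin ;; .while (.lt 10 18) (stage ;; findMin)

end Prog

variable {D : Data}

theorem labels_spec {s : State} (hs : D.Has s) :
    ∃ s', Runs .labels s (100 * D.size) s' ∧ ∀ v < D.N,
      s'.arr 24 v = (if s.arr 24 v = 0 ∧ s.arr 34 v ≠ 0 then s.reg 17 else s.arr 24 v) ∧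
      s'.arr 25 v = (if s.arr 24 v = 0 ∧ s.arr 34 v ≠ 0 then if s.arr 34 v = 2 then 0 else 1
        else s.arr 25 v) := by
  obtain ⟨s', hr, h1, h2⟩ := Runs.each (y := 13) (s := s)
    (c := .labelStep) rfl (by decide) (by decide) (by decide)
    (fun j t => (∀ v < j,
      t.arr 24 v = (if s.arr 24 v = 0 ∧ s.arr 34 v ≠ 0 then s.reg 17 else s.arr 24 v) ∧
      t.arr 25 v = (if s.arr 24 v = 0 ∧ s.arr 34 v ≠ 0 then if s.arr 34 v = 2 then 0 else 1
        else s.arr 25 v)) ∧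
      ∀ v, j ≤ v → t.arr 24 v = s.arr 24 v ∧ t.arr 25 v = s.arr 25 v)
    (by simp)
    (by
      intro t j hf hj hlt ⟨ht1, ht2⟩
      have ht := hs.frame hf rfl rfl
      have e1 : t.arr 34 = s.arr 34 := hf.2 34 (by decide)
      have e2 : t.reg 17 = s.reg 17 := hf.1 17 (by decide)
      obtain ⟨h24, h25⟩ := ht2 j le_rfl
      have hev : ∀ b, ((Prog.labelStep ;; .succ 19).ev t).arr b =
          if s.arr 24 j = 0 ∧ s.arr 34 j ≠ 0 then
            if b = 25 then Function.update (t.arr 25) j (if s.arr 34 j = 2 then 0 else 1)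
            else if b = 24 then Function.update (t.arr 24) j (s.reg 17) else t.arr b
          else t.arr b := by
        intro b
        by_cases c1 : s.arr 24 j = 0
        · rcases (by omega : s.arr 34 j = 0 ∨ s.arr 34 j = 2 ∨ s.arr 34 j ≠ 0 ∧ s.arr 34 j ≠ 2) with
            c2 | c2 | ⟨c2, c3⟩
          · simp [Prog.labelStep, Prog.ev, e1, ht.zero, hj, h24, c1, c2]
          · simp [Prog.labelStep, Prog.ev, e1, e2, ht.zero, ht.two, hj, h24, c1, c2]
          · simp [Prog.labelStep, Prog.ev, e1, e2, ht.zero, ht.one, ht.two, hj, h24, c1, c2, c3]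
        · simp [Prog.labelStep, Prog.ev, ht.zero, hj, h24, c1]
      rw [hev, hev]
      simp only [Nat.reduceEqDiff, if_true, if_false]
      refine ⟨fun v hv => ?_, fun v hv => ?_⟩
      · by_cases h : v = j
        · rw [h]
          split_ifs <;> simp [h24, h25]
        · have := ht1 v (by omega)
          rw [← this.1, ← this.2]
          split_ifs <;> simp [h]
      · have := ht2 v (by omega)
        have hvj : v ≠ j := by omega
        split_ifs <;> simp [this, hvj])
  rw [hs.N] at hr h1
  refine ⟨s', hr.mono ?_, h1⟩
  simp only [Prog.labelStep, Prog.cost, Data.size]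
  omega

/-- The condition under which an edge is deleted in stage `i`, in terms of the labels `a` and `b` of
its end-points and its rank `ρ`. -/
def Dead (i a b ρ : ℕ) : Prop :=
  if i < ρ then a ≠ 0 ∨ b ≠ 0 else a = 2 ∧ b ≠ 0 ∨ b = 2 ∧ a ≠ 0

instance (i a b ρ : ℕ) : Decidable (Dead i a b ρ) := by
  unfold Dead
  infer_instance

theorem deletion_spec {s : State} (hs : D.Has s) :
    ∃ s', Runs .deletion s (100 * D.size) s' ∧ ∀ k < D.m,
      s'.arr 6 k = if s.arr 6 k = 0 ∧
        Dead (s.reg 17) (s.arr 34 (D.U k)) (s.arr 34 (D.W k)) (D.RK k) then s.reg 17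
        else s.arr 6 k := by
  obtain ⟨s', hr, h1, h2⟩ := Runs.each (y := 2) (s := s)
    (c := .deletionStep) rfl (by decide) (by decide) (by decide)
    (fun j t => (∀ k < j, t.arr 6 k = if s.arr 6 k = 0 ∧
        Dead (s.reg 17) (s.arr 34 (D.U k)) (s.arr 34 (D.W k)) (D.RK k) then s.reg 17
        else s.arr 6 k) ∧ ∀ k, j ≤ k → t.arr 6 k = s.arr 6 k)
    (by simp)
    (by
      intro t j hf hj hlt ⟨ht1, ht2⟩
      have ht := hs.frame hf rfl rfl
      have e1 : t.arr 34 = s.arr 34 := hf.2 34 (by decide)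
      have e2 : t.reg 17 = s.reg 17 := hf.1 17 (by decide)
      have h6 := ht2 j le_rfl
      have hev : ((Prog.deletionStep ;; .succ 19).ev t).arr 6 = if s.arr 6 j = 0 ∧
            Dead (s.reg 17) (s.arr 34 (D.U j)) (s.arr 34 (D.W j)) (D.RK j) then
            Function.update (t.arr 6) j (s.reg 17) else t.arr 6 := by
        by_cases c1 : s.arr 6 j = 0
        · by_cases c2 : s.reg 17 < D.RK j <;>
          rcases (by omega : s.arr 34 (D.U j) = 0 ∨ s.arr 34 (D.U j) = 2 ∨
            s.arr 34 (D.U j) ≠ 0 ∧ s.arr 34 (D.U j) ≠ 2) with a1 | a1 | ⟨a1, a2⟩ <;>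
          rcases (by omega : s.arr 34 (D.W j) = 0 ∨ s.arr 34 (D.W j) = 2 ∨
            s.arr 34 (D.W j) ≠ 0 ∧ s.arr 34 (D.W j) ≠ 2) with b1 | b1 | ⟨b1, b2⟩ <;>
          simp [Prog.deletionStep, Prog.ev, Dead, e1, e2, ht.zero, ht.two, ht.U, ht.W, ht.RK, hj, h6, *]
        · simp [Prog.deletionStep, Prog.ev, ht.zero, hj, h6, c1]
      rw [hev]
      refine ⟨fun k hk => ?_, fun k hk => ?_⟩
      · by_cases h : k = j
        · rw [h]
          split_ifs <;> simp [h6]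
        · have := ht1 k (by omega)
          rw [← this]
          split_ifs <;> simp [h]
      · have := ht2 k (by omega)
        have hvj : k ≠ j := by omega
        split_ifs <;> simp [this, hvj])
  rw [hs.m] at hr h1
  refine ⟨s', hr.mono ?_, h1⟩
  simp only [Prog.deletionStep, Prog.cost, Data.size]
  omega

/-! ### The sequence of stages -/

/-- The situation after stage `i`, where `i` is in register `17`: the matching `K` is optimal up to
rank `i`, its labels are `w`, and everything that happened in the stages up to `i` is recorded. -/
structure MainInv (D : Data) (s : State) (i : ℕ) (K : Finset Edge) (w : Vertex → ℕ) : Prop where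
  has : D.Has s
  stage : s.reg 17 = i
  rep : D.Rep (s.arr 27) K
  old : D.Rep (s.arr 26) (D.H.trunc i D.M₀)
  hist : D.H.Hist i
  opt : D.H.Opt i K
  cert : Cert (D.H.labelGraph i) K w
  del_le : ∀ k < D.m, s.arr 6 k ≤ i
  alive : ∀ k < D.m, ∀ j ≤ i, D.ed k ∈ D.H.alive j ↔ s.arr 6 k = 0 ∨ j < s.arr 6 k
  even : ∀ v < D.N, ∀ j, 1 ≤ j → j ≤ i → (s.arr 24 v = 0 ∨ j < s.arr 24 v) →
    IsEvenVertex (D.H.labelGraph j) (D.vx v)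
  first : ∀ v < D.N, s.arr 24 v ≠ 0 → s.arr 24 v ≤ i ∧
    (s.arr 25 v = 0 ∧ IsOddVertex (D.H.labelGraph (s.arr 24 v)) (D.vx v) ∨
      s.arr 25 v = 1 ∧ IsUnreachableVertex (D.H.labelGraph (s.arr 24 v)) (D.vx v))

namespace MainInv

variable {D : Data} {s : State} {i : ℕ} {K : Finset Edge} {w : Vertex → ℕ}

theorem weight_eq_zero (h : MainInv D s i K w) {v : ℕ} (hv : v < D.N) (h0 : s.arr 24 v = 0) :
    w (D.vx v) = 0 := by
  have hc := h.cert
  rcases Nat.eq_zero_or_pos i with rfl | hi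
  · rw [Instance.labelGraph_zero] at hc
    exact hc.eq_zero_of_empty _
  · exact (hc.isEvenVertex_iff _).1 (h.even v hv i hi le_rfl (Or.inl h0))

theorem mem_rest_iff (h : MainInv D s i K w) (hD : D.Valid) {k : ℕ} (hk : k < D.m) :
    D.ed k ∈ (D.H.phase i).rest ↔ s.arr 6 k = 0 ∧ i < D.RK k := by
  have h1 := h.alive k hk i le_rfl
  have h2 := h.del_le k hk
  rw [Instance.mem_alive] at h1
  rw [hD.RK_eq k hk]
  constructor
  · intro h3
    refine ⟨?_, D.H.lt_rank_of_mem_rest h3⟩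
    have := h1.1 (Or.inr h3)
    omega
  · rintro ⟨h3, h4⟩
    refine (h1.2 (Or.inl h3)).resolve_left fun h5 => ?_
    have := (D.H.labelGraph_subset i _ (D.H.reduced_subset i h5)).2
    omega

theorem skip (h : MainInv D s i K w) (hD : D.Valid) {j : ℕ} (hj : i ≤ j)
    (hr : ∀ k < D.m, s.arr 6 k = 0 → i < D.RK k → j < D.RK k) :
    D.H.Hist j ∧ D.H.Opt j K ∧ Cert (D.H.labelGraph j) K w ∧ D.H.phase j = D.H.phase i := by
  obtain ⟨d, rfl⟩ := Nat.exists_eq_add_of_le hj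
  refine h.hist.skip h.opt h.cert d fun e he => ?_
  obtain ⟨k, hk, rfl⟩ := hD.ed_surj e (D.H.rest_subset i he)
  have := (h.mem_rest_iff hD hk).1 he
  rw [← hD.RK_eq k hk]
  exact hr k hk this.1 this.2

theorem alive_skip (h : MainInv D s i K w) (hD : D.Valid) {j : ℕ} (hj : i ≤ j)
    (hr : ∀ k < D.m, s.arr 6 k = 0 → i < D.RK k → j < D.RK k) {k : ℕ} (hk : k < D.m) :
    D.ed k ∈ D.H.alive j ↔ s.arr 6 k = 0 := by
  have h1 := h.alive k hk i le_rfl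
  have h2 := h.del_le k hk
  rw [Instance.mem_alive] at h1 ⊢
  rw [(h.skip hD hj hr).2.2.2, h1]
  omega

theorem even_skip (h : MainInv D s i K w) (hD : D.Valid) {j : ℕ} (hj : i ≤ j)
    (hr : ∀ k < D.m, s.arr 6 k = 0 → i < D.RK k → j < D.RK k) {v : ℕ} (hv : v < D.N)
    (h0 : s.arr 24 v = 0) : IsEvenVertex (D.H.labelGraph j) (D.vx v) :=
  ((h.skip hD hj hr).2.2.1.isEvenVertex_iff _).2 (h.weight_eq_zero hv h0)

end MainInv

/-- The least closed set of vertices that contains `z`, and its intersections with the matchings. -/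
theorem card_inside_of_least {K M : Finset Edge} (hK : IsMatching K) (hM : IsMatching M)
    {z : Vertex} {S : Set Vertex} (hz : z ∈ S) (hS : Closed (K ∪ M) S)
    (hmin : ∀ Y, Closed (K ∪ M) Y → z ∈ Y → S ⊆ Y) :
    (inside S M).card ≤ (inside S K).card + 1 := by
  obtain ⟨S', hz', hS', hmin', h, -⟩ := exists_component hK hM z
  obtain rfl : S = S' := (hmin S' hS' hz').antisymm (hmin' S hS hz)
  exact h

/-- The edges that survive a stage, in terms of the labels. -/
theorem Instance.mem_alive_succ_iff {G : Instance} {p : ℕ} {L : Finset Edge} {w : Vertex → ℕ}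
    (hc : Cert (G.labelGraph (p + 1)) L w) (e : Edge) :
    e ∈ G.alive (p + 1) ↔ e ∈ G.alive p ∧
      ¬ Dead (p + 1) (w (Sum.inl e.1)) (w (Sum.inr e.2)) (G.rank e) := by
  rw [mem_alive]
  by_cases hr : p + 1 < G.rank e
  · have h1 : e ∉ (G.phase (p + 1)).reduced := fun h => by
      have := (G.labelGraph_subset _ _ (G.reduced_subset _ h)).2
      omega
    have h2 : e ∉ (G.phase p).reduced := fun h => by
      have := (G.labelGraph_subset _ _ (G.reduced_subset _ h)).2
      omega
    rw [mem_alive, Instance.mem_rest_iff hc, Dead, if_pos hr]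
    tauto
  · have h1 : e ∉ (G.phase (p + 1)).rest := fun h => hr (G.lt_rank_of_mem_rest h)
    have h2 : e ∈ G.labelGraph (p + 1) ↔ e ∈ G.alive p := by
      rw [mem_labelGraph_succ_iff, and_iff_left (by omega)]
    rw [or_iff_left h1, ← h2, Dead, if_neg hr]
    constructor
    · intro h3
      have h4 := G.reduced_subset _ h3
      have h5 := (mem_reduced_of_tight hc h4).1 h3
      unfold wt at h5
      exact ⟨h4, by omega⟩
    · rintro ⟨h4, h5⟩
      have h6 := hc.dual.feasible e h4
      have h7 := hc.dual.le_two (Sum.inl e.1)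
      have h8 := hc.dual.le_two (Sum.inr e.2)
      refine (mem_reduced_of_tight hc h4).2 ?_
      unfold wt at h6 ⊢
      omega

/-- A stage in which an edge joins the graph takes linear time, as two augmentations suffice, and it
enlarges the matching. -/
theorem stage_spec {D : Data} (hD : D.Valid) {s : State} {i : ℕ} {K : Finset Edge}
    {w : Vertex → ℕ} (h : MainInv D s i K w) (hi : i < s.reg 18)
    (hr : ∀ k < D.m, s.arr 6 k = 0 → i < D.RK k → s.reg 18 ≤ D.RK k)
    (hr' : ∃ k < D.m, s.arr 6 k = 0 ∧ D.RK k = s.reg 18) :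
    ∃ s' L w', Runs .stage s (4000 * D.size) s' ∧ MainInv D s' (s.reg 18) L w' ∧
      K.card < L.card := by
  obtain ⟨p, hp⟩ : ∃ p, s.reg 18 = p + 1 := ⟨s.reg 18 - 1, by omega⟩
  rw [hp] at hi hr hr' ⊢
  have hskip : ∀ j ≤ p, ∀ k < D.m, s.arr 6 k = 0 → i < D.RK k → j < D.RK k :=
    fun j hj k hk h1 h2 => by
      have := hr k hk h1 h2
      omega
  obtain ⟨hhist, hopt, hcert, hphase⟩ := h.skip hD (j := p) (by omega) (hskip p le_rfl)
  have halive := fun k hk => h.alive_skip hD (j := p) (by omega) (hskip p le_rfl) (k := k) hk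
  have hM := hD.good.matching
  have hM' : IsMatching (D.H.trunc (p + 1) D.M₀) := hM.mono (D.H.trunc_subset _ _)
  -- the initial matching up to rank `p + 1`
  have hr₀ := Runs.ev (c := .copy 17 18) rfl s
  have hs₀ := h.has.frame hr₀.frame rfl rfl
  obtain ⟨s₀, hs₀'⟩ : ∃ s₀, s₀ = (Prog.copy 17 18).ev s := ⟨_, rfl⟩
  rw [← hs₀'] at hr₀ hs₀
  have a17₀ : s₀.reg 17 = p + 1 := by simp [hs₀', Prog.ev, hp]
  obtain ⟨s₁, hr₁, hR₁⟩ := setOld_spec hD hs₀ (i := i) (by omega)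
    (by rw [hr₀.frame.2 26 (by decide)]; exact h.old)
  have hs₁ := hs₀.frame hr₁.frame rfl rfl
  rw [a17₀] at hR₁
  -- the exchange on the complement of the component of `z`
  have hrep₁ : D.Rep (s₁.arr 27) K := by
    rw [hr₁.frame.2 27 (by decide), hr₀.frame.2 27 (by decide)]
    exact h.rep
  obtain ⟨s₂, S, hr₂, hzS, hSc, hSmin, hS⟩ := trace_spec hD hs₁ h.opt.matching hM' hrep₁ hR₁
    (fun ⟨e, he, hv⟩ => hD.good.uncovered ⟨e, D.H.trunc_subset _ _ he, hv⟩) h.opt.sub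
    ((D.H.trunc_subset _ _).trans hD.good.sub)
  have hs₂ := hs₁.frame hr₂.frame rfl rfl
  obtain ⟨s₃, hr₃, hR₃⟩ := mixOld_spec hs₂ (K := K) (M := D.H.trunc (p + 1) D.M₀)
    (by rwa [hr₂.frame.2 27 (by decide)]) (by rwa [hr₂.frame.2 26 (by decide)]) hS hSc
  have hs₃ := hs₂.frame hr₃.frame rfl rfl
  obtain ⟨hKE, hKm, hKo⟩ := hD.good.mix_opt (Nat.le_succ p) hopt hSc hzS
  obtain ⟨K₁, hK₁⟩ : ∃ K₁, K₁ = mix S K (D.H.trunc (p + 1) D.M₀) := ⟨_, rfl⟩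
  rw [← hK₁] at hR₃ hKE hKm hKo
  have hKrank : ∀ e ∈ K₁, D.H.rank e ≤ p + 1 := by
    intro e he
    rw [hK₁] at he
    rcases mem_mix.1 he with he | he
    · exact (hopt.rank_le e he.1).trans (Nat.le_succ p)
    · exact ((Instance.mem_trunc _).1 he.1).2
  have hKF : K₁ ⊆ D.H.labelGraph (p + 1) := by
    have := hhist.trunc_succ_subset hKE hKm hKo
    rwa [D.H.trunc_eq_self hKrank] at this
  have hKcard : (D.H.trunc (p + 1) D.M₀).card ≤ K₁.card + 1 := by
    have h1 := card_inside_of_least h.opt.matching hM' hzS hSc hSmin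
    have h2 := hSc.mono (Finset.subset_union_right (s₁ := K))
    rw [hK₁, card_mix h2, card_inside_add h2]
    omega
  -- augmentation
  have hopt' : ∀ L ⊆ D.H.labelGraph (p + 1), IsMatching L → (∀ v, Covers K₁ v → Covers L v) →
      D.H.Opt p (D.H.trunc p L) := fun L hL hL' hc => hhist.opt_of_covers hKo hL hL'
    fun v ⟨e, he, hv⟩ => hc v ⟨e, D.H.trunc_subset _ _ he, hv⟩
  have a6₃ : s₃.arr 6 = s.arr 6 := by
    rw [hr₃.frame.2 6 (by decide), hr₂.frame.2 6 (by decide), hr₁.frame.2 6 (by decide),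
      hr₀.frame.2 6 (by decide)]
  have a17₃ : s₃.reg 17 = p + 1 := by
    rw [hr₃.frame.1 17 (by decide), hr₂.frame.1 17 (by decide), hr₁.frame.1 17 (by decide), a17₀]
  obtain ⟨s₄, L, w', hr₄, hLF, hLm, hLc, hR₄, hW, hcL⟩ := labelling_spec hD hs₃ hKF
    (fun e he => (D.H.labelGraph_subset _ e he).1) hKm hR₃
    (fun k hk => by
      rw [Instance.mem_labelGraph_succ_iff, halive k hk, a6₃, a17₃, hD.RK_eq k hk])
    (fun L hL hL' hc => by
      have := hD.good.card_le (i := p) (fun e he => (D.H.labelGraph_subset _ e (hL he)).1) hL'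
        (fun e he => (D.H.labelGraph_subset _ e (hL he)).2) (hopt' L hL hL' hc)
      omega)
  have hs₄ := hs₃.frame hr₄.frame rfl rfl
  obtain ⟨hH, hO⟩ := hhist.succ (hopt' L hLF hLm hLc) hcL
  -- records
  obtain ⟨s₅, hr₅, h5⟩ := labels_spec hs₄
  have hs₅ := hs₄.frame hr₅.frame rfl rfl
  obtain ⟨s₆, hr₆, h6⟩ := deletion_spec hs₅
  have hs₆ := hs₅.frame hr₆.frame rfl rfl
  have a17₄ : s₄.reg 17 = p + 1 := by rw [hr₄.frame.1 17 (by decide), a17₃]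
  have a17₅ : s₅.reg 17 = p + 1 := by rw [hr₅.frame.1 17 (by decide), a17₄]
  have a6₅ : s₅.arr 6 = s.arr 6 := by
    rw [hr₅.frame.2 6 (by decide), hr₄.frame.2 6 (by decide), a6₃]
  have a34₅ : s₅.arr 34 = s₄.arr 34 := hr₅.frame.2 34 (by decide)
  have b24 : s₄.arr 24 = s.arr 24 := by
    rw [hr₄.frame.2 24 (by decide), hr₃.frame.2 24 (by decide), hr₂.frame.2 24 (by decide),
      hr₁.frame.2 24 (by decide), hr₀.frame.2 24 (by decide)]
  have b25 : s₄.arr 25 = s.arr 25 := by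
    rw [hr₄.frame.2 25 (by decide), hr₃.frame.2 25 (by decide), hr₂.frame.2 25 (by decide),
      hr₁.frame.2 25 (by decide), hr₀.frame.2 25 (by decide)]
  have c24 : s₆.arr 24 = s₅.arr 24 := hr₆.frame.2 24 (by decide)
  have c25 : s₆.arr 25 = s₅.arr 25 := hr₆.frame.2 25 (by decide)
  rw [a17₄, b24, b25] at h5
  rw [a17₅, a6₅, a34₅] at h6
  have hdead : ∀ k < D.m, (Dead (p + 1) (s₄.arr 34 (D.U k)) (s₄.arr 34 (D.W k)) (D.RK k) ↔
      Dead (p + 1) (w' (Sum.inl (D.ed k).1)) (w' (Sum.inr (D.ed k).2)) (D.H.rank (D.ed k))) := by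
    intro k hk
    rw [← hD.vx_U k hk, ← hD.vx_W k hk, hW.eq _ (hD.U_lt_N hk), hW.eq _ (hD.W_lt k hk),
      hD.RK_eq k hk]
  refine ⟨s₆, L, w', (hr₀.seq (hr₁.seq (hr₂.seq (hr₃.seq (hr₄.seq (hr₅.seq hr₆)))))).mono ?_,
    ⟨hs₆, by rw [hr₆.frame.1 17 (by decide), a17₅], ?_, ?_, hH, hO, hcL, fun k hk => ?_,
      fun k hk j hj => ?_, fun v hv j hj hj' h0 => ?_, fun v hv h0 => ?_⟩, ?_⟩
  · simp only [Prog.cost, Data.size]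
    omega
  · rw [hr₆.frame.2 27 (by decide), hr₅.frame.2 27 (by decide)]
    exact hR₄
  · rw [hr₆.frame.2 26 (by decide), hr₅.frame.2 26 (by decide), hr₄.frame.2 26 (by decide),
      hr₃.frame.2 26 (by decide), hr₂.frame.2 26 (by decide)]
    exact hR₁
  · rw [h6 k hk]
    have := h.del_le k hk
    split_ifs <;> omega
  · have h1 := h.del_le k hk
    rw [h6 k hk]
    rcases Nat.lt_or_ge p j with h2 | h2
    · obtain rfl : j = p + 1 := by omega
      rw [Instance.mem_alive_succ_iff hcL, halive k hk, ← hdead k hk]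
      split_ifs with h3
      · have := h3.2
        simp only [this, not_true_eq_false, and_false, lt_self_iff_false, or_false, false_iff]
      · constructor
        · exact fun h4 => Or.inl h4.1
        · intro h4
          have h4 : s.arr 6 k = 0 := by omega
          exact ⟨h4, fun h5 => h3 ⟨h4, h5⟩⟩
    · rcases Nat.lt_or_ge i j with h3 | h3
      · rw [h.alive_skip hD h3.le (hskip j h2) hk]
        split_ifs with h4
        · simp only [h4.1, true_iff]
          omega
        · omega
      · rw [h.alive k hk j h3]
        split_ifs with h4
        · simp only [h4.1, true_or, true_iff]
          omega
        · exact Iff.rfl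
  · rw [c24, (h5 v hv).1] at h0
    have hor : s.arr 24 v = 0 ∨ j < s.arr 24 v := by
      split_ifs at h0 with h1
      · exact Or.inl h1.1
      · exact h0
    rcases Nat.lt_or_ge p j with h2 | h2
    · obtain rfl : j = p + 1 := by omega
      have h3 : s.arr 24 v = 0 := by
        rcases hor with h3 | h3
        · exact h3
        · have := (h.first v hv (by omega)).1
          omega
      rw [hcL.isEvenVertex_iff, hW.eq v hv]
      by_contra h4
      rw [if_pos ⟨h3, h4⟩] at h0
      omega
    · rcases Nat.lt_or_ge i j with h3 | h3
      · have h4 : s.arr 24 v = 0 := by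
          rcases hor with h4 | h4
          · exact h4
          · have := (h.first v hv (by omega)).1
            omega
        exact h.even_skip hD h3.le (hskip j h2) hv h4
      · exact h.even v hv j hj h3 hor
  · rw [c24, (h5 v hv).1] at h0 ⊢
    rw [c25, (h5 v hv).2]
    have h3 := hcL.dual.le_two (D.vx v)
    rw [hW.eq v hv] at h3
    by_cases h1 : s.arr 24 v = 0 ∧ s₄.arr 34 v ≠ 0
    · simp only [if_pos h1]
      refine ⟨le_rfl, ?_⟩
      rw [hcL.isOddVertex_iff, hcL.isUnreachableVertex_iff, hW.eq v hv]
      split_ifs with h2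
      · exact Or.inl ⟨rfl, h2⟩
      · exact Or.inr ⟨rfl, by omega⟩
    · simp only [if_neg h1] at h0 ⊢
      have := h.first v hv h0
      exact ⟨by omega, this.2⟩
  · obtain ⟨k, hk, h1, h2⟩ := hr'
    have h3 := (h.mem_rest_iff hD hk).2 ⟨h1, by omega⟩
    have h4 := Instance.even_of_mem_rest hcert (hphase ▸ h3)
    refine hcert.card_lt hcL (fun e he ht => D.H.mem_labelGraph_succ.2
      (Or.inl ((Instance.mem_reduced_of_tight hcert he).2 ht))) (e := D.ed k) ?_ h4.1 h4.2
    exact D.H.mem_labelGraph_succ.2 (Or.inr ⟨hphase ▸ h3, by rw [← hD.RK_eq k hk, h2]⟩)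

/-- The stages take linear time each. Apart from those up to `r`, there are at most three more than
`M₀` has edges of rank above `r`. -/
theorem stages_spec {D : Data} (hD : D.Valid) {s : State} (hs : D.Has s)
    (hK : ∀ v < D.N, s.arr 27 v = 0) (hM : ∀ v < D.N, s.arr 26 v = 0)
    (h6 : ∀ k < D.m, s.arr 6 k = 0) (h24 : ∀ v < D.N, s.arr 24 v = 0) (r : ℕ) :
    ∃ s' K, Runs .stages s (5000 * D.size * (r + 4 + (D.M₀ \ D.H.trunc r D.M₀).card)) s' ∧
      D.H.IsRankMaximal K ∧ D.Rep (s'.arr 27) K ∧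
      (∀ k < D.m, ∀ j, D.ed k ∈ (D.H.phase j).reduced ∪ (D.H.phase j).rest ↔
        s'.arr 6 k = 0 ∨ j < s'.arr 6 k) ∧
      ∀ v < D.N, StoresLabel D.H (D.vx v) (s'.arr 24 v) (s'.arr 25 v) := by
  have hr₀ := Runs.ev (c := .const 17 0) rfl s
  have hs₀ := hs.frame hr₀.frame rfl rfl
  obtain ⟨s₀, hs₀'⟩ : ∃ s₀, s₀ = (Prog.const 17 0).ev s := ⟨_, rfl⟩
  rw [← hs₀'] at hr₀ hs₀
  have a17₀ : s₀.reg 17 = 0 := by simp [hs₀', Prog.ev]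
  have harr : s₀.arr = s.arr := by simp [hs₀', Prog.ev]
  have htr : D.H.trunc 0 D.M₀ = ∅ := by
    refine Finset.eq_empty_of_forall_notMem fun e he => ?_
    rw [Instance.mem_trunc] at he
    have := D.H.mem_edges.1 (hD.good.sub he.1)
    omega
  have hrep : ∀ A : ℕ → ℕ, (∀ v < D.N, A v = 0) → D.Rep A ∅ := fun A hA v hv =>
    Or.inl ⟨hA v hv, fun ⟨e, he, _⟩ => by simp at he⟩
  have hI₀ : MainInv D s₀ 0 ∅ (fun _ => 0) := by
    refine ⟨hs₀, a17₀, hrep _ (by rwa [harr]), by rw [htr]; exact hrep _ (by rwa [harr]),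
      Instance.Hist.zero, Instance.Opt.zero, by rw [Instance.labelGraph_zero]; exact Cert.empty,
      fun k hk => by rw [harr, h6 k hk], fun k hk j hj => ?_, fun v hv j hj hj' => by omega,
      fun v hv h => absurd (by rw [harr]; exact h24 v hv) h⟩
    obtain rfl : j = 0 := by omega
    rw [harr, h6 k hk, Instance.mem_alive]
    simpa [Instance.phase] using hD.ed_mem k hk
  obtain ⟨s₁, hr₁, h1, h2⟩ := findMin_spec hs₀
  have hs₁ := hs₀.frame hr₁.frame rfl rfl
  -- the invariant depends only on what `findMin` does not change
  have hcongr : ∀ {t t' : State} {i K w}, MainInv D t i K w → Frame .findMin t t' →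
      MainInv D t' i K w := by
    intro t t' i K w hI hf
    have e6 : t'.arr 6 = t.arr 6 := hf.2 6 (by decide)
    have e24 : t'.arr 24 = t.arr 24 := hf.2 24 (by decide)
    have e25 : t'.arr 25 = t.arr 25 := hf.2 25 (by decide)
    exact ⟨hI.has.frame hf rfl rfl, by rw [hf.1 17 (by decide), hI.stage],
      by rw [hf.2 27 (by decide)]; exact hI.rep, by rw [hf.2 26 (by decide)]; exact hI.old,
      hI.hist, hI.opt, hI.cert, by rw [e6]; exact hI.del_le, by rw [e6]; exact hI.alive,
      by rw [e24]; exact hI.even, by rw [e24, e25]; exact hI.first⟩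
  obtain ⟨q, hq⟩ : ∃ q, q = (D.M₀ \ D.H.trunc r D.M₀).card := ⟨_, rfl⟩
  have hq' : ∀ i, r ≤ i → D.M₀.card ≤ (D.H.trunc i D.M₀).card + q := by
    intro i hi
    have h1 := Finset.card_sdiff_add_card_eq_card (D.H.trunc_subset r D.M₀)
    have h2 : (D.H.trunc r D.M₀).card ≤ (D.H.trunc i D.M₀).card := by
      rw [← D.H.trunc_trunc hi]
      exact Finset.card_le_card (D.H.trunc_subset _ _)
    omega
  obtain ⟨s₂, hr₂, ⟨i, K, w, hI, h3, h4⟩, hq₂, -⟩ := Runs.loop (q := .lt 10 18)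
    (c := .stage ;; .findMin) (T := 4100 * D.size) (s₀ := s₁)
    (fun t => ∃ i K w, MainInv D t i K w ∧
      (∀ k < D.m, t.arr 6 k = 0 → i < D.RK k → t.reg 18 ≠ 0 ∧ t.reg 18 ≤ D.RK k) ∧
      (t.reg 18 ≠ 0 → i < t.reg 18 ∧ ∃ k < D.m, t.arr 6 k = 0 ∧ D.RK k = t.reg 18))
    -- up to stage `r`, the number of the stage grows; later, the size of the matching grows, which is
    -- between `|M₀| - q - 1` and `|M₀| + 1`
    (fun t => (r - t.reg 17) + min (3 + q) (D.M₀.card + 2 - D.count (t.arr 27)))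
    (by
      rintro t - ⟨i, K, w, hI, h3, h4⟩ hlt
      have h18 : t.reg 18 ≠ 0 := by
        have h5 : t.reg 10 < t.reg 18 := hlt
        omega
      obtain ⟨h5, h6⟩ := h4 h18
      obtain ⟨t₁, L, w', hr, hJ, hcard⟩ := stage_spec hD hI h5
        (fun k hk h7 h8 => (h3 k hk h7 h8).2) h6
      obtain ⟨t₂, hr', h7, h8⟩ := findMin_spec hJ.has
      have hJ' := hcongr hJ hr'.frame
      have e6 : t₂.arr 6 = t₁.arr 6 := hr'.frame.2 6 (by decide)
      rw [hJ.stage, ← e6] at h7 h8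
      refine ⟨t₂, (hr.seq hr').mono (by omega), ⟨_, L, w', hJ', h7, h8⟩, ?_⟩
      rw [hJ'.stage, hI.stage, hJ'.rep.count_eq hD hJ'.opt.matching hJ'.opt.sub,
        hI.rep.count_eq hD hI.opt.matching hI.opt.sub]
      have k1 := (hD.good.card_opt hI.opt).1
      have k2 := (hD.good.card_opt hJ'.opt).2
      have k3 := Finset.card_le_card (D.H.trunc_subset (t.reg 18) D.M₀)
      rcases Nat.lt_or_ge i r with k4 | k4
      · omega
      · have := hq' i k4
        omega)
    ⟨0, ∅, _, hcongr hI₀ hr₁.frame, by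
      rw [hr₁.frame.2 6 (by decide)]
      rw [a17₀] at h1
      exact h1, by
      rw [hr₁.frame.2 6 (by decide)]
      rw [a17₀] at h2
      exact h2⟩
  have h18 : s₂.reg 18 = 0 := by
    have h5 : ¬ s₂.reg 10 < s₂.reg 18 := hq₂
    rw [hI.has.zero] at h5
    omega
  have hnone : ∀ k < D.m, s₂.arr 6 k = 0 → ¬ i < D.RK k := fun k hk h5 h6 =>
    (h3 k hk h5 h6).1 h18
  have hskip : ∀ j, ∀ k < D.m, s₂.arr 6 k = 0 → i < D.RK k → j < D.RK k := fun j k hk h5 h6 =>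
    absurd h6 (hnone k hk h5)
  refine ⟨s₂, K, (hr₀.seq (hr₁.seq hr₂)).mono ?_, hI.hist.isRankMaximal hI.opt ?_, hI.rep,
    fun k hk j => ?_, fun v hv => ⟨fun j hj h0 => ?_, fun h0 => (hI.first v hv h0).2⟩⟩
  · have k1 : (r - s₁.reg 17) + min (3 + q) (D.M₀.card + 2 - D.count (s₁.arr 27)) ≤ r + 3 + q := by
      omega
    have k2 := Nat.mul_le_mul_left (4100 * D.size + 1) k1
    have k3 : 1 ≤ D.size := by simp [Data.size]
    rw [← hq]
    simp only [Prog.cost]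
    nlinarith
  · refine Finset.eq_empty_of_forall_notMem fun e he => ?_
    obtain ⟨k, hk, rfl⟩ := hD.ed_surj e (D.H.rest_subset i he)
    have := (hI.mem_rest_iff hD hk).1 he
    exact hnone k hk this.1 this.2
  · rcases Nat.lt_or_ge i j with h5 | h5
    · have h6 := hI.alive_skip hD h5.le (hskip j) hk
      have h7 := hI.del_le k hk
      show D.ed k ∈ D.H.alive j ↔ _
      rw [h6]
      omega
    · exact hI.alive k hk j h5
  · rcases Nat.lt_or_ge i j with h5 | h5
    · have h6 : s₂.arr 24 v = 0 := by
        rcases h0 with h0 | h0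
        · exact h0
        · have := (hI.first v hv (by omega)).1
          omega
      exact hI.even_skip hD h5.le (hskip j) hv h6
    · exact hI.even v hv j hj h5 h0

/-! ### Building the internal representation -/

/-- The state `s` holds the lists of vertices and edges of `H`, with a mark on the edges of `M`. -/
structure Loaded (s : State) (H : Instance) (M : Finset Edge) : Prop where
  applicants : Set.BijOn (s.arr 0) (Set.Iio (s.reg 0)) (H.applicants : Set ℕ)
  posts : Set.BijOn (s.arr 1) (Set.Iio (s.reg 1)) (H.posts : Set ℕ)
  edges : Set.BijOn (fun k => (s.arr 2 k, s.arr 3 k)) (Set.Iio (s.reg 2)) (H.edges : Set Edge)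
  rank : ∀ k < s.reg 2, s.arr 4 k = H.rank (s.arr 2 k, s.arr 3 k)
  matched : ∀ k < s.reg 2, (s.arr 2 k, s.arr 3 k) ∈ M → s.arr 5 k = 1
  unmatched : ∀ k < s.reg 2, (s.arr 2 k, s.arr 3 k) ∉ M → s.arr 5 k = 0

/-- The vertex `z` is encoded by the registers `15` and `16`: an applicant or a post of `H` with its
name, or a vertex outside `H`. -/
def Encodes (s : State) (H : Instance) (z : Vertex) : Prop :=
  (s.reg 15 = 0 ∧ s.reg 16 ∈ H.applicants ∧ z = Sum.inl (s.reg 16)) ∨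
  (s.reg 15 = 1 ∧ s.reg 16 ∈ H.posts ∧ z = Sum.inr (s.reg 16)) ∨
  (s.reg 15 = 2 ∧ (∀ a ∈ H.applicants, z ≠ Sum.inl a) ∧ ∀ p ∈ H.posts, z ≠ Sum.inr p)

namespace Prog

/-- The number of the next applicant is stored with its name. -/
def indexApplicant : Prog := read 20 0 19 ;; write 20 20 19

/-- The number of the next post, from register `13`, is stored with its name. -/
def indexPost : Prog := read 20 1 19 ;; write 21 20 13 ;; succ 13

/-- The vertices are numbered; the arrays `20` and `21` receive the numbers of the applicants and
posts. -/
def number : Prog :=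
  (const 10 0 ;; const 11 1 ;; const 12 2 ;; copy 13 0) ;; each 0 indexApplicant ;;
    each 1 indexPost ;;
    (copy 14 13 ;; succ 13 ;; ite (.eq 15 10) (read 14 20 16) (ite (.eq 15 11) (read 14 21 16) skip))

/-- The vertex arrays are cleared. -/
def clear : Prog :=
  each 13 (write 24 19 10 ;; write 26 19 10 ;; write 27 19 10 ;; write 28 19 10)

/-- A half-edge from register `a` to register `b` along the edge in register `19` is appended. -/
def half (a b : ℕ) : Prog :=
  succ 36 ;; write 30 36 b ;; write 31 36 19 ;; read 22 28 a ;; write 29 36 22 ;; write 28 a 36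

/-- The numbers of the end-points of the next edge and its two half-edges are stored. -/
def loadEdge : Prog :=
  write 6 19 10 ;; read 20 2 19 ;; read 20 20 20 ;; write 22 19 20 ;; read 21 3 19 ;;
    read 21 21 21 ;; write 23 19 21 ;; half 20 21 ;; half 21 20

/-- The internal representation of the instance is built. -/
def setup : Prog := number ;; clear ;; const 36 0 ;; each 2 loadEdge

end Prog

theorem number_spec {s : State} {H : Instance} {M : Finset Edge} (h : Loaded s H M) {z : Vertex}
    (hz : Encodes s H z) :
    ∃ s', Runs .number s (100 * (s.reg 0 + s.reg 1 + s.reg 2 + 2)) s' ∧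
      s'.reg 10 = 0 ∧ s'.reg 11 = 1 ∧ s'.reg 12 = 2 ∧ s'.reg 13 = s.reg 0 + s.reg 1 + 1 ∧
      (∀ j < s.reg 0, s'.arr 20 (s.arr 0 j) = j) ∧
      (∀ j < s.reg 1, s'.arr 21 (s.arr 1 j) = s.reg 0 + j) ∧
      ((∃ j < s.reg 0, s'.reg 14 = j ∧ z = Sum.inl (s.arr 0 j)) ∨
        (∃ j < s.reg 1, s'.reg 14 = s.reg 0 + j ∧ z = Sum.inr (s.arr 1 j)) ∨
        s'.reg 14 = s.reg 0 + s.reg 1 ∧ (∀ a ∈ H.applicants, z ≠ Sum.inl a) ∧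
          ∀ p ∈ H.posts, z ≠ Sum.inr p) := by
  have hr₁ := Runs.ev (c := .const 10 0 ;; .const 11 1 ;; .const 12 2 ;; .copy 13 0) rfl s
  obtain ⟨s₁, hs₁⟩ : ∃ s₁, s₁ = (Prog.const 10 0 ;; .const 11 1 ;; .const 12 2 ;; .copy 13 0).ev s :=
    ⟨_, rfl⟩
  rw [← hs₁] at hr₁
  obtain ⟨s₂, hr₂, h₂⟩ := Runs.each (y := 0) (s := s₁) (c := .indexApplicant) rfl (by decide)
    (by decide) (by decide) (fun j t => ∀ i < j, t.arr 20 (s.arr 0 i) = i) (by simp)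
    (by
      intro t j hf hj hlt ht i hi
      have e0 : t.arr 0 = s.arr 0 := by rw [hf.2 0 (by decide), hs₁]; simp [Prog.ev]
      have e1 : s₁.reg 0 = s.reg 0 := by simp [hs₁, Prog.ev]
      simp only [Prog.indexApplicant, Prog.ev, State.setReg_arr, State.setArr_arr, State.setReg_reg,
        e0, hj, if_true, Nat.reduceEqDiff, if_false, Function.update_apply]
      rcases Nat.lt_succ_iff_lt_or_eq.1 hi with h1 | rfl
      · have h2 : s.arr 0 i ≠ s.arr 0 j := fun h3 => by
          have := h.applicants.injOn (show i < s.reg 0 by omega) (show j < s.reg 0 by omega) h3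
          omega
        rw [if_neg h2, ht i h1]
      · rw [if_pos rfl])
  have f₁ := hr₁.frame
  have f₂ := hr₂.frame
  have e20 : s₂.reg 0 = s.reg 0 := by rw [f₂.1 0 (by decide), f₁.1 0 (by decide)]
  obtain ⟨s₃, hr₃, h₃, h₃'⟩ := Runs.each (y := 1) (s := s₂) (c := .indexPost) rfl (by decide)
    (by decide) (by decide) (fun j t => (∀ i < j, t.arr 21 (s.arr 1 i) = s.reg 0 + i) ∧
      t.reg 13 = s.reg 0 + j)
    (by
      refine ⟨by simp, ?_⟩
      simp only [State.setReg_reg, Nat.reduceEqDiff, if_false]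
      rw [f₂.1 13 (by decide)]
      simp [hs₁, Prog.ev])
    (by
      intro t j hf hj hlt ⟨ht, ht'⟩
      have e0 : t.arr 1 = s.arr 1 := by
        rw [hf.2 1 (by decide), f₂.2 1 (by decide), f₁.2 1 (by decide)]
      have e1 : s₂.reg 1 = s.reg 1 := by rw [f₂.1 1 (by decide), f₁.1 1 (by decide)]
      simp only [Prog.indexPost, Prog.ev, State.setReg_arr, State.setArr_arr, State.setReg_reg,
        State.setArr_reg, e0, hj, if_true, Nat.reduceEqDiff, if_false, Function.update_apply, ht']
      refine ⟨fun i hi => ?_, by omega⟩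
      rcases Nat.lt_succ_iff_lt_or_eq.1 hi with h1 | rfl
      · have h2 : s.arr 1 i ≠ s.arr 1 j := fun h3 => by
          have := h.posts.injOn (show i < s.reg 1 by omega) (show j < s.reg 1 by omega) h3
          omega
        rw [if_neg h2, ht i h1]
      · rw [if_pos rfl])
  have f₃ := hr₃.frame
  have e21 : s₂.reg 1 = s.reg 1 := by rw [f₂.1 1 (by decide), f₁.1 1 (by decide)]
  have e10 : s₁.reg 0 = s.reg 0 := f₁.1 0 (by decide)
  rw [e21] at h₃ h₃' hr₃
  rw [e10] at h₂ hr₂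
  have g10 : s₃.reg 10 = 0 := by
    rw [f₃.1 10 (by decide), f₂.1 10 (by decide), hs₁]; simp [Prog.ev]
  have g11 : s₃.reg 11 = 1 := by
    rw [f₃.1 11 (by decide), f₂.1 11 (by decide), hs₁]; simp [Prog.ev]
  have g12 : s₃.reg 12 = 2 := by
    rw [f₃.1 12 (by decide), f₂.1 12 (by decide), hs₁]; simp [Prog.ev]
  have g15 : s₃.reg 15 = s.reg 15 := by
    rw [f₃.1 15 (by decide), f₂.1 15 (by decide), f₁.1 15 (by decide)]
  have g16 : s₃.reg 16 = s.reg 16 := by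
    rw [f₃.1 16 (by decide), f₂.1 16 (by decide), f₁.1 16 (by decide)]
  have a20 : s₃.arr 20 = s₂.arr 20 := f₃.2 20 (by decide)
  have hr₄ := Runs.ev (c := .copy 14 13 ;; .succ 13 ;;
    .ite (.eq 15 10) (.read 14 20 16) (.ite (.eq 15 11) (.read 14 21 16) .skip)) rfl s₃
  refine ⟨_, (hr₁.seq (hr₂.seq (hr₃.seq hr₄))).mono ?_, ?_⟩
  · simp only [Prog.cost, Prog.indexApplicant, Prog.indexPost]
    omega
  · obtain ⟨s₄, hs₄⟩ : ∃ s₄, s₄ = (Prog.copy 14 13 ;; .succ 13 ;; .ite (.eq 15 10) (.read 14 20 16)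
      (.ite (.eq 15 11) (.read 14 21 16) .skip)).ev s₃ := ⟨_, rfl⟩
    rw [← hs₄] at hr₄ ⊢
    have f₄ := hr₄.frame
    have a4 : s₄.arr = s₃.arr := by
      funext b
      exact f₄.2 b (by simp [Prog.arrs])
    rw [f₄.1 10 (by decide), f₄.1 11 (by decide), f₄.1 12 (by decide), a4, a20]
    refine ⟨g10, g11, g12, ?_, h₂, h₃, ?_⟩
    · rw [hs₄]
      simp only [Prog.ev, Test.holds_eq]
      split_ifs <;> simp [h₃']
    · rcases hz with ⟨h1, h2, h3⟩ | ⟨h1, h2, h3⟩ | ⟨h1, h2⟩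
      · left
        obtain ⟨j, hj, h4⟩ := h.applicants.surjOn h2
        refine ⟨j, hj, ?_, by rw [h3, h4]⟩
        have := h₂ j hj
        rw [h4] at this
        simp [hs₄, Prog.ev, g15, g10, g16, h1, a20, this]
      · right; left
        obtain ⟨j, hj, h4⟩ := h.posts.surjOn h2
        refine ⟨j, hj, ?_, by rw [h3, h4]⟩
        have := h₃ j hj
        rw [h4] at this
        simp [hs₄, Prog.ev, g15, g10, g11, g16, h1, this]
      · right; right
        refine ⟨?_, h2⟩
        simp [hs₄, Prog.ev, g15, g10, g11, g16, h1, h₃']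

/-- The lists of half-edges, with sources `HS`, for the half-edges with numbers at most `NH`. -/
structure Chain (HS : ℕ → ℕ) (N : ℕ) (HEAD HN : ℕ → ℕ) (NH : ℕ) : Prop where
  head_le : ∀ v < N, HEAD v ≤ NH
  head_src : ∀ v < N, HEAD v ≠ 0 → HS (HEAD v) = v
  le_head : ∀ h, 1 ≤ h → h ≤ NH → h ≤ HEAD (HS h)
  next_lt : ∀ h, 1 ≤ h → h ≤ NH → HN h < h
  next_src : ∀ h, 1 ≤ h → h ≤ NH → HN h ≠ 0 → HS (HN h) = HS h
  le_next : ∀ h h', 1 ≤ h' → h' < h → h ≤ NH → HS h' = HS h → h' ≤ HN h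

theorem Chain.push {HS HEAD HN : ℕ → ℕ} {N NH u : ℕ} (hc : Chain HS N HEAD HN NH) (hu : u < N)
    (hs : HS (NH + 1) = u) :
    Chain HS N (Function.update HEAD u (NH + 1)) (Function.update HN (NH + 1) (HEAD u)) (NH + 1) := by
  have hh := hc.head_le u hu
  constructor
  · intro v hv
    have := hc.head_le v hv
    rw [Function.update_apply]
    split_ifs <;> omega
  · intro v hv
    rw [Function.update_apply]
    split_ifs with h
    · rw [h]
      exact fun _ => hs
    · exact hc.head_src v hv
  · intro h h1 h2
    rw [Function.update_apply]
    split_ifs with h3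
    · exact h2
    · have : h ≠ NH + 1 := by
        rintro rfl
        exact h3 hs
      exact hc.le_head h h1 (by omega)
  · intro h h1 h2
    rw [Function.update_apply]
    split_ifs with h3
    · omega
    · exact hc.next_lt h h1 (by omega)
  · intro h h1 h2
    rw [Function.update_apply]
    split_ifs with h3
    · intro h4
      rw [h3, hs]
      exact hc.head_src u hu h4
    · exact hc.next_src h h1 (by omega)
  · intro h h' h1 h2 h3 h4
    rw [Function.update_apply]
    split_ifs with h5
    · rw [h5, hs] at h4
      rw [← h4]
      exact hc.le_head h' h1 (by omega)
    · exact hc.le_next h h' h1 h2 (by omega) h4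

theorem clear_spec {s : State} (h10 : s.reg 10 = 0) :
    ∃ s', Runs .clear s (100 * (s.reg 13 + 1)) s' ∧ ∀ v < s.reg 13,
      s'.arr 24 v = 0 ∧ s'.arr 26 v = 0 ∧ s'.arr 27 v = 0 ∧ s'.arr 28 v = 0 := by
  obtain ⟨s', hr, h⟩ := Runs.each (y := 13) (s := s)
    (c := .write 24 19 10 ;; .write 26 19 10 ;; .write 27 19 10 ;; .write 28 19 10) rfl (by decide)
    (by decide) (by decide) (fun j t => ∀ v < j,
      t.arr 24 v = 0 ∧ t.arr 26 v = 0 ∧ t.arr 27 v = 0 ∧ t.arr 28 v = 0) (by simp)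
    (by
      intro t j hf hj hlt ht v hv
      have e : t.reg 10 = 0 := by rw [hf.1 10 (by decide), h10]
      by_cases h1 : v = j
      · simp [Prog.ev, hj, e, h1]
      · simpa [Prog.ev, hj, e, h1] using ht v (by omega))
  refine ⟨s', hr.mono ?_, h⟩
  simp only [Prog.cost]
  omega

/-- The source of a half-edge: edge number `k` has the half-edges `2 * k + 1` and `2 * k + 2`. -/
def halfSource (U W : ℕ → ℕ) (h : ℕ) : ℕ := if h % 2 = 1 then U ((h - 1) / 2) else W ((h - 1) / 2)

theorem halfSource_odd (U W : ℕ → ℕ) (k : ℕ) : halfSource U W (2 * k + 1) = U k := by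
  have h1 : (2 * k + 1) % 2 = 1 := by omega
  have h2 : (2 * k + 1 - 1) / 2 = k := by omega
  rw [halfSource, if_pos h1, h2]

theorem halfSource_even (U W : ℕ → ℕ) (k : ℕ) : halfSource U W (2 * k + 2) = W k := by
  have h1 : ¬ (2 * k + 2) % 2 = 1 := by omega
  have h2 : (2 * k + 2 - 1) / 2 = k := by omega
  rw [halfSource, if_neg h1, h2]

/-- The contents of the arrays after the first `j` edges have been loaded. -/
structure LoadInv (U W : ℕ → ℕ) (N j : ℕ) (t : State) : Prop where
  num : t.reg 36 = 2 * j
  del : ∀ k < j, t.arr 6 k = 0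
  fst : ∀ k < j, t.arr 22 k = U k
  snd : ∀ k < j, t.arr 23 k = W k
  chain : Chain (halfSource U W) N (t.arr 28) (t.arr 29) (2 * j)
  odd : ∀ k < j, t.arr 30 (2 * k + 1) = W k ∧ t.arr 31 (2 * k + 1) = k
  even : ∀ k < j, t.arr 30 (2 * k + 2) = U k ∧ t.arr 31 (2 * k + 2) = k

theorem loadEdges_spec {s : State} {N : ℕ} (h10 : s.reg 10 = 0) (h28 : ∀ v < N, s.arr 28 v = 0)
    (hU : ∀ k < s.reg 2, s.arr 20 (s.arr 2 k) < N) (hW : ∀ k < s.reg 2, s.arr 21 (s.arr 3 k) < N) :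
    ∃ s', Runs (.const 36 0 ;; .each 2 .loadEdge) s (100 * (s.reg 2 + 1)) s' ∧
      LoadInv (fun k => s.arr 20 (s.arr 2 k)) (fun k => s.arr 21 (s.arr 3 k)) N (s.reg 2) s' := by
  have hr₁ := Runs.ev (c := .const 36 0) rfl s
  have f₁ := hr₁.frame
  obtain ⟨s', hr, h⟩ := Runs.each (y := 2) (s := (Prog.const 36 0).ev s) (c := .loadEdge) rfl
    (by decide) (by decide) (by decide)
    (fun j t => LoadInv (fun k => s.arr 20 (s.arr 2 k)) (fun k => s.arr 21 (s.arr 3 k)) N j t)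
    (by
      refine ⟨by simp [Prog.ev], by simp, by simp, by simp, ?_, by simp, by simp⟩
      constructor
      · intro v hv
        simp [Prog.ev, h28 v hv]
      · intro v hv
        simp [Prog.ev, h28 v hv]
      all_goals
        intros
        omega)
    (by
      intro t j hf hj hlt ht
      have e10 : t.reg 10 = 0 := by rw [hf.1 10 (by decide), f₁.1 10 (by decide), h10]
      have e2 : t.arr 2 = s.arr 2 := by rw [hf.2 2 (by decide), f₁.2 2 (by decide)]
      have e3 : t.arr 3 = s.arr 3 := by rw [hf.2 3 (by decide), f₁.2 3 (by decide)]
      have e20 : t.arr 20 = s.arr 20 := by rw [hf.2 20 (by decide), f₁.2 20 (by decide)]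
      have e21 : t.arr 21 = s.arr 21 := by rw [hf.2 21 (by decide), f₁.2 21 (by decide)]
      have hlt : j < s.reg 2 := by rwa [f₁.1 2 (by decide)] at hlt
      have e36 := ht.num
      obtain ⟨t', ht'⟩ : ∃ t', t' = (Prog.loadEdge ;; .succ 19).ev t := ⟨_, rfl⟩
      obtain ⟨u, hu⟩ : ∃ u, u = s.arr 20 (s.arr 2 j) := ⟨_, rfl⟩
      obtain ⟨w, hw⟩ : ∃ w, w = s.arr 21 (s.arr 3 j) := ⟨_, rfl⟩
      have k36 : t'.reg 36 = 2 * j + 2 := by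
        simp [ht', Prog.loadEdge, Prog.half, Prog.ev, e36]
      have k6 : t'.arr 6 = Function.update (t.arr 6) j 0 := by
        simp [ht', Prog.loadEdge, Prog.half, Prog.ev, e10, hj]
      have k22 : t'.arr 22 = Function.update (t.arr 22) j u := by
        simp [ht', Prog.loadEdge, Prog.half, Prog.ev, e2, e20, hj, hu]
      have k23 : t'.arr 23 = Function.update (t.arr 23) j w := by
        simp [ht', Prog.loadEdge, Prog.half, Prog.ev, e3, e21, hj, hw]
      have k30 : t'.arr 30 = Function.update (Function.update (t.arr 30) (2 * j + 1) w)
          (2 * j + 2) u := by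
        simp [ht', Prog.loadEdge, Prog.half, Prog.ev, e2, e3, e20, e21, e36, hj, hu, hw]
      have k31 : t'.arr 31 = Function.update (Function.update (t.arr 31) (2 * j + 1) j)
          (2 * j + 2) j := by
        simp [ht', Prog.loadEdge, Prog.half, Prog.ev, e36, hj]
      have k28 : t'.arr 28 = Function.update (Function.update (t.arr 28) u (2 * j + 1)) w
          (2 * j + 1 + 1) := by
        simp [ht', Prog.loadEdge, Prog.half, Prog.ev, e2, e3, e20, e21, e36, hj, hu, hw]
      have k29 : t'.arr 29 = Function.update (Function.update (t.arr 29) (2 * j + 1) (t.arr 28 u))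
          (2 * j + 1 + 1) (Function.update (t.arr 28) u (2 * j + 1) w) := by
        simp [ht', Prog.loadEdge, Prog.half, Prog.ev, e2, e3, e20, e21, e36, hj, hu, hw]
      rw [← ht']
      refine ⟨by omega, fun k hk => ?_, fun k hk => ?_, fun k hk => ?_, ?_, fun k hk => ?_,
        fun k hk => ?_⟩
      · rw [k6, Function.update_apply]
        split_ifs
        · rfl
        · exact ht.del k (by omega)
      · rw [k22, Function.update_apply]
        split_ifs with h
        · rw [hu, h]
        · exact ht.fst k (by omega)
      · rw [k23, Function.update_apply]
        split_ifs with h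
        · rw [hw, h]
        · exact ht.snd k (by omega)
      · rw [k28, k29]
        refine (ht.chain.push (u := u) (by rw [hu]; exact hU j hlt) ?_).push
          (u := w) (by rw [hw]; exact hW j hlt) ?_
        · rw [halfSource_odd, hu]
        · rw [halfSource_even, hw]
      · have a1 : (2 * k + 1 = 2 * j + 2) = False := eq_false (by omega)
        have a2 : (2 * k + 1 = 2 * j + 1) = (k = j) := propext (by omega)
        rw [k30, k31]
        simp only [Function.update_apply, a1, a2, if_false]
        split_ifs with h
        · rw [h]
          exact ⟨hw, rfl⟩
        · exact ht.odd k (by omega)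
      · have a1 : (2 * k + 2 = 2 * j + 1) = False := eq_false (by omega)
        have a2 : (2 * k + 2 = 2 * j + 2) = (k = j) := propext (by omega)
        rw [k30, k31]
        simp only [Function.update_apply, a1, a2, if_false]
        split_ifs with h
        · rw [h]
          exact ⟨hu, rfl⟩
        · exact ht.even k (by omega))
  rw [f₁.1 2 (by decide)] at hr h
  refine ⟨s', (hr₁.seq hr).mono ?_, h⟩
  simp only [Prog.cost, Prog.loadEdge, Prog.half]
  omega

/-- The representation that `setup` builds. -/
theorem setup_spec {s : State} {H : Instance} {M : Finset Edge} (h : Loaded s H M) {z : Vertex}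
    (hz : Encodes s H z) (hg : H.Good M z) :
    ∃ (s' : State) (D : Data), Runs .setup s (1000 * (s.reg 0 + s.reg 1 + s.reg 2 + 2)) s' ∧ D.Valid ∧ D.Has s' ∧
      D.H = H ∧ D.M₀ = M ∧ D.n₁ = s.reg 0 ∧ D.m = s.reg 2 ∧ D.N = s.reg 0 + s.reg 1 + 1 ∧
      (∀ j < s.reg 0, D.vx j = Sum.inl (s.arr 0 j)) ∧
      (∀ j < s.reg 1, D.vx (s.reg 0 + j) = Sum.inr (s.arr 1 j)) ∧
      (∀ k < s.reg 2, D.ed k = (s.arr 2 k, s.arr 3 k)) ∧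
      (∀ v < D.N, s'.arr 24 v = 0 ∧ s'.arr 26 v = 0 ∧ s'.arr 27 v = 0) ∧
      ∀ k < D.m, s'.arr 6 k = 0 := by
  obtain ⟨s₁, hr₁, h10, h11, h12, h13, hIA, hIP, hZ⟩ := number_spec h hz
  have f₁ := hr₁.frame
  obtain ⟨s₂, hr₂, hc⟩ := clear_spec h10
  have f₂ := hr₂.frame
  have g10 : s₂.reg 10 = 0 := by rw [f₂.1 10 (by decide), h10]
  have g20 : s₂.arr 20 = s₁.arr 20 := f₂.2 20 (by decide)
  have g21 : s₂.arr 21 = s₁.arr 21 := f₂.2 21 (by decide)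
  have g2 : s₂.arr 2 = s.arr 2 := by rw [f₂.2 2 (by decide), f₁.2 2 (by decide)]
  have g3 : s₂.arr 3 = s.arr 3 := by rw [f₂.2 3 (by decide), f₁.2 3 (by decide)]
  have gm : s₂.reg 2 = s.reg 2 := by rw [f₂.1 2 (by decide), f₁.1 2 (by decide)]
  have hmem : ∀ k < s.reg 2, (s.arr 2 k, s.arr 3 k) ∈ H.edges := fun k hk => h.edges.mapsTo hk
  -- the numbers of the end-points of the edges
  have hU : ∀ k < s.reg 2, ∃ j < s.reg 0, s₁.arr 20 (s.arr 2 k) = j ∧ s.arr 0 j = s.arr 2 k := by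
    intro k hk
    have h1 := (Finset.mem_filter.1 (hmem k hk)).1
    rw [Finset.mem_product] at h1
    obtain ⟨j, hj, h2⟩ := h.applicants.surjOn h1.1
    exact ⟨j, hj, by rw [← hIA j hj, h2], h2⟩
  have hW : ∀ k < s.reg 2, ∃ j < s.reg 1, s₁.arr 21 (s.arr 3 k) = s.reg 0 + j ∧
      s.arr 1 j = s.arr 3 k := by
    intro k hk
    have h1 := (Finset.mem_filter.1 (hmem k hk)).1
    rw [Finset.mem_product] at h1
    obtain ⟨j, hj, h2⟩ := h.posts.surjOn h1.2
    exact ⟨j, hj, by rw [← hIP j hj, h2], h2⟩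
  obtain ⟨s₃, hr₃, hL⟩ := loadEdges_spec (N := s.reg 0 + s.reg 1 + 1) g10
    (fun v hv => (hc v (by omega)).2.2.2)
    (fun k hk => by
      obtain ⟨j, hj, h1, -⟩ := hU k (by omega)
      rw [g20, g2, h1]
      omega)
    (fun k hk => by
      obtain ⟨j, hj, h1, -⟩ := hW k (by omega)
      rw [g21, g3, h1]
      omega)
  have f₃ := hr₃.frame
  rw [g20, g21, g2, g3, gm] at hL
  -- a vertex outside the instance
  obtain ⟨d, hd, hdA, hdP⟩ : ∃ d : Vertex, (s₁.reg 14 = s.reg 0 + s.reg 1 → d = z) ∧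
      (∀ a ∈ H.applicants, d ≠ Sum.inl a) ∧ ∀ p ∈ H.posts, d ≠ Sum.inr p := by
    by_cases h1 : s₁.reg 14 = s.reg 0 + s.reg 1
    · refine ⟨z, fun _ => rfl, ?_⟩
      rcases hZ with ⟨j, hj, h2, -⟩ | ⟨j, hj, h2, -⟩ | ⟨-, h2⟩
      · omega
      · omega
      · exact h2
    · obtain ⟨a, ha⟩ := Infinite.exists_notMem_finset H.applicants
      exact ⟨Sum.inl a, fun h2 => absurd h2 h1, fun b hb h2 => ha (Sum.inl.inj h2 ▸ hb),
        fun p _ h2 => by simp at h2⟩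
  obtain ⟨vx, hvx⟩ : ∃ vx : ℕ → Vertex, vx = fun v =>
      if v < s.reg 0 then Sum.inl (s.arr 0 v)
      else if v < s.reg 0 + s.reg 1 then Sum.inr (s.arr 1 (v - s.reg 0)) else d := ⟨_, rfl⟩
  have vx1 : ∀ j < s.reg 0, vx j = Sum.inl (s.arr 0 j) := fun j hj => by simp [hvx, hj]
  have vx2 : ∀ j < s.reg 1, vx (s.reg 0 + j) = Sum.inr (s.arr 1 j) := fun j hj => by
    simp [hvx, hj]
  have vx3 : vx (s.reg 0 + s.reg 1) = d := by simp [hvx]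
  have hcase : ∀ v < s.reg 0 + s.reg 1 + 1, (∃ j < s.reg 0, v = j) ∨
      (∃ j < s.reg 1, v = s.reg 0 + j) ∨ v = s.reg 0 + s.reg 1 := by
    intro v hv
    by_cases h1 : v < s.reg 0
    · exact Or.inl ⟨v, h1, rfl⟩
    · by_cases h2 : v < s.reg 0 + s.reg 1
      · exact Or.inr (Or.inl ⟨v - s.reg 0, by omega, by omega⟩)
      · exact Or.inr (Or.inr (by omega))
  have hch := hL.chain
  obtain ⟨HS, hHS⟩ : ∃ HS, HS = halfSource (fun k => s₁.arr 20 (s.arr 2 k))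
    (fun k => s₁.arr 21 (s.arr 3 k)) := ⟨_, rfl⟩
  rw [← hHS] at hch
  have hodd : ∀ k, HS (2 * k + 1) = s₁.arr 20 (s.arr 2 k) := fun k => hHS ▸ halfSource_odd _ _ k
  have heven : ∀ k, HS (2 * k + 2) = s₁.arr 21 (s.arr 3 k) := fun k => hHS ▸ halfSource_even _ _ k
  obtain ⟨D, hD⟩ : ∃ D : Data, D = {
      H := H
      M₀ := M
      z := z
      vx := vx
      ed := fun k => (s.arr 2 k, s.arr 3 k)
      n₁ := s.reg 0
      N := s.reg 0 + s.reg 1 + 1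
      m := s.reg 2
      NH := 2 * s.reg 2
      Z := s₁.reg 14
      RK := s.arr 4
      ORG := s.arr 5
      U := s₃.arr 22
      W := s₃.arr 23
      HEAD := s₃.arr 28
      HN := s₃.arr 29
      HO := s₃.arr 30
      HK := s₃.arr 31
      HS := HS } := ⟨_, rfl⟩
  have hhalf : ∀ g, 1 ≤ g → g ≤ 2 * s.reg 2 → ∃ k < s.reg 2, g = 2 * k + 1 ∨ g = 2 * k + 2 := by
    intro g h1 h2
    exact ⟨(g - 1) / 2, by omega, by omega⟩
  refine ⟨s₃, D, (hr₁.seq (hr₂.seq hr₃)).mono ?_, ?_, ?_, ?_⟩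
  · rw [h13, gm]
    omega
  · subst hD
    constructor
    case good => exact hg
    case vx_inj =>
      intro u hu v hv huv
      have huv : vx u = vx v := huv
      rcases hcase u hu with ⟨i, hi, rfl⟩ | ⟨i, hi, rfl⟩ | rfl <;>
        rcases hcase v hv with ⟨j, hj, rfl⟩ | ⟨j, hj, rfl⟩ | rfl
      · rw [vx1 _ hi, vx1 _ hj] at huv
        exact h.applicants.injOn hi hj (Sum.inl.inj huv)
      · rw [vx1 _ hi, vx2 _ hj] at huv
        simp at huv
      · rw [vx1 _ hi, vx3] at huv
        exact absurd huv.symm (hdA _ (h.applicants.mapsTo hi))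
      · rw [vx2 _ hi, vx1 _ hj] at huv
        simp at huv
      · rw [vx2 _ hi, vx2 _ hj] at huv
        rw [h.posts.injOn hi hj (Sum.inr.inj huv)]
      · rw [vx2 _ hi, vx3] at huv
        exact absurd huv.symm (hdP _ (h.posts.mapsTo hi))
      · rw [vx3, vx1 _ hj] at huv
        exact absurd huv (hdA _ (h.applicants.mapsTo hj))
      · rw [vx3, vx2 _ hj] at huv
        exact absurd huv (hdP _ (h.posts.mapsTo hj))
      · rfl
    case ed_mem => exact hmem
    case ed_inj => exact fun k hk l hl hkl => h.edges.injOn hk hl hkl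
    case ed_surj =>
      intro e he
      obtain ⟨k, hk, h1⟩ := h.edges.surjOn he
      exact ⟨k, hk, h1⟩
    case n₁_le => exact show s.reg 0 ≤ s.reg 0 + s.reg 1 + 1 by omega
    case U_lt =>
      intro k hk
      obtain ⟨j, hj, h1, -⟩ := hU k hk
      show s₃.arr 22 k < s.reg 0
      rw [hL.fst k hk, h1]
      exact hj
    case W_ge =>
      intro k hk
      obtain ⟨j, hj, h1, -⟩ := hW k hk
      show s.reg 0 ≤ s₃.arr 23 k
      rw [hL.snd k hk, h1]
      omega
    case W_lt =>
      intro k hk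
      obtain ⟨j, hj, h1, -⟩ := hW k hk
      show s₃.arr 23 k < s.reg 0 + s.reg 1 + 1
      rw [hL.snd k hk, h1]
      omega
    case vx_U =>
      intro k hk
      obtain ⟨j, hj, h1, h2⟩ := hU k hk
      show vx (s₃.arr 22 k) = _
      rw [hL.fst k hk, h1, vx1 j hj, h2]
    case vx_W =>
      intro k hk
      obtain ⟨j, hj, h1, h2⟩ := hW k hk
      show vx (s₃.arr 23 k) = _
      rw [hL.snd k hk, h1, vx2 j hj, h2]
    case Z_lt =>
      show s₁.reg 14 < s.reg 0 + s.reg 1 + 1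
      rcases hZ with ⟨j, hj, h2, -⟩ | ⟨j, hj, h2, -⟩ | ⟨h2, -⟩ <;> omega
    case vx_Z =>
      show vx (s₁.reg 14) = z
      rcases hZ with ⟨j, hj, h2, h3⟩ | ⟨j, hj, h2, h3⟩ | ⟨h2, -⟩
      · rw [h2, vx1 j hj, h3]
      · rw [h2, vx2 j hj, h3]
      · rw [← hd h2, h2, vx3]
    case RK_eq => exact h.rank
    case ORG_one => exact h.matched
    case ORG_zero => exact h.unmatched
    case NH_eq => rfl
    case head_le => exact hch.head_le
    case head_src => exact hch.head_src
    case le_head => exact hch.le_head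
    case next_lt => exact hch.next_lt
    case next_src => exact hch.next_src
    case le_next => exact hch.le_next
    case half_lt =>
      intro g h1 h2
      obtain ⟨k, hk, rfl | rfl⟩ := hhalf g h1 h2
      · exact ((hL.odd k hk).2 ▸ hk :)
      · exact ((hL.even k hk).2 ▸ hk :)
    case half =>
      intro g h1 h2
      obtain ⟨k, hk, rfl | rfl⟩ := hhalf g h1 h2
      · left
        refine ⟨?_, ?_⟩
        · show HS _ = s₃.arr 22 (s₃.arr 31 _)
          rw [hodd, (hL.odd k hk).2, hL.fst k hk]
        · show s₃.arr 30 _ = s₃.arr 23 (s₃.arr 31 _)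
          rw [(hL.odd k hk).1, (hL.odd k hk).2, hL.snd k hk]
      · right
        refine ⟨?_, ?_⟩
        · show HS _ = s₃.arr 23 (s₃.arr 31 _)
          rw [heven, (hL.even k hk).2, hL.snd k hk]
        · show s₃.arr 30 _ = s₃.arr 22 (s₃.arr 31 _)
          rw [(hL.even k hk).1, (hL.even k hk).2, hL.fst k hk]
    case half_U =>
      intro k hk
      have hk : k < s.reg 2 := hk
      refine ⟨2 * k + 1, by omega, show 2 * k + 1 ≤ 2 * s.reg 2 by omega, (hL.odd k hk).2, ?_, ?_⟩
      · show HS _ = s₃.arr 22 k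
        rw [hodd, hL.fst k hk]
      · show s₃.arr 30 _ = s₃.arr 23 k
        rw [(hL.odd k hk).1, hL.snd k hk]
    case half_W =>
      intro k hk
      have hk : k < s.reg 2 := hk
      refine ⟨2 * k + 2, by omega, show 2 * k + 2 ≤ 2 * s.reg 2 by omega, (hL.even k hk).2, ?_, ?_⟩
      · show HS _ = s₃.arr 23 k
        rw [heven, hL.snd k hk]
      · show s₃.arr 30 _ = s₃.arr 22 k
        rw [(hL.even k hk).1, hL.fst k hk]
  · subst hD
    refine ⟨?_, ?_, ?_, ?_, ?_, ?_, ?_, ?_, ?_, rfl, rfl, rfl, rfl, rfl, rfl⟩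
    · rw [f₃.1 10 (by decide), g10]
    · rw [f₃.1 11 (by decide), f₂.1 11 (by decide), h11]
    · rw [f₃.1 12 (by decide), f₂.1 12 (by decide), h12]
    · rw [f₃.1 0 (by decide), f₂.1 0 (by decide), f₁.1 0 (by decide)]
    · rw [f₃.1 2 (by decide), gm]
    · rw [f₃.1 13 (by decide), f₂.1 13 (by decide), h13]
    · rw [f₃.1 14 (by decide), f₂.1 14 (by decide)]
    · rw [f₃.2 4 (by decide), f₂.2 4 (by decide), f₁.2 4 (by decide)]
    · rw [f₃.2 5 (by decide), f₂.2 5 (by decide), f₁.2 5 (by decide)]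
  · subst hD
    refine ⟨rfl, rfl, rfl, rfl, rfl, vx1, vx2, fun _ _ => rfl, fun v hv => ?_, hL.del⟩
    have hv : v < s.reg 0 + s.reg 1 + 1 := hv
    obtain ⟨c1, c2, c3, -⟩ := hc v (by omega)
    rw [f₃.2 24 (by decide), f₃.2 26 (by decide), f₃.2 27 (by decide)]
    exact ⟨c1, c2, c3⟩

/-! ### The update of a loaded instance -/

namespace Prog

/-- An edge is marked if it is in the matching at its applicant. -/
def markEdge : Prog :=
  read 20 22 19 ;; read 20 27 20 ;; copy 21 19 ;; succ 21 ;;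
    ite (.eq 20 21) (write 5 19 11) (write 5 19 10)

/-- The label of the next applicant is stored with its name. -/
def labelApplicant : Prog :=
  read 20 0 19 ;; read 22 24 19 ;; write 7 20 22 ;; read 22 25 19 ;; write 8 20 22

/-- The label of the next post, whose number is in register `23`, is stored with its name. -/
def labelPost : Prog :=
  read 20 1 19 ;; read 22 24 23 ;; write 9 20 22 ;; read 22 25 23 ;; write 10 20 22 ;; succ 23

/-- The matching and the labels of the vertices are written to the output arrays. -/
def finish : Prog :=
  each 2 markEdge ;; each 0 labelApplicant ;; copy 23 0 ;; each 1 labelPost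

/-- From the lists of vertices and edges, a matching and an encoded vertex, all stored information
is computed. -/
def core : Prog := setup ;; stages ;; finish

end Prog

theorem markEdges_spec {s : State} (h10 : s.reg 10 = 0) (h11 : s.reg 11 = 1) :
    ∃ s', Runs (.each 2 .markEdge) s (100 * (s.reg 2 + 1)) s' ∧ ∀ k < s.reg 2,
      s'.arr 5 k = if s.arr 27 (s.arr 22 k) = k + 1 then 1 else 0 := by
  obtain ⟨s', hr, h⟩ := Runs.each (y := 2) (s := s) (c := .markEdge) rfl (by decide)
    (by decide) (by decide) (fun j t => ∀ k < j,
      t.arr 5 k = if s.arr 27 (s.arr 22 k) = k + 1 then 1 else 0) (by simp)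
    (by
      intro t j hf hj hlt ht k hk
      have e10 : t.reg 10 = 0 := by rw [hf.1 10 (by decide), h10]
      have e11 : t.reg 11 = 1 := by rw [hf.1 11 (by decide), h11]
      have e22 : t.arr 22 = s.arr 22 := hf.2 22 (by decide)
      have e27 : t.arr 27 = s.arr 27 := hf.2 27 (by decide)
      have ev : ((Prog.markEdge ;; .succ 19).ev t).arr 5 = Function.update (t.arr 5) j
          (if s.arr 27 (s.arr 22 j) = j + 1 then 1 else 0) := by
        by_cases h1 : s.arr 27 (s.arr 22 j) = j + 1 <;>
          simp [Prog.markEdge, Prog.ev, hj, e10, e11, e22, e27, h1]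
      rw [ev, Function.update_apply]
      by_cases h1 : k = j
      · rw [if_pos h1, h1]
      · rw [if_neg h1]
        exact ht k (by omega))
  refine ⟨s', hr.mono ?_, h⟩
  simp only [Prog.cost, Prog.markEdge]
  omega

theorem labelApplicants_spec {s : State} (hi : Set.InjOn (s.arr 0) (Set.Iio (s.reg 0))) :
    ∃ s', Runs (.each 0 .labelApplicant) s (100 * (s.reg 0 + 1)) s' ∧ ∀ j < s.reg 0,
      s'.arr 7 (s.arr 0 j) = s.arr 24 j ∧ s'.arr 8 (s.arr 0 j) = s.arr 25 j := by
  obtain ⟨s', hr, h⟩ := Runs.each (y := 0) (s := s) (c := .labelApplicant) rfl (by decide)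
    (by decide) (by decide) (fun j t => ∀ i < j,
      t.arr 7 (s.arr 0 i) = s.arr 24 i ∧ t.arr 8 (s.arr 0 i) = s.arr 25 i) (by simp)
    (by
      intro t j hf hj hlt ht i hi'
      have e0 : t.arr 0 = s.arr 0 := hf.2 0 (by decide)
      have e24 : t.arr 24 = s.arr 24 := hf.2 24 (by decide)
      have e25 : t.arr 25 = s.arr 25 := hf.2 25 (by decide)
      have ev7 : ((Prog.labelApplicant ;; .succ 19).ev t).arr 7 =
          Function.update (t.arr 7) (s.arr 0 j) (s.arr 24 j) := by
        simp [Prog.labelApplicant, Prog.ev, hj, e0, e24]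
      have ev8 : ((Prog.labelApplicant ;; .succ 19).ev t).arr 8 =
          Function.update (t.arr 8) (s.arr 0 j) (s.arr 25 j) := by
        simp [Prog.labelApplicant, Prog.ev, hj, e0, e25]
      rw [ev7, ev8, Function.update_apply, Function.update_apply]
      rcases Nat.lt_succ_iff_lt_or_eq.1 hi' with h1 | rfl
      · have h2 : s.arr 0 i ≠ s.arr 0 j := fun h3 => by
          have := hi (show i < s.reg 0 by omega) (show j < s.reg 0 by omega) h3
          omega
        rw [if_neg h2, if_neg h2]
        exact ht i h1
      · rw [if_pos rfl, if_pos rfl]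
        exact ⟨rfl, rfl⟩)
  refine ⟨s', hr.mono ?_, h⟩
  simp only [Prog.cost, Prog.labelApplicant]
  omega

theorem labelPosts_spec {s : State} (hi : Set.InjOn (s.arr 1) (Set.Iio (s.reg 1))) :
    ∃ s', Runs (.copy 23 0 ;; .each 1 .labelPost) s (100 * (s.reg 1 + 1)) s' ∧ ∀ j < s.reg 1,
      s'.arr 9 (s.arr 1 j) = s.arr 24 (s.reg 0 + j) ∧
      s'.arr 10 (s.arr 1 j) = s.arr 25 (s.reg 0 + j) := by
  have hr₁ := Runs.ev (c := .copy 23 0) rfl s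
  have f₁ := hr₁.frame
  obtain ⟨s', hr, h, -⟩ := Runs.each (y := 1) (s := (Prog.copy 23 0).ev s) (c := .labelPost) rfl
    (by decide) (by decide) (by decide) (fun j t => (∀ i < j,
      t.arr 9 (s.arr 1 i) = s.arr 24 (s.reg 0 + i) ∧
      t.arr 10 (s.arr 1 i) = s.arr 25 (s.reg 0 + i)) ∧ t.reg 23 = s.reg 0 + j)
    (by simp [Prog.ev])
    (by
      intro t j hf hj hlt ⟨ht, ht'⟩
      have e0 : t.arr 1 = s.arr 1 := by rw [hf.2 1 (by decide), f₁.2 1 (by decide)]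
      have e24 : t.arr 24 = s.arr 24 := by rw [hf.2 24 (by decide), f₁.2 24 (by decide)]
      have e25 : t.arr 25 = s.arr 25 := by rw [hf.2 25 (by decide), f₁.2 25 (by decide)]
      have hlt : j < s.reg 1 := by rwa [f₁.1 1 (by decide)] at hlt
      have ev9 : ((Prog.labelPost ;; .succ 19).ev t).arr 9 =
          Function.update (t.arr 9) (s.arr 1 j) (s.arr 24 (s.reg 0 + j)) := by
        simp [Prog.labelPost, Prog.ev, hj, e0, e24, ht']
      have ev10 : ((Prog.labelPost ;; .succ 19).ev t).arr 10 =
          Function.update (t.arr 10) (s.arr 1 j) (s.arr 25 (s.reg 0 + j)) := by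
        simp [Prog.labelPost, Prog.ev, hj, e0, e25, ht']
      refine ⟨fun i hi' => ?_, by simp [Prog.labelPost, Prog.ev, ht']; omega⟩
      rw [ev9, ev10, Function.update_apply, Function.update_apply]
      rcases Nat.lt_succ_iff_lt_or_eq.1 hi' with h1 | rfl
      · have h2 : s.arr 1 i ≠ s.arr 1 j := fun h3 => by
          have := hi (show i < s.reg 1 by omega) (show j < s.reg 1 by omega) h3
          omega
        rw [if_neg h2, if_neg h2]
        exact ht i h1
      · rw [if_pos rfl, if_pos rfl]
        exact ⟨rfl, rfl⟩)
  rw [f₁.1 1 (by decide)] at hr h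
  refine ⟨s', (hr₁.seq hr).mono ?_, h⟩
  simp only [Prog.cost, Prog.labelPost]
  omega

/-- From a good starting matching, the stored information is computed in time proportional to the
size of the instance times the number of ranks and matching edges of higher rank. -/
theorem core_spec {s : State} {H : Instance} {M : Finset Edge} (h : Loaded s H M) {z : Vertex}
    (hz : Encodes s H z) (hg : H.Good M z) (r : ℕ) :
    ∃ s' K, Runs .core s
      (20000 * (s.reg 0 + s.reg 1 + s.reg 2 + 1) * (r + 4 + (M \ H.trunc r M).card)) s' ∧
      Stores s' H K := by
  obtain ⟨s₁, D, hr₁, hD, hs₁, rfl, rfl, hn₁, hm, hN, hv1, hv2, hed, hv, h6⟩ := setup_spec h hz hg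
  obtain ⟨s₂, K, hr₂, hK, hrep, hdel, hlab⟩ := stages_spec hD hs₁ (fun v h => (hv v h).2.2)
    (fun v h => (hv v h).2.1) h6 (fun v h => (hv v h).1) r
  have f₁ := hr₁.frame
  have f₂ := hr₂.frame
  have hs₂ := hs₁.frame f₂ rfl rfl
  obtain ⟨s₃, hr₃, h₃⟩ := markEdges_spec hs₂.zero hs₂.one
  have f₃ := hr₃.frame
  have r0 : s₂.reg 0 = s.reg 0 := by rw [f₂.1 0 (by decide), f₁.1 0 (by decide)]
  have r1 : s₂.reg 1 = s.reg 1 := by rw [f₂.1 1 (by decide), f₁.1 1 (by decide)]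
  have r2 : s₂.reg 2 = s.reg 2 := by rw [f₂.1 2 (by decide), f₁.1 2 (by decide)]
  have a0 : s₂.arr 0 = s.arr 0 := by rw [f₂.2 0 (by decide), f₁.2 0 (by decide)]
  have a1 : s₂.arr 1 = s.arr 1 := by rw [f₂.2 1 (by decide), f₁.2 1 (by decide)]
  have r0' : s₃.reg 0 = s.reg 0 := by rw [f₃.1 0 (by decide), r0]
  have a0' : s₃.arr 0 = s.arr 0 := by rw [f₃.2 0 (by decide), a0]
  obtain ⟨s₄, hr₄, h₄⟩ := labelApplicants_spec (s := s₃) (by rw [r0', a0']; exact h.applicants.injOn)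
  have f₄ := hr₄.frame
  have r1' : s₄.reg 1 = s.reg 1 := by rw [f₄.1 1 (by decide), f₃.1 1 (by decide), r1]
  have a1' : s₄.arr 1 = s.arr 1 := by rw [f₄.2 1 (by decide), f₃.2 1 (by decide), a1]
  obtain ⟨s₅, hr₅, h₅⟩ := labelPosts_spec (s := s₄) (by rw [r1', a1']; exact h.posts.injOn)
  have f₅ := hr₅.frame
  rw [r1'] at hr₅ h₅
  rw [r0'] at hr₄ h₄
  rw [r2] at hr₃ h₃
  have g0 : s₅.reg 0 = s.reg 0 := by rw [f₅.1 0 (by decide), f₄.1 0 (by decide), r0']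
  have g1 : s₅.reg 1 = s.reg 1 := by rw [f₅.1 1 (by decide), r1']
  have g2 : s₅.reg 2 = s.reg 2 := by
    rw [f₅.1 2 (by decide), f₄.1 2 (by decide), f₃.1 2 (by decide), r2]
  have b0 : s₅.arr 0 = s.arr 0 := by rw [f₅.2 0 (by decide), f₄.2 0 (by decide), a0']
  have b1 : s₅.arr 1 = s.arr 1 := by rw [f₅.2 1 (by decide), a1']
  have b2 : s₅.arr 2 = s.arr 2 := by
    rw [f₅.2 2 (by decide), f₄.2 2 (by decide), f₃.2 2 (by decide), f₂.2 2 (by decide),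
      f₁.2 2 (by decide)]
  have b3 : s₅.arr 3 = s.arr 3 := by
    rw [f₅.2 3 (by decide), f₄.2 3 (by decide), f₃.2 3 (by decide), f₂.2 3 (by decide),
      f₁.2 3 (by decide)]
  have b4 : s₅.arr 4 = s.arr 4 := by
    rw [f₅.2 4 (by decide), f₄.2 4 (by decide), f₃.2 4 (by decide), f₂.2 4 (by decide),
      f₁.2 4 (by decide)]
  have b5 : s₅.arr 5 = s₃.arr 5 := by rw [f₅.2 5 (by decide), f₄.2 5 (by decide)]
  have b6 : s₅.arr 6 = s₂.arr 6 := by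
    rw [f₅.2 6 (by decide), f₄.2 6 (by decide), f₃.2 6 (by decide)]
  have b7 : s₅.arr 7 = s₄.arr 7 := f₅.2 7 (by decide)
  have b8 : s₅.arr 8 = s₄.arr 8 := f₅.2 8 (by decide)
  have c24 : s₃.arr 24 = s₂.arr 24 := f₃.2 24 (by decide)
  have c25 : s₃.arr 25 = s₂.arr 25 := f₃.2 25 (by decide)
  have c24' : s₄.arr 24 = s₂.arr 24 := by rw [f₄.2 24 (by decide), c24]
  have c25' : s₄.arr 25 = s₂.arr 25 := by rw [f₄.2 25 (by decide), c25]
  have hmark : ∀ k < s.reg 2, s₂.arr 27 (s₂.arr 22 k) = k + 1 ↔ D.ed k ∈ K := by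
    intro k hk
    have hk : k < D.m := by omega
    rw [hs₂.U]
    constructor
    · exact fun h1 => (hrep.mem_of_eq (hD.U_lt_N hk) h1).2.1
    · exact fun h1 => hrep.eq_of_mem hD hK.2.1 (hD.U_lt_N hk) hk h1
        ((hD.inc_iff hk (hD.U_lt_N hk)).2 (Or.inl rfl))
  refine ⟨s₅, K, (hr₁.seq (hr₂.seq (hr₃.seq (hr₄.seq hr₅)))).mono ?_, ?_⟩
  · obtain ⟨x, hx⟩ : ∃ x, x = r + 4 + (D.M₀ \ D.H.trunc r D.M₀).card := ⟨_, rfl⟩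
    have hx4 : 4 ≤ x := by omega
    have hsz : D.size ≤ 2 * (s.reg 0 + s.reg 1 + s.reg 2 + 1) := by
      simp only [Data.size]
      omega
    obtain ⟨w, hw⟩ : ∃ w, w = s.reg 0 + s.reg 1 + s.reg 2 + 1 := ⟨_, rfl⟩
    rw [← hx]
    rw [← hw] at hsz ⊢
    have h1 : 5000 * D.size * x ≤ 10000 * (w * x) := by
      calc 5000 * D.size * x ≤ 5000 * (2 * w) * x := by gcongr
        _ = 10000 * (w * x) := by ring
    have h2 : w * 4 ≤ w * x := by gcongr
    have h3 : 20000 * w * x = 20000 * (w * x) := by ring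
    rw [h3]
    omega
  · constructor
    · rw [b0, g0]
      exact h.applicants
    · rw [b1, g1]
      exact h.posts
    · rw [b2, b3, g2]
      exact h.edges
    · rw [b2, b3, b4, g2]
      exact h.rank
    · exact hK
    · intro k hk
      rw [g2] at hk
      rw [b2, b3, b5, h₃ k hk, ← hed k hk]
      exact fun h1 => if_pos ((hmark k hk).2 h1)
    · intro k hk
      rw [g2] at hk
      rw [b2, b3, b5, h₃ k hk, ← hed k hk]
      exact fun h1 => if_neg fun h2 => h1 ((hmark k hk).1 h2)
    · intro k hk i
      rw [g2] at hk
      rw [b2, b3, b6, ← hed k hk]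
      exact hdel k (by omega) i
    · intro a ha
      obtain ⟨j, hj, rfl⟩ := h.applicants.surjOn ha
      have h1 := h₄ j hj
      rw [a0', c24, c25] at h1
      rw [b7, b8, h1.1, h1.2, ← hv1 j hj]
      exact hlab j (by have : j < s.reg 0 := hj; omega)
    · intro p hp
      obtain ⟨j, hj, rfl⟩ := h.posts.surjOn hp
      have h1 := h₅ j hj
      rw [a1', c24', c25', f₄.1 0 (by decide), r0'] at h1
      rw [h1.1, h1.2, ← hv2 j hj]
      exact hlab _ (by have : j < s.reg 1 := hj; omega)

/-! ### Insertion and deletion in the lists of vertices and edges -/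

namespace Prog

/-- The next edge of the request is appended, as an edge outside the matching. The end-points on the
side of the requested vertex are in array `2 + b`, the others in array `3 - b`. -/
def appendEdge (b : ℕ) : Prog :=
  write (2 + b) 2 3 ;; read 20 11 19 ;; write (3 - b) 2 20 ;; read 20 12 19 ;; write 4 2 20 ;;
    write 5 2 10 ;; succ 2

/-- The requested vertex is appended to the list number `b`, that is, to the applicants if `b = 0`
and to the posts if `b = 1`, and its edges are appended to the list of edges. The new vertex is
encoded as starting point of the update. -/
def insertVertex (b : ℕ) : Prog :=
  (const 10 0 ;; const 15 b ;; copy 16 3 ;; write b b 3 ;; succ b) ;; each 4 (appendEdge b)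

/-- The next edge is moved to the position in register `24`, unless the requested vertex is an
end-point; then the other end-point is noted if the edge is in the matching. -/
def keepEdge (b : ℕ) : Prog :=
  read 20 2 19 ;; read 21 3 19 ;; read 22 4 19 ;; read 23 5 19 ;;
    ite (.eq (20 + b) 3) (ite (.eq 23 11) (const 15 (1 - b) ;; copy 16 (21 - b)) skip)
      (write 2 24 20 ;; write 3 24 21 ;; write 4 24 22 ;; write 5 24 23 ;; succ 24)

/-- The next vertex is moved to the position in register `24`, unless it is the requested one. -/
def keepVertex (b : ℕ) : Prog :=
  read 20 b 19 ;; ite (.eq 20 3) skip (write b 24 20 ;; succ 24)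

/-- The requested vertex is deleted from the list number `b`, and its edges from the list of edges.
Its former partner is encoded as starting point of the update; if there is none, the deleted vertex
itself is. -/
def eraseVertex (b : ℕ) : Prog :=
  ((const 11 1 ;; const 15 2 ;; const 24 0) ;; each 2 (keepEdge b)) ;;
    (copy 2 24 ;; const 24 0) ;; each b (keepVertex b) ;; copy b 24

end Prog

theorem bijOn_update {α : Type*} {g : ℕ → α} {c : ℕ} {S : Set α} (h : Set.BijOn g (Set.Iio c) S)
    {x : α} (hx : x ∉ S) : Set.BijOn (Function.update g c x) (Set.Iio (c + 1)) (insert x S) := by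
  have h1 : Set.EqOn g (Function.update g c x) (Set.Iio c) := fun k hk =>
    (Function.update_of_ne (ne_of_lt hk) _ _).symm
  have h2 := (h.congr h1).insert (a := c) (by simpa using hx)
  rw [Function.update_self] at h2
  convert h2 using 1
  ext k
  simp

theorem bijOn_append {α : Type*} {f : ℕ → α} {m l : ℕ} {S T : Set α}
    (h : Set.BijOn f (Set.Iio m) S) (h' : Set.BijOn (fun i => f (m + i)) (Set.Iio l) T)
    (hd : Disjoint S T) : Set.BijOn f (Set.Iio (m + l)) (S ∪ T) := by
  refine ⟨fun k hk => ?_, fun k hk k' hk' he => ?_, ?_⟩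
  · by_cases h1 : k < m
    · exact Or.inl (h.mapsTo h1)
    · have := h'.mapsTo (show k - m < l by have : k < m + l := hk; omega)
      rw [show m + (k - m) = k by omega] at this
      exact Or.inr this
  · have key : ∀ k < m + l, ∀ k' < m + l, f k = f k' → k ≤ k' → k = k' := by
      intro k hk k' hk' he hle
      by_cases h1 : k' < m
      · exact h.injOn (show k < m by omega) h1 he
      · have h2 : f k' ∈ T := by
          have := h'.mapsTo (show k' - m < l by omega)
          rwa [show m + (k' - m) = k' by omega] at this
        by_cases h3 : k < m
        · exact absurd (he ▸ h2) (Set.disjoint_left.1 hd (h.mapsTo h3))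
        · have := h'.injOn (show k - m < l by omega) (show k' - m < l by omega)
            (by rw [show m + (k - m) = k by omega, show m + (k' - m) = k' by omega, he])
          omega
    rcases le_total k k' with h1 | h1
    · exact key k hk k' hk' he h1
    · exact (key k' hk' k hk he.symm h1).symm
  · rintro x (hx | hx)
    · obtain ⟨k, hk, rfl⟩ := h.surjOn hx
      exact ⟨k, show k < m + l by have : k < m := hk; omega, rfl⟩
    · obtain ⟨k, hk, rfl⟩ := h'.surjOn hx
      exact ⟨m + k, show m + k < m + l by have : k < l := hk; omega, rfl⟩

/-- The edge lists of `t` are those of `s`, followed by the first `j` edges of the request. -/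
structure Appended (b : ℕ) (s t : State) (j : ℕ) : Prop where
  num : t.reg 2 = s.reg 2 + j
  old : ∀ k < s.reg 2, t.arr 2 k = s.arr 2 k ∧ t.arr 3 k = s.arr 3 k ∧ t.arr 4 k = s.arr 4 k ∧
    t.arr 5 k = s.arr 5 k
  new : ∀ i < j, t.arr (2 + b) (s.reg 2 + i) = s.reg 3 ∧
    t.arr (3 - b) (s.reg 2 + i) = s.arr 11 i ∧ t.arr 4 (s.reg 2 + i) = s.arr 12 i ∧
    t.arr 5 (s.reg 2 + i) = 0

theorem insertVertex_spec {b : ℕ} (hb : b = 0 ∨ b = 1) (s : State) :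
    ∃ s', Runs (.insertVertex b) s (100 * (s.reg 4 + 1)) s' ∧ s'.reg 15 = b ∧
      s'.reg 16 = s.reg 3 ∧ s'.reg b = s.reg b + 1 ∧
      s'.arr b = Function.update (s.arr b) (s.reg b) (s.reg 3) ∧
      s'.reg (1 - b) = s.reg (1 - b) ∧ s'.arr (1 - b) = s.arr (1 - b) ∧
      Appended b s s' (s.reg 4) := by
  obtain ⟨s₁, hs₁⟩ : ∃ s₁, s₁ = (Prog.const 10 0 ;; .const 15 b ;; .copy 16 3 ;; .write b b 3 ;;
    .succ b).ev s := ⟨_, rfl⟩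
  have hr₁ : Runs (Prog.const 10 0 ;; .const 15 b ;; .copy 16 3 ;; .write b b 3 ;; .succ b) s 5 s₁ := by
    rw [hs₁]
    exact Runs.ev rfl s
  have k3 : s₁.reg 3 = s.reg 3 := by rcases hb with rfl | rfl <;> simp [hs₁, Prog.ev]
  have k4 : s₁.reg 4 = s.reg 4 := by rcases hb with rfl | rfl <;> simp [hs₁, Prog.ev]
  have k2 : s₁.reg 2 = s.reg 2 := by rcases hb with rfl | rfl <;> simp [hs₁, Prog.ev]
  have k10 : s₁.reg 10 = 0 := by rcases hb with rfl | rfl <;> simp [hs₁, Prog.ev]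
  have k15 : s₁.reg 15 = b := by rcases hb with rfl | rfl <;> simp [hs₁, Prog.ev]
  have k16 : s₁.reg 16 = s.reg 3 := by rcases hb with rfl | rfl <;> simp [hs₁, Prog.ev]
  have kb : s₁.reg b = s.reg b + 1 := by rcases hb with rfl | rfl <;> simp [hs₁, Prog.ev]
  have kb' : s₁.reg (1 - b) = s.reg (1 - b) := by rcases hb with rfl | rfl <;> simp [hs₁, Prog.ev]
  have ab : s₁.arr b = Function.update (s.arr b) (s.reg b) (s.reg 3) := by
    rcases hb with rfl | rfl <;> simp [hs₁, Prog.ev]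
  have ac : ∀ c, c ≠ b → s₁.arr c = s.arr c := fun c hc => by simp [hs₁, Prog.ev, hc]
  have hb2 : b < 2 := by omega
  obtain ⟨s', hr, h⟩ := Runs.each (y := 4) (s := s₁) (c := .appendEdge b) rfl
    (by rcases hb with rfl | rfl <;> decide) (by rcases hb with rfl | rfl <;> decide) (by decide)
    (fun j t => Appended b s t j)
    (by
      refine ⟨by simp [k2], fun k hk => ?_, by simp⟩
      simp only [State.setReg_arr]
      rw [ac 2 (by omega), ac 3 (by omega), ac 4 (by omega), ac 5 (by omega)]
      exact ⟨rfl, rfl, rfl, rfl⟩)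
    (by
      intro t j hf hj hlt ht
      have e3 : t.reg 3 = s.reg 3 := by
        rw [← k3]
        rcases hb with rfl | rfl <;> exact hf.1 3 (by decide)
      have e10 : t.reg 10 = 0 := by
        rw [← k10]
        rcases hb with rfl | rfl <;> exact hf.1 10 (by decide)
      have e11 : t.arr 11 = s.arr 11 := by
        rw [← ac 11 (by omega)]
        rcases hb with rfl | rfl <;> exact hf.2 11 (by decide)
      have e12 : t.arr 12 = s.arr 12 := by
        rw [← ac 12 (by omega)]
        rcases hb with rfl | rfl <;> exact hf.2 12 (by decide)
      have e2 := ht.num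
      obtain ⟨t', ht'⟩ : ∃ t', t' = (Prog.appendEdge b ;; .succ 19).ev t := ⟨_, rfl⟩
      have c2 : t'.reg 2 = s.reg 2 + (j + 1) := by
        rcases hb with rfl | rfl <;> simp [ht', Prog.appendEdge, Prog.ev, e2, add_assoc]
      have cown : t'.arr (2 + b) = Function.update (t.arr (2 + b)) (s.reg 2 + j) (s.reg 3) := by
        rcases hb with rfl | rfl <;> simp [ht', Prog.appendEdge, Prog.ev, e2, e3]
      have coth : t'.arr (3 - b) = Function.update (t.arr (3 - b)) (s.reg 2 + j) (s.arr 11 j) := by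
        rcases hb with rfl | rfl <;> simp [ht', Prog.appendEdge, Prog.ev, e2, e11, hj]
      have c4 : t'.arr 4 = Function.update (t.arr 4) (s.reg 2 + j) (s.arr 12 j) := by
        rcases hb with rfl | rfl <;> simp [ht', Prog.appendEdge, Prog.ev, e2, e12, hj]
      have c5 : t'.arr 5 = Function.update (t.arr 5) (s.reg 2 + j) 0 := by
        rcases hb with rfl | rfl <;> simp [ht', Prog.appendEdge, Prog.ev, e2, e10]
      rw [← ht']
      refine ⟨c2, fun k hk => ?_, fun i hi => ?_⟩
      · obtain ⟨o2, o3, o4, o5⟩ := ht.old k hk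
        have hne : k ≠ s.reg 2 + j := by omega
        rw [← o2, ← o3, ← o4, ← o5, c4, c5, Function.update_of_ne hne, Function.update_of_ne hne]
        refine ⟨?_, ?_, rfl, rfl⟩ <;> rcases hb with rfl | rfl
        · exact (congrFun cown k).trans (Function.update_of_ne hne _ _)
        · exact (congrFun coth k).trans (Function.update_of_ne hne _ _)
        · exact (congrFun coth k).trans (Function.update_of_ne hne _ _)
        · exact (congrFun cown k).trans (Function.update_of_ne hne _ _)
      · rw [cown, coth, c4, c5]
        by_cases h1 : i = j
        · rw [h1, Function.update_self, Function.update_self, Function.update_self,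
            Function.update_self]
          exact ⟨rfl, rfl, rfl, rfl⟩
        · have hne : s.reg 2 + i ≠ s.reg 2 + j := by omega
          rw [Function.update_of_ne hne, Function.update_of_ne hne, Function.update_of_ne hne,
            Function.update_of_ne hne]
          exact ht.new i (by omega))
  have f := hr.frame
  rw [k4] at h hr
  refine ⟨s', (hr₁.seq hr).mono ?_, ?_, ?_, ?_, ?_, ?_, ?_, h⟩
  · simp only [Prog.cost, Prog.appendEdge]
    omega
  · rw [← k15]
    rcases hb with rfl | rfl <;> exact f.1 15 (by decide)
  · rw [← k16]
    rcases hb with rfl | rfl <;> exact f.1 16 (by decide)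
  · rw [← kb]
    rcases hb with rfl | rfl
    · exact f.1 0 (by decide)
    · exact f.1 1 (by decide)
  · rw [← ab]
    rcases hb with rfl | rfl
    · exact f.2 0 (by decide)
    · exact f.2 1 (by decide)
  · rw [← kb']
    rcases hb with rfl | rfl
    · exact f.1 1 (by decide)
    · exact f.1 0 (by decide)
  · rw [← ac (1 - b) (by omega)]
    rcases hb with rfl | rfl
    · exact f.2 1 (by decide)
    · exact f.2 0 (by decide)

/-- The edge lists of `t` are those of `s`, in which of the first `j` edges only those without the
requested vertex are kept; the partner of the vertex, if found, is recorded. -/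
structure Kept (b : ℕ) (s t : State) (j : ℕ) : Prop where
  le : t.reg 24 ≤ j
  kept : ∃ g : ℕ → ℕ, Set.BijOn g (Set.Iio (t.reg 24)) {k | k < j ∧ s.arr (2 + b) k ≠ s.reg 3} ∧
    ∀ k < t.reg 24, t.arr 2 k = s.arr 2 (g k) ∧ t.arr 3 k = s.arr 3 (g k) ∧
      t.arr 4 k = s.arr 4 (g k) ∧ t.arr 5 k = s.arr 5 (g k)
  rest : ∀ k, j ≤ k → t.arr 2 k = s.arr 2 k ∧ t.arr 3 k = s.arr 3 k ∧ t.arr 4 k = s.arr 4 k ∧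
    t.arr 5 k = s.arr 5 k
  partner : (t.reg 15 = 2 ∧ ∀ k < j, s.arr (2 + b) k = s.reg 3 → s.arr 5 k ≠ 1) ∨
    (t.reg 15 = 1 - b ∧ ∃ k < j, s.arr (2 + b) k = s.reg 3 ∧ s.arr 5 k = 1 ∧
      t.reg 16 = s.arr (3 - b) k)

theorem keepEdges_spec {b : ℕ} (hb : b = 0 ∨ b = 1) (s : State) :
    ∃ s', Runs ((.const 11 1 ;; .const 15 2 ;; .const 24 0) ;; .each 2 (.keepEdge b)) s
      (100 * (s.reg 2 + 1)) s' ∧ Kept b s s' (s.reg 2) := by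
  have hr₁ := Runs.ev (c := .const 11 1 ;; .const 15 2 ;; .const 24 0) rfl s
  have f₁ := hr₁.frame
  obtain ⟨s₁, hs₁⟩ : ∃ s₁, s₁ = (Prog.const 11 1 ;; .const 15 2 ;; .const 24 0).ev s := ⟨_, rfl⟩
  rw [← hs₁] at hr₁ f₁
  have k11 : s₁.reg 11 = 1 := by simp [hs₁, Prog.ev]
  have k15 : s₁.reg 15 = 2 := by simp [hs₁, Prog.ev]
  have k24 : s₁.reg 24 = 0 := by simp [hs₁, Prog.ev]
  have k2 : s₁.reg 2 = s.reg 2 := f₁.1 2 (by decide)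
  have ka : s₁.arr = s.arr := by
    funext c
    exact f₁.2 c (by simp [Prog.arrs])
  obtain ⟨s', hr, h⟩ := Runs.each (y := 2) (s := s₁) (c := .keepEdge b) rfl
    (by rcases hb with rfl | rfl <;> decide) (by rcases hb with rfl | rfl <;> decide) (by decide)
    (fun j t => Kept b s t j)
    (by
      refine ⟨by simp [k24], ⟨id, by simp [k24], by simp [k24]⟩, by simp [ka], ?_⟩
      exact Or.inl ⟨by simp [k15], by simp⟩)
    (by
      intro t j hf hj hlt ht
      have e3 : t.reg 3 = s.reg 3 := by
        rw [← f₁.1 3 (by decide)]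
        rcases hb with rfl | rfl <;> exact hf.1 3 (by decide)
      have e11 : t.reg 11 = 1 := by
        rw [← k11]
        rcases hb with rfl | rfl <;> exact hf.1 11 (by decide)
      obtain ⟨r2, r3, r4, r5⟩ := ht.rest j le_rfl
      have hle := ht.le
      obtain ⟨t', ht'⟩ : ∃ t', t' = (Prog.keepEdge b ;; .succ 19).ev t := ⟨_, rfl⟩
      rw [← ht']
      obtain ⟨g, hg, hg'⟩ := ht.kept
      by_cases h1 : s.arr (2 + b) j = s.reg 3
      · have c24 : t'.reg 24 = t.reg 24 := by
          rcases hb with rfl | rfl <;> by_cases h2 : s.arr 5 j = 1 <;>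
            simp [ht', Prog.keepEdge, Prog.ev, hj, e3, e11, r2, r3, r4, r5, h2,
              show s.arr _ j = s.reg 3 from h1]
        have ca : t'.arr = t.arr := by
          rcases hb with rfl | rfl <;> by_cases h2 : s.arr 5 j = 1 <;>
            simp [ht', Prog.keepEdge, Prog.ev, hj, e3, e11, r2, r3, r4, r5, h2,
              show s.arr _ j = s.reg 3 from h1]
        refine ⟨by omega, ⟨g, ?_, ?_⟩, ?_, ?_⟩
        · rw [c24]
          convert hg using 1
          ext k
          simp only [Set.mem_ofPred_eq]
          constructor
          · rintro ⟨h2, h3⟩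
            refine ⟨?_, h3⟩
            have : k ≠ j := fun h4 => h3 (h4 ▸ h1)
            omega
          · rintro ⟨h2, h3⟩
            exact ⟨by omega, h3⟩
        · rw [c24, ca]
          exact hg'
        · rw [ca]
          exact fun k hk => ht.rest k (by omega)
        · by_cases h2 : s.arr 5 j = 1
          · right
            refine ⟨?_, j, by omega, h1, h2, ?_⟩ <;> rcases hb with rfl | rfl <;>
              simp [ht', Prog.keepEdge, Prog.ev, hj, e3, e11, r2, r3, r4, r5, h2,
                show s.arr _ j = s.reg 3 from h1]
          · have c15 : t'.reg 15 = t.reg 15 := by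
              rcases hb with rfl | rfl <;>
                simp [ht', Prog.keepEdge, Prog.ev, hj, e3, e11, r2, r3, r4, r5, h2,
                  show s.arr _ j = s.reg 3 from h1]
            have c16 : t'.reg 16 = t.reg 16 := by
              rcases hb with rfl | rfl <;>
                simp [ht', Prog.keepEdge, Prog.ev, hj, e3, e11, r2, r3, r4, r5, h2,
                  show s.arr _ j = s.reg 3 from h1]
            rw [c15, c16]
            rcases ht.partner with ⟨h3, h4⟩ | ⟨h3, k, hk, h4⟩
            · refine Or.inl ⟨h3, fun k hk h5 => ?_⟩
              rcases Nat.lt_succ_iff_lt_or_eq.1 hk with h6 | rfl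
              · exact h4 k h6 h5
              · exact h2
            · exact Or.inr ⟨h3, k, by omega, h4⟩
      · have c24 : t'.reg 24 = t.reg 24 + 1 := by
          rcases hb with rfl | rfl <;>
            simp [ht', Prog.keepEdge, Prog.ev, hj, e3, e11, r2, r3, r4, r5,
              show ¬ s.arr _ j = s.reg 3 from h1]
        have c15 : t'.reg 15 = t.reg 15 := by
          rcases hb with rfl | rfl <;>
            simp [ht', Prog.keepEdge, Prog.ev, hj, e3, e11, r2, r3, r4, r5,
              show ¬ s.arr _ j = s.reg 3 from h1]
        have c16 : t'.reg 16 = t.reg 16 := by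
          rcases hb with rfl | rfl <;>
            simp [ht', Prog.keepEdge, Prog.ev, hj, e3, e11, r2, r3, r4, r5,
              show ¬ s.arr _ j = s.reg 3 from h1]
        have ca : ∀ c, c = 2 ∨ c = 3 ∨ c = 4 ∨ c = 5 →
            t'.arr c = Function.update (t.arr c) (t.reg 24) (s.arr c j) := by
          rintro c (rfl | rfl | rfl | rfl) <;> rcases hb with rfl | rfl <;>
            simp [ht', Prog.keepEdge, Prog.ev, hj, e3, e11, r2, r3, r4, r5,
              show ¬ s.arr _ j = s.reg 3 from h1]
        refine ⟨by omega, ⟨Function.update g (t.reg 24) j, ?_, ?_⟩, ?_, ?_⟩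
        · rw [c24]
          convert bijOn_update hg (x := j) (fun h2 => (lt_irrefl j h2.1)) using 1
          ext k
          simp only [Set.mem_ofPred_eq, Set.mem_insert_iff]
          constructor
          · rintro ⟨h2, h3⟩
            by_cases h4 : k = j
            · exact Or.inl h4
            · exact Or.inr ⟨by omega, h3⟩
          · rintro (rfl | ⟨h2, h3⟩)
            · exact ⟨by omega, h1⟩
            · exact ⟨by omega, h3⟩
        · intro k hk
          rw [ca 2 (by simp), ca 3 (by simp), ca 4 (by simp), ca 5 (by simp)]
          by_cases h2 : k = t.reg 24
          · subst h2
            simp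
          · simp only [Function.update_of_ne h2]
            exact hg' k (by omega)
        · intro k hk
          have h2 : k ≠ t.reg 24 := by omega
          rw [ca 2 (by simp), ca 3 (by simp), ca 4 (by simp), ca 5 (by simp)]
          simp only [Function.update_of_ne h2]
          exact ht.rest k (by omega)
        · rw [c15, c16]
          rcases ht.partner with ⟨h3, h4⟩ | ⟨h3, k, hk, h4⟩
          · refine Or.inl ⟨h3, fun k hk h5 => ?_⟩
            rcases Nat.lt_succ_iff_lt_or_eq.1 hk with h6 | rfl
            · exact h4 k h6 h5
            · exact absurd h5 h1
          · exact Or.inr ⟨h3, k, by omega, h4⟩)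
  rw [k2] at hr h
  refine ⟨s', (hr₁.seq hr).mono ?_, h⟩
  simp only [Prog.cost, Prog.keepEdge]
  omega

theorem keepVertices_spec {b : ℕ} (hb : b = 0 ∨ b = 1) {s : State} (h24 : s.reg 24 = 0) :
    ∃ s', Runs (.each b (.keepVertex b)) s (100 * (s.reg b + 1)) s' ∧
      ∃ g : ℕ → ℕ, Set.BijOn g (Set.Iio (s'.reg 24)) {k | k < s.reg b ∧ s.arr b k ≠ s.reg 3} ∧
        ∀ k < s'.reg 24, s'.arr b k = s.arr b (g k) := by
  obtain ⟨s', hr, h⟩ := Runs.each (y := b) (s := s) (c := .keepVertex b) rfl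
    (by rcases hb with rfl | rfl <;> decide) (by rcases hb with rfl | rfl <;> decide)
    (by rcases hb with rfl | rfl <;> decide)
    (fun j t => t.reg 24 ≤ j ∧ (∀ k, j ≤ k → t.arr b k = s.arr b k) ∧
      ∃ g : ℕ → ℕ, Set.BijOn g (Set.Iio (t.reg 24)) {k | k < j ∧ s.arr b k ≠ s.reg 3} ∧
        ∀ k < t.reg 24, t.arr b k = s.arr b (g k))
    (by simp [h24, Set.bijOn_empty_iff_left])
    (by
      intro t j hf hj hlt ⟨hle, hrest, g, hg, hg'⟩
      have e3 : t.reg 3 = s.reg 3 := by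
        rcases hb with rfl | rfl <;> exact hf.1 3 (by decide)
      have r := hrest j le_rfl
      obtain ⟨t', ht'⟩ : ∃ t', t' = (Prog.keepVertex b ;; .succ 19).ev t := ⟨_, rfl⟩
      rw [← ht']
      by_cases h1 : s.arr b j = s.reg 3
      · have c24 : t'.reg 24 = t.reg 24 := by simp [ht', Prog.keepVertex, Prog.ev, hj, e3, r, h1]
        have ca : t'.arr = t.arr := by simp [ht', Prog.keepVertex, Prog.ev, hj, e3, r, h1]
        rw [c24, ca]
        refine ⟨by omega, fun k hk => hrest k (by omega), g, ?_, hg'⟩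
        convert hg using 1
        ext k
        simp only [Set.mem_ofPred_eq]
        constructor
        · rintro ⟨h2, h3⟩
          refine ⟨?_, h3⟩
          have : k ≠ j := fun h4 => h3 (h4 ▸ h1)
          omega
        · rintro ⟨h2, h3⟩
          exact ⟨by omega, h3⟩
      · have c24 : t'.reg 24 = t.reg 24 + 1 := by
          simp [ht', Prog.keepVertex, Prog.ev, hj, e3, r, h1]
        have ca : t'.arr b = Function.update (t.arr b) (t.reg 24) (s.arr b j) := by
          simp [ht', Prog.keepVertex, Prog.ev, hj, e3, r, h1]
        rw [c24, ca]
        refine ⟨by omega, fun k hk => ?_, Function.update g (t.reg 24) j, ?_, fun k hk => ?_⟩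
        · rw [Function.update_of_ne (by omega)]
          exact hrest k (by omega)
        · convert bijOn_update hg (x := j) (fun h2 => (lt_irrefl j h2.1)) using 1
          ext k
          simp only [Set.mem_ofPred_eq, Set.mem_insert_iff]
          constructor
          · rintro ⟨h2, h3⟩
            by_cases h4 : k = j
            · exact Or.inl h4
            · exact Or.inr ⟨by omega, h3⟩
          · rintro (rfl | ⟨h2, h3⟩)
            · exact ⟨by omega, h1⟩
            · exact ⟨by omega, h3⟩
        · by_cases h2 : k = t.reg 24
          · rw [h2, Function.update_self, Function.update_self]
          · rw [Function.update_of_ne h2, Function.update_of_ne h2]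
            exact hg' k (by omega))
  refine ⟨s', hr.mono ?_, h.2.2⟩
  simp only [Prog.cost, Prog.keepVertex]
  omega

/-! ### The updated instances -/

namespace Update

variable {G : Instance}

theorem rank_mk (A P : Finset ℕ) (ρ : Edge → ℕ) (e : Edge) :
    (mk A P ρ).rank e = if e ∈ A ×ˢ P then ρ e else 0 := rfl

theorem rank_addApplicant {a : ℕ} {list : ℕ → ℕ} (h : (addApplicant a list).Valid G) (e : Edge) :
    ((addApplicant a list).apply G).rank e = if e.1 = a then list e.2 else G.rank e := by
  simp only [apply, rank_mk, Finset.mem_product, Finset.mem_insert]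
  by_cases h1 : e.1 = a
  · simp only [h1, true_or, true_and, if_true, ite_eq_left_iff]
    intro h2
    by_contra h3
    exact h2 (h.2 _ (Ne.symm h3))
  · simp only [h1, false_or, if_false, ite_eq_left_iff]
    exact fun h2 => (G.rank_eq_zero e (by rwa [Finset.mem_product])).symm

theorem rank_addPost {p : ℕ} {list : ℕ → ℕ} (h : (addPost p list).Valid G) (e : Edge) :
    ((addPost p list).apply G).rank e = if e.2 = p then list e.1 else G.rank e := by
  simp only [apply, rank_mk, Finset.mem_product, Finset.mem_insert]
  by_cases h1 : e.2 = p
  · simp only [h1, true_or, and_true, if_true, ite_eq_left_iff]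
    intro h2
    by_contra h3
    exact h2 (h.2 _ (Ne.symm h3))
  · simp only [h1, false_or, if_false, ite_eq_left_iff]
    exact fun h2 => (G.rank_eq_zero e (by rwa [Finset.mem_product])).symm

theorem rank_delApplicant (a : ℕ) (e : Edge) :
    ((delApplicant a).apply G).rank e = if e.1 = a then 0 else G.rank e := by
  simp only [apply, rank_mk, Finset.mem_product, Finset.mem_erase]
  by_cases h1 : e.1 = a
  · simp [h1]
  · simp only [h1, ne_eq, not_false_eq_true, true_and, if_false, ite_eq_left_iff]
    exact fun h2 => (G.rank_eq_zero e (by rwa [Finset.mem_product])).symm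

theorem rank_delPost (p : ℕ) (e : Edge) :
    ((delPost p).apply G).rank e = if e.2 = p then 0 else G.rank e := by
  simp only [apply, rank_mk, Finset.mem_product, Finset.mem_erase]
  by_cases h1 : e.2 = p
  · simp [h1]
  · simp only [h1, ne_eq, not_false_eq_true, true_and, if_false, ite_eq_left_iff]
    exact fun h2 => (G.rank_eq_zero e (by rwa [Finset.mem_product])).symm

theorem rank_addEdge {a p i : ℕ} (h : (addEdge a p i).Valid G) (e : Edge) :
    ((addEdge a p i).apply G).rank e = if e = (a, p) then i else G.rank e := by
  simp only [apply, rank_mk, Finset.mem_product]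
  by_cases h1 : e = (a, p)
  · simp [h1, h.1, h.2.1]
  · simp only [h1, if_false, ite_eq_left_iff]
    exact fun h2 => (G.rank_eq_zero e (by rwa [Finset.mem_product])).symm

theorem rank_delEdge (a p : ℕ) (e : Edge) :
    ((delEdge a p).apply G).rank e = if e = (a, p) then 0 else G.rank e := by
  simp only [apply, rank_mk, Finset.mem_product]
  by_cases h1 : e = (a, p)
  · simp [h1]
  · simp only [h1, if_false, ite_eq_left_iff]
    exact fun h2 => (G.rank_eq_zero e (by rwa [Finset.mem_product])).symm

theorem isDeletion_addApplicant {a : ℕ} {list : ℕ → ℕ} (h : (addApplicant a list).Valid G) :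
    Instance.IsDeletion ((addApplicant a list).apply G) G (Sum.inl a) := by
  have key : ∀ e ∈ G.edges, e.1 ≠ a := fun e he h1 =>
    h.1 (h1 ▸ (Finset.mem_product.1 (Finset.mem_filter.1 he).1).1)
  refine ⟨fun e => ?_, fun e he => ?_⟩
  · by_cases h1 : e.1 = a
    · simp only [Inc, h1, true_or, not_true, and_false, iff_false]
      exact fun h2 => key e h2 h1
    · simp [Instance.mem_edges, rank_addApplicant h, h1, Inc, Ne.symm h1]
  · rw [rank_addApplicant h, if_neg (key e he)]

theorem isDeletion_addPost {p : ℕ} {list : ℕ → ℕ} (h : (addPost p list).Valid G) :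
    Instance.IsDeletion ((addPost p list).apply G) G (Sum.inr p) := by
  have key : ∀ e ∈ G.edges, e.2 ≠ p := fun e he h1 =>
    h.1 (h1 ▸ (Finset.mem_product.1 (Finset.mem_filter.1 he).1).2)
  refine ⟨fun e => ?_, fun e he => ?_⟩
  · by_cases h1 : e.2 = p
    · simp only [Inc, h1, or_true, not_true, and_false, iff_false]
      exact fun h2 => key e h2 h1
    · simp [Instance.mem_edges, rank_addPost h, h1, Inc, Ne.symm h1]
  · rw [rank_addPost h, if_neg (key e he)]

theorem isDeletion_delApplicant (a : ℕ) :
    Instance.IsDeletion G ((delApplicant a).apply G) (Sum.inl a) := by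
  refine ⟨fun e => ?_, fun e he => ?_⟩
  · by_cases h1 : e.1 = a
    · simp [Instance.mem_edges, rank_delApplicant, h1, Inc]
    · simp [Instance.mem_edges, rank_delApplicant, h1, Inc, Ne.symm h1]
  · rw [Instance.mem_edges, rank_delApplicant] at he
    rw [rank_delApplicant, if_neg fun h => he (if_pos h)]

theorem isDeletion_delPost (p : ℕ) :
    Instance.IsDeletion G ((delPost p).apply G) (Sum.inr p) := by
  refine ⟨fun e => ?_, fun e he => ?_⟩
  · by_cases h1 : e.2 = p
    · simp [Instance.mem_edges, rank_delPost, h1, Inc]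
    · simp [Instance.mem_edges, rank_delPost, h1, Inc, Ne.symm h1]
  · rw [Instance.mem_edges, rank_delPost] at he
    rw [rank_delPost, if_neg fun h => he (if_pos h)]

end Update

/-! ### The vertex updates -/

theorem card_eq_of_bijOn {α : Type*} {f : ℕ → α} {n : ℕ} {S : Finset α}
    (h : Set.BijOn f (Set.Iio n) (S : Set α)) : S.card = n := by
  have h1 : Set.BijOn f (Finset.range n : Set ℕ) (S : Set α) := by
    rwa [Finset.coe_range]
  rw [← Finset.card_range n]
  exact (Finset.card_nbij f h1.mapsTo h1.injOn h1.surjOn).symm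

theorem Stores.loaded {s : State} {G : Instance} {M : Finset Edge} (h : Stores s G M) :
    Loaded s G M :=
  ⟨h.applicants, h.posts, h.edges, h.rank, h.matched, h.unmatched⟩

theorem Loaded.append {s s' : State} {G H : Instance} {M : Finset Edge} {v : Vertex} {b l : ℕ}
    (h : Loaded s G M) (hM : M ⊆ G.edges) (hd : Instance.IsDeletion H G v)
    (ha : Appended b s s' l)
    (hA : Set.BijOn (s'.arr 0) (Set.Iio (s'.reg 0)) (H.applicants : Set ℕ))
    (hP : Set.BijOn (s'.arr 1) (Set.Iio (s'.reg 1)) (H.posts : Set ℕ))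
    (hnew : Set.BijOn (fun i => (s'.arr 2 (s.reg 2 + i), s'.arr 3 (s.reg 2 + i))) (Set.Iio l)
      {e | e ∈ H.edges ∧ Inc v e})
    (hrk : ∀ i < l, s.arr 12 i = H.rank (s'.arr 2 (s.reg 2 + i), s'.arr 3 (s.reg 2 + i))) :
    Loaded s' H M := by
  have hold : ∀ k < s.reg 2, (s'.arr 2 k, s'.arr 3 k) = (s.arr 2 k, s.arr 3 k) := fun k hk => by
    rw [(ha.old k hk).1, (ha.old k hk).2.1]
  have hcase : ∀ k < s'.reg 2, k < s.reg 2 ∨ ∃ i < l, k = s.reg 2 + i := by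
    intro k hk
    have := ha.num
    by_cases h1 : k < s.reg 2
    · exact Or.inl h1
    · exact Or.inr ⟨k - s.reg 2, by omega, by omega⟩
  refine ⟨hA, hP, ?_, fun k hk => ?_, fun k hk => ?_, fun k hk => ?_⟩
  · rw [ha.num]
    have h1 : Set.BijOn (fun k => (s'.arr 2 k, s'.arr 3 k)) (Set.Iio (s.reg 2))
        (G.edges : Set Edge) := h.edges.congr fun k hk => (hold k hk).symm
    convert bijOn_append h1 hnew ?_ using 1
    · ext e
      simp only [SetLike.mem_coe, Set.mem_union, Set.mem_ofPred_eq, hd.mem_edges]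
      by_cases h2 : Inc v e <;> simp [h2]
    · rw [Set.disjoint_left]
      exact fun e he he' => ((hd.mem_edges e).1 he).2 he'.2
  · rcases hcase k hk with h1 | ⟨i, hi, rfl⟩
    · rw [(ha.old k h1).2.2.1, hold k h1, h.rank k h1]
      exact hd.rank_eq _ (h.edges.mapsTo h1)
    · rw [(ha.new i hi).2.2.1, hrk i hi]
  · rcases hcase k hk with h1 | ⟨i, hi, rfl⟩
    · rw [(ha.old k h1).2.2.2, hold k h1]
      exact h.matched k h1
    · exact fun h1 => absurd (hnew.mapsTo hi).2 ((hd.mem_edges _).1 (hM h1)).2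
  · rcases hcase k hk with h1 | ⟨i, hi, rfl⟩
    · rw [(ha.old k h1).2.2.2, hold k h1]
      exact h.unmatched k h1
    · exact fun _ => (ha.new i hi).2.2.2

theorem Instance.IsDeletion.trunc_eq {G H : Instance} {v : Vertex} (h : Instance.IsDeletion H G v)
    {M : Finset Edge} (hM : M ⊆ G.edges) (r : ℕ) : H.trunc r M = G.trunc r M :=
  Instance.trunc_congr (fun e he => (h.rank_eq e (hM he)).symm) r

/-- The length of the list of a new vertex. -/
theorem card_list_le {s : State} {list : ℕ → ℕ} (h : Lists s list) {S : Finset ℕ}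
    (hS : ∀ x, list x ≠ 0 → x ∈ S) : s.reg 4 ≤ S.card := by
  rw [← Finset.card_range (s.reg 4)]
  refine Finset.card_le_card_of_injOn (s.arr 11) (fun i hi => ?_) ?_
  · exact hS _ (h.1.mapsTo (by simpa using hi))
  · rw [Finset.coe_range]
    exact h.1.injOn

theorem add_time {l n₀ n₁ m x : ℕ} (hl : l ≤ n₀ + n₁) (hx : 4 ≤ x) :
    100 * (l + 1) + 20000 * (n₀ + n₁ + 1 + (m + l) + 1) * x ≤
      50000 * (n₀ + n₁ + m + 1) * x := by
  obtain ⟨w, hw⟩ : ∃ w, w = n₀ + n₁ + m + 1 := ⟨_, rfl⟩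
  rw [← hw]
  have h1 : 20000 * (n₀ + n₁ + 1 + (m + l) + 1) * x ≤ 20000 * (2 * w) * x := by
    gcongr
    omega
  have h2 : w * 4 ≤ w * x := by gcongr
  calc 100 * (l + 1) + 20000 * (n₀ + n₁ + 1 + (m + l) + 1) * x
      ≤ 100 * w + 20000 * (2 * w) * x := by omega
    _ = 100 * w + 40000 * (w * x) := by ring
    _ ≤ 50000 * (w * x) := by omega
    _ = 50000 * w * x := by ring

theorem addApplicant_spec {s : State} {G : Instance} {M : Finset Edge} {a : ℕ} {list : ℕ → ℕ}
    (hv : (Update.addApplicant a list).Valid G) (h : Stores s G M)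
    (hq : Requests s (Update.addApplicant a list)) (r : ℕ) :
    ∃ s' K, Runs (.insertVertex 0 ;; .core) s
      (50000 * (G.numVertices + G.numEdges + 1) * (r + 4 + (M \ G.trunc r M).card)) s' ∧
      Stores s' ((Update.addApplicant a list).apply G) K := by
  obtain ⟨hq3, hl, hl'⟩ := hq
  have hd := Update.isDeletion_addApplicant hv
  have hM := h.rankMaximal
  obtain ⟨s₁, hr₁, h15, h16, hb, ab, hb', ab', ha⟩ := insertVertex_spec (Or.inl rfl) s
  have ha0 : s₁.reg 0 = s.reg 0 + 1 := hb
  have ha1 : s₁.reg 1 = s.reg 1 := hb'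
  have e2 : ∀ i < s.reg 4, s₁.arr 2 (s.reg 2 + i) = a := fun i hi => (ha.new i hi).1.trans hq3
  have e3 : ∀ i < s.reg 4, s₁.arr 3 (s.reg 2 + i) = s.arr 11 i := fun i hi => (ha.new i hi).2.1
  have hL : Loaded s₁ ((Update.addApplicant a list).apply G) M := by
    refine h.loaded.append hM.1 hd ha ?_ ?_ ?_ ?_
    · rw [ha0, ab, hq3]
      have := bijOn_update h.applicants (x := a) (by simpa using hv.1)
      rw [← Finset.coe_insert] at this
      exact this
    · rw [ha1, show s₁.arr 1 = s.arr 1 from ab']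
      exact h.posts
    · refine ⟨fun i hi => ?_, fun i hi j hj hij => ?_, ?_⟩
      · simp only [e2 i hi, e3 i hi]
        refine ⟨?_, Or.inl rfl⟩
        rw [Instance.mem_edges, Update.rank_addApplicant hv, if_pos rfl]
        exact hl.mapsTo hi
      · simp only [e2 i hi, e3 i hi, e2 j hj, e3 j hj, Prod.mk.injEq, true_and] at hij
        exact hl.injOn hi hj hij
      · rintro ⟨x, p⟩ ⟨h1, h2⟩
        obtain rfl : a = x := by simpa [Inc] using h2
        rw [Instance.mem_edges, Update.rank_addApplicant hv, if_pos rfl] at h1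
        obtain ⟨i, hi, rfl⟩ := hl.surjOn h1
        exact ⟨i, hi, by simp only [e2 i hi, e3 i hi]⟩
    · intro i hi
      rw [hl' i hi, e2 i hi, e3 i hi, Update.rank_addApplicant hv, if_pos rfl]
  obtain ⟨s₂, K, hr₂, h₂⟩ := core_spec hL (z := Sum.inl a)
    (Or.inl ⟨h15, by rw [h16, hq3]; exact Finset.mem_insert_self _ _, by rw [h16, hq3]⟩)
    (hd.good_of_add hM) r
  refine ⟨s₂, K, (hr₁.seq hr₂).mono ?_, h₂⟩
  have hl4 := card_list_le ⟨hl, hl'⟩ hv.2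
  rw [card_eq_of_bijOn h.posts] at hl4
  rw [Instance.numVertices, Instance.numEdges, card_eq_of_bijOn h.applicants,
    card_eq_of_bijOn h.posts, card_eq_of_bijOn h.edges, ha0, ha1, ha.num, hd.trunc_eq hM.1]
  exact le_trans (by ring_nf; rfl) (add_time (show s.reg 4 ≤ s.reg 0 + s.reg 1 by omega)
    (show 4 ≤ r + 4 + (M \ G.trunc r M).card by omega))

theorem addPost_spec {s : State} {G : Instance} {M : Finset Edge} {p : ℕ} {list : ℕ → ℕ}
    (hv : (Update.addPost p list).Valid G) (h : Stores s G M)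
    (hq : Requests s (Update.addPost p list)) (r : ℕ) :
    ∃ s' K, Runs (.insertVertex 1 ;; .core) s
      (50000 * (G.numVertices + G.numEdges + 1) * (r + 4 + (M \ G.trunc r M).card)) s' ∧
      Stores s' ((Update.addPost p list).apply G) K := by
  obtain ⟨hq3, hl, hl'⟩ := hq
  have hd := Update.isDeletion_addPost hv
  have hM := h.rankMaximal
  obtain ⟨s₁, hr₁, h15, h16, hb, ab, hb', ab', ha⟩ := insertVertex_spec (Or.inr rfl) s
  have ha0 : s₁.reg 0 = s.reg 0 := hb'
  have ha1 : s₁.reg 1 = s.reg 1 + 1 := hb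
  have e2 : ∀ i < s.reg 4, s₁.arr 2 (s.reg 2 + i) = s.arr 11 i := fun i hi => (ha.new i hi).2.1
  have e3 : ∀ i < s.reg 4, s₁.arr 3 (s.reg 2 + i) = p := fun i hi => (ha.new i hi).1.trans hq3
  have hL : Loaded s₁ ((Update.addPost p list).apply G) M := by
    refine h.loaded.append hM.1 hd ha ?_ ?_ ?_ ?_
    · rw [ha0, show s₁.arr 0 = s.arr 0 from ab']
      exact h.applicants
    · rw [ha1, ab, hq3]
      have := bijOn_update h.posts (x := p) (by simpa using hv.1)
      rw [← Finset.coe_insert] at this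
      exact this
    · refine ⟨fun i hi => ?_, fun i hi j hj hij => ?_, ?_⟩
      · simp only [e2 i hi, e3 i hi]
        refine ⟨?_, Or.inr rfl⟩
        rw [Instance.mem_edges, Update.rank_addPost hv, if_pos rfl]
        exact hl.mapsTo hi
      · simp only [e2 i hi, e3 i hi, e2 j hj, e3 j hj, Prod.mk.injEq, and_true] at hij
        exact hl.injOn hi hj hij
      · rintro ⟨a, x⟩ ⟨h1, h2⟩
        obtain rfl : p = x := by simpa [Inc] using h2
        rw [Instance.mem_edges, Update.rank_addPost hv, if_pos rfl] at h1
        obtain ⟨i, hi, rfl⟩ := hl.surjOn h1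
        exact ⟨i, hi, by simp only [e2 i hi, e3 i hi]⟩
    · intro i hi
      rw [hl' i hi, e2 i hi, e3 i hi, Update.rank_addPost hv, if_pos rfl]
  obtain ⟨s₂, K, hr₂, h₂⟩ := core_spec hL (z := Sum.inr p)
    (Or.inr (Or.inl ⟨h15, by rw [h16, hq3]; exact Finset.mem_insert_self _ _, by rw [h16, hq3]⟩))
    (hd.good_of_add hM) r
  refine ⟨s₂, K, (hr₁.seq hr₂).mono ?_, h₂⟩
  have hl4 := card_list_le ⟨hl, hl'⟩ hv.2
  rw [card_eq_of_bijOn h.applicants] at hl4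
  rw [Instance.numVertices, Instance.numEdges, card_eq_of_bijOn h.applicants,
    card_eq_of_bijOn h.posts, card_eq_of_bijOn h.edges, ha0, ha1, ha.num, hd.trunc_eq hM.1]
  exact le_trans (by ring_nf; rfl) (add_time (show s.reg 4 ≤ s.reg 0 + s.reg 1 by omega)
    (show 4 ≤ r + 4 + (M \ G.trunc r M).card by omega))

/-- Keeping the entries of a list with the property `p`. -/
theorem bijOn_filter {α : Type*} {f f' : ℕ → α} {g : ℕ → ℕ} {n c : ℕ} {S : Set α} {p : α → Prop}
    (h : Set.BijOn f (Set.Iio n) S) (hg : Set.BijOn g (Set.Iio c) {k | k < n ∧ p (f k)})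
    (hf : ∀ k < c, f' k = f (g k)) : Set.BijOn f' (Set.Iio c) {x | x ∈ S ∧ p x} := by
  refine ⟨fun k hk => ?_, fun k hk l hl hkl => ?_, ?_⟩
  · rw [hf k hk]
    exact ⟨h.mapsTo (hg.mapsTo hk).1, (hg.mapsTo hk).2⟩
  · rw [hf k hk, hf l hl] at hkl
    exact hg.injOn hk hl (h.injOn (hg.mapsTo hk).1 (hg.mapsTo hl).1 hkl)
  · rintro x ⟨hx, hp⟩
    obtain ⟨k, hk, rfl⟩ := h.surjOn hx
    obtain ⟨i, hi, rfl⟩ := hg.surjOn (show k ∈ {k | k < n ∧ p (f k)} from ⟨hk, hp⟩)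
    exact ⟨i, hi, hf i hi⟩

theorem eraseVertex_spec {b : ℕ} (hb : b = 0 ∨ b = 1) (s : State) :
    ∃ s', Runs (.eraseVertex b) s (100 * (s.reg 2 + s.reg b + 3)) s' ∧
      (∃ g : ℕ → ℕ,
        Set.BijOn g (Set.Iio (s'.reg 2)) {k | k < s.reg 2 ∧ s.arr (2 + b) k ≠ s.reg 3} ∧
        ∀ k < s'.reg 2, s'.arr 2 k = s.arr 2 (g k) ∧ s'.arr 3 k = s.arr 3 (g k) ∧
          s'.arr 4 k = s.arr 4 (g k) ∧ s'.arr 5 k = s.arr 5 (g k)) ∧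
      (∃ g : ℕ → ℕ, Set.BijOn g (Set.Iio (s'.reg b)) {k | k < s.reg b ∧ s.arr b k ≠ s.reg 3} ∧
        ∀ k < s'.reg b, s'.arr b k = s.arr b (g k)) ∧
      s'.reg (1 - b) = s.reg (1 - b) ∧ s'.arr (1 - b) = s.arr (1 - b) ∧
      ((s'.reg 15 = 2 ∧ ∀ k < s.reg 2, s.arr (2 + b) k = s.reg 3 → s.arr 5 k ≠ 1) ∨
        (s'.reg 15 = 1 - b ∧ ∃ k < s.reg 2, s.arr (2 + b) k = s.reg 3 ∧ s.arr 5 k = 1 ∧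
          s'.reg 16 = s.arr (3 - b) k)) := by
  obtain ⟨s₁, hr₁, h₁⟩ := keepEdges_spec hb s
  have f₁ := hr₁.frame
  have hr₂ := Runs.ev (c := .copy 2 24 ;; .const 24 0) rfl s₁
  obtain ⟨s₂, hs₂⟩ : ∃ s₂, s₂ = (Prog.copy 2 24 ;; .const 24 0).ev s₁ := ⟨_, rfl⟩
  rw [← hs₂] at hr₂
  have f₂ := hr₂.frame
  have k24 : s₂.reg 24 = 0 := by simp [hs₂, Prog.ev]
  have k2 : s₂.reg 2 = s₁.reg 24 := by simp [hs₂, Prog.ev]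
  have ka : s₂.arr = s₁.arr := by simp [hs₂, Prog.ev]
  obtain ⟨s₃, hr₃, g, hg, hg'⟩ := keepVertices_spec hb k24
  have f₃ := hr₃.frame
  have hfl : (Prog.copy b 24).Flat = true := by rcases hb with rfl | rfl <;> rfl
  have hr₄ := Runs.ev hfl s₃
  obtain ⟨s₄, hs₄⟩ : ∃ s₄, s₄ = (Prog.copy b 24).ev s₃ := ⟨_, rfl⟩
  rw [← hs₄] at hr₄
  have c3 : s₂.reg 3 = s.reg 3 := by
    rw [f₂.1 3 (by decide)]
    rcases hb with rfl | rfl <;> exact f₁.1 3 (by decide)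
  have cb : s₂.reg b = s.reg b := by
    rcases hb with rfl | rfl
    · rw [f₂.1 0 (by decide), f₁.1 0 (by decide)]
    · rw [f₂.1 1 (by decide), f₁.1 1 (by decide)]
  have cab : s₂.arr b = s.arr b := by
    rw [ka]
    rcases hb with rfl | rfl
    · exact f₁.2 0 (by decide)
    · exact f₁.2 1 (by decide)
  have d24 : s₄.reg b = s₃.reg 24 := by simp [hs₄, Prog.ev]
  have dr : ∀ x, x ≠ b → s₄.reg x = s₃.reg x := fun x hx => by simp [hs₄, Prog.ev, hx]
  have da : s₄.arr = s₃.arr := by simp [hs₄, Prog.ev]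
  have d2 : s₄.reg 2 = s₁.reg 24 := by
    rw [dr 2 (by omega), ← k2]
    rcases hb with rfl | rfl <;> exact f₃.1 2 (by decide)
  have d15 : s₄.reg 15 = s₁.reg 15 := by
    rw [dr 15 (by omega), ← f₂.1 15 (by decide)]
    rcases hb with rfl | rfl <;> exact f₃.1 15 (by decide)
  have d16 : s₄.reg 16 = s₁.reg 16 := by
    rw [dr 16 (by omega), ← f₂.1 16 (by decide)]
    rcases hb with rfl | rfl <;> exact f₃.1 16 (by decide)
  have e2 : s₄.arr 2 = s₁.arr 2 := by
    rw [da, ← ka]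
    rcases hb with rfl | rfl <;> exact f₃.2 2 (by decide)
  have e3 : s₄.arr 3 = s₁.arr 3 := by
    rw [da, ← ka]
    rcases hb with rfl | rfl <;> exact f₃.2 3 (by decide)
  have e4 : s₄.arr 4 = s₁.arr 4 := by
    rw [da, ← ka]
    rcases hb with rfl | rfl <;> exact f₃.2 4 (by decide)
  have e5 : s₄.arr 5 = s₁.arr 5 := by
    rw [da, ← ka]
    rcases hb with rfl | rfl <;> exact f₃.2 5 (by decide)
  rw [cb, cab, c3] at hg
  rw [cab] at hg'
  rw [cb] at hr₃
  refine ⟨s₄, (hr₁.seq (hr₂.seq (hr₃.seq hr₄))).mono ?_, ?_, ?_, ?_, ?_, ?_⟩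
  · simp only [Prog.cost]
    omega
  · rw [d2, e2, e3, e4, e5]
    exact h₁.kept
  · rw [d24, da]
    exact ⟨g, hg, hg'⟩
  · rw [dr (1 - b) (by omega)]
    rcases hb with rfl | rfl
    · rw [f₃.1 1 (by decide), f₂.1 1 (by decide), f₁.1 1 (by decide)]
    · rw [f₃.1 0 (by decide), f₂.1 0 (by decide), f₁.1 0 (by decide)]
  · rw [da]
    rcases hb with rfl | rfl
    · rw [f₃.2 1 (by decide), f₂.2 1 (by decide), f₁.2 1 (by decide)]
    · rw [f₃.2 0 (by decide), f₂.2 0 (by decide), f₁.2 0 (by decide)]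
  · rw [d15, d16]
    exact h₁.partner

open Classical in
/-- The edges of `M` without the vertex `v`. -/
noncomputable def avoid (v : Vertex) (M : Finset Edge) : Finset Edge := M.filter (fun e => ¬ Inc v e)

@[simp] theorem mem_avoid {v : Vertex} {M : Finset Edge} {e : Edge} :
    e ∈ avoid v M ↔ e ∈ M ∧ ¬ Inc v e := by simp [avoid]

theorem Loaded.erase {s s' : State} {G H : Instance} {M : Finset Edge} {v : Vertex} {q : ℕ → Prop}
    (h : Loaded s G M) (hd : Instance.IsDeletion G H v)
    (hq : ∀ k < s.reg 2, q k ↔ ¬ Inc v (s.arr 2 k, s.arr 3 k))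
    (hk : ∃ g : ℕ → ℕ, Set.BijOn g (Set.Iio (s'.reg 2)) {k | k < s.reg 2 ∧ q k} ∧
        ∀ k < s'.reg 2, s'.arr 2 k = s.arr 2 (g k) ∧ s'.arr 3 k = s.arr 3 (g k) ∧
          s'.arr 4 k = s.arr 4 (g k) ∧ s'.arr 5 k = s.arr 5 (g k))
    (hA : Set.BijOn (s'.arr 0) (Set.Iio (s'.reg 0)) (H.applicants : Set ℕ))
    (hP : Set.BijOn (s'.arr 1) (Set.Iio (s'.reg 1)) (H.posts : Set ℕ)) :
    Loaded s' H (avoid v M) := by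
  obtain ⟨g, hg, hg'⟩ := hk
  have hlt : ∀ k < s'.reg 2, g k < s.reg 2 ∧ ¬ Inc v (s.arr 2 (g k), s.arr 3 (g k)) := fun k hk =>
    ⟨(hg.mapsTo hk).1, (hq _ (hg.mapsTo hk).1).1 (hg.mapsTo hk).2⟩
  have he : ∀ k < s'.reg 2, (s'.arr 2 k, s'.arr 3 k) = (s.arr 2 (g k), s.arr 3 (g k)) :=
    fun k hk => by rw [(hg' k hk).1, (hg' k hk).2.1]
  have hE : Set.BijOn (fun k => (s'.arr 2 k, s'.arr 3 k)) (Set.Iio (s'.reg 2))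
      (H.edges : Set Edge) := by
    convert bijOn_filter (p := fun e => ¬ Inc v e) h.edges (g := g) ?_ he using 1
    · ext e
      simp [hd.mem_edges]
    · convert hg using 1
      ext k
      exact and_congr_right fun hk => (hq k hk).symm
  refine ⟨hA, hP, hE, fun k hk => ?_, fun k hk => ?_, fun k hk => ?_⟩
  · rw [(hg' k hk).2.2.1, h.rank _ (hlt k hk).1, hd.rank_eq _ (hE.mapsTo hk), he k hk]
  · rw [(hg' k hk).2.2.2, he k hk, mem_avoid]
    exact fun h1 => h.matched _ (hlt k hk).1 h1.1
  · rw [(hg' k hk).2.2.2, he k hk, mem_avoid]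
    exact fun h1 => h.unmatched _ (hlt k hk).1 fun h2 => h1 ⟨h2, (hlt k hk).2⟩

theorem del_time {n₀ n₁ m n₀' n₁' m' b x y : ℕ} (h0 : n₀' ≤ n₀) (h1 : n₁' ≤ n₁) (hm : m' ≤ m)
    (hb : b ≤ n₀ + n₁) (hx : 4 ≤ x) (hy : y ≤ x) :
    100 * (m + b + 3) + 20000 * (n₀' + n₁' + m' + 1) * y ≤ 50000 * (n₀ + n₁ + m + 1) * x := by
  obtain ⟨w, hw⟩ : ∃ w, w = n₀ + n₁ + m + 1 := ⟨_, rfl⟩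
  rw [← hw]
  have h1 : 20000 * (n₀' + n₁' + m' + 1) * y ≤ 20000 * w * x := by
    gcongr
    omega
  have h2 : w * 4 ≤ w * x := by gcongr
  calc 100 * (m + b + 3) + 20000 * (n₀' + n₁' + m' + 1) * y
      ≤ 300 * w + 20000 * w * x := by omega
    _ = 300 * w + 20000 * (w * x) := by ring
    _ ≤ 50000 * (w * x) := by omega
    _ = 50000 * w * x := by ring

theorem card_avoid_trunc_le {G H : Instance} {v : Vertex} (hd : Instance.IsDeletion G H v)
    {M : Finset Edge} (hM : M ⊆ G.edges) (r : ℕ) :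
    (avoid v M \ H.trunc r (avoid v M)).card ≤ (M \ G.trunc r M).card := by
  refine Finset.card_le_card fun e he => ?_
  simp only [Finset.mem_sdiff, mem_avoid, Instance.mem_trunc, not_and, not_le] at he ⊢
  have h1 := hd.rank_eq e ((hd.mem_edges e).2 ⟨hM he.1.1, he.1.2⟩)
  exact ⟨he.1.1, fun _ => h1 ▸ he.2 he.1⟩

theorem delApplicant_spec {s : State} {G : Instance} {M : Finset Edge} {a : ℕ}
    (h : Stores s G M) (hq : Requests s (Update.delApplicant a)) (r : ℕ) :
    ∃ s' K, Runs (.eraseVertex 0 ;; .core) s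
      (50000 * (G.numVertices + G.numEdges + 1) * (r + 4 + (M \ G.trunc r M).card)) s' ∧
      Stores s' ((Update.delApplicant a).apply G) K := by
  have hq3 : s.reg 3 = a := hq
  have hd := Update.isDeletion_delApplicant (G := G) a
  have hM := h.rankMaximal
  obtain ⟨s₁, hr₁, hE, ⟨g, hg, hg'⟩, hr, hA, hz⟩ := eraseVertex_spec (Or.inl rfl) s
  rw [hq3] at hE hg hz
  have ha1 : s₁.reg 1 = s.reg 1 := hr
  have hmem : ∀ k < s.reg 2, (s.arr 2 k, s.arr 3 k) ∈ G.edges := fun k hk => h.edges.mapsTo hk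
  have hL : Loaded s₁ ((Update.delApplicant a).apply G) (avoid (Sum.inl a) M) := by
    refine h.loaded.erase hd (q := fun k => s.arr 2 k ≠ a) ?_ hE ?_ ?_
    · intro k hk
      simp [Inc, eq_comm]
    · convert bijOn_filter (p := fun x => x ≠ a) h.applicants hg hg' using 1
      ext x
      simp [Update.apply, Update.mk, and_comm]
    · rw [ha1, show s₁.arr 1 = s.arr 1 from hA]
      exact h.posts
  obtain ⟨z, hz1, hz2⟩ : ∃ z, Encodes s₁ ((Update.delApplicant a).apply G) z ∧
      ((Update.delApplicant a).apply G).Good (avoid (Sum.inl a) M) z := by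
    rcases hz with ⟨h15, h1⟩ | ⟨h15, k, hk, h1, h2, h16⟩
    · refine ⟨Sum.inl a, Or.inr (Or.inr ⟨h15, fun x hx hax => ?_, fun p hp => by simp⟩), ?_⟩
      · obtain rfl := Sum.inl.inj hax
        simp [Update.apply, Update.mk] at hx
      · refine hd.good_of_delete hM (fun e => mem_avoid) (fun e he hi => ?_)
          fun ⟨e, he, hi⟩ => (mem_avoid.1 he).2 hi
        obtain ⟨k, hk, rfl⟩ := h.edges.surjOn (hM.1 he)
        have h3 : s.arr 2 k = a := by simpa [Inc, eq_comm] using hi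
        exact absurd (h.matched k hk he) (h1 k hk h3)
    · have hkM : (s.arr 2 k, s.arr 3 k) ∈ M := by
        by_contra h3
        rw [h.unmatched k hk h3] at h2
        simp at h2
      have h1 : s.arr 2 k = a := h1
      have hi : Inc (Sum.inl a) (s.arr 2 k, s.arr 3 k) := Or.inl (by rw [h1])
      have h16 : s₁.reg 16 = s.arr 3 k := h16
      refine ⟨Sum.inr (s.arr 3 k), Or.inr (Or.inl ⟨h15, ?_, by rw [h16]⟩), ?_⟩
      · rw [h16]
        exact (Finset.mem_product.1 (Finset.mem_filter.1 (hmem k hk)).1).2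
      · refine hd.good_of_delete hM (fun e => mem_avoid) (fun e he hi' => ?_) ?_
        · rw [hM.2.1.eq he hkM hi' hi]
          exact ⟨Or.inr rfl, by simp⟩
        · rintro ⟨e, he, hi'⟩
          rw [mem_avoid] at he
          refine he.2 ?_
          rw [hM.2.1.eq he.1 hkM hi' (Or.inr rfl)]
          exact hi
  obtain ⟨s₂, K, hr₂, h₂⟩ := core_spec hL hz1 hz2 r
  refine ⟨s₂, K, (hr₁.seq hr₂).mono ?_, h₂⟩
  have c0 := Finset.card_le_card (Finset.erase_subset a G.applicants)
  have c2 : ((Update.delApplicant a).apply G).edges.card ≤ G.edges.card :=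
    Finset.card_le_card fun e he => ((hd.mem_edges e).1 he).1
  rw [show G.applicants.erase a = ((Update.delApplicant a).apply G).applicants from rfl,
    card_eq_of_bijOn hL.applicants, card_eq_of_bijOn h.applicants] at c0
  rw [card_eq_of_bijOn hL.edges, card_eq_of_bijOn h.edges] at c2
  rw [Instance.numVertices, Instance.numEdges, card_eq_of_bijOn h.applicants,
    card_eq_of_bijOn h.posts, card_eq_of_bijOn h.edges]
  have := card_avoid_trunc_le hd hM.1 r
  exact del_time c0 ha1.le c2 (by omega) (by omega) (by omega)

theorem delPost_spec {s : State} {G : Instance} {M : Finset Edge} {p : ℕ}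
    (h : Stores s G M) (hq : Requests s (Update.delPost p)) (r : ℕ) :
    ∃ s' K, Runs (.eraseVertex 1 ;; .core) s
      (50000 * (G.numVertices + G.numEdges + 1) * (r + 4 + (M \ G.trunc r M).card)) s' ∧
      Stores s' ((Update.delPost p).apply G) K := by
  have hq3 : s.reg 3 = p := hq
  have hd := Update.isDeletion_delPost (G := G) p
  have hM := h.rankMaximal
  obtain ⟨s₁, hr₁, hE, ⟨g, hg, hg'⟩, hr, hA, hz⟩ := eraseVertex_spec (Or.inr rfl) s
  rw [hq3] at hE hg hz
  have ha0 : s₁.reg 0 = s.reg 0 := hr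
  have hmem : ∀ k < s.reg 2, (s.arr 2 k, s.arr 3 k) ∈ G.edges := fun k hk => h.edges.mapsTo hk
  have hL : Loaded s₁ ((Update.delPost p).apply G) (avoid (Sum.inr p) M) := by
    refine h.loaded.erase hd (q := fun k => s.arr 3 k ≠ p) ?_ hE ?_ ?_
    · intro k hk
      simp [Inc, eq_comm]
    · rw [ha0, show s₁.arr 0 = s.arr 0 from hA]
      exact h.applicants
    · convert bijOn_filter (p := fun x => x ≠ p) h.posts hg hg' using 1
      ext x
      simp [Update.apply, Update.mk, and_comm]
  obtain ⟨z, hz1, hz2⟩ : ∃ z, Encodes s₁ ((Update.delPost p).apply G) z ∧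
      ((Update.delPost p).apply G).Good (avoid (Sum.inr p) M) z := by
    rcases hz with ⟨h15, h1⟩ | ⟨h15, k, hk, h1, h2, h16⟩
    · refine ⟨Sum.inr p, Or.inr (Or.inr ⟨h15, fun x hx => by simp, fun x hx hax => ?_⟩), ?_⟩
      · obtain rfl := Sum.inr.inj hax
        simp [Update.apply, Update.mk] at hx
      · refine hd.good_of_delete hM (fun e => mem_avoid) (fun e he hi => ?_)
          fun ⟨e, he, hi⟩ => (mem_avoid.1 he).2 hi
        obtain ⟨k, hk, rfl⟩ := h.edges.surjOn (hM.1 he)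
        have h3 : s.arr 3 k = p := by simpa [Inc, eq_comm] using hi
        exact absurd (h.matched k hk he) (h1 k hk h3)
    · have hkM : (s.arr 2 k, s.arr 3 k) ∈ M := by
        by_contra h3
        rw [h.unmatched k hk h3] at h2
        simp at h2
      have h1 : s.arr 3 k = p := h1
      have hi : Inc (Sum.inr p) (s.arr 2 k, s.arr 3 k) := Or.inr (by rw [h1])
      have h16 : s₁.reg 16 = s.arr 2 k := h16
      refine ⟨Sum.inl (s.arr 2 k), Or.inl ⟨h15, ?_, by rw [h16]⟩, ?_⟩
      · rw [h16]
        exact (Finset.mem_product.1 (Finset.mem_filter.1 (hmem k hk)).1).1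
      · refine hd.good_of_delete hM (fun e => mem_avoid) (fun e he hi' => ?_) ?_
        · rw [hM.2.1.eq he hkM hi' hi]
          exact ⟨Or.inl rfl, by simp⟩
        · rintro ⟨e, he, hi'⟩
          rw [mem_avoid] at he
          refine he.2 ?_
          rw [hM.2.1.eq he.1 hkM hi' (Or.inl rfl)]
          exact hi
  obtain ⟨s₂, K, hr₂, h₂⟩ := core_spec hL hz1 hz2 r
  refine ⟨s₂, K, (hr₁.seq hr₂).mono ?_, h₂⟩
  have c1 := Finset.card_le_card (Finset.erase_subset p G.posts)
  have c2 : ((Update.delPost p).apply G).edges.card ≤ G.edges.card :=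
    Finset.card_le_card fun e he => ((hd.mem_edges e).1 he).1
  rw [show G.posts.erase p = ((Update.delPost p).apply G).posts from rfl,
    card_eq_of_bijOn hL.posts, card_eq_of_bijOn h.posts] at c1
  rw [card_eq_of_bijOn hL.edges, card_eq_of_bijOn h.edges] at c2
  rw [Instance.numVertices, Instance.numEdges, card_eq_of_bijOn h.applicants,
    card_eq_of_bijOn h.posts, card_eq_of_bijOn h.edges]
  have := card_avoid_trunc_le hd hM.1 r
  exact del_time ha0.le c1 c2 (by omega) (by omega) (by omega)

/-! ### Edge updates by vertex updates -/

namespace Prog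

/-- The next edge is listed if it has the applicant in register `3` and not the post in register `6`. -/
def gatherEdge : Prog :=
  read 20 2 19 ;; read 21 3 19 ;;
    ite (.eq 20 3) (ite (.eq 21 6) skip
      (write 11 4 21 ;; read 22 4 19 ;; write 12 4 22 ;; succ 4)) skip

/-- The edges of the applicant in register `3`, except for the one to the post in register `4`, are
written to the list of the request. -/
def gather : Prog := (copy 6 4 ;; const 4 0) ;; each 2 gatherEdge

/-- The list of `gather`, with the edge to that post and of the rank in register `5` appended. -/
def gatherWith : Prog := gather ;; write 11 4 6 ;; write 12 4 5 ;; succ 4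

end Prog

theorem Stores.congr {s s' : State} {G : Instance} {M : Finset Edge} (h : Stores s G M)
    (hr : ∀ x ≤ 2, s'.reg x = s.reg x) (ha : ∀ b ≤ 10, s'.arr b = s.arr b) : Stores s' G M := by
  constructor
  all_goals
    try rw [hr 0 (by omega)]
    try rw [hr 1 (by omega)]
    try rw [hr 2 (by omega)]
    try rw [ha 0 (by omega)]
    try rw [ha 1 (by omega)]
    try rw [ha 2 (by omega)]
    try rw [ha 3 (by omega)]
    try rw [ha 4 (by omega)]
    try rw [ha 5 (by omega)]
    try rw [ha 6 (by omega)]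
    try rw [ha 7 (by omega)]
    try rw [ha 8 (by omega)]
    try rw [ha 9 (by omega)]
    try rw [ha 10 (by omega)]
  exacts [h.applicants, h.posts, h.edges, h.rank, h.rankMaximal, h.matched, h.unmatched, h.deleted,
    h.applicantLabel, h.postLabel]

theorem gather_spec {s : State} {G : Instance} {M : Finset Edge} (h : Stores s G M) :
    ∃ s', Runs .gather s (100 * (s.reg 2 + 1)) s' ∧ s'.reg 6 = s.reg 4 ∧
      Lists s' (fun x => if x = s.reg 4 then 0 else G.rank (s.reg 3, x)) := by
  have hr₁ := Runs.ev (c := .copy 6 4 ;; .const 4 0) rfl s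
  have f₁ := hr₁.frame
  obtain ⟨s₁, hs₁⟩ : ∃ s₁, s₁ = (Prog.copy 6 4 ;; .const 4 0).ev s := ⟨_, rfl⟩
  rw [← hs₁] at hr₁ f₁
  have k6 : s₁.reg 6 = s.reg 4 := by simp [hs₁, Prog.ev]
  have k4 : s₁.reg 4 = 0 := by simp [hs₁, Prog.ev]
  have k2 : s₁.reg 2 = s.reg 2 := f₁.1 2 (by decide)
  obtain ⟨s', hr, -, g, hg, hg'⟩ := Runs.each (y := 2) (s := s₁) (c := .gatherEdge) rfl
    (by decide) (by decide) (by decide)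
    (fun j t => t.reg 4 ≤ j ∧ ∃ g : ℕ → ℕ,
      Set.BijOn g (Set.Iio (t.reg 4)) {k | k < j ∧ s.arr 2 k = s.reg 3 ∧ s.arr 3 k ≠ s.reg 4} ∧
      ∀ k < t.reg 4, t.arr 11 k = s.arr 3 (g k) ∧ t.arr 12 k = s.arr 4 (g k))
    (by simp [k4, Set.bijOn_empty_iff_left])
    (by
      intro t j hf hj hlt ⟨hle, g, hg, hg'⟩
      have e3 : t.reg 3 = s.reg 3 := by rw [hf.1 3 (by decide), f₁.1 3 (by decide)]
      have e6 : t.reg 6 = s.reg 4 := by rw [hf.1 6 (by decide), k6]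
      have a2 : t.arr 2 = s.arr 2 := by rw [hf.2 2 (by decide), f₁.2 2 (by decide)]
      have a3 : t.arr 3 = s.arr 3 := by rw [hf.2 3 (by decide), f₁.2 3 (by decide)]
      have a4 : t.arr 4 = s.arr 4 := by rw [hf.2 4 (by decide), f₁.2 4 (by decide)]
      obtain ⟨t', ht'⟩ : ∃ t', t' = (Prog.gatherEdge ;; .succ 19).ev t := ⟨_, rfl⟩
      rw [← ht']
      by_cases h1 : s.arr 2 j = s.reg 3 ∧ s.arr 3 j ≠ s.reg 4
      · have c4 : t'.reg 4 = t.reg 4 + 1 := by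
          simp [ht', Prog.gatherEdge, Prog.ev, hj, e3, e6, a2, a3, h1.1, h1.2]
        have c11 : t'.arr 11 = Function.update (t.arr 11) (t.reg 4) (s.arr 3 j) := by
          simp [ht', Prog.gatherEdge, Prog.ev, hj, e3, e6, a2, a3, h1.1, h1.2]
        have c12 : t'.arr 12 = Function.update (t.arr 12) (t.reg 4) (s.arr 4 j) := by
          simp [ht', Prog.gatherEdge, Prog.ev, hj, e3, e6, a2, a3, a4, h1.1, h1.2]
        rw [c4, c11, c12]
        refine ⟨by omega, Function.update g (t.reg 4) j, ?_, fun k hk => ?_⟩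
        · convert bijOn_update hg (x := j) (fun h2 => (lt_irrefl j h2.1)) using 1
          ext k
          simp only [Set.mem_ofPred_eq, Set.mem_insert_iff]
          constructor
          · rintro ⟨h2, h3⟩
            by_cases h4 : k = j
            · exact Or.inl h4
            · exact Or.inr ⟨by omega, h3⟩
          · rintro (rfl | ⟨h2, h3⟩)
            · exact ⟨by omega, h1⟩
            · exact ⟨by omega, h3⟩
        · by_cases h2 : k = t.reg 4
          · rw [h2, Function.update_self, Function.update_self, Function.update_self]
            exact ⟨rfl, rfl⟩
          · rw [Function.update_of_ne h2, Function.update_of_ne h2, Function.update_of_ne h2]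
            exact hg' k (by omega)
      · have c4 : t'.reg 4 = t.reg 4 := by
          by_cases h2 : s.arr 2 j = s.reg 3 <;> by_cases h3 : s.arr 3 j = s.reg 4
          · simp [ht', Prog.gatherEdge, Prog.ev, hj, e3, e6, a2, a3, h2, h3]
          · exact absurd ⟨h2, h3⟩ h1
          · simp [ht', Prog.gatherEdge, Prog.ev, hj, e3, e6, a2, a3, h2]
          · simp [ht', Prog.gatherEdge, Prog.ev, hj, e3, e6, a2, a3, h2]
        have ca : t'.arr = t.arr := by
          by_cases h2 : s.arr 2 j = s.reg 3 <;> by_cases h3 : s.arr 3 j = s.reg 4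
          · simp [ht', Prog.gatherEdge, Prog.ev, hj, e3, e6, a2, a3, h2, h3]
          · exact absurd ⟨h2, h3⟩ h1
          · simp [ht', Prog.gatherEdge, Prog.ev, hj, e3, e6, a2, a3, h2]
          · simp [ht', Prog.gatherEdge, Prog.ev, hj, e3, e6, a2, a3, h2]
        rw [c4, ca]
        refine ⟨by omega, g, ?_, hg'⟩
        convert hg using 1
        ext k
        simp only [Set.mem_ofPred_eq]
        constructor
        · rintro ⟨h2, h3⟩
          refine ⟨?_, h3⟩
          have : k ≠ j := fun h4 => h1 (h4 ▸ h3)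
          omega
        · rintro ⟨h2, h3⟩
          exact ⟨by omega, h3⟩)
  have f := hr.frame
  rw [k2] at hr hg
  refine ⟨s', (hr₁.seq hr).mono ?_, ?_, ?_, fun k hk => ?_⟩
  · simp only [Prog.cost, Prog.gatherEdge]
    omega
  · rw [f.1 6 (by decide), k6]
  · refine ⟨fun k hk => ?_, fun k hk l hl hkl => ?_, ?_⟩
    · obtain ⟨h1, h2, h3⟩ := hg.mapsTo hk
      have h4 : (s.arr 2 (g k), s.arr 3 (g k)) ∈ G.edges := h.edges.mapsTo h1
      rw [h2, Instance.mem_edges] at h4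
      rw [(hg' k hk).1]
      show (if _ then _ else _) ≠ 0
      rwa [if_neg h3]
    · obtain ⟨h1, h2, -⟩ := hg.mapsTo hk
      obtain ⟨h1', h2', -⟩ := hg.mapsTo hl
      rw [(hg' k hk).1, (hg' l hl).1] at hkl
      exact hg.injOn hk hl (h.edges.injOn h1 h1' (Prod.ext (h2.trans h2'.symm) hkl))
    · intro x hx
      have hx : (if x = s.reg 4 then 0 else G.rank (s.reg 3, x)) ≠ 0 := hx
      split_ifs at hx with h1
      · exact absurd rfl hx
      · obtain ⟨k, hk, h2⟩ := h.edges.surjOn ((G.mem_edges).2 hx)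
        have h3 := (Prod.ext_iff.1 h2).1
        have h4 := (Prod.ext_iff.1 h2).2
        simp only at h3 h4
        obtain ⟨l, hl, rfl⟩ := hg.surjOn
          (show k ∈ {k | k < s.reg 2 ∧ s.arr 2 k = s.reg 3 ∧ s.arr 3 k ≠ s.reg 4} from
            ⟨hk, h3, by rwa [h4]⟩)
        exact ⟨l, hl, by rw [(hg' l hl).1, h4]⟩
  · obtain ⟨h1, h2, h3⟩ := hg.mapsTo hk
    beta_reduce
    rw [(hg' k hk).1, (hg' k hk).2, if_neg h3, h.rank _ h1, h2]

/-- A vertex deletion from an instance whose rank-maximal matchings use ranks up to `r` only brings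
at most two edges of higher rank into a rank-maximal matching. -/
theorem Instance.IsDeletion.card_le {G H : Instance} {v : Vertex} (h : Instance.IsDeletion G H v)
    {M M' : Finset Edge} (hM : G.IsRankMaximal M) {r : ℕ} (hr : ∀ e ∈ M, G.rank e ≤ r)
    (hM' : H.IsRankMaximal M') : (M' \ H.trunc r M').card ≤ 2 := by
  have hg := h.good_of_add hM'
  have hsub : M' ⊆ G.edges := hg.sub
  have h1 := (hg.card_opt (hM.opt_trunc r)).2
  have h2 := (hg.card_opt (hM.opt_trunc (r + M'.sup G.rank))).1
  rw [G.trunc_eq_self hr] at h1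
  rw [G.trunc_eq_self fun e he => (hr e he).trans (Nat.le_add_right _ _),
    G.trunc_eq_self fun e he => (Finset.le_sup he).trans (Nat.le_add_left _ _)] at h2
  rw [← h.trunc_eq hM'.1, Finset.card_sdiff_of_subset (G.trunc_subset r M')]
  omega

theorem Instance.IsRankMaximal.rank_le {G : Instance} {M : Finset Edge} (h : G.IsRankMaximal M) :
    ∀ e ∈ M, G.rank e ≤ G.maxRank := by
  classical
  intro e he
  unfold Instance.maxRank
  refine Finset.le_sup (f := G.rank) (Finset.mem_filter.2 ⟨h.1 he, M, h, he⟩)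

theorem Instance.IsRankMaximal.sdiff_trunc {G : Instance} {M : Finset Edge}
    (h : G.IsRankMaximal M) : (M \ G.trunc G.maxRank M).card = 0 := by
  rw [G.trunc_eq_self h.rank_le, Finset.sdiff_self, Finset.card_empty]

/-- If `H` agrees with `G` off the applicant `a`, then it arises from `G` by deleting `a` and adding it
back with its edges in `H`. -/
theorem apply_delete_add {G H : Instance} {a : ℕ} (ha : a ∈ G.applicants)
    (hA : H.applicants = G.applicants) (hP : H.posts = G.posts)
    (hr : ∀ e, e.1 ≠ a → H.rank e = G.rank e) :
    (Update.addApplicant a (fun p => H.rank (a, p))).Valid ((Update.delApplicant a).apply G) ∧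
    (Update.addApplicant a (fun p => H.rank (a, p))).apply ((Update.delApplicant a).apply G) =
      H := by
  have hv : (Update.addApplicant a (fun p => H.rank (a, p))).Valid
      ((Update.delApplicant a).apply G) := by
    refine ⟨by simp [Update.apply, Update.mk], fun p hp => ?_⟩
    have := (Finset.mem_product.1 (Finset.mem_filter.1 ((H.mem_edges (e := (a, p))).2 hp)).1).2
    rw [hP] at this
    exact this
  refine ⟨hv, ?_⟩
  ext e
  · simp only [Update.apply, Update.mk, hA, Finset.mem_insert, Finset.mem_erase]
    by_cases h : e = a
    · simp [h, ha]
    · simp [h]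
  · simp [Update.apply, Update.mk, hP]
  · rw [Update.rank_addApplicant hv, Update.rank_delApplicant]
    by_cases h : e.1 = a
    · rw [if_pos h, ← h]
    · rw [if_neg h, if_neg h, hr e h]

/-- An update of the edges of the applicant `a`, once the updated list of its edges is in place. -/
theorem updatesByVertexWithin {G : Instance} {a : ℕ} {u : Update} {before : Prog}
    (ha : a ∈ G.applicants) (hA : (u.apply G).applicants = G.applicants)
    (hP : (u.apply G).posts = G.posts) (hr : ∀ e, e.1 ≠ a → (u.apply G).rank e = G.rank e)
    (hb : ∀ M s, Stores s G M → Requests s u →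
      ∃ s', Runs before s (200 * (G.numVertices + G.numEdges + 1)) s' ∧ Stores s' G M ∧
        s'.reg 3 = a ∧ Lists s' (fun p => (u.apply G).rank (a, p))) :
    UpdatesByVertexWithin (200000 * (G.numVertices + G.numEdges + 1) * (G.maxRank + 6)) before
      (.eraseVertex 0 ;; .core) .skip (.insertVertex 0 ;; .core) G a u := by
  intro M s hs hq
  obtain ⟨s₁, ⟨t₁, ht₁, hr₁⟩, hs₁, h3, hl⟩ := hb M s hs hq
  obtain ⟨s₂, M₁, hR₂, hs₂⟩ := delApplicant_spec (a := a) hs₁ h3 G.maxRank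
  have f₂ := hR₂.frame
  obtain ⟨t₂, ht₂, hr₂⟩ := hR₂
  obtain ⟨hv, he⟩ := apply_delete_add ha hA hP hr
  have hq₂ : Requests s₂ (Update.addApplicant a (fun p => (u.apply G).rank (a, p))) := by
    refine ⟨by rw [f₂.1 3 (by decide), h3], ?_⟩
    unfold Lists
    rw [f₂.2 11 (by decide), f₂.2 12 (by decide), f₂.1 4 (by decide)]
    exact hl
  obtain ⟨s₃, M₂, ⟨t₃, ht₃, hr₃⟩, hs₃⟩ := addApplicant_spec hv hs₂ hq₂ G.maxRank
  rw [he] at hs₃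
  refine ⟨M₁, M₂, s₁, s₂, s₂, s₃, t₁, t₂, 1, t₃, hr₁, hs₁, h3, hr₂, hs₂, .skip _, hs₂, hq₂, hr₃,
    hs₃, ?_⟩
  have hd := Update.isDeletion_delApplicant (G := G) a
  have h4 := hd.card_le hs.rankMaximal hs.rankMaximal.rank_le hs₂.rankMaximal
  rw [hs₁.rankMaximal.sdiff_trunc] at ht₂
  obtain ⟨w, hw⟩ : ∃ w, w = G.numVertices + G.numEdges + 1 := ⟨_, rfl⟩
  have h5 : ((Update.delApplicant a).apply G).numVertices +
      ((Update.delApplicant a).apply G).numEdges + 1 ≤ w := by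
    have h6 : ((Update.delApplicant a).apply G).applicants.card ≤ G.applicants.card :=
      Finset.card_le_card (Finset.erase_subset _ _)
    have h7 : ((Update.delApplicant a).apply G).posts = G.posts := rfl
    have h8 : ((Update.delApplicant a).apply G).edges.card ≤ G.edges.card :=
      Finset.card_le_card fun e he => ((hd.mem_edges e).1 he).1
    simp only [Instance.numVertices, Instance.numEdges, h7] at hw ⊢
    omega
  rw [← hw] at ht₁ ht₂ ⊢
  obtain ⟨x, hx⟩ : ∃ x, x = G.maxRank + 6 := ⟨_, rfl⟩
  have h9 : t₂ ≤ 50000 * w * x := ht₂.trans (by gcongr; omega)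
  have h10 : t₃ ≤ 50000 * w * x := ht₃.trans (by gcongr; omega)
  have h11 : w * 6 ≤ w * x := by
    gcongr
    omega
  rw [← hx]
  calc t₁ + t₂ + 1 + t₃ ≤ 200 * w + 50000 * w * x + w + 50000 * w * x := by omega
    _ = 201 * w + 100000 * (w * x) := by ring
    _ ≤ 200000 * (w * x) := by omega
    _ = 200000 * w * x := by ring

theorem delEdge_spec {G : Instance} {a p : ℕ} (hv : (Update.delEdge a p).Valid G) :
    UpdatesByVertexWithin (200000 * (G.numVertices + G.numEdges + 1) * (G.maxRank + 6)) .gather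
      (.eraseVertex 0 ;; .core) .skip (.insertVertex 0 ;; .core) G a (Update.delEdge a p) := by
  have ha : a ∈ G.applicants := (Finset.mem_product.1 (Finset.mem_filter.1 hv).1).1
  refine updatesByVertexWithin ha rfl rfl (fun e he => ?_) fun M s hs ⟨h3, h4⟩ => ?_
  · rw [Update.rank_delEdge, if_neg fun h => he (by rw [h])]
  · obtain ⟨s', hr, -, hl⟩ := gather_spec hs
    have f := hr.frame
    refine ⟨s', hr.mono ?_, hs.congr (fun x hx => ?_) (fun b hb => ?_), ?_, ?_⟩
    · rw [Instance.numEdges, card_eq_of_bijOn hs.edges]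
      omega
    · interval_cases x <;> exact f.1 _ (by decide)
    · interval_cases b <;> exact f.2 _ (by decide)
    · rw [f.1 3 (by decide), h3]
    · rw [h3, h4] at hl
      convert hl using 1
      ext x
      simp [Update.rank_delEdge]

theorem addEdge_spec {G : Instance} {a p i : ℕ} (hv : (Update.addEdge a p i).Valid G) :
    UpdatesByVertexWithin (200000 * (G.numVertices + G.numEdges + 1) * (G.maxRank + 6))
      .gatherWith (.eraseVertex 0 ;; .core) .skip (.insertVertex 0 ;; .core) G a
      (Update.addEdge a p i) := by
  refine updatesByVertexWithin hv.1 rfl rfl (fun e he => ?_) fun M s hs ⟨h3, h4, h5⟩ => ?_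
  · rw [Update.rank_addEdge hv, if_neg fun h => he (by rw [h])]
  · obtain ⟨s₁, hr₁, h6, hl⟩ := gather_spec hs
    have f₁ := hr₁.frame
    have hr₂ := Runs.ev (c := .write 11 4 6 ;; .write 12 4 5 ;; .succ 4) rfl s₁
    obtain ⟨s₂, hs₂⟩ : ∃ s₂, s₂ = (Prog.write 11 4 6 ;; .write 12 4 5 ;; .succ 4).ev s₁ := ⟨_, rfl⟩
    rw [← hs₂] at hr₂
    have k5 : s₁.reg 5 = i := by rw [f₁.1 5 (by decide), h5]
    have c4 : s₂.reg 4 = s₁.reg 4 + 1 := by simp [hs₂, Prog.ev]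
    have c11 : s₂.arr 11 = Function.update (s₁.arr 11) (s₁.reg 4) p := by
      simp [hs₂, Prog.ev, h6, h4]
    have c12 : s₂.arr 12 = Function.update (s₁.arr 12) (s₁.reg 4) i := by
      simp [hs₂, Prog.ev, k5]
    rw [h3, h4] at hl
    have hr := hr₁.seq hr₂
    have f := hr.frame
    refine ⟨s₂, hr.mono ?_, hs.congr (fun x hx => ?_) (fun b hb => ?_), ?_, ?_, fun k hk => ?_⟩
    · rw [Instance.numEdges, card_eq_of_bijOn hs.edges]
      simp only [Prog.cost]
      omega
    · interval_cases x <;> exact f.1 _ (by decide)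
    · interval_cases b <;> exact f.2 _ (by decide)
    · rw [f.1 3 (by decide), h3]
    · rw [c4, c11]
      convert bijOn_update hl.1 (x := p) (by simp) using 1
      ext x
      have := hv.2.2.2
      simp only [Update.rank_addEdge hv, Set.mem_ofPred_eq, Set.mem_insert_iff, Prod.mk.injEq,
        true_and]
      by_cases h : x = p
      · simp [h]
        omega
      · simp [h]
    · beta_reduce
      rw [Update.rank_addEdge hv, c11, c12]
      by_cases h : k = s₁.reg 4
      · rw [h, Function.update_self, Function.update_self, if_pos rfl]
      · have hk : k < s₁.reg 4 := by omega
        have h7 := hl.1.mapsTo hk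
        have h8 : s₁.arr 11 k ≠ p := fun h8 => h7 (if_pos h8)
        rw [Function.update_of_ne h, Function.update_of_ne h, if_neg (by simpa using h8)]
        exact (hl.2 k hk).trans (if_neg h8)

theorem time_le (n m r x : ℕ) (hx : x ≤ r + 6) :
    200000 * (n + m + 1) * x ≤ 3000000 * (max 1 r * max 1 (m + n)) := by
  have h1 : x ≤ 7 * max 1 r := by omega
  have h2 : n + m + 1 ≤ 2 * max 1 (m + n) := by omega
  calc 200000 * (n + m + 1) * x ≤ 200000 * (2 * max 1 (m + n)) * (7 * max 1 r) := by gcongr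
    _ = 2800000 * (max 1 r * max 1 (m + n)) := by ring
    _ ≤ 3000000 * (max 1 r * max 1 (m + n)) := by gcongr; norm_num

theorem vertexUpdate_within {G : Instance} {u : Update} {c : Prog}
    (h : ∀ M s, Stores s G M → Requests s u → ∃ s' K, Runs c s
      (50000 * (G.numVertices + G.numEdges + 1) *
        (G.maxRank + 4 + (M \ G.trunc G.maxRank M).card)) s' ∧ Stores s' (u.apply G) K) :
    UpdatesWithin (3000000 * (max 1 G.maxRank * max 1 (G.numEdges + G.numVertices))) c G u := by
  intro M s hs hq
  obtain ⟨s', K, ⟨t, ht, hr⟩, hs'⟩ := h M s hs hq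
  rw [hs.rankMaximal.sdiff_trunc] at ht
  refine ⟨K, s', t, hr, ht.trans ?_, hs'⟩
  refine le_trans ?_ (time_le G.numVertices G.numEdges G.maxRank (G.maxRank + 4 + 0) (by omega))
  gcongr
  norm_num

theorem edgeUpdate_within {G : Instance} {u : Update} {a : ℕ} {before del between add : Prog}
    (h : UpdatesByVertexWithin (200000 * (G.numVertices + G.numEdges + 1) * (G.maxRank + 6))
      before del between add G a u) :
    UpdatesByVertexWithin (3000000 * (max 1 G.maxRank * max 1 (G.numEdges + G.numVertices)))
      before del between add G a u := by
  intro M s hs hq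
  obtain ⟨M₁, M', s₁, s₂, s₃, s', t₁, t₂, t₃, t₄, h1, h2, h3, h4, h5, h6, h7, h8, h9, h10, h11⟩ :=
    h M s hs hq
  exact ⟨M₁, M', s₁, s₂, s₃, s', t₁, t₂, t₃, t₄, h1, h2, h3, h4, h5, h6, h7, h8, h9, h10,
    h11.trans (time_le _ _ _ _ le_rfl)⟩

end DynRankMax

theorem theorem1 :
    ∃ (C : ℕ) (addA addP delA delP beforeAdd betweenAdd beforeDel betweenDel : Prog),
      ∀ (G : Instance) (B : ℕ), B = C * (max 1 G.maxRank * max 1 (G.numEdges + G.numVertices)) →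
        (∀ a list, (Update.addApplicant a list).Valid G →
          UpdatesWithin B addA G (Update.addApplicant a list)) ∧
        (∀ p list, (Update.addPost p list).Valid G →
          UpdatesWithin B addP G (Update.addPost p list)) ∧
        (∀ a, (Update.delApplicant a).Valid G →
          UpdatesWithin B delA G (Update.delApplicant a)) ∧
        (∀ p, (Update.delPost p).Valid G →
          UpdatesWithin B delP G (Update.delPost p)) ∧
        (∀ a p i, (Update.addEdge a p i).Valid G →
          UpdatesByVertexWithin B beforeAdd delA betweenAdd addA G a (Update.addEdge a p i)) ∧
        (∀ a p, (Update.delEdge a p).Valid G →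
          UpdatesByVertexWithin B beforeDel delA betweenDel addA G a (Update.delEdge a p)) := by
  refine ⟨3000000, .insertVertex 0 ;; .core, .insertVertex 1 ;; .core, .eraseVertex 0 ;; .core,
    .eraseVertex 1 ;; .core, .gatherWith, .skip, .gather, .skip, ?_⟩
  rintro G B rfl
  refine ⟨fun a list hv => ?_, fun p list hv => ?_, fun a _ => ?_, fun p _ => ?_,
    fun a p i hv => ?_, fun a p hv => ?_⟩
  · exact vertexUpdate_within fun M s hs hq => addApplicant_spec hv hs hq _
  · exact vertexUpdate_within fun M s hs hq => addPost_spec hv hs hq _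
  · exact vertexUpdate_within fun M s hs hq => delApplicant_spec hs hq _
  · exact vertexUpdate_within fun M s hs hq => delPost_spec hs hq _
  · exact edgeUpdate_within (addEdge_spec hv)
  · exact edgeUpdate_within (delEdge_spec hv)
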